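/- **Setting.** Let $G$ be a connected Lie group with Lie algebra $\mathfrak g$, and let $\pi:P\to M$ be a smooth right principal $G$-bundle, where $M$ and $P$ are finite-dimensional smooth manifolds (Hausdorff, second countable, without boundary). Let $\mathbb K=\mathbb R$ or $\mathbb C$, and let $\Omega^q(N)$ be the space of smooth $\mathbb K$-valued $q$-forms on a manifold $N$. Let $\mathrm{Lie}\,\mathbb G$ be the Lie algebra of vector fields on $P$ that are vertical and $G$-invariant. Let $$C^{q,k}(P)=\{\text{alternating } \mathbb R\text{-multilinear maps } (\mathrm{Lie}\,\mathbb G)^k\to\Omega^q(P)\},\qquad C^{q,k}(M)=\{\text{alternating } \mathbb R\text{-multilinear maps } (\mathrm{Lie}\,\mathbb G)^k\to\Omega^q(M)\}.$$ On both, $d:C^{q,k}\to C^{q+1,k}$ is the de Rham differential applied to the values, and $s:C^{q,k}\to C^{q,k+1}$ is the Lie algebra coboundary $$(sf)(X_0,\dots,X_k)=\sum_i(-1)^{q+i}L_{X_i}f(\dots,\widehat{X_i},\dots)+\sum_{i<j}(-1)^{q+i+j}f([X_i,X_j],\dots,\widehat{X_i},\dots,\widehat{X_j},\dots),$$ where $L_X$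 is the Lie derivative on $\Omega^q(P)$, and $L_X$ is replaced by $0$ on $\Omega^q(M)$ (trivial module). The product of $f\in C^{q,k}(P)$ and $g\in C^{q',k'}(P)$ is $$(fg)(X_1,\dots,X_{k+k'})=\frac{(-1)^{kq'}}{k!\,k'!}\sum_{\sigma\in S_{k+k'}}\mathrm{sign}(\sigma)\,f(X_{\sigma(1)},\dots,X_{\sigma(k)})\wedge g(X_{\sigma(k+1)},\dots,X_{\sigma(k+k')}).$$ For $N=P$ or $M$, a cochain $f\in C^{q,k}(N)$ is a *cocycle $s$ mod $d$* if $sf+dg=0$ for some $g\in C^{q-1,k+1}(N)$. The BRS cohomology $H^{q,k}(N,s\ \mathrm{mod}\ d)$ is the quotient of the space of these cocycles by $s\,C^{q,k-1}(N)+d\,C^{q-1,k}(N)$ (a space with a negative index is $0$). The pullback of forms gives a map $\pi^*:C^{q,k}(M)\to C^{q,k}(P)$, and it induces a map $H^{q,k}(M,s\ \mathrm{mod}\ d)\to H^{q,k}(P,s\ \mathrm{mod}\ d)$. The *ghost* $\omega\in\mathfrak g\otimes C^{0,1}(P)$ assigns to $X\in\mathrm{Lie}\,\mathbb G$ the function $\omega(X):P\to\mathfrak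 g$ such that $X_p=\frac{d}{d\tau}\big|_{\tau=0}\,p\exp(\tau\,\omega(X)(p))$ for all $p\in P$. A connection on $P$, given by its connection form $A$, is regarded as an element of $\mathfrak g\otimes C^{1,0}(P)$. Let $I:\mathfrak g^n\to\mathbb K$ be a symmetric $\mathbb R$-multilinear form that is invariant, that is, $\sum_i I(\lambda_1,\dots,[\lambda,\lambda_i],\dots,\lambda_n)=0$ for all $\lambda,\lambda_1,\dots,\lambda_n\in\mathfrak g$. It is extended to $\mathfrak g\otimes C^{*,*}(P)\otimes\Omega[0,1]$ through the product. Let $d_t$ be the differential of $\Omega[0,1]$. For $\theta,\eta\in\mathfrak g\otimes C^{*,*}(P)$ of total degree $1$, the operator $\nabla=s+d+d_t+\theta+t\eta$ has the curvature $$\nabla^2=dt\,\eta+F_t,\qquad F_t=(s+d)(\theta+t\eta)+\tfrac12[\theta+t\eta,\theta+t\eta].$$ Write $I(\nabla^2,\dots,\nabla^2)=I^0+dt\,I^t$ and put $Q=\int_0^1 dt\,I^t$, so that $Q=\int_0^1\sum_{j=1}^n I(F_t,\dots,F_t,\underset{(j)}{\eta},F_t,\dots,F_t)\,dt$. The *consistent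 transgression* $Q_{\mathrm{cons}}(A,\omega)\in C^{*,*}(P)$ is obtained from $\nabla=s+d+d_t+t(A+\omega)$. The *covariant transgression* $Q_{\mathrm{cov}}(A,\omega)$ is obtained from $\nabla=s+d+d_t+A+t\omega$. Superscripts denote components in $C^{q,k}$. **Proposition.** For every connection $A$ on $P$ each component of $Q_{\mathrm{cov}}(A,\omega)$ is the pullback $\pi^*c$ of a unique cochain $c$ on $M$; thus $Q_{\mathrm{cov}}(A,\omega)$ is also regarded as an element of $C^{*,*}(M)$. In the following, $k$ is an integer with $k\le 2n-1$. i) For $k\ge1$, $Q_{\mathrm{cons}}^{2n-k-1,k}(A,\omega)$ is a cocycle $s$ mod $d$ on $P$, and its class in $H^{2n-k-1,k}(P,s\ \mathrm{mod}\ d)$ does not depend on the connection $A$. ii) For $k\ge n$, $Q_{\mathrm{cov}}^{2n-k-1,k}(A,\omega)$ is a cocycle $s$ mod $d$ on $M$, and its class in $H^{2n-k-1,k}(M,s\ \mathrm{mod}\ d)$ does not depend on the connection $A$. iii) For $k\ge n$ and every connection $A$, the image under $\pi^*$ of the class of $Q_{\mathrm{cov}}^{2n-k-1,k}(A,\omega)$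 in $H^{2n-k-1,k}(P,s\ \mathrm{mod}\ d)$ is the class of $Q_{\mathrm{cons}}^{2n-k-1,k}(A,\omega)$. -/

import Mathlib

open scoped Manifold ContDiff Topology
open Bundle VectorField

set_option linter.unusedSectionVars false

namespace BRS

noncomputable section

section Manifolds
variable (E : Type*) [NormedAddCommGroup E] [NormedSpace ℝ E]
  (N : Type*) [TopologicalSpace N] [ChartedSpace E N] [IsManifold 𝓘(ℝ, E) ∞ N]

/-- Smooth vector fields on `N`. -/
abbrev VField : Type _ := Cₛ^∞⟮𝓘(ℝ, E); E, (TangentSpace 𝓘(ℝ, E) : N → Type _)⟯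

/-- Smooth functions on `N` with values in `𝕜`, where `𝕜` is `ℝ` or `ℂ`. -/
abbrev SmoothFun (𝕜 : Type*) [RCLike 𝕜] : Type _ := C^∞⟮𝓘(ℝ, E), N; 𝓘(ℝ, 𝕜), 𝕜⟯

variable {E N}

instance (𝕜 : Type*) [RCLike 𝕜] : ContMDiffRing 𝓘(ℝ, 𝕜) ∞ 𝕜 :=
  { instNormedSpaceLieAddGroup with
    contMDiff_mul := by
      rw [contMDiff_iff]
      refine ⟨continuous_mul, fun x y => ?_⟩
      simp only [mfld_simps, chartAt_self_eq]
      rw [contDiffOn_univ]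
      exact contDiff_mul }

theorem contMDiff_deriv {F : Type*} [NormedAddCommGroup F] [NormedSpace ℝ F]
    (X : VField E N) {f : N → F} (hf : ContMDiff 𝓘(ℝ, E) 𝓘(ℝ, F) ∞ f) :
    ContMDiff 𝓘(ℝ, E) 𝓘(ℝ, F) ∞ (fun p => mvfderiv 𝓘(ℝ, E) f p (X p)) := by
  have h1 := (hf.contMDiff_tangentMap (m := ∞) (by simp)).comp X.contMDiff
  exact (contMDiff_snd_tangentBundle_modelSpace F 𝓘(ℝ, F)).comp h1

/-- The derivative `X f` of a smooth function along a vector field. -/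
def VField.deriv {𝕜 : Type*} [RCLike 𝕜] (X : VField E N) :
    SmoothFun E N 𝕜 →ₗ[ℝ] SmoothFun E N 𝕜 where
  toFun f := ⟨fun p => mvfderiv 𝓘(ℝ, E) f p (X p), contMDiff_deriv X f.contMDiff⟩
  map_add' f g := by
    ext p
    have hf := f.contMDiff.mdifferentiableAt (x := p) (by simp)
    have hg := g.contMDiff.mdifferentiableAt (x := p) (by simp)
    change mvfderiv 𝓘(ℝ, E) (⇑f + ⇑g) p (X p) = _
    rw [mvfderiv_add hf hg]; rfl
  map_smul' c f := by
    ext p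
    have hf := f.contMDiff.mdifferentiableAt (x := p) (by simp)
    have hc : MDifferentiableAt 𝓘(ℝ, E) 𝓘(ℝ, ℝ) (fun _ : N => c) p := mdifferentiableAt_const
    change mvfderiv 𝓘(ℝ, E) ((fun _ : N => c) • ⇑f) p (X p) = _
    rw [mvfderiv_smul hc hf, mvfderiv_const]
    simp; rfl

/-- The Lie bracket of vector fields. -/
instance [FiniteDimensional ℝ E] : Bracket (VField E N) (VField E N) where
  bracket X Y := ⟨mlieBracket 𝓘(ℝ, E) X Y, by
    have : CompleteSpace E := FiniteDimensional.complete ℝ E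
    have : IsManifold 𝓘(ℝ, E) (((⊤ : ℕ∞) : ℕ∞ω) + 1) N := by simpa
    have : IsManifold 𝓘(ℝ, E) (minSmoothness ℝ 2) N := by
      simpa using IsManifold.of_le (I := 𝓘(ℝ, E)) (M := N) (m := 2) (n := ∞) (by norm_cast)
    exact ContDiff.mlieBracket_vectorField (m := ⊤) (n := ⊤) X.contMDiff Y.contMDiff (by simp)⟩

instance : SMul (SmoothFun E N ℝ) (VField E N) where
  smul φ X := ⟨(φ : N → ℝ) • (X : ∀ p : N, TangentSpace 𝓘(ℝ, E) p),
    φ.contMDiff.smul_section X.contMDiff⟩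

instance : Module (SmoothFun E N ℝ) (VField E N) where
  one_smul X := by ext p; exact one_smul ℝ (X p)
  mul_smul φ ψ X := by ext p; exact mul_smul (φ p) (ψ p) (X p)
  smul_zero φ := by ext p; exact smul_zero (φ p)
  smul_add φ X Y := by ext p; exact smul_add (φ p) (X p) (Y p)
  add_smul φ ψ X := by ext p; exact add_smul (φ p) (ψ p) (X p)
  zero_smul X := by ext p; exact zero_smul ℝ (X p)

instance (𝕜 : Type*) [RCLike 𝕜] : SMulCommClass (SmoothFun E N ℝ) ℝ (SmoothFun E N 𝕜) where
  smul_comm φ c f := by ext p; exact smul_comm (φ p) c (f p)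

theorem fderiv_lieBracket [CompleteSpace E] {F : Type*} [NormedAddCommGroup F] [NormedSpace ℝ F]
    {V W : E → E} {f : E → F} {x : E}
    (hf : ContDiffAt ℝ 2 f x) (hV : DifferentiableAt ℝ V x) (hW : DifferentiableAt ℝ W x) :
    fderiv ℝ f x (lieBracket ℝ V W x) =
      fderiv ℝ (fun y => fderiv ℝ f y (W y)) x (V x) -
        fderiv ℝ (fun y => fderiv ℝ f y (V y)) x (W x) := by
  have h1 : DifferentiableAt ℝ (fderiv ℝ f) x :=
    (hf.fderiv_right (m := 1) (by norm_num)).differentiableAt (by norm_num)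
  have h2 := hf.isSymmSndFDerivAt (by simp)
  rw [fderiv_clm_apply h1 hW, fderiv_clm_apply h1 hV]
  simp [lieBracket, h2 (V x) (W x)]

theorem mvfderiv_bracket_eq_zero [FiniteDimensional ℝ E] {F : Type*} [NormedAddCommGroup F] [NormedSpace ℝ F]
    {f : N → F} {p : N} (hf : ContMDiffAt 𝓘(ℝ, E) 𝓘(ℝ, F) 2 f p) (X Y : VField E N)
    (hX : ∀ᶠ q in 𝓝 p, mvfderiv 𝓘(ℝ, E) f q (X q) = 0)
    (hY : ∀ᶠ q in 𝓝 p, mvfderiv 𝓘(ℝ, E) f q (Y q) = 0) :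
    mvfderiv 𝓘(ℝ, E) f p (⁅X, Y⁆ p) = 0 := by
  have : CompleteSpace E := FiniteDimensional.complete ℝ E
  have : IsManifold 𝓘(ℝ, E) 2 N := .of_le (m := 2) (n := ∞) (by norm_cast)
  set φ := extChartAt 𝓘(ℝ, E) p with hφ
  let H : VField E N → E → E := fun Z =>
    mpullbackWithin 𝓘(ℝ, E) 𝓘(ℝ, E) φ.symm Z (Set.range 𝓘(ℝ, E))
  have hr : Set.range 𝓘(ℝ, E) = Set.univ := by simp
  have dZ : ∀ Z : VField E N, DifferentiableAt ℝ (H Z) (φ p) := by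
    intro Z
    have h0 := MDifferentiableWithinAt.differentiableWithinAt_mpullbackWithin_vectorField
      (Z.mdifferentiableAt (x := p)).mdifferentiableWithinAt (s := Set.univ)
    rw [Set.preimage_univ, Set.univ_inter] at h0
    have h1 : DifferentiableWithinAt ℝ (H Z) (Set.range 𝓘(ℝ, E)) (φ p) := h0
    rwa [hr, differentiableWithinAt_univ] at h1
  have hsymm : ∀ y ∈ φ.target, ContMDiffAt 𝓘(ℝ, E) 𝓘(ℝ, E) 2 φ.symm y := by
    intro y hy
    have := contMDiffWithinAt_extChartAt_symm_range (I := 𝓘(ℝ, E)) (n := 2) p hy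
    rwa [hr, contMDiffWithinAt_univ] at this
  have hp : φ p ∈ φ.target := mem_extChartAt_target p
  have hpp : φ.symm (φ p) = p := extChartAt_to_inv p
  have dg : ContDiffAt ℝ 2 (f ∘ φ.symm) (φ p) := by
    rw [← contMDiffAt_iff_contDiffAt]
    exact ContMDiffAt.comp _ (by rw [hpp]; exact hf) (hsymm _ hp)
  have chain : ∀ y ∈ φ.target, ContMDiffAt 𝓘(ℝ, E) 𝓘(ℝ, F) 2 f (φ.symm y) → ∀ v : E,
      fderiv ℝ (f ∘ φ.symm) y v
        = mvfderiv 𝓘(ℝ, E) f (φ.symm y) (mfderiv 𝓘(ℝ, E) 𝓘(ℝ, E) φ.symm y v) := by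
    intro y hy hfy v
    rw [← mfderiv_eq_fderiv, mfderiv_comp y (hfy.mdifferentiableAt (by norm_num))
      ((hsymm y hy).mdifferentiableAt (by norm_num))]
    rfl
  have key : ∀ (Z : VField E N), (∀ᶠ q in 𝓝 p, mvfderiv 𝓘(ℝ, E) f q (Z q) = 0) →
      (fun y => fderiv ℝ (f ∘ φ.symm) y (H Z y)) =ᶠ[𝓝 (φ p)] fun _ => 0 := by
    intro Z hZ
    have c : Filter.Tendsto φ.symm (𝓝 (φ p)) (𝓝 p) := by
      have := (hsymm _ hp).continuousAt.tendsto
      rwa [hpp] at this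
    filter_upwards [c.eventually hZ,
      c.eventually (contMDiffAt_iff_contMDiffAt_nhds (by simp) |>.1 hf),
      extChartAt_target_mem_nhds (I := 𝓘(ℝ, E)) p] with y h1 h2 h3
    rw [chain y h3 h2]
    have inv := isInvertible_mfderivWithin_extChartAt_symm (I := 𝓘(ℝ, E)) h3
    have e : mfderiv 𝓘(ℝ, E) 𝓘(ℝ, E) φ.symm y (H Z y) = Z (φ.symm y) := by
      have := congrArg (fun T => T (Z (φ.symm y))) inv.self_comp_inverse
      rw [← mfderivWithin_univ, ← hr]
      exact this
    exact (congrArg _ e).trans h1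
  have e1 := fderiv_lieBracket (F := F) dg (dZ X) (dZ Y)
  rw [(key Y hY).fderiv_eq, (key X hX).fderiv_eq, chain _ hp (by rw [hpp]; exact hf)] at e1
  have e2 : (⁅X, Y⁆ p : E) = mfderiv 𝓘(ℝ, E) 𝓘(ℝ, E) φ.symm (φ p) (lieBracket ℝ (E := E) (H X) (H Y) (φ p)) := by
    have h0 : (⁅X, Y⁆ p : E) = (mfderiv 𝓘(ℝ, E) 𝓘(ℝ, E) φ p).inverse
        (lieBracketWithin ℝ (E := E) (H X) (H Y) (φ.symm ⁻¹' Set.univ ∩ Set.range 𝓘(ℝ, E)) (φ p)) := rfl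
    rw [h0, hr, Set.preimage_univ, Set.univ_inter, lieBracketWithin_univ]
    have i1 := mfderivWithin_extChartAt_symm_comp_mfderiv_extChartAt' (I := 𝓘(ℝ, E))
      (mem_extChartAt_source (I := 𝓘(ℝ, E)) p)
    have i2 := mfderiv_extChartAt_comp_mfderivWithin_extChartAt_symm' (I := 𝓘(ℝ, E))
      (mem_extChartAt_source (I := 𝓘(ℝ, E)) p)
    rw [hr, mfderivWithin_univ] at i1 i2
    have i3 := ContinuousLinearMap.inverse_eq i2 i1
    rw [i3]
    rfl
  simp at e1
  rw [hpp] at e1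
  rw [← e1]
  exact congrArg _ e2
end Manifolds

section Forms

variable (E : Type*) [NormedAddCommGroup E] [NormedSpace ℝ E]
  (N : Type*) [TopologicalSpace N] [ChartedSpace E N] [IsManifold 𝓘(ℝ, E) ∞ N]
  (𝕜 : Type*) [RCLike 𝕜] (L : Type*)

/-- Functions of `q` vector fields on `N` with values in `C^∞(N, 𝕜)`.  The differential forms of
degree `q` are those that are alternating and `C^∞(N, ℝ)`-multilinear. -/
abbrev RawForm (q : ℕ) : Type _ := (Fin q → VField E N) → SmoothFun E N 𝕜

/-- Functions of `k` elements of `L` and `q` vector fields on `N`.  The first index is the form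
degree `q`, the second one is the ghost degree `k`. -/
abbrev RawCochain (q k : ℕ) : Type _ := (Fin k → L) → RawForm E N 𝕜 q

/-- The space `Ω^q(N)` of differential forms of degree `q` with values in `𝕜`: alternating
`C^∞(N, ℝ)`-multilinear functions of `q` vector fields. -/
abbrev DiffForm (q : ℕ) : Type _ :=
  VField E N [⋀^Fin q]→ₗ[SmoothFun E N ℝ] SmoothFun E N 𝕜

/-- The space of `k`-cochains over `L` with values in `Ω^q(N)`: alternating `ℝ`-multilinear
functions of `k` elements of `L` with values in the differential forms of degree `q`. -/
def cochains [AddCommGroup L] [Module ℝ L] (q k : ℕ) : Submodule ℝ (RawCochain E N 𝕜 L q k) where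
  carrier := {f | ∃ F : L [⋀^Fin k]→ₗ[ℝ] DiffForm E N 𝕜 q, ∀ X Y, f X Y = F X Y}
  add_mem' := by
    rintro f g ⟨F, hF⟩ ⟨F', hF'⟩
    exact ⟨F + F', fun X Y => by simp [hF, hF']⟩
  zero_mem' := ⟨0, fun X Y => by simp⟩
  smul_mem' := by
    rintro c f ⟨F, hF⟩
    exact ⟨c • F, fun X Y => by simp [hF]⟩

variable {E N 𝕜 L}

/-- `∑_{i<j} (-1)^(i+j) f([Y_i, Y_j], Y_0, …, Ŷ_i, …, Ŷ_j, …, Y_q)`.  In the code the pair of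
positions is `(i, j + 1)` with `i ≤ j`. -/
def bracketSum {α V : Type*} [Bracket α α] [AddCommGroup V] :
    ∀ {q : ℕ}, ((Fin q → α) → V) → (Fin (q + 1) → α) → V
  | 0, _, _ => 0
  | q + 1, f, Y => ∑ i : Fin (q + 1), ∑ j ∈ Finset.Ici i, (-1 : ℤ) ^ (i + (j + 1) : ℕ) •
      f (Fin.cons ⁅Y i.castSucc, Y j.succ⁆ (j.removeNth (i.castSucc.removeNth Y)))

theorem bracketSum_add {α V : Type*} [Bracket α α] [AddCommGroup V] {q : ℕ}
    (f g : (Fin q → α) → V) (Y : Fin (q + 1) → α) :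
    bracketSum (f + g) Y = bracketSum f Y + bracketSum g Y := by
  cases q with
  | zero => simp [bracketSum]
  | succ q => simp [bracketSum, Finset.sum_add_distrib]

theorem bracketSum_smul {α V : Type*} [Bracket α α] [AddCommGroup V] [Module ℝ V] {q : ℕ}
    (c : ℝ) (f : (Fin q → α) → V) (Y : Fin (q + 1) → α) :
    bracketSum (c • f) Y = c • bracketSum f Y := by
  cases q with
  | zero => simp [bracketSum]
  | succ q => simp [bracketSum, Finset.smul_sum, smul_comm c]

/-- The exterior derivative of differential forms. -/
def extD [FiniteDimensional ℝ E] (q : ℕ) : RawForm E N 𝕜 q →ₗ[ℝ] RawForm E N 𝕜 (q + 1) where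
  toFun f Y := ∑ i : Fin (q + 1), (-1 : ℤ) ^ (i : ℕ) • (Y i).deriv (f (i.removeNth Y)) + bracketSum f Y
  map_add' f g := by
    funext Y
    simp only [Pi.add_apply, map_add, smul_add, Finset.sum_add_distrib, bracketSum_add]
    abel
  map_smul' c f := by
    funext Y
    simp only [Pi.smul_apply, map_smul, bracketSum_smul, smul_add, Finset.smul_sum, RingHom.id_apply,
      smul_comm c]

/-- The Lie derivative of differential forms along a vector field. -/
def lieD [FiniteDimensional ℝ E] (q : ℕ) (X : VField E N) :
    RawForm E N 𝕜 q →ₗ[ℝ] RawForm E N 𝕜 q where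
  toFun f Y := X.deriv (f Y) - ∑ i, f (Function.update Y i ⁅X, Y i⁆)
  map_add' f g := by
    funext Y
    simp only [Pi.add_apply, map_add, Finset.sum_add_distrib]
    abel
  map_smul' c f := by
    funext Y
    simp only [Pi.smul_apply, map_smul, smul_sub, Finset.smul_sum, RingHom.id_apply]

/-- The de Rham differential on cochains, applied to the values. -/
def cochainD [FiniteDimensional ℝ E] (q k : ℕ) :
    RawCochain E N 𝕜 L q k →ₗ[ℝ] RawCochain E N 𝕜 L (q + 1) k where
  toFun f X := extD q (f X)
  map_add' f g := by funext X; simp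
  map_smul' c f := by funext X; simp

/-- The coboundary `s` of cochains over `L` with values in forms of degree `q`, for the action `ρ`
of `L` on these forms.  It carries the global sign `(-1)^q`, so that it anticommutes with `d`. -/
def cochainS [Bracket L L] (q k : ℕ) (ρ : L → RawForm E N 𝕜 q →ₗ[ℝ] RawForm E N 𝕜 q) :
    RawCochain E N 𝕜 L q k →ₗ[ℝ] RawCochain E N 𝕜 L q (k + 1) where
  toFun f X := (-1 : ℤ) ^ q •
    (∑ i : Fin (k + 1), (-1 : ℤ) ^ (i : ℕ) • ρ (X i) (f (i.removeNth X)) + bracketSum f X)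
  map_add' f g := by
    funext X
    simp only [Pi.add_apply, map_add, smul_add, Finset.sum_add_distrib, bracketSum_add]
    abel
  map_smul' c f := by
    funext X
    simp only [Pi.smul_apply, map_smul, bracketSum_smul, smul_add, Finset.smul_sum,
      RingHom.id_apply, smul_comm c]

variable (E N 𝕜 L) in
/-- A family of components in all bidegrees. -/
abbrev Total : Type _ := ∀ q k : ℕ, RawCochain E N 𝕜 L q k

/-- The unit of the product of cochains. -/
def Total.one : Total E N 𝕜 L
  | 0, 0 => fun _ _ => 1
  | _ + 1, _ => 0
  | 0, _ + 1 => 0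

/-- The first `i` entries of a tuple. -/
def headPart {α : Type*} {q : ℕ} (i : Fin (q + 1)) (x : Fin q → α) : Fin i → α :=
  fun j => x ⟨j, by omega⟩

/-- The last `q - i` entries of a tuple. -/
def tailPart {α : Type*} {q : ℕ} (i : Fin (q + 1)) (x : Fin q → α) : Fin (q - i) → α :=
  fun j => x ⟨i + j, by omega⟩

/-- The graded product of cochains.  On components of bidegrees `(i, l)` and `(q - i, k - l)` it is
the antisymmetrised product with the sign `(-1)^(l (q - i))`, where the values are multiplied by
the wedge product of differential forms. -/
def Total.mul (f g : Total E N 𝕜 L) : Total E N 𝕜 L := fun q k X Y =>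
  ∑ i : Fin (q + 1), ∑ l : Fin (k + 1),
    ((-1 : ℝ) ^ ((l : ℕ) * (q - i)) / ((l : ℕ).factorial * (k - l).factorial *
        ((i : ℕ).factorial * (q - i).factorial))) •
      ∑ σ : Equiv.Perm (Fin k), ∑ τ : Equiv.Perm (Fin q),
        ((Equiv.Perm.sign σ * Equiv.Perm.sign τ : ℤˣ) : ℤ) •
          (f i l (headPart l (X ∘ σ)) (headPart i (Y ∘ τ)) *
            g (q - i) (k - l) (tailPart l (X ∘ σ)) (tailPart i (Y ∘ τ)))

/-- The product of finitely many families. -/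
def Total.prod : ∀ {n : ℕ}, (Fin n → Total E N 𝕜 L) → Total E N 𝕜 L
  | 0, _ => Total.one
  | _ + 1, f => (f 0).mul (Total.prod fun i => f i.succ)

/-- The integral of a family of functions over the parameter interval `[0, 1]`, taken pointwise.
It is only used for families that are polynomial in the parameter, whose integral is smooth. -/
def integrate (g : ℝ → SmoothFun E N 𝕜) : SmoothFun E N 𝕜 :=
  open Classical in
  if h : ContMDiff 𝓘(ℝ, E) 𝓘(ℝ, 𝕜) ∞ (fun p => ∫ t in (0 : ℝ)..1, g t p) then
    ⟨fun p => ∫ t in (0 : ℝ)..1, g t p, h⟩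
  else 0

end Forms

section Cohomology

variable {C : ℕ → ℕ → Type*} [∀ q k, AddCommGroup (C q k)] [∀ q k, Module ℝ (C q k)]
  (S : ∀ q k, Submodule ℝ (C q k)) (d : ∀ q k, C q k →ₗ[ℝ] C (q + 1) k)
  (s : ∀ q k, C q k →ₗ[ℝ] C q (k + 1))

/-- Cocycles `s` mod `d`: the cochains `f` such that `s f + d g = 0` for some cochain `g`. -/
def modCocycles : ∀ q k : ℕ, Submodule ℝ (C q k)
  | 0, k => S 0 k ⊓ LinearMap.ker (s 0 k)
  | q + 1, k => S (q + 1) k ⊓ ((S q (k + 1)).map (d q (k + 1))).comap (s (q + 1) k)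

/-- Coboundaries `s` mod `d`: the sums `s f + d g` for cochains `f`, `g`. -/
def modCoboundaries : ∀ q k : ℕ, Submodule ℝ (C q k)
  | 0, 0 => ⊥
  | 0, k + 1 => (S 0 k).map (s 0 k)
  | q + 1, 0 => (S q 0).map (d q 0)
  | q + 1, k + 1 => (S (q + 1) k).map (s (q + 1) k) ⊔ (S q (k + 1)).map (d q (k + 1))

/-- The cohomology `s` mod `d` in bidegree `(q, k)`. -/
abbrev ModCohomology (q k : ℕ) : Type _ :=
  modCocycles S d s q k ⧸ (modCoboundaries S d s q k).submoduleOf (modCocycles S d s q k)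

/-- The class of a cocycle `s` mod `d`. -/
def modClass {q k : ℕ} (f : C q k) (hf : f ∈ modCocycles S d s q k) : ModCohomology S d s q k :=
  Submodule.Quotient.mk ⟨f, hf⟩

end Cohomology

/-- A smooth principal `G`-bundle `P → M` with right action of `G` on `P`. -/
structure PrincipalBundle
    (EM : Type*) [NormedAddCommGroup EM] [NormedSpace ℝ EM]
    (M : Type*) [TopologicalSpace M] [ChartedSpace EM M]
    (EG : Type*) [NormedAddCommGroup EG] [NormedSpace ℝ EG]
    (G : Type*) [TopologicalSpace G] [ChartedSpace EG G] [Group G]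
    (EP : Type*) [NormedAddCommGroup EP] [NormedSpace ℝ EP]
    (P : Type*) [TopologicalSpace P] [ChartedSpace EP P] where
  proj : P → M
  act : P → G → P
  contMDiff_proj : ContMDiff 𝓘(ℝ, EP) 𝓘(ℝ, EM) ∞ proj
  contMDiff_act : ContMDiff (𝓘(ℝ, EP).prod 𝓘(ℝ, EG)) 𝓘(ℝ, EP) ∞ fun x : P × G => act x.1 x.2
  act_one : ∀ p, act p 1 = p
  act_mul : ∀ p g h, act p (g * h) = act (act p g) h
  proj_act : ∀ p g, proj (act p g) = proj p
  locally_trivial : ∀ m : M, ∃ (U : Set M) (e : OpenPartialHomeomorph P (M × G)),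
    IsOpen U ∧ m ∈ U ∧ e.source = proj ⁻¹' U ∧ e.target = U ×ˢ Set.univ ∧
    ContMDiffOn 𝓘(ℝ, EP) (𝓘(ℝ, EM).prod 𝓘(ℝ, EG)) ∞ e e.source ∧
    ContMDiffOn (𝓘(ℝ, EM).prod 𝓘(ℝ, EG)) 𝓘(ℝ, EP) ∞ e.symm e.target ∧
    ∀ p ∈ e.source, (e p).1 = proj p ∧ ∀ g, e (act p g) = (proj p, (e p).2 * g)

namespace PrincipalBundle

variable
    {EM : Type*} [NormedAddCommGroup EM] [NormedSpace ℝ EM] [FiniteDimensional ℝ EM]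
    {M : Type*} [TopologicalSpace M] [ChartedSpace EM M] [IsManifold 𝓘(ℝ, EM) ∞ M]
    {EG : Type*} [NormedAddCommGroup EG] [NormedSpace ℝ EG] [FiniteDimensional ℝ EG]
    {G : Type*} [TopologicalSpace G] [ChartedSpace EG G] [Group G]
    {EP : Type*} [NormedAddCommGroup EP] [NormedSpace ℝ EP] [FiniteDimensional ℝ EP]
    {P : Type*} [TopologicalSpace P] [ChartedSpace EP P] [IsManifold 𝓘(ℝ, EP) ∞ P]
    (B : PrincipalBundle EM M EG G EP P)

theorem contMDiff_act_right (g : G) : ContMDiff 𝓘(ℝ, EP) 𝓘(ℝ, EP) ∞ fun p => B.act p g :=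
  B.contMDiff_act.comp (contMDiff_id.prodMk contMDiff_const)

/-- The derivative of right multiplication by `g` on `P`. -/
def dAct (p : P) (g : G) : TangentSpace 𝓘(ℝ, EP) p →L[ℝ] TangentSpace 𝓘(ℝ, EP) (B.act p g) :=
  mfderiv 𝓘(ℝ, EP) 𝓘(ℝ, EP) (fun p => B.act p g) p

theorem dAct_isInvertible (p : P) (g : G) : (B.dAct p g).IsInvertible := by
  let Φ : P ≃ₘ^∞⟮𝓘(ℝ, EP), 𝓘(ℝ, EP)⟯ P :=
    { toFun := fun p => B.act p g
      invFun := fun p => B.act p g⁻¹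
      left_inv := fun p => by beta_reduce; rw [← B.act_mul, mul_inv_cancel, B.act_one]
      right_inv := fun p => by beta_reduce; rw [← B.act_mul, inv_mul_cancel, B.act_one]
      contMDiff_toFun := B.contMDiff_act_right g
      contMDiff_invFun := B.contMDiff_act_right g⁻¹ }
  exact ⟨Φ.mfderivToContinuousLinearEquiv (by simp) p, rfl⟩

/-- The Lie algebra of the gauge group: the vertical `G`-invariant vector fields on `P`. -/
def gaugeAlg : Submodule ℝ (VField EP P) where
  carrier := {X | (∀ p, mfderiv 𝓘(ℝ, EP) 𝓘(ℝ, EM) B.proj p (X p) = 0) ∧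
    ∀ p g, B.dAct p g (X p) = X (B.act p g)}
  add_mem' := by
    rintro X Y ⟨h1, h2⟩ ⟨h3, h4⟩
    refine ⟨fun p => ?_, fun p g => ?_⟩
    · rw [ContMDiffSection.coe_add, Pi.add_apply, map_add, h1, h3, add_zero]
    · rw [ContMDiffSection.coe_add, Pi.add_apply, map_add, h2, h4]; rfl
  zero_mem' := ⟨fun p => map_zero _, fun p g => map_zero _⟩
  smul_mem' := by
    rintro c X ⟨h1, h2⟩
    refine ⟨fun p => ?_, fun p g => ?_⟩
    · rw [ContMDiffSection.coe_smul, Pi.smul_apply, map_smul, h1, smul_zero]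
    · rw [ContMDiffSection.coe_smul, Pi.smul_apply, map_smul, h2]; rfl

theorem bracket_mem {X Y : VField EP P} (hX : X ∈ B.gaugeAlg) (hY : Y ∈ B.gaugeAlg) :
    ⁅X, Y⁆ ∈ B.gaugeAlg := by
  have : CompleteSpace EP := FiniteDimensional.complete ℝ EP
  have : IsManifold 𝓘(ℝ, EP) 2 P := .of_le (m := 2) (n := ∞) (by norm_cast)
  have : IsManifold 𝓘(ℝ, EP) (minSmoothness ℝ 2) P := by simpa
  refine ⟨fun p => ?_, fun p g => ?_⟩
  · set χ := extChartAt 𝓘(ℝ, EM) (B.proj p) with hχ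
    have hχs : ∀ m ∈ χ.source, ContMDiffAt 𝓘(ℝ, EM) 𝓘(ℝ, EM) ∞ χ m :=
      fun m hm => contMDiffAt_extChartAt' (by simpa [hχ] using hm)
    have hc : ∀ q, B.proj q ∈ χ.source → ∀ v : TangentSpace 𝓘(ℝ, EP) q,
        mvfderiv 𝓘(ℝ, EP) (χ ∘ B.proj) q v =
          mfderiv 𝓘(ℝ, EM) 𝓘(ℝ, EM) χ (B.proj q) (mfderiv 𝓘(ℝ, EP) 𝓘(ℝ, EM) B.proj q v) := by
      intro q hq v
      rw [mvfderiv, mfderiv_comp q ((hχs _ hq).mdifferentiableAt (by simp))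
        (B.contMDiff_proj.mdifferentiableAt (by simp))]
      rfl
    have hp : B.proj p ∈ χ.source := mem_extChartAt_source _
    have near : ∀ᶠ q in 𝓝 p, B.proj q ∈ χ.source :=
      B.contMDiff_proj.continuous.continuousAt.eventually (extChartAt_source_mem_nhds _)
    have hz : ∀ Z ∈ B.gaugeAlg, ∀ᶠ q in 𝓝 p, mvfderiv 𝓘(ℝ, EP) (χ ∘ B.proj) q (Z q) = 0 := by
      intro Z hZ
      filter_upwards [near] with q hq
      rw [hc q hq]
      exact (congrArg _ (hZ.1 q)).trans (map_zero _)
    have h0 := mvfderiv_bracket_eq_zero (f := χ ∘ B.proj)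
      (((hχs _ hp).comp p B.contMDiff_proj.contMDiffAt).of_le (by norm_cast)) X Y
      (hz X hX) (hz Y hY)
    rw [hc p hp] at h0
    have inv := isInvertible_mfderiv_extChartAt (I := 𝓘(ℝ, EM)) hp
    exact inv.injective (h0.trans (map_zero _).symm)
  · have hpb : ∀ Z ∈ B.gaugeAlg, mpullback 𝓘(ℝ, EP) 𝓘(ℝ, EP) (fun p => B.act p g) Z = Z := by
      intro Z hZ
      funext q
      rw [mpullback_apply, ← hZ.2 q g]
      exact (B.dAct_isInvertible q g).inverse_apply_self _
    have h := mpullback_mlieBracket (x₀ := p) (n := ∞) (f := fun p => B.act p g)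
      (V := X) (W := Y) X.mdifferentiableAt Y.mdifferentiableAt
      (B.contMDiff_act_right g).contMDiffAt (by simp; norm_cast)
    rw [hpb X hX, hpb Y hY, mpullback_apply] at h
    have h' : (B.dAct p g).inverse (⁅X, Y⁆ (B.act p g)) = ⁅X, Y⁆ p := h
    rw [← h']
    exact (B.dAct_isInvertible p g).self_apply_inverse _

instance : Bracket B.gaugeAlg B.gaugeAlg where
  bracket X Y := ⟨⁅(X : VField EP P), (Y : VField EP P)⁆, B.bracket_mem X.2 Y.2⟩

/-- The tangent vector at `p` of the fundamental vector field of `v ∈ 𝔤`, that is, the derivative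
at `g = 1` of `g ↦ p g` in the direction `v`. -/
def fundamental (p : P) (v : GroupLieAlgebra 𝓘(ℝ, EG) G) : TangentSpace 𝓘(ℝ, EP) p :=
  mfderiv 𝓘(ℝ, EG) 𝓘(ℝ, EP) (fun g => B.act p g) 1 v

/-- The adjoint action of `G` on its Lie algebra. -/
def Ad (g : G) (v : GroupLieAlgebra 𝓘(ℝ, EG) G) : GroupLieAlgebra 𝓘(ℝ, EG) G :=
  mfderiv 𝓘(ℝ, EG) 𝓘(ℝ, EG) (fun h => g * h * g⁻¹) 1 v

/-- A `G`-connection on `P`, given by its connection form: a smooth `𝔤`-valued one-form `A` with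
`A(fundamental v) = v` and `R_g^* A = Ad(g⁻¹) A`. -/
structure Connection where
  form : ∀ p : P, TangentSpace 𝓘(ℝ, EP) p →ₗ[ℝ] GroupLieAlgebra 𝓘(ℝ, EG) G
  smooth : ∀ Y : VField EP P, ContMDiff (M' := EG) 𝓘(ℝ, EP) 𝓘(ℝ, EG) ∞ (fun p => form p (Y p))
  form_fundamental : ∀ p v, form p (B.fundamental p v) = v
  equivariant : ∀ p g v, form (B.act p g) (B.dAct p g v) = Ad g⁻¹ (form p v)

variable {B} in
/-- The smooth function `A(Y) : P → 𝔤`. -/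
def Connection.eval (A : B.Connection) (Y : VField EP P) : C^∞⟮𝓘(ℝ, EP), P; 𝓘(ℝ, EG), EG⟯ :=
  ⟨fun p => A.form p (Y p), A.smooth Y⟩

/-- The ghost `X ↦ ω(X)`: the smooth function `ω(X) : P → 𝔤` such that the value of `X` at every
point `p` is the fundamental tangent vector of `ω(X)(p)`.  Such a function exists and is unique,
because the fibres of `P` are principal homogeneous spaces. -/
def ghost (X : B.gaugeAlg) : C^∞⟮𝓘(ℝ, EP), P; 𝓘(ℝ, EG), EG⟯ :=
  open Classical in
  if h : ∃ ξ : C^∞⟮𝓘(ℝ, EP), P; 𝓘(ℝ, EG), EG⟯,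
      ∀ p, B.fundamental p (ξ p) = (X : VField EP P) p then h.choose
  else 0

section Coefficients

variable (𝕜 : Type*) [RCLike 𝕜] {ι : Type*} (b : Module.Basis ι ℝ (GroupLieAlgebra 𝓘(ℝ, EG) G))

/-- The component with index `α` of a smooth `𝔤`-valued function in the basis `b`. -/
def component (α : ι) (ξ : C^∞⟮𝓘(ℝ, EP), P; 𝓘(ℝ, EG), EG⟯) : SmoothFun EP P 𝕜 :=
  ⟨fun p => ((b.coord α (ξ p) : ℝ) : 𝕜), by
    let T : EG →L[ℝ] 𝕜 := (RCLike.ofRealCLM (K := 𝕜)).comp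
      (LinearMap.toContinuousLinearMap (E := EG) (F' := ℝ) (b.coord α))
    exact T.contDiff.contMDiff.comp ξ.contMDiff⟩

/-- The BRS cochains of `P` as families of components in all bidegrees. -/
abbrev TotalP : Type _ := Total EP P 𝕜 B.gaugeAlg

variable {B} in
/-- The connection `A` as an element of `𝔤 ⊗ C^{1,0}(P)`, in components. -/
def Connection.total (A : B.Connection) (α : ι) : B.TotalP 𝕜
  | 1, 0 => fun _ Y => component 𝕜 b α (A.eval (Y 0))
  | _, _ => 0

/-- The ghost `ω` as an element of `𝔤 ⊗ C^{0,1}(P)`, in components. -/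
def ghostTotal (α : ι) : B.TotalP 𝕜
  | 0, 1 => fun X _ => component 𝕜 b α (B.ghost (X 0))
  | _, _ => 0

variable {𝕜}

/-- The de Rham differential of `C^{*,*}(P)`. -/
def dP (q k : ℕ) : RawCochain EP P 𝕜 B.gaugeAlg q k →ₗ[ℝ] RawCochain EP P 𝕜 B.gaugeAlg (q + 1) k :=
  cochainD q k

/-- The coboundary `s` of `C^{*,*}(P)`, where the gauge algebra acts by Lie derivatives. -/
def sP (q k : ℕ) : RawCochain EP P 𝕜 B.gaugeAlg q k →ₗ[ℝ] RawCochain EP P 𝕜 B.gaugeAlg q (k + 1) :=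
  cochainS q k fun X => lieD q (X : VField EP P)

/-- The de Rham differential of `C^{*,*}(M)`. -/
def dM (q k : ℕ) : RawCochain EM M 𝕜 B.gaugeAlg q k →ₗ[ℝ] RawCochain EM M 𝕜 B.gaugeAlg (q + 1) k :=
  cochainD q k

/-- The coboundary `s` of `C^{*,*}(M)`, where the gauge algebra acts trivially. -/
def sM (q k : ℕ) : RawCochain EM M 𝕜 B.gaugeAlg q k →ₗ[ℝ] RawCochain EM M 𝕜 B.gaugeAlg q (k + 1) :=
  cochainS q k fun _ => 0

/-- The total differential `s + d` of `C^{*,*}(P)`. -/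
def totalD (f : B.TotalP 𝕜) : B.TotalP 𝕜
  | 0, 0 => 0
  | 0, k + 1 => B.sP 0 k (f 0 k)
  | q + 1, 0 => B.dP q 0 (f q 0)
  | q + 1, k + 1 => B.sP (q + 1) k (f (q + 1) k) + B.dP q (k + 1) (f q (k + 1))

variable [Fintype ι]

/-- The graded Lie bracket `[e_α ⊗ f, e_β ⊗ g] = [e_α, e_β] ⊗ f g` of `𝔤 ⊗ C^{*,*}(P)`. -/
def totalBracket (χ ψ : ι → B.TotalP 𝕜) (γ : ι) : B.TotalP 𝕜 :=
  ∑ α, ∑ β, b.repr ⁅b α, b β⁆ γ • (χ α).mul (ψ β)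

/-- The curvature `(s + d)θ + ½[θ, θ]` of `s + d + θ`. -/
def curvature (θ : ι → B.TotalP 𝕜) (γ : ι) : B.TotalP 𝕜 :=
  B.totalD (θ γ) + (1 / 2 : ℝ) • B.totalBracket b θ θ γ

/-- `I(χ_1, …, χ_n)` for `χ_i ∈ 𝔤 ⊗ C^{*,*}(P)`. -/
def evalPoly {n : ℕ} (I : MultilinearMap ℝ (fun _ : Fin n => GroupLieAlgebra 𝓘(ℝ, EG) G) 𝕜)
    (χ : Fin n → ι → B.TotalP 𝕜) : B.TotalP 𝕜 := fun q k X Y =>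
  ∑ a : Fin n → ι, ContMDiffMap.const (I fun i => b (a i)) *
    Total.prod (fun i => χ i (a i)) q k X Y

/-- The transgression of `I` along the path `θ + t η`, `t ∈ [0, 1]`.  The curvature of
`∇ = s + d + d_t + θ + t η` is `∇² = dt η + F_t`, where `F_t` is the curvature of `s + d + θ + t η`.
All entries of `I` being of even total degree, `I(∇², …, ∇²)` has the `dt`-component
`∑_j I(F_t, …, η, …, F_t)` with `η` in position `j`, which is integrated over `[0, 1]`. -/
def transgression {n : ℕ}
    (I : MultilinearMap ℝ (fun _ : Fin n => GroupLieAlgebra 𝓘(ℝ, EG) G) 𝕜)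
    (θ η : ι → B.TotalP 𝕜) : B.TotalP 𝕜 := fun q k X Y =>
  integrate fun t => (∑ j : Fin n, B.evalPoly b I
    (Function.update (fun _ => B.curvature b (θ + t • η)) j η)) q k X Y

/-- The consistent transgression `Q_cons(A, ω)`, with `∇ = s + d + d_t + t (A + ω)`. -/
def Qcons {n : ℕ} (I : MultilinearMap ℝ (fun _ : Fin n => GroupLieAlgebra 𝓘(ℝ, EG) G) 𝕜)
    (A : B.Connection) : B.TotalP 𝕜 :=
  B.transgression b I 0 (A.total 𝕜 b + B.ghostTotal 𝕜 b)

/-- The covariant transgression `Q_cov(A, ω)`, with `∇ = s + d + d_t + A + t ω`. -/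
def Qcov {n : ℕ} (I : MultilinearMap ℝ (fun _ : Fin n => GroupLieAlgebra 𝓘(ℝ, EG) G) 𝕜)
    (A : B.Connection) : B.TotalP 𝕜 :=
  B.transgression b I (A.total 𝕜 b) (B.ghostTotal 𝕜 b)

/-- The cochain `f` on `P` is the pullback `π^* c` of the cochain `c` on `M`: the value of `f` on
vector fields `Y_i` at `p` is the value of `c` at `π(p)` on all vector fields `Z_i` on `M` with
`Z_i(π(p)) = dπ(Y_i(p))`. -/
def IsPullback {q k : ℕ} (c : RawCochain EM M 𝕜 B.gaugeAlg q k)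
    (f : RawCochain EP P 𝕜 B.gaugeAlg q k) : Prop :=
  ∀ (X : Fin k → B.gaugeAlg) (Y : Fin q → VField EP P) (Z : Fin q → VField EM M) (p : P),
    (∀ i, Z i (B.proj p) = mfderiv 𝓘(ℝ, EP) 𝓘(ℝ, EM) B.proj p (Y i p)) →
      f X Y p = c X Z (B.proj p)

variable (𝕜)

/-- The bigraded space `C^{q,k}(P)`. -/
abbrev CP (q k : ℕ) : Submodule ℝ (RawCochain EP P 𝕜 B.gaugeAlg q k) :=
  cochains EP P 𝕜 B.gaugeAlg q k

/-- The bigraded space `C^{q,k}(M)`. -/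
abbrev CM (q k : ℕ) : Submodule ℝ (RawCochain EM M 𝕜 B.gaugeAlg q k) :=
  cochains EM M 𝕜 B.gaugeAlg q k

/-- The cocycles `s` mod `d` of bidegree `(q, k)` on `P`. -/
abbrev ZP (q k : ℕ) : Submodule ℝ (RawCochain EP P 𝕜 B.gaugeAlg q k) :=
  modCocycles (B.CP 𝕜) B.dP B.sP q k

/-- The cocycles `s` mod `d` of bidegree `(q, k)` on `M`. -/
abbrev ZM (q k : ℕ) : Submodule ℝ (RawCochain EM M 𝕜 B.gaugeAlg q k) :=
  modCocycles (B.CM 𝕜) B.dM B.sM q k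

variable {𝕜}

/-- The class in the BRS cohomology `H^{q,k}(P, s mod d)`. -/
abbrev classP {q k : ℕ} {f : RawCochain EP P 𝕜 B.gaugeAlg q k} (hf : f ∈ B.ZP 𝕜 q k) :
    ModCohomology (B.CP 𝕜) B.dP B.sP q k :=
  modClass (B.CP 𝕜) B.dP B.sP f hf

/-- The class in the BRS cohomology `H^{q,k}(M, s mod d)`. -/
abbrev classM {q k : ℕ} {f : RawCochain EM M 𝕜 B.gaugeAlg q k} (hf : f ∈ B.ZM 𝕜 q k) :
    ModCohomology (B.CM 𝕜) B.dM B.sM q k :=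
  modClass (B.CM 𝕜) B.dM B.sM f hf

end Coefficients

end PrincipalBundle

end

end BRS

/-! The argument lives in one super-commutative differential algebra: the families of cochains on
`P` in all bidegrees, with total differential `D = s + d` and parity `(-1)^(q+k)`. Chern–Weil theory
holds there verbatim. For odd `𝔤`-valued `θ`, `η`, the Bianchi identity and the invariance of `I`
give the transgression formula `D Q = I(F₁,…,F₁) - I(F₀,…,F₀)` (`D_transgr`). For a two-parameter
family `θ + tα + uβ + tuγ` the same computation, done with two commuting derivations, shows that `D`
of a double integral is the signed sum of the transgressions along the four edges of the square
(`D_squareInt`).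

Being a cocycle `s` mod `d` is a matter of ghost degree. The component of `D x` in bidegree `(q,
k+1)` is `s x^{q,k} + d x^{q-1,k+1}`, so `x^{q,k}` is a cocycle as soon as `D x` has no component of
ghost degree `k+1`. If `D r - (x - y)` has no component of ghost degree `k ≥ 1`, the classes of
`x^{q,k}` and `y^{q,k}` agree. It remains to bound the ghost degree of curvatures. By the Russian
formula (`Connection.iX_curv_eq_zero`) the curvature of `s + d + A + ω` has ghost degree zero. The
curvature of `s + d + A` contains `sA` and has ghost degree at most one, so `I` of it has ghost
degree at most `n`, and a transgression in a ghost-free direction, having `n - 1` curvature factors,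
at most `n - 1`.

Hence `D Q_cons` has ghost degree zero and `D Q_cov` ghost degree at most `n`, which gives the
cocycles. The equalities of classes come from three squares: with corners `0, A+ω, 0, A'+ω` for the
consistent classes, `A, A+ω, A', A'+ω` for the covariant ones, and `0, A, 0, A+ω` for the comparison
of both. In each of them the edges other than the two compared have ghost degree zero or at most `n
- 1`.

For the descent to `M`, contract with fundamental vector fields. They commute with the gauge
algebra, `A` behaves as a connection and `ω` as a tensorial element, so `Q_cov` and the covariant
square integral are horizontal and invariant (`transgr_basic`, `squareInt_basic`). The value of such
a cochain on lifts of vector fields is constant on the fibres because `G` is connected, so the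
cochain is a pullback. Gauge fields are vertical, so on pullbacks `s` becomes the coboundary of the
trivial module.

The algebraic laws of the product, which is defined by sums over permutations, come from an
induction over contractions (`eq_zero_of_iY_iX`): a cochain is determined by the functions obtained
from iterated contractions, and contractions are antiderivations. The laws of `d` and `s` come in
the same way from Cartan's formula. -/

namespace BRS

noncomputable section

/-! ### Alternating multilinear maps as a property of plain functions -/

section Alternating

variable {R α V W : Type*} [CommRing R] [AddCommGroup α] [Module R α]
  [AddCommGroup V] [Module R V] [AddCommGroup W] [Module R W]

variable (R) in
/-- The function `u` of `k` arguments is alternating and `R`-multilinear. -/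
def IsAlt {k : ℕ} (u : (Fin k → α) → V) : Prop :=
  ∃ U : α [⋀^Fin k]→ₗ[R] V, ∀ x, u x = U x

namespace IsAlt

variable {k : ℕ} {u v : (Fin k → α) → V}

theorem add (hu : IsAlt R u) (hv : IsAlt R v) : IsAlt R (fun x => u x + v x) := by
  obtain ⟨U, hU⟩ := hu
  obtain ⟨V, hV⟩ := hv
  exact ⟨U + V, fun x => by simp [hU, hV]⟩

theorem zero : IsAlt R (fun _ : Fin k → α => (0 : V)) := ⟨0, fun _ => rfl⟩

theorem map {F : Type*} [FunLike F V W] [AddMonoidHomClass F V W] (f : F)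
    (hf : ∀ (c : R) x, f (c • x) = c • f x) (hu : IsAlt R u) : IsAlt R (fun x => f (u x)) := by
  obtain ⟨U, hU⟩ := hu
  let f' : V →ₗ[R] W := { toFun := f, map_add' := map_add f, map_smul' := hf }
  exact ⟨f'.compAlternatingMap U, fun x => by simp [hU]; rfl⟩

theorem neg (hu : IsAlt R u) : IsAlt R (fun x => -u x) := by
  obtain ⟨U, hU⟩ := hu
  exact ⟨-U, fun x => by simp [hU]⟩

theorem sub (hu : IsAlt R u) (hv : IsAlt R v) : IsAlt R (fun x => u x - v x) := by
  simpa [sub_eq_add_neg] using hu.add hv.neg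

theorem zsmul (c : ℤ) (hu : IsAlt R u) : IsAlt R (fun x => c • u x) := by
  obtain ⟨U, hU⟩ := hu
  exact ⟨c • U, fun x => by simp [hU]⟩

theorem of_isEmpty (u : (Fin 0 → α) → V) : IsAlt R u :=
  ⟨AlternatingMap.constOfIsEmpty R α (Fin 0) (u 0), fun x => by
    rw [Subsingleton.elim x 0]; rfl⟩

theorem cons {u : (Fin (k + 1) → α) → V} (hu : IsAlt R u) (z : α) :
    IsAlt R (fun x => u (Fin.cons z x)) := by
  obtain ⟨U, hU⟩ := hu
  exact ⟨U.curryLeft z, fun x => hU _⟩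

theorem map_insertNth {u : (Fin (k + 1) → α) → V} (hu : IsAlt R u) (j : Fin (k + 1)) (z : α)
    (x : Fin k → α) : u (j.insertNth z x) = (-1 : ℤ) ^ (j : ℕ) • u (Fin.cons z x) := by
  obtain ⟨U, hU⟩ := hu
  rw [hU, hU, U.map_insertNth]
  exact (Int.cast_smul_eq_zsmul ℤ _ _).symm

theorem map_update_add (hu : IsAlt R u) (x : Fin k → α) (i : Fin k) (z z' : α) :
    u (Function.update x i (z + z')) = u (Function.update x i z) + u (Function.update x i z') := by
  obtain ⟨U, hU⟩ := hu
  simp [hU]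

theorem map_update_smul (hu : IsAlt R u) (x : Fin k → α) (i : Fin k) (c : R) (z : α) :
    u (Function.update x i (c • z)) = c • u (Function.update x i z) := by
  obtain ⟨U, hU⟩ := hu
  simp [hU]

theorem map_eq_zero (hu : IsAlt R u) (x : Fin k → α) {i j : Fin k} (hij : i ≠ j) (h : x i = x j) :
    u x = 0 := by
  obtain ⟨U, hU⟩ := hu
  rw [hU, U.map_eq_zero_of_eq x h hij]

theorem map_coord_zero (hu : IsAlt R u) {x : Fin k → α} (i : Fin k) (h : x i = 0) :
    u x = 0 := by
  obtain ⟨U, hU⟩ := hu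
  rw [hU, U.map_coord_zero i h]

theorem map_cons_add {u : (Fin (k + 1) → α) → V} (hu : IsAlt R u) (z z' : α) (x : Fin k → α) :
    u (Fin.cons (z + z') x) = u (Fin.cons z x) + u (Fin.cons z' x) := by
  simpa using hu.map_update_add (Fin.cons z x) 0 z z'

theorem map_cons_smul {u : (Fin (k + 1) → α) → V} (hu : IsAlt R u) (c : R) (z : α)
    (x : Fin k → α) : u (Fin.cons (c • z) x) = c • u (Fin.cons z x) := by
  simpa using hu.map_update_smul (Fin.cons z x) 0 c z

theorem map_cons_cons {u : (Fin (k + 2) → α) → V} (hu : IsAlt R u) (z : α)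
    (x : Fin k → α) : u (Fin.cons z (Fin.cons z x)) = 0 :=
  hu.map_eq_zero _ (i := 0) (j := Fin.succ 0) (Fin.succ_ne_zero _).symm (by simp)

theorem map_cons_swap {u : (Fin (k + 2) → α) → V} (hu : IsAlt R u) (z w : α)
    (x : Fin k → α) : u (Fin.cons z (Fin.cons w x)) = - u (Fin.cons w (Fin.cons z x)) := by
  have h := hu.map_cons_cons (z + w) x
  rw [hu.map_cons_add, (hu.cons z).map_cons_add, (hu.cons w).map_cons_add, hu.map_cons_cons,
    hu.map_cons_cons, zero_add, add_zero] at h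
  exact eq_neg_of_add_eq_zero_left h

/-- Every slot other than the first belongs to a slice with the first argument frozen. So linearity
in the first slot and coincidences that involve it are all that the slices leave open. -/
theorem of_cons {u : (Fin (k + 1) → α) → V} (h1 : ∀ z, IsAlt R (fun x => u (Fin.cons z x)))
    (hadd : ∀ z z' x, u (Fin.cons (z + z') x) = u (Fin.cons z x) + u (Fin.cons z' x))
    (hsmul : ∀ (c : R) z x, u (Fin.cons (c • z) x) = c • u (Fin.cons z x))
    (h3 : ∀ z (x : Fin k → α) (j), x j = z → u (Fin.cons z x) = 0) : IsAlt R u := by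
  refine ⟨{ toFun := u, map_update_add' := ?_, map_update_smul' := ?_,
            map_eq_zero_of_eq' := ?_ }, fun _ => rfl⟩
  · intro inst m i x y
    rw [Subsingleton.elim inst (instDecidableEqFin _)]
    rw [← Fin.cons_self_tail m]
    cases i using Fin.cases with
    | zero => simpa only [Fin.update_cons_zero] using hadd _ _ _
    | succ i => simp only [← Fin.cons_update]; exact (h1 _).map_update_add _ _ _ _
  · intro inst m i c x
    rw [Subsingleton.elim inst (instDecidableEqFin _)]
    rw [← Fin.cons_self_tail m]
    cases i using Fin.cases with
    | zero => simpa only [Fin.update_cons_zero] using hsmul _ _ _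
    | succ i => simp only [← Fin.cons_update]; exact (h1 _).map_update_smul _ _ _ _
  · intro m i j hm hij
    rw [← Fin.cons_self_tail m] at hm ⊢
    cases i using Fin.cases with
    | zero =>
      cases j using Fin.cases with
      | zero => exact absurd rfl hij
      | succ j => exact h3 _ _ j (by simpa using hm.symm)
    | succ i =>
      cases j using Fin.cases with
      | zero => exact h3 _ _ i (by simpa using hm)
      | succ j => exact (h1 _).map_eq_zero _ (by simpa using hij) (by simpa using hm)

/-- Inside an alternating slice the argument equal to the first one can be moved to the second
position at the cost of a sign. This is the form in which products, Lie derivatives and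
differentials are later shown to be alternating, by induction on the degree. -/
theorem of_cons_cons {u : (Fin (k + 2) → α) → V} (h1 : ∀ z, IsAlt R (fun x => u (Fin.cons z x)))
    (hadd : ∀ z z' x, u (Fin.cons (z + z') x) = u (Fin.cons z x) + u (Fin.cons z' x))
    (hsmul : ∀ (c : R) z x, u (Fin.cons (c • z) x) = c • u (Fin.cons z x))
    (h3 : ∀ z (x : Fin k → α), u (Fin.cons z (Fin.cons z x)) = 0) : IsAlt R u := by
  refine of_cons h1 hadd hsmul fun z x j hj => ?_
  have := (h1 z).map_insertNth j (x j) (j.removeNth x)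
  rw [Fin.insertNth_self_removeNth] at this
  rw [this, hj, h3, smul_zero]

theorem of_cons_one {u : (Fin 1 → α) → V}
    (hadd : ∀ z z' x, u (Fin.cons (z + z') x) = u (Fin.cons z x) + u (Fin.cons z' x))
    (hsmul : ∀ (c : R) z x, u (Fin.cons (c • z) x) = c • u (Fin.cons z x)) : IsAlt R u :=
  of_cons (fun _ => of_isEmpty _) hadd hsmul fun _ _ j => j.elim0

theorem map_removeNth {u : (Fin (k + 1) → α) → V} (hu : IsAlt R u) (j : Fin (k + 1)) (z : α)
    (x : Fin (k + 1) → α) :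
    u (Function.update x j z) = (-1 : ℤ) ^ (j : ℕ) • u (Fin.cons z (j.removeNth x)) := by
  rw [← hu.map_insertNth, Fin.insertNth_removeNth]

end IsAlt

end Alternating

section Cochains

variable {E : Type*} [NormedAddCommGroup E] [NormedSpace ℝ E]
  {N : Type*} [TopologicalSpace N] [ChartedSpace E N] [IsManifold 𝓘(ℝ, E) ∞ N]
  {𝕜 : Type*} [RCLike 𝕜] {L : Type*} [AddCommGroup L] [Module ℝ L]

/-- Separates the nested alternating maps into one condition per group of arguments, so that
cochains can be handled as plain functions of two tuples. -/
theorem mem_cochains_iff {q k : ℕ} {f : RawCochain E N 𝕜 L q k} :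
    f ∈ cochains E N 𝕜 L q k ↔
      (∀ X, IsAlt (SmoothFun E N ℝ) (f X)) ∧ ∀ Y, IsAlt ℝ (fun X => f X Y) := by
  constructor
  · rintro ⟨F, hF⟩
    refine ⟨fun X => ⟨F X, hF X⟩, fun Y => ?_⟩
    refine ⟨{ toFun := fun X => F X Y, map_update_add' := ?_, map_update_smul' := ?_,
              map_eq_zero_of_eq' := ?_ }, fun X => hF X Y⟩
    · intro _ m i x y; simp
    · intro _ m i c x; simp
    · intro m i j h hij; simp [F.map_eq_zero_of_eq m h hij]
  · rintro ⟨h1, h2⟩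
    choose F hF using h1
    refine ⟨{ toFun := F, map_update_add' := ?_, map_update_smul' := ?_,
              map_eq_zero_of_eq' := ?_ }, hF⟩
    · intro inst m i x y
      rw [Subsingleton.elim inst (instDecidableEqFin _)]
      ext1 Y
      simpa [hF] using (h2 Y).map_update_add m i x y
    · intro inst m i c x
      rw [Subsingleton.elim inst (instDecidableEqFin _)]
      ext1 Y
      simpa [hF] using (h2 Y).map_update_smul m i c x
    · intro m i j h hij
      ext1 Y
      simpa [hF] using (h2 Y).map_eq_zero m hij h

end Cochains

/-! ### Antisymmetrised sums over splittings of the arguments -/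

section Shuffle

variable {α V W : Type*} [AddCommGroup V] [Module ℝ V] [AddCommGroup W] [Module ℝ W]

/-- The antisymmetrised sum over all ways to distribute `n` arguments over the two slots of `Ψ`. -/
def shuf (Ψ : ∀ a b : ℕ, (Fin a → α) → (Fin b → α) → V) (n : ℕ) (x : Fin n → α) : V :=
  ∑ i : Fin (n + 1), (1 / ((i : ℕ).factorial * (n - i).factorial) : ℝ) •
    ∑ τ : Equiv.Perm (Fin n), ((Equiv.Perm.sign τ : ℤˣ) : ℤ) •
      Ψ i (n - i) (headPart i (x ∘ τ)) (tailPart i (x ∘ τ))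

theorem shuf_congr {Ψ Φ : ∀ a b : ℕ, (Fin a → α) → (Fin b → α) → V} {n : ℕ}
    (h : ∀ a b x y, a + b = n → Ψ a b x y = Φ a b x y) (x : Fin n → α) : shuf Ψ n x = shuf Φ n x := by
  unfold shuf
  refine Finset.sum_congr rfl fun i _ => ?_
  congr 1
  refine Finset.sum_congr rfl fun τ _ => ?_
  rw [h _ _ _ _ (by omega)]

theorem shuf_add (Ψ Φ : ∀ a b : ℕ, (Fin a → α) → (Fin b → α) → V) (n : ℕ) (x : Fin n → α) :
    shuf (fun a b y z => Ψ a b y z + Φ a b y z) n x = shuf Ψ n x + shuf Φ n x := by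
  simp only [shuf, smul_add, Finset.sum_add_distrib]

theorem shuf_map (f : V →ₗ[ℝ] W) (Ψ : ∀ a b : ℕ, (Fin a → α) → (Fin b → α) → V) (n : ℕ)
    (x : Fin n → α) : shuf (fun a b y z => f (Ψ a b y z)) n x = f (shuf Ψ n x) := by
  simp only [shuf, map_sum, map_smul, map_zsmul]

theorem shuf_zsmul (c : ℤ) (Ψ : ∀ a b : ℕ, (Fin a → α) → (Fin b → α) → V) (n : ℕ)
    (x : Fin n → α) : shuf (fun a b y z => c • Ψ a b y z) n x = c • shuf Ψ n x := by
  simp only [shuf, Finset.smul_sum, smul_comm c]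

@[simp] theorem shuf_zero (Ψ : ∀ a b : ℕ, (Fin a → α) → (Fin b → α) → V) (x : Fin 0 → α) :
    shuf Ψ 0 x = Ψ 0 0 x x := by
  simp only [shuf, Nat.reduceAdd, Finset.univ_unique, Finset.sum_singleton]
  simp
  exact congrArg₂ (Ψ 0 0) (funext fun j => absurd j.2 (by simp)) (funext fun j => absurd j.2 (by simp))

/-- The permutation of `Fin (n + 1)` that sends `j` to `0` and permutes the rest by `τ`. -/
def permCons {n : ℕ} (j : Fin (n + 1)) (τ : Equiv.Perm (Fin n)) : Equiv.Perm (Fin (n + 1)) :=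
  Equiv.Perm.decomposeFin.symm (0, τ) * j.cycleRange

theorem sign_permCons {n : ℕ} (j : Fin (n + 1)) (τ : Equiv.Perm (Fin n)) :
    Equiv.Perm.sign (permCons j τ) = (-1) ^ (j : ℕ) * Equiv.Perm.sign τ := by
  simp [permCons, Equiv.Perm.sign_mul, mul_comm]

theorem cons_comp_permCons {n : ℕ} (j : Fin (n + 1)) (τ : Equiv.Perm (Fin n)) (z : α)
    (x : Fin n → α) :
    (Fin.cons z x : Fin (n + 1) → α) ∘ permCons j τ = j.insertNth z (x ∘ τ) := by
  rw [permCons, ← Fin.cons_comp_cycleRange]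
  ext i
  simp only [Function.comp_apply, Equiv.Perm.coe_mul]
  generalize j.cycleRange i = i'
  cases i' using Fin.cases <;> simp

theorem permCons_bijective (n : ℕ) :
    Function.Bijective fun p : Fin (n + 1) × Equiv.Perm (Fin n) => permCons p.1 p.2 := by
  rw [Fintype.bijective_iff_injective_and_card]
  constructor
  · rintro ⟨j, τ⟩ ⟨j', τ'⟩ h
    have h : permCons j τ = permCons j' τ' := h
    have key : ∀ (j : Fin (n + 1)) (τ : Equiv.Perm (Fin n)), permCons j τ j = 0 := by
      intro j τ; simp [permCons]
    obtain rfl : j = j' := (permCons j τ).injective (by rw [key, h, key])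
    have := mul_right_cancel h
    have := Equiv.Perm.decomposeFin.symm.injective this
    simpa using this
  · simp [Fintype.card_perm, Nat.factorial_succ]

/-- Sorts the permutations by the position at which the distinguished first argument ends up. -/
theorem sum_perm_succ {n : ℕ} (f : Equiv.Perm (Fin (n + 1)) → V) :
    ∑ τ, f τ = ∑ j : Fin (n + 1), ∑ τ : Equiv.Perm (Fin n), f (permCons j τ) := by
  rw [← Fintype.sum_prod_type', ← (permCons_bijective n).sum_comp f]

theorem slot_congr (Ψ : ∀ a b : ℕ, (Fin a → α) → (Fin b → α) → V) {a b b' : ℕ} (h : b = b')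
    {y y' : Fin a → α} {w : Fin b → α} {w' : Fin b' → α} (hy : y = y')
    (hw : ∀ j, w j = w' (Fin.cast h j)) : Ψ a b y w = Ψ a b' y' w' := by
  subst h hy
  congr 1
  exact funext hw

theorem sum_ite_lt_const {m a : ℕ} (h : a ≤ m) (v : V) :
    ∑ j : Fin m, (if (j : ℕ) < a then v else 0) = (a : ℝ) • v := by
  rw [Fin.sum_univ_eq_sum_range (fun j => if j < a then v else 0) m, ← Finset.sum_filter,
    Finset.sum_const, ← Nat.cast_smul_eq_nsmul ℝ]
  congr 2
  rw [← Finset.card_range a]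
  congr 1
  ext j
  simp
  omega

theorem sum_ite_lt_const' {m a : ℕ} (h : a ≤ m) (v : V) :
    ∑ j : Fin m, (if (j : ℕ) < a then 0 else v) = ((m - a : ℕ) : ℝ) • v := by
  have h1 := sum_ite_lt_const h v
  have h2 : ∑ j : Fin m, (if (j : ℕ) < a then v else 0) + ∑ j : Fin m, (if (j : ℕ) < a then 0 else v)
      = (m : ℝ) • v := by
    rw [← Finset.sum_add_distrib, ← sum_ite_lt_const le_rfl v]
    refine Finset.sum_congr rfl fun j _ => ?_
    split_ifs <;> simp_all
  rw [h1] at h2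
  rw [Nat.cast_sub h, sub_smul, ← h2]
  abel

theorem headPart_insertNth {n : ℕ} (i : Fin (n + 1)) (j : Fin (n + 1)) (hj : (j : ℕ) < i + 1) (z : α)
    (x : Fin n → α) : headPart i.succ (j.insertNth z x : Fin (n + 1) → α) =
      (⟨j, hj⟩ : Fin (i + 1)).insertNth z (headPart i x) := by
  refine Fin.eq_insertNth_iff.2 ⟨?_, ?_⟩
  · simp [headPart]
  · ext l
    simp only [headPart, Fin.removeNth]
    have : (⟨((⟨j, hj⟩ : Fin (i + 1)).succAbove l : ℕ), by have := i.2; omega⟩ : Fin (n + 1)) =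
        j.succAbove ⟨l, by omega⟩ := by
      ext
      simp [Fin.succAbove, Fin.lt_def]
      split_ifs <;> simp
    exact (congrArg _ this).trans (by simp)

theorem tailPart_insertNth_lt {n : ℕ} (i : Fin (n + 1)) (j : Fin (n + 1)) (hj : (j : ℕ) < i + 1)
    (z : α) (x : Fin n → α) (l : Fin (n + 1 - i.succ)) :
    tailPart i.succ (j.insertNth z x : Fin (n + 1) → α) l =
      tailPart i x (Fin.cast (by simp) l) := by
  simp only [tailPart]
  have : (⟨(i.succ : ℕ) + l, by have := l.2; omega⟩ : Fin (n + 1)) =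
      j.succAbove ⟨i + (Fin.cast (by simp) l : Fin (n - i)), by have := l.2; simp at this ⊢; omega⟩ := by
    ext
    rw [Fin.succAbove_of_le_castSucc]
    · simp; omega
    · simp [Fin.le_def]; omega
  exact (congrArg _ this).trans (by simp)

theorem headPart_insertNth_le {n : ℕ} (i : Fin (n + 1)) (j : Fin (n + 1)) (hj : (i : ℕ) ≤ j) (z : α)
    (x : Fin n → α) : headPart i.castSucc (j.insertNth z x : Fin (n + 1) → α) = headPart i x := by
  ext l
  simp only [headPart]
  have hl : (l : ℕ) < i := l.2
  have : (⟨(l : ℕ), by omega⟩ : Fin (n + 1)) = j.succAbove ⟨l, by omega⟩ := by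
    ext
    rw [Fin.succAbove_of_castSucc_lt]
    · simp
    · simp [Fin.lt_def]; omega
  exact (congrArg _ this).trans (by simp)

theorem tailPart_insertNth_le {n : ℕ} (i : Fin (n + 1)) (j : Fin (n + 1)) (hj : (i : ℕ) ≤ j)
    (z : α) (x : Fin n → α) (l : Fin (n + 1 - i.castSucc)) :
    tailPart i.castSucc (j.insertNth z x : Fin (n + 1) → α) l =
      Fin.insertNth (α := fun _ => α) (⟨j - i, by omega⟩ : Fin (n - i + 1)) z (tailPart i x)
        (Fin.cast (by simp; omega) l) := by
  have h : n + 1 - i.castSucc = n - i + 1 := by simp; omega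
  obtain ⟨l, rfl⟩ : ∃ l', l = Fin.cast h.symm l' := ⟨Fin.cast h l, by simp⟩
  simp only [Fin.cast_cast, Fin.cast_eq_self]
  have key : (fun l => tailPart i.castSucc (j.insertNth z x : Fin (n + 1) → α) (Fin.cast h.symm l))
      = (⟨j - i, by omega⟩ : Fin (n - i + 1)).insertNth z (tailPart i x) := by
    refine Fin.eq_insertNth_iff.2 ⟨?_, ?_⟩
    · simp only [tailPart]
      have : (⟨(i.castSucc : ℕ) + (Fin.cast h.symm ⟨j - i, by omega⟩ : Fin (n + 1 - i.castSucc)),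
          by simp; omega⟩ : Fin (n + 1)) = j := by
        ext; simp; omega
      exact (congrArg _ this).trans (by simp)
    · ext l
      simp only [tailPart, Fin.removeNth]
      have : (⟨(i.castSucc : ℕ) + (Fin.cast h.symm ((⟨j - i, by omega⟩ : Fin (n - i + 1)).succAbove l) :
          Fin (n + 1 - i.castSucc)), by
            have := ((⟨j - i, by omega⟩ : Fin (n - i + 1)).succAbove l).2; simp; omega⟩ : Fin (n + 1)) =
          j.succAbove ⟨i + l, by omega⟩ := by
        ext
        simp [Fin.succAbove, Fin.lt_def]
        split_ifs <;> simp <;> omega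
      exact (congrArg _ this).trans (by simp)
  exact congrFun key l

/-- Sort the permutations by the position `j` of `z`. If `z` lands in the first slot, which has `i +
1` places, the sign of the permutation cancels the sign of moving `z` to the front; all these
positions contribute equally, and the factor `i + 1` turns `1/(i+1)!` into `1/i!`. In the second
slot the same happens, except that `z` has also passed the `i` arguments of the first slot, which
leaves `(-1)^i`. This identity is the source of the antiderivation property of contractions. -/
theorem shuf_cons (Ψ : ∀ a b : ℕ, (Fin a → α) → (Fin b → α) → V)
    (h1 : ∀ a b (j : Fin (a + 1)) z y y',
      Ψ (a + 1) b (j.insertNth z y) y' = (-1 : ℤ) ^ (j : ℕ) • Ψ (a + 1) b (Fin.cons z y) y')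
    (h2 : ∀ a b (j : Fin (b + 1)) z y y',
      Ψ a (b + 1) y (j.insertNth z y') = (-1 : ℤ) ^ (j : ℕ) • Ψ a (b + 1) y (Fin.cons z y'))
    (n : ℕ) (z : α) (x : Fin n → α) :
    shuf Ψ (n + 1) (Fin.cons z x) = shuf (fun a b y y' => Ψ (a + 1) b (Fin.cons z y) y') n x +
      shuf (fun a b y y' => (-1 : ℤ) ^ a • Ψ a (b + 1) y (Fin.cons z y')) n x := by
  have sq : ∀ j : ℕ, (-1 : ℤ) ^ j * (-1) ^ j = 1 := fun j => by
    rw [← mul_pow]; simp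
  let t : Fin (n + 2) → Fin (n + 1) → V := fun i j => ∑ τ : Equiv.Perm (Fin n),
    ((Equiv.Perm.sign (permCons j τ) : ℤˣ) : ℤ) •
      Ψ i (n + 1 - i) (headPart i (j.insertNth z (x ∘ τ))) (tailPart i (j.insertNth z (x ∘ τ)))
  let G : Fin (n + 1) → V := fun i => ∑ τ : Equiv.Perm (Fin n), ((Equiv.Perm.sign τ : ℤˣ) : ℤ) •
    Ψ (i + 1) (n - i) (Fin.cons z (headPart i (x ∘ τ))) (tailPart i (x ∘ τ))
  let H : Fin (n + 1) → V := fun i => ∑ τ : Equiv.Perm (Fin n), ((Equiv.Perm.sign τ : ℤˣ) : ℤ) •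
    (-1 : ℤ) ^ (i : ℕ) • Ψ i (n - i + 1) (headPart i (x ∘ τ)) (Fin.cons z (tailPart i (x ∘ τ)))
  have tG : ∀ (i : Fin (n + 1)) (j : Fin (n + 1)), (j : ℕ) < i + 1 → t i.succ j = G i := by
    intro i j hj
    refine Finset.sum_congr rfl fun τ _ => ?_
    rw [headPart_insertNth i j hj]
    have e := slot_congr Ψ (a := i + 1) (b := n + 1 - i.succ) (b' := n - i) (by simp)
      (y := (⟨j, hj⟩ : Fin (i + 1)).insertNth z (headPart i (x ∘ τ))) rfl
      (tailPart_insertNth_lt i j hj z (x ∘ τ))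
    refine (congrArg _ e).trans ?_
    rw [h1, sign_permCons, smul_smul]
    congr 1
    push_cast
    linear_combination ((Equiv.Perm.sign τ : ℤˣ) : ℤ) * sq j
  have tH : ∀ (i : Fin (n + 1)) (j : Fin (n + 1)), (i : ℕ) ≤ j → t i.castSucc j = H i := by
    intro i j hj
    refine Finset.sum_congr rfl fun τ _ => ?_
    rw [headPart_insertNth_le i j hj]
    have e := slot_congr Ψ (a := i) (b := n + 1 - i.castSucc) (b' := n - i + 1) (by simp; omega)
      (y := headPart i (x ∘ τ)) rfl (tailPart_insertNth_le i j hj z (x ∘ τ))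
    refine (congrArg _ e).trans ?_
    rw [h2, sign_permCons, smul_smul, smul_smul]
    congr 1
    push_cast
    obtain ⟨d, hd⟩ := Nat.exists_eq_add_of_le hj
    simp only [hd, Nat.add_sub_cancel_left]
    rw [pow_add]
    linear_combination ((Equiv.Perm.sign τ : ℤˣ) : ℤ) * (-1) ^ (i : ℕ) * sq d
  have hL : shuf Ψ (n + 1) (Fin.cons z x) = ∑ i : Fin (n + 2),
      (1 / ((i : ℕ).factorial * (n + 1 - i).factorial) : ℝ) • ∑ j, t i j := by
    refine Finset.sum_congr rfl fun i _ => ?_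
    rw [sum_perm_succ]
    simp only [cons_comp_permCons, t]
  have split : ∀ i, ∑ j, t i j = ∑ j : Fin (n + 1), (if (j : ℕ) < i then t i j else 0) +
      ∑ j : Fin (n + 1), (if (j : ℕ) < i then 0 else t i j) := by
    intro i
    rw [← Finset.sum_add_distrib]
    refine Finset.sum_congr rfl fun j _ => ?_
    split_ifs <;> simp
  simp only [hL, split, smul_add, Finset.sum_add_distrib]
  congr 1
  · rw [Fin.sum_univ_succ]
    -- An empty first slot cannot contain `z`, so the sum over `i` starts at `1` and can be
    -- reindexed by `i.succ`.
    have z0 : ∑ j : Fin (n + 1), (if (j : ℕ) < (0 : Fin (n + 2)) then t 0 j else 0) = 0 := by simp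
    rw [z0, smul_zero, zero_add]
    refine Finset.sum_congr rfl fun i _ => ?_
    have e : ∑ j : Fin (n + 1), (if (j : ℕ) < i.succ then t i.succ j else 0) =
        ∑ j : Fin (n + 1), (if (j : ℕ) < i + 1 then G i else 0) := by
      refine Finset.sum_congr rfl fun j _ => ?_
      simp only [Fin.val_succ]
      split_ifs with h
      · exact tG i j h
      · rfl
    rw [e, sum_ite_lt_const (by omega), smul_smul]
    congr 1
    simp only [Fin.val_succ, Nat.factorial_succ, Nat.add_sub_add_right]
    push_cast
    have : ((i : ℕ) + 1 : ℝ) ≠ 0 := by positivity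
    field_simp
  · rw [Fin.sum_univ_castSucc]
    have z0 : ∑ j : Fin (n + 1), (if (j : ℕ) < Fin.last (n + 1) then 0 else t (Fin.last (n + 1)) j)
        = 0 := by
      refine Finset.sum_eq_zero fun j _ => ?_
      rw [if_pos (by simp; omega)]
    rw [z0, smul_zero, add_zero]
    refine Finset.sum_congr rfl fun i _ => ?_
    have e : ∑ j : Fin (n + 1), (if (j : ℕ) < i.castSucc then 0 else t i.castSucc j) =
        ∑ j : Fin (n + 1), (if (j : ℕ) < i then 0 else H i) := by
      refine Finset.sum_congr rfl fun j _ => ?_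
      simp only [Fin.val_castSucc]
      split_ifs with h
      · rfl
      · exact tH i j (by omega)
    rw [e, sum_ite_lt_const' (by omega), smul_smul]
    congr 1
    have : n + 1 - (i : ℕ) = n - i + 1 := by omega
    simp only [Fin.val_castSucc, this, Nat.factorial_succ]
    have : ((n - (i : ℕ) : ℕ) + 1 : ℝ) ≠ 0 := by positivity
    push_cast
    field_simp

end Shuffle

end

end BRS

namespace BRS

noncomputable section

/-! ### The graded product and its contractions -/

section TotalProduct

variable {E : Type*} [NormedAddCommGroup E] [NormedSpace ℝ E]
  {N : Type*} [TopologicalSpace N] [ChartedSpace E N] [IsManifold 𝓘(ℝ, E) ∞ N]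
  {𝕜 : Type*} [RCLike 𝕜] {L : Type*}

theorem smoothFun_smul_mul (φ : SmoothFun E N ℝ) (a b : SmoothFun E N 𝕜) :
    (φ • a) * b = φ • (a * b) := by
  ext p; exact smul_mul_assoc (φ p) (a p) (b p)

theorem smoothFun_mul_smul (φ : SmoothFun E N ℝ) (a b : SmoothFun E N 𝕜) :
    a * (φ • b) = φ • (a * b) := by
  ext p; exact mul_smul_comm (φ p) (a p) (b p)

theorem smoothFun_real_smul_mul (c : ℝ) (a b : SmoothFun E N 𝕜) :
    (c • a) * b = c • (a * b) := by
  ext p; exact smul_mul_assoc c (a p) (b p)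

theorem smoothFun_mul_real_smul (c : ℝ) (a b : SmoothFun E N 𝕜) :
    a * (c • b) = c • (a * b) := by
  ext p; exact mul_smul_comm c (a p) (b p)

/-- Multiplication by a smooth real function as a linear map. -/
def smoothSMul (φ : SmoothFun E N ℝ) : SmoothFun E N 𝕜 →ₗ[ℝ] SmoothFun E N 𝕜 where
  toFun a := φ • a
  map_add' := smul_add φ
  map_smul' c a := smul_comm φ c a

/-- Multiplication by a smooth function as a linear map. -/
def smoothMul (φ : SmoothFun E N 𝕜) : SmoothFun E N 𝕜 →ₗ[ℝ] SmoothFun E N 𝕜 where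
  toFun a := φ * a
  map_add' := mul_add φ
  map_smul' c a := smoothFun_mul_real_smul c φ a

/-- The product of two families is a double shuffle. -/
theorem Total.mul_eq_shuf (f g : Total E N 𝕜 L) (q k : ℕ) (X : Fin k → L) (Y : Fin q → VField E N) :
    Total.mul f g q k X Y = shuf (fun i j y y' => shuf (fun l m x x' =>
      (-1 : ℤ) ^ (l * j) • (f i l x y * g j m x' y')) k X) q Y := by
  simp only [Total.mul, shuf, Finset.smul_sum]
  refine Finset.sum_congr rfl fun i _ => ?_
  refine (Finset.sum_congr rfl fun l _ => Finset.sum_comm).trans ?_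
  rw [Finset.sum_comm]
  refine Finset.sum_congr rfl fun τ _ => Finset.sum_congr rfl fun l _ =>
    Finset.sum_congr rfl fun σ _ => ?_
  simp only [← Int.cast_smul_eq_zsmul ℝ, smul_smul]
  congr 1
  push_cast
  field_simp

theorem Total.mul_zero_zero (f g : Total E N 𝕜 L) (X : Fin 0 → L) (Y : Fin 0 → VField E N) :
    Total.mul f g 0 0 X Y = f 0 0 X Y * g 0 0 X Y := by
  simp [Total.mul_eq_shuf]

theorem Total.add_mul (f f' g : Total E N 𝕜 L) :
    Total.mul (f + f') g = Total.mul f g + Total.mul f' g := by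
  funext q k X Y
  simp only [Total.mul_eq_shuf, Pi.add_apply, _root_.add_mul, smul_add, shuf_add]

theorem Total.mul_add (f g g' : Total E N 𝕜 L) :
    Total.mul f (g + g') = Total.mul f g + Total.mul f g' := by
  funext q k X Y
  simp only [Total.mul_eq_shuf, Pi.add_apply, _root_.mul_add, smul_add, shuf_add]

/-- Apply a linear map to all values of a family. -/
def Total.mapVal (T : SmoothFun E N 𝕜 →ₗ[ℝ] SmoothFun E N 𝕜) (f : Total E N 𝕜 L) :
    Total E N 𝕜 L := fun q k X Y => T (f q k X Y)

theorem Total.mapVal_mul_of_left (T : SmoothFun E N 𝕜 →ₗ[ℝ] SmoothFun E N 𝕜)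
    (hT : ∀ a b, T (a * b) = T a * b) (f g : Total E N 𝕜 L) :
    Total.mul (Total.mapVal T f) g = Total.mapVal T (Total.mul f g) := by
  funext q k X Y
  simp only [Total.mul_eq_shuf, Total.mapVal, ← hT, ← map_zsmul, shuf_map]

theorem Total.mapVal_mul_of_right (T : SmoothFun E N 𝕜 →ₗ[ℝ] SmoothFun E N 𝕜)
    (hT : ∀ a b, T (a * b) = a * T b) (f g : Total E N 𝕜 L) :
    Total.mul f (Total.mapVal T g) = Total.mapVal T (Total.mul f g) := by
  funext q k X Y
  simp only [Total.mul_eq_shuf, Total.mapVal, ← hT, ← map_zsmul, shuf_map]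

/-- In ghost degree zero the ghost arguments split in only one way. Hence ghost degree zero can
serve as the base case of inductions over `iX`. -/
theorem Total.mul_ghost_zero_congr {f f' g g' : Total E N 𝕜 L} (hf : ∀ q, f q 0 = f' q 0)
    (hg : ∀ q, g q 0 = g' q 0) (q : ℕ) : Total.mul f g q 0 = Total.mul f' g' q 0 := by
  funext X Y
  simp only [Total.mul_eq_shuf, shuf_zero, hf, hg]

theorem Total.mul_form_zero_congr {f f' g g' : Total E N 𝕜 L} (hf : ∀ k, f 0 k = f' 0 k)
    (hg : ∀ k, g 0 k = g' 0 k) (k : ℕ) : Total.mul f g 0 k = Total.mul f' g' 0 k := by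
  funext X Y
  simp only [Total.mul_eq_shuf, shuf_zero, hf, hg]

/-- Contraction with a vector field. -/
def Total.iY (Z : VField E N) (f : Total E N 𝕜 L) : Total E N 𝕜 L :=
  fun q k X Y => f (q + 1) k X (Fin.cons Z Y)

/-- Contraction with an element of `L`. -/
def Total.iX (ξ : L) (f : Total E N 𝕜 L) : Total E N 𝕜 L :=
  fun q k X Y => (-1 : ℤ) ^ q • f q (k + 1) (Fin.cons ξ X) Y

/-- The parity operator, `(-1)^(q + k)` in bidegree `(q, k)`. -/
def Total.parity (f : Total E N 𝕜 L) : Total E N 𝕜 L :=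
  fun q k X Y => (-1 : ℤ) ^ (q + k) • f q k X Y

variable [AddCommGroup L] [Module ℝ L]

/-- All components of the family are cochains. -/
def Total.IsCochain (f : Total E N 𝕜 L) : Prop := ∀ q k, f q k ∈ cochains E N 𝕜 L q k

theorem Total.IsCochain.altY {f : Total E N 𝕜 L} (hf : f.IsCochain) (q k : ℕ) (X : Fin k → L) :
    IsAlt (SmoothFun E N ℝ) (f q k X) := (mem_cochains_iff.1 (hf q k)).1 X

theorem Total.IsCochain.altX {f : Total E N 𝕜 L} (hf : f.IsCochain) (q k : ℕ)
    (Y : Fin q → VField E N) : IsAlt ℝ (fun X => f q k X Y) := (mem_cochains_iff.1 (hf q k)).2 Y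

theorem Total.IsCochain.iY {f : Total E N 𝕜 L} (hf : f.IsCochain) (Z : VField E N) :
    (Total.iY Z f).IsCochain := fun q k =>
  mem_cochains_iff.2 ⟨fun X => (hf.altY (q + 1) k X).cons Z, fun _ => hf.altX _ _ _⟩

theorem Total.IsCochain.iX {f : Total E N 𝕜 L} (hf : f.IsCochain) (ξ : L) :
    (Total.iX ξ f).IsCochain := fun q k =>
  mem_cochains_iff.2 ⟨fun _ => (hf.altY q (k + 1) _).zsmul _,
    fun Y => ((hf.altX q (k + 1) Y).cons ξ).zsmul _⟩

theorem Total.IsCochain.parity {f : Total E N 𝕜 L} (hf : f.IsCochain) :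
    (Total.parity f).IsCochain := fun q k =>
  mem_cochains_iff.2 ⟨fun _ => (hf.altY q k _).zsmul _, fun Y => ((hf.altX q k Y)).zsmul _⟩

/-- `shuf_cons` yields `(-1)^i` when the contraction passes the form arguments of `f`; raising the
form degree of `g` by one in the sign `(-1)^(l j)` of the product yields `(-1)^l`. Together these
make the parity of `f`. -/
theorem Total.iY_mul {f g : Total E N 𝕜 L} (hf : f.IsCochain) (hg : g.IsCochain) (Z : VField E N) :
    Total.iY Z (f.mul g) = (Total.iY Z f).mul g + f.parity.mul (Total.iY Z g) := by
  funext q k X Y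
  simp only [Total.iY, Pi.add_apply, Total.mul_eq_shuf]
  rw [shuf_cons]
  · congr 1
    refine shuf_congr (fun i j y y' _ => ?_) Y
    rw [← shuf_zsmul]
    refine shuf_congr (fun l m x x' _ => ?_) X
    simp only [Total.parity, smul_mul_assoc, smul_smul]
    congr 1
    ring
  · intro i j c z y y'
    rw [← shuf_zsmul]
    refine shuf_congr (fun l m x x' _ => ?_) X
    rw [(hf.altY _ _ _).map_insertNth, smul_mul_assoc, smul_comm]
  · intro i j c z y y'
    rw [← shuf_zsmul]
    refine shuf_congr (fun l m x x' _ => ?_) X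
    rw [(hg.altY _ _ _).map_insertNth, mul_smul_comm, smul_comm]

/-- The sign `(-1)^q` built into `iX` is what makes it an odd antiderivation as well: it absorbs the
change of `(-1)^(l j)` when the ghost degree of `f` drops by one, and supplies the form part of the
parity of `f` in the other term. -/
theorem Total.iX_mul {f g : Total E N 𝕜 L} (hf : f.IsCochain) (hg : g.IsCochain) (ξ : L) :
    Total.iX ξ (f.mul g) = (Total.iX ξ f).mul g + f.parity.mul (Total.iX ξ g) := by
  funext q k X Y
  simp only [Total.iX, Pi.add_apply, Total.mul_eq_shuf]
  rw [← shuf_zsmul, ← shuf_add]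
  refine shuf_congr (fun i j y y' hij => ?_) Y
  subst hij
  rw [shuf_cons, smul_add, ← shuf_zsmul, ← shuf_zsmul]
  · congr 1
    · refine shuf_congr (fun l m x x' _ => ?_) X
      simp only [smul_mul_assoc, smul_smul]
      congr 1
      have : (-1 : ℤ) ^ j * (-1) ^ j = 1 := by rw [← mul_pow]; simp
      ring_nf
      linear_combination ((-1 : ℤ) ^ i * (-1) ^ (l * j)) * this
    · refine shuf_congr (fun l m x x' _ => ?_) X
      simp only [Total.parity, smul_mul_assoc, mul_smul_comm, smul_smul]
      congr 1
      ring
  · intro l m c z x x'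
    have := (hf.altX i (l + 1) y).map_insertNth c z x
    rw [this, smul_mul_assoc, smul_comm]
  · intro l m c z x x'
    have := (hg.altX j (m + 1) y').map_insertNth c z x'
    rw [this, mul_smul_comm, smul_comm]

theorem Total.iY_iY {f : Total E N 𝕜 L} (hf : f.IsCochain) (Z : VField E N) :
    Total.iY Z (Total.iY Z f) = 0 := by
  funext q k X Y
  exact (hf.altY (q + 2) k X).map_cons_cons Z Y

theorem Total.iX_iX {f : Total E N 𝕜 L} (hf : f.IsCochain) (ξ : L) :
    Total.iX ξ (Total.iX ξ f) = 0 := by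
  funext q k X Y
  have := (hf.altX q (k + 2) Y).map_cons_cons ξ X
  simp [Total.iX, this]

theorem Total.iY_parity (f : Total E N 𝕜 L) (Z : VField E N) :
    Total.iY Z f.parity = -(Total.iY Z f).parity := by
  funext q k X Y
  simp only [Total.iY, Total.parity, Pi.neg_apply, ← neg_smul]
  congr 1
  ring

theorem Total.iX_parity (f : Total E N 𝕜 L) (ξ : L) :
    Total.iX ξ f.parity = -(Total.iX ξ f).parity := by
  funext q k X Y
  simp only [Total.iX, Total.parity, Pi.neg_apply, ← neg_smul, smul_smul]
  congr 1
  ring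

theorem Total.parity_parity (f : Total E N 𝕜 L) : f.parity.parity = f := by
  funext q k X Y
  simp only [Total.parity, smul_smul, ← mul_pow]
  simp

theorem Total.zero_mul (f : Total E N 𝕜 L) : Total.mul 0 f = 0 := by
  have := Total.add_mul 0 0 f
  simpa using this

theorem Total.mul_zero (f : Total E N 𝕜 L) : Total.mul f 0 = 0 := by
  have := Total.mul_add f 0 0
  simpa using this

theorem Total.neg_mul (f g : Total E N 𝕜 L) : Total.mul (-f) g = -Total.mul f g := by
  rw [eq_neg_iff_add_eq_zero, ← Total.add_mul, neg_add_cancel, Total.zero_mul]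

/-- The two mixed terms cancel because the parity operator anticommutes with contractions. Vanishing
of the double contraction is the alternating condition needed in `Total.altY_mul`. -/
theorem Total.iY_iY_mul {f g : Total E N 𝕜 L} (hf : f.IsCochain) (hg : g.IsCochain)
    (Z : VField E N) : Total.iY Z (Total.iY Z (f.mul g)) = 0 := by
  have e : ∀ a b : Total E N 𝕜 L, Total.iY Z (a + b) = Total.iY Z a + Total.iY Z b :=
    fun _ _ => rfl
  rw [Total.iY_mul hf hg, e, Total.iY_mul (hf.iY Z) hg, Total.iY_mul hf.parity (hg.iY Z),
    Total.iY_iY hf, Total.iY_iY hg, Total.zero_mul, Total.mul_zero, Total.iY_parity, Total.neg_mul]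
  simp

theorem Total.iX_iX_mul {f g : Total E N 𝕜 L} (hf : f.IsCochain) (hg : g.IsCochain)
    (ξ : L) : Total.iX ξ (Total.iX ξ (f.mul g)) = 0 := by
  have e : ∀ a b : Total E N 𝕜 L, Total.iX ξ (a + b) = Total.iX ξ a + Total.iX ξ b :=
    fun _ _ => by funext q k X Y; simp [Total.iX]
  rw [Total.iX_mul hf hg, e, Total.iX_mul (hf.iX ξ) hg, Total.iX_mul hf.parity (hg.iX ξ),
    Total.iX_iX hf, Total.iX_iX hg, Total.zero_mul, Total.mul_zero, Total.iX_parity, Total.neg_mul]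
  simp

theorem Total.iY_add_left {f : Total E N 𝕜 L} (hf : f.IsCochain) (Z Z' : VField E N) :
    Total.iY (Z + Z') f = Total.iY Z f + Total.iY Z' f := by
  funext q k X Y
  exact (hf.altY _ _ _).map_cons_add _ _ _

theorem Total.iY_smul_left {f : Total E N 𝕜 L} (hf : f.IsCochain) (φ : SmoothFun E N ℝ)
    (Z : VField E N) : Total.iY (φ • Z) f = Total.mapVal (smoothSMul φ) (Total.iY Z f) := by
  funext q k X Y
  exact (hf.altY _ _ _).map_cons_smul _ _ _

theorem Total.iX_add_left {f : Total E N 𝕜 L} (hf : f.IsCochain) (ξ ξ' : L) :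
    Total.iX (ξ + ξ') f = Total.iX ξ f + Total.iX ξ' f := by
  funext q k X Y
  have := (hf.altX q (k + 1) Y).map_cons_add ξ ξ' X
  simp [Total.iX, this]

theorem Total.iX_smul_left {f : Total E N 𝕜 L} (hf : f.IsCochain) (c : ℝ)
    (ξ : L) : Total.iX (c • ξ) f = Total.mapVal (c • LinearMap.id) (Total.iX ξ f) := by
  funext q k X Y
  have := (hf.altX q (k + 1) Y).map_cons_smul c ξ X
  simp [Total.iX, Total.mapVal, this]

/-- Induction on the form degree for all factors at once: a contraction of the product is a sum of
products of lower degree, with contracted factors that are again cochains. -/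
theorem Total.altY_mul {q : ℕ} : ∀ {f g : Total E N 𝕜 L}, f.IsCochain → g.IsCochain →
    ∀ k X, IsAlt (SmoothFun E N ℝ) (f.mul g q k X) := by
  induction q with
  | zero => exact fun _ _ _ _ => IsAlt.of_isEmpty _
  | succ q ih =>
    intro f g hf hg k X
    have r := fun Z => Total.iY_mul hf hg Z
    have cs : ∀ Z Y, f.mul g (q + 1) k X (Fin.cons Z Y) =
        (Total.iY Z f).mul g q k X Y + f.parity.mul (Total.iY Z g) q k X Y :=
      fun Z Y => congrFun (congrFun (congrFun (congrFun (r Z) q) k) X) Y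
    have h1 : ∀ Z, IsAlt (SmoothFun E N ℝ) (fun Y => f.mul g (q + 1) k X (Fin.cons Z Y)) := by
      intro Z
      simp only [cs]
      exact (ih (hf.iY Z) hg k X).add (ih hf.parity (hg.iY Z) k X)
    have hadd : ∀ Z Z' Y, f.mul g (q + 1) k X (Fin.cons (Z + Z') Y) =
        f.mul g (q + 1) k X (Fin.cons Z Y) + f.mul g (q + 1) k X (Fin.cons Z' Y) := by
      intro Z Z' Y
      simp only [cs, Total.iY_add_left hf, Total.iY_add_left hg, Total.add_mul, Total.mul_add,
        Pi.add_apply]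
      abel
    have hsmul : ∀ (c : SmoothFun E N ℝ) Z Y, f.mul g (q + 1) k X (Fin.cons (c • Z) Y) =
        c • f.mul g (q + 1) k X (Fin.cons Z Y) := by
      intro c Z Y
      simp only [cs, Total.iY_smul_left hf, Total.iY_smul_left hg, smul_add]
      rw [Total.mapVal_mul_of_left _ (fun a b => (smoothFun_smul_mul c a b).symm),
        Total.mapVal_mul_of_right _ (fun a b => (smoothFun_mul_smul c a b).symm)]
      rfl
    cases q with
    | zero => exact IsAlt.of_cons_one hadd hsmul
    | succ q =>
      refine IsAlt.of_cons_cons h1 hadd hsmul fun Z Y => ?_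
      exact congrFun (congrFun (congrFun (congrFun (Total.iY_iY_mul hf hg Z) q) k) X) Y

theorem Total.altX_mul {k : ℕ} : ∀ {f g : Total E N 𝕜 L}, f.IsCochain → g.IsCochain →
    ∀ q Y, IsAlt ℝ (fun X => f.mul g q k X Y) := by
  induction k with
  | zero => exact fun _ _ _ _ => IsAlt.of_isEmpty _
  | succ k ih =>
    intro f g hf hg q Y
    have sq : (-1 : ℤ) ^ q * (-1) ^ q = 1 := by rw [← mul_pow]; simp
    have r := fun ξ => Total.iX_mul hf hg ξ
    have cs : ∀ ξ X, f.mul g q (k + 1) (Fin.cons ξ X) Y =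
        (-1 : ℤ) ^ q • ((Total.iX ξ f).mul g q k X Y + f.parity.mul (Total.iX ξ g) q k X Y) := by
      intro ξ X
      have : (-1 : ℤ) ^ q • f.mul g q (k + 1) (Fin.cons ξ X) Y = _ :=
        congrFun (congrFun (congrFun (congrFun (r ξ) q) k) X) Y
      rw [Pi.add_apply, Pi.add_apply, Pi.add_apply, Pi.add_apply] at this
      rw [← this, smul_smul, sq, one_smul]
    have h1 : ∀ ξ, IsAlt ℝ (fun X => f.mul g q (k + 1) (Fin.cons ξ X) Y) := by
      intro ξ
      simp only [cs]
      exact ((ih (hf.iX ξ) hg q Y).add (ih hf.parity (hg.iX ξ) q Y)).zsmul _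
    have hadd : ∀ ξ ξ' X, f.mul g q (k + 1) (Fin.cons (ξ + ξ') X) Y =
        f.mul g q (k + 1) (Fin.cons ξ X) Y + f.mul g q (k + 1) (Fin.cons ξ' X) Y := by
      intro ξ ξ' X
      simp only [cs, Total.iX_add_left hf, Total.iX_add_left hg, Total.add_mul, Total.mul_add,
        Pi.add_apply, ← smul_add]
      congr 1
      abel
    have hsmul : ∀ (c : ℝ) ξ X, f.mul g q (k + 1) (Fin.cons (c • ξ) X) Y =
        c • f.mul g q (k + 1) (Fin.cons ξ X) Y := by
      intro c ξ X
      simp only [cs, Total.iX_smul_left hf, Total.iX_smul_left hg, smul_add]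
      rw [Total.mapVal_mul_of_left _ (fun a b => (smoothFun_real_smul_mul c a b).symm),
        Total.mapVal_mul_of_right _ (fun a b => (smoothFun_mul_real_smul c a b).symm)]
      simp only [Total.mapVal, smul_comm c]
      rfl
    cases k with
    | zero => exact IsAlt.of_cons_one hadd hsmul
    | succ k =>
      refine IsAlt.of_cons_cons h1 hadd hsmul fun ξ X => ?_
      have := congrFun (congrFun (congrFun (congrFun (Total.iX_iX_mul hf hg ξ) q) k) X) Y
      simpa [Total.iX, smul_smul, sq] using this

theorem Total.IsCochain.mul {f g : Total E N 𝕜 L} (hf : f.IsCochain) (hg : g.IsCochain) :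
    (f.mul g).IsCochain := fun q k =>
  mem_cochains_iff.2 ⟨fun X => Total.altY_mul hf hg k X, fun Y => Total.altX_mul hf hg q Y⟩

theorem Total.isCochain_one : (Total.one : Total E N 𝕜 L).IsCochain := by
  rintro (_ | q) (_ | k)
  · exact mem_cochains_iff.2 ⟨fun _ => IsAlt.of_isEmpty _, fun _ => IsAlt.of_isEmpty _⟩
  all_goals exact Submodule.zero_mem _

theorem Total.iY_one (Z : VField E N) : Total.iY Z (Total.one : Total E N 𝕜 L) = 0 := by
  funext q k X Y
  rfl

theorem Total.iX_one (ξ : L) : Total.iX ξ (Total.one : Total E N 𝕜 L) = 0 := by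
  funext q k X Y
  cases q <;> simp [Total.iX, Total.one]

end TotalProduct

end

end BRS

namespace BRS

noncomputable section

/-! ### The super-commutative algebra of cochain families -/

section CochainAlgebra

variable (E : Type*) [NormedAddCommGroup E] [NormedSpace ℝ E]
  (N : Type*) [TopologicalSpace N] [ChartedSpace E N] [IsManifold 𝓘(ℝ, E) ∞ N]
  (𝕜 : Type*) [RCLike 𝕜] (L : Type*) [AddCommGroup L] [Module ℝ L]

/-- The algebra of all families of cochains. -/
def CochainAlg : Type _ := {f : Total E N 𝕜 L // f.IsCochain}

variable {E N 𝕜 L}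

namespace CochainAlg

instance : CoeFun (CochainAlg E N 𝕜 L) (fun _ => ∀ q k : ℕ, RawCochain E N 𝕜 L q k) :=
  ⟨fun f => f.1⟩

@[ext] theorem ext {f g : CochainAlg E N 𝕜 L} (h : ∀ q k X Y, f q k X Y = g q k X Y) : f = g :=
  Subtype.ext (funext fun q => funext fun k => funext fun X => funext fun Y => h q k X Y)

theorem ext_val {f g : CochainAlg E N 𝕜 L} (h : f.1 = g.1) : f = g := Subtype.ext h

/-- The families of cochains as an additive subgroup. -/
def addSubgroup : AddSubgroup (Total E N 𝕜 L) where
  carrier := {f | f.IsCochain}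
  add_mem' hf hg q k := (cochains E N 𝕜 L q k).add_mem (hf q k) (hg q k)
  zero_mem' q k := (cochains E N 𝕜 L q k).zero_mem
  neg_mem' hf q k := (cochains E N 𝕜 L q k).neg_mem (hf q k)

instance : AddCommGroup (CochainAlg E N 𝕜 L) :=
  inferInstanceAs (AddCommGroup (addSubgroup (E := E) (N := N) (𝕜 := 𝕜) (L := L)))

@[simp] theorem val_add (f g : CochainAlg E N 𝕜 L) : (f + g).1 = f.1 + g.1 := rfl
@[simp] theorem val_sub (f g : CochainAlg E N 𝕜 L) : (f - g).1 = f.1 - g.1 := rfl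
@[simp] theorem val_neg (f : CochainAlg E N 𝕜 L) : (-f).1 = -f.1 := rfl

/-- A bidegree component as an additive map. -/
def comp (q k : ℕ) (X : Fin k → L) (Y : Fin q → VField E N) :
    CochainAlg E N 𝕜 L →+ SmoothFun E N 𝕜 where
  toFun f := f q k X Y
  map_zero' := rfl
  map_add' _ _ := rfl

theorem val_sum {J : Type*} (s : Finset J) (f : J → CochainAlg E N 𝕜 L) (q k : ℕ) (X : Fin k → L)
    (Y : Fin q → VField E N) : (∑ j ∈ s, f j) q k X Y = ∑ j ∈ s, f j q k X Y :=
  map_sum (comp q k X Y) f s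

theorem isCochain_mapVal {f : Total E N 𝕜 L} (hf : f.IsCochain)
    (T : SmoothFun E N 𝕜 →ₗ[ℝ] SmoothFun E N 𝕜)
    (hT : ∀ (φ : SmoothFun E N ℝ) a, T (φ • a) = φ • T a) : (Total.mapVal T f).IsCochain :=
  fun q k => mem_cochains_iff.2 ⟨fun X => (hf.altY q k X).map T hT,
    fun Y => (hf.altX q k Y).map T (map_smul T)⟩

instance : SMul 𝕜 (CochainAlg E N 𝕜 L) where
  smul c f := ⟨Total.mapVal (smoothMul (ContMDiffMap.const c)) f.1,
    isCochain_mapVal f.2 _ fun _ _ => smoothFun_mul_smul _ _ _⟩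

theorem smul_apply (c : 𝕜) (f : CochainAlg E N 𝕜 L) (q k : ℕ) (X : Fin k → L)
    (Y : Fin q → VField E N) : (c • f) q k X Y = ContMDiffMap.const c * f q k X Y := rfl

instance : Module 𝕜 (CochainAlg E N 𝕜 L) where
  one_smul f := by ext q k X Y p; exact one_mul (f q k X Y p)
  mul_smul c d f := by ext q k X Y p; exact mul_assoc c d (f q k X Y p)
  smul_zero c := by ext q k X Y p; exact mul_zero c
  smul_add c f g := by ext q k X Y p; exact mul_add c (f q k X Y p) (g q k X Y p)
  add_smul c d f := by ext q k X Y p; exact add_mul c d (f q k X Y p)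
  zero_smul f := by ext q k X Y p; exact zero_mul (f q k X Y p)

theorem ofReal_smul_val (c : ℝ) (f : CochainAlg E N 𝕜 L) : ((c : 𝕜) • f).1 = c • f.1 := by
  funext q k X Y
  ext p
  exact (RCLike.real_smul_eq_coe_mul c (f q k X Y p)).symm

instance : Mul (CochainAlg E N 𝕜 L) := ⟨fun f g => ⟨f.1.mul g.1, f.2.mul g.2⟩⟩

instance : One (CochainAlg E N 𝕜 L) := ⟨⟨Total.one, Total.isCochain_one⟩⟩

@[simp] theorem val_mul (f g : CochainAlg E N 𝕜 L) : (f * g).1 = f.1.mul g.1 := rfl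
@[simp] theorem val_one : (1 : CochainAlg E N 𝕜 L).1 = Total.one := rfl

instance instNonUnitalNonAssocRing : NonUnitalNonAssocRing (CochainAlg E N 𝕜 L) where
  left_distrib _ _ _ := ext_val (Total.mul_add _ _ _)
  right_distrib _ _ _ := ext_val (Total.add_mul _ _ _)
  zero_mul _ := ext_val (Total.zero_mul _)
  mul_zero _ := ext_val (Total.mul_zero _)

/-- Contraction with a vector field. -/
def iY (Z : VField E N) : CochainAlg E N 𝕜 L →ₗ[𝕜] CochainAlg E N 𝕜 L where
  toFun f := ⟨Total.iY Z f.1, f.2.iY Z⟩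
  map_add' _ _ := rfl
  map_smul' _ _ := rfl

/-- Contraction with an element of `L`. -/
def iX (ξ : L) : CochainAlg E N 𝕜 L →ₗ[𝕜] CochainAlg E N 𝕜 L where
  toFun f := ⟨Total.iX ξ f.1, f.2.iX ξ⟩
  map_add' _ _ := CochainAlg.ext fun _ _ _ _ => smul_add _ _ _
  map_smul' _ _ := CochainAlg.ext fun _ _ _ _ => (mul_smul_comm _ _ _).symm

/-- The parity operator. -/
def parity : CochainAlg E N 𝕜 L →ₗ[𝕜] CochainAlg E N 𝕜 L where
  toFun f := ⟨f.1.parity, f.2.parity⟩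
  map_add' _ _ := CochainAlg.ext fun _ _ _ _ => smul_add _ _ _
  map_smul' _ _ := CochainAlg.ext fun _ _ _ _ => (mul_smul_comm _ _ _).symm

theorem iY_apply (Z : VField E N) (f : CochainAlg E N 𝕜 L) (q k : ℕ) (X : Fin k → L)
    (Y : Fin q → VField E N) : iY Z f q k X Y = f (q + 1) k X (Fin.cons Z Y) := rfl

theorem iX_apply (ξ : L) (f : CochainAlg E N 𝕜 L) (q k : ℕ) (X : Fin k → L)
    (Y : Fin q → VField E N) : iX ξ f q k X Y = (-1 : ℤ) ^ q • f q (k + 1) (Fin.cons ξ X) Y := rfl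

theorem parity_apply (f : CochainAlg E N 𝕜 L) (q k : ℕ) (X : Fin k → L)
    (Y : Fin q → VField E N) : parity f q k X Y = (-1 : ℤ) ^ (q + k) • f q k X Y := rfl

theorem iY_mul (Z : VField E N) (f g : CochainAlg E N 𝕜 L) :
    iY Z (f * g) = iY Z f * g + parity f * iY Z g := ext_val (Total.iY_mul f.2 g.2 Z)

theorem iX_mul (ξ : L) (f g : CochainAlg E N 𝕜 L) :
    iX ξ (f * g) = iX ξ f * g + parity f * iX ξ g := ext_val (Total.iX_mul f.2 g.2 ξ)

theorem iY_parity (Z : VField E N) (f : CochainAlg E N 𝕜 L) :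
    iY Z (parity f) = -parity (iY Z f) := ext_val (Total.iY_parity f.1 Z)

theorem iX_parity (ξ : L) (f : CochainAlg E N 𝕜 L) :
    iX ξ (parity f) = -parity (iX ξ f) := ext_val (Total.iX_parity f.1 ξ)

theorem parity_parity (f : CochainAlg E N 𝕜 L) : parity (parity f) = f :=
  ext_val (Total.parity_parity f.1)

theorem iY_one (Z : VField E N) : iY Z (1 : CochainAlg E N 𝕜 L) = 0 := ext_val (Total.iY_one Z)

theorem iX_one (ξ : L) : iX ξ (1 : CochainAlg E N 𝕜 L) = 0 := ext_val (Total.iX_one ξ)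

theorem mul_apply_zero (f g : CochainAlg E N 𝕜 L) (X : Fin 0 → L) (Y : Fin 0 → VField E N) :
    (f * g) 0 0 X Y = f 0 0 X Y * g 0 0 X Y := Total.mul_zero_zero _ _ _ _

theorem apply_cons_eq_zero {f : CochainAlg E N 𝕜 L} {q k : ℕ} {ξ : L} {X : Fin k → L}
    {Y : Fin q → VField E N} (h : iX ξ f q k X Y = 0) : f q (k + 1) (Fin.cons ξ X) Y = 0 := by
  rw [iX_apply] at h
  have : (-1 : ℤ) ^ q * (-1) ^ q = 1 := by rw [← mul_pow]; simp
  rw [← one_smul ℤ (f q (k + 1) (Fin.cons ξ X) Y), ← this, ← smul_smul, h, smul_zero]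

/-- A set of families that vanish in form degree `0` and that is closed under contractions with
vector fields, up to sums, consists of `0` only. -/
theorem eq_zero_of_iY (S : Set (CochainAlg E N 𝕜 L)) (h0 : ∀ x ∈ S, ∀ k X Y, x 0 k X Y = 0)
    (hY : ∀ x ∈ S, ∀ Z, iY Z x ∈ AddSubgroup.closure S) : ∀ x ∈ S, x = 0 := by
  have key : ∀ q : ℕ, ∀ x ∈ AddSubgroup.closure S, ∀ k X Y, x q k X Y = 0 := by
    intro q
    induction q with
    | zero =>
      intro x hx k X Y
      induction hx using AddSubgroup.closure_induction with
      | mem x hx => exact h0 x hx k X Y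
      | zero => rfl
      | add x y _ _ hx hy => simp [hx, hy]
      | neg x _ hx => simp [hx]
    | succ q ih =>
      intro x hx k X Y
      rw [← Fin.cons_self_tail Y, ← iY_apply]
      refine ih _ ?_ k X _
      induction hx using AddSubgroup.closure_induction with
      | mem x hx => exact hY x hx _
      | zero => simp
      | add x y _ _ hx hy => rw [map_add]; exact add_mem hx hy
      | neg x _ hx => rw [map_neg]; exact neg_mem hx
  intro x hx
  ext1 q k X Y
  exact key q x (AddSubgroup.subset_closure hx) k X Y

/-- The same principle for ghost arguments: the vanishing in ghost degree zero propagates upwards,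
since a value of ghost degree `k + 1` is, up to sign, a value of a contraction. -/
theorem eq_zero_of_iX (S : Set (CochainAlg E N 𝕜 L)) (h0 : ∀ x ∈ S, ∀ q X Y, x q 0 X Y = 0)
    (hX : ∀ x ∈ S, ∀ ξ, iX ξ x ∈ AddSubgroup.closure S) : ∀ x ∈ S, x = 0 := by
  have key : ∀ k : ℕ, ∀ x ∈ AddSubgroup.closure S, ∀ q X Y, x q k X Y = 0 := by
    intro k
    induction k with
    | zero =>
      intro x hx k X Y
      induction hx using AddSubgroup.closure_induction with
      | mem x hx => exact h0 x hx k X Y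
      | zero => rfl
      | add x y _ _ hx hy => simp [hx, hy]
      | neg x _ hx => simp [hx]
    | succ k ih =>
      intro x hx q X Y
      rw [← Fin.cons_self_tail X]
      refine apply_cons_eq_zero (ih _ ?_ q _ _)
      induction hx using AddSubgroup.closure_induction with
      | mem x hx => exact hX x hx _
      | zero => simp
      | add x y _ _ hx hy => rw [map_add]; exact add_mem hx hy
      | neg x _ hx => rw [map_neg]; exact neg_mem hx
  intro x hx
  ext1 q k X Y
  exact key k x (AddSubgroup.subset_closure hx) q X Y

/-- The tool behind the algebraic laws. The set `S` collects all defects of an identity; if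
contracting a defect produces sums of defects of the same shape, the identity only has to be checked
in bidegree `(0, 0)`, where it concerns functions. -/
theorem eq_zero_of_iY_iX (S : Set (CochainAlg E N 𝕜 L)) (h0 : ∀ x ∈ S, ∀ X Y, x 0 0 X Y = 0)
    (hY : ∀ x ∈ S, ∀ Z, iY Z x ∈ AddSubgroup.closure S)
    (hX : ∀ x ∈ S, ∀ ξ, iX ξ x ∈ AddSubgroup.closure S) : ∀ x ∈ S, x = 0 := by
  have hX' : ∀ x ∈ AddSubgroup.closure S, ∀ ξ, iX ξ x ∈ AddSubgroup.closure S := by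
    intro x hx ξ
    induction hx using AddSubgroup.closure_induction with
    | mem x hx => exact hX x hx _
    | zero => simp
    | add x y _ _ hx hy => rw [map_add]; exact add_mem hx hy
    | neg x _ hx => rw [map_neg]; exact neg_mem hx
  refine eq_zero_of_iY S (fun x hx k => ?_) hY
  replace hx := AddSubgroup.subset_closure hx
  induction k generalizing x with
  | zero =>
    intro X Y
    induction hx using AddSubgroup.closure_induction with
    | mem x hx => exact h0 x hx X Y
    | zero => rfl
    | add x y _ _ hx hy => simp [hx, hy]
    | neg x _ hx => simp [hx]
  | succ k ih =>
    intro X Y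
    rw [← Fin.cons_self_tail X]
    exact apply_cons_eq_zero (ih _ (hX' x hx _) _ _)

theorem parity_mul (f g : CochainAlg E N 𝕜 L) : parity (f * g) = parity f * parity g := by
  refine sub_eq_zero.1 (eq_zero_of_iY_iX {x | ∃ f g : CochainAlg E N 𝕜 L,
    x = parity (f * g) - parity f * parity g} ?_ ?_ ?_ _ ⟨f, g, rfl⟩)
  · rintro _ ⟨f, g, rfl⟩ X Y
    simp [parity_apply, mul_apply_zero, Total.mul_zero_zero]
  · rintro _ ⟨f, g, rfl⟩ Z
    have : iY Z (parity (f * g) - parity f * parity g) =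
        -((parity (iY Z f * g) - parity (iY Z f) * parity g) +
        (parity (parity f * iY Z g) - parity (parity f) * parity (iY Z g))) := by
      simp only [map_sub, iY_mul, iY_parity, map_add, neg_mul, mul_neg]
      abel
    rw [this]
    exact neg_mem (add_mem (AddSubgroup.subset_closure ⟨_, _, rfl⟩)
      (AddSubgroup.subset_closure ⟨_, _, rfl⟩))
  · rintro _ ⟨f, g, rfl⟩ Z
    have : iX Z (parity (f * g) - parity f * parity g) =
        -((parity (iX Z f * g) - parity (iX Z f) * parity g) +
        (parity (parity f * iX Z g) - parity (parity f) * parity (iX Z g))) := by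
      simp only [map_sub, iX_mul, iX_parity, map_add, neg_mul, mul_neg]
      abel
    rw [this]
    exact neg_mem (add_mem (AddSubgroup.subset_closure ⟨_, _, rfl⟩)
      (AddSubgroup.subset_closure ⟨_, _, rfl⟩))

/-- Contracting an associator gives a sum of three associators, one for each factor, and in bidegree
`(0, 0)` the product is the pointwise one. -/
theorem mul_assoc' (f g h : CochainAlg E N 𝕜 L) : f * g * h = f * (g * h) := by
  refine sub_eq_zero.1 (eq_zero_of_iY_iX {x | ∃ f g h : CochainAlg E N 𝕜 L,
    x = f * g * h - f * (g * h)} ?_ ?_ ?_ _ ⟨f, g, h, rfl⟩)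
  · rintro _ ⟨f, g, h, rfl⟩ X Y
    simp only [val_sub, Pi.sub_apply, mul_apply_zero, mul_assoc, sub_self]
  · rintro _ ⟨f, g, h, rfl⟩ Z
    have : iY Z (f * g * h - f * (g * h)) =
        (iY Z f * g * h - iY Z f * (g * h)) + (parity f * iY Z g * h - parity f * (iY Z g * h)) +
        (parity f * parity g * iY Z h - parity f * (parity g * iY Z h)) := by
      simp only [map_sub, iY_mul, parity_mul, add_mul, mul_add]
      abel
    rw [this]
    exact add_mem (add_mem (AddSubgroup.subset_closure ⟨_, _, _, rfl⟩)
      (AddSubgroup.subset_closure ⟨_, _, _, rfl⟩)) (AddSubgroup.subset_closure ⟨_, _, _, rfl⟩)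
  · rintro _ ⟨f, g, h, rfl⟩ Z
    have : iX Z (f * g * h - f * (g * h)) =
        (iX Z f * g * h - iX Z f * (g * h)) + (parity f * iX Z g * h - parity f * (iX Z g * h)) +
        (parity f * parity g * iX Z h - parity f * (parity g * iX Z h)) := by
      simp only [map_sub, iX_mul, parity_mul, add_mul, mul_add]
      abel
    rw [this]
    exact add_mem (add_mem (AddSubgroup.subset_closure ⟨_, _, _, rfl⟩)
      (AddSubgroup.subset_closure ⟨_, _, _, rfl⟩)) (AddSubgroup.subset_closure ⟨_, _, _, rfl⟩)

theorem parity_one : parity (1 : CochainAlg E N 𝕜 L) = 1 := by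
  ext q k X Y
  rw [parity_apply]
  rcases q with _ | q <;> rcases k with _ | k <;> simp [Total.one]

theorem one_mul' (f : CochainAlg E N 𝕜 L) : 1 * f = f := by
  refine sub_eq_zero.1 (eq_zero_of_iY_iX {x | ∃ f : CochainAlg E N 𝕜 L,
    x = 1 * f - f} ?_ ?_ ?_ _ ⟨f, rfl⟩)
  · rintro _ ⟨f, rfl⟩ X Y
    simp only [val_sub, Pi.sub_apply, mul_apply_zero]
    simp [Total.one]
  · rintro _ ⟨f, rfl⟩ Z
    refine AddSubgroup.subset_closure ⟨iY Z f, ?_⟩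
    simp only [map_sub, iY_mul, iY_one, parity_one, zero_mul, zero_add]
  · rintro _ ⟨f, rfl⟩ Z
    refine AddSubgroup.subset_closure ⟨iX Z f, ?_⟩
    simp only [map_sub, iX_mul, iX_one, parity_one, zero_mul, zero_add]

theorem mul_one' (f : CochainAlg E N 𝕜 L) : f * 1 = f := by
  refine sub_eq_zero.1 (eq_zero_of_iY_iX {x | ∃ f : CochainAlg E N 𝕜 L,
    x = f * 1 - f} ?_ ?_ ?_ _ ⟨f, rfl⟩)
  · rintro _ ⟨f, rfl⟩ X Y
    simp only [val_sub, Pi.sub_apply, mul_apply_zero]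
    simp [Total.one]
  · rintro _ ⟨f, rfl⟩ Z
    refine AddSubgroup.subset_closure ⟨iY Z f, ?_⟩
    simp only [map_sub, iY_mul, iY_one, mul_zero, add_zero]
  · rintro _ ⟨f, rfl⟩ Z
    refine AddSubgroup.subset_closure ⟨iX Z f, ?_⟩
    simp only [map_sub, iX_mul, iX_one, mul_zero, add_zero]

instance : Ring (CochainAlg E N 𝕜 L) :=
  { instNonUnitalNonAssocRing with
    mul_assoc := mul_assoc'
    one := 1
    one_mul := one_mul'
    mul_one := mul_one' }

instance : Algebra 𝕜 (CochainAlg E N 𝕜 L) := Algebra.ofModule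
  (fun c f g => ext_val (Total.mapVal_mul_of_left (smoothMul (ContMDiffMap.const c))
    (fun a b => (mul_assoc _ a b).symm) f.1 g.1))
  (fun c f g => ext_val (Total.mapVal_mul_of_right (smoothMul (ContMDiffMap.const c))
    (fun a b => mul_left_comm _ a b) f.1 g.1))

/-- Bidegree `(0, 0)` is even, so this component of an odd family equals its own negative. -/
theorem apply_zero_of_odd {f : CochainAlg E N 𝕜 L} (hf : parity f = -f) (X : Fin 0 → L)
    (Y : Fin 0 → VField E N) : f 0 0 X Y = 0 := by
  have h : parity f 0 0 X Y = (-f) 0 0 X Y := by rw [hf]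
  rw [parity_apply] at h
  ext p
  have hp := congrArg (fun a : SmoothFun E N 𝕜 => a p) h
  have hp : f 0 0 X Y p = - f 0 0 X Y p := by simpa using hp
  exact self_eq_neg.1 hp

/-- The even and the odd case must be proved together: contracting `f` reverses its parity, so the
defects of one case contract to defects of both. -/
theorem supercomm_aux (f g : CochainAlg E N 𝕜 L) :
    (parity f = f → f * g = g * f) ∧ (parity f = -f → f * g = parity g * f) := by
  suffices H : ∀ x ∈ {x : CochainAlg E N 𝕜 L | ∃ f g, (parity f = f ∧ x = f * g - g * f) ∨
      (parity f = -f ∧ x = f * g - parity g * f)}, x = 0 from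
    ⟨fun h => sub_eq_zero.1 (H _ ⟨f, g, Or.inl ⟨h, rfl⟩⟩),
      fun h => sub_eq_zero.1 (H _ ⟨f, g, Or.inr ⟨h, rfl⟩⟩)⟩
  refine eq_zero_of_iY_iX _ ?_ ?_ ?_
  · rintro _ ⟨f, g, ⟨h, rfl⟩ | ⟨h, rfl⟩⟩ X Y
    · simp only [val_sub, Pi.sub_apply, mul_apply_zero, mul_comm, sub_self]
    · simp only [val_sub, Pi.sub_apply, mul_apply_zero, apply_zero_of_odd h, zero_mul, mul_zero,
        sub_self]
  · rintro _ ⟨f, g, ⟨h, rfl⟩ | ⟨h, rfl⟩⟩ Z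
    · have hi : parity (iY Z f) = -iY Z f := by rw [← neg_eq_iff_eq_neg, ← iY_parity, h]
      have : iY Z (f * g - g * f) = (iY Z f * g - parity g * iY Z f) + (f * iY Z g - iY Z g * f) := by
        simp only [map_sub, iY_mul, h]; abel
      rw [this]
      exact add_mem (AddSubgroup.subset_closure ⟨_, _, Or.inr ⟨hi, rfl⟩⟩)
        (AddSubgroup.subset_closure ⟨_, _, Or.inl ⟨h, rfl⟩⟩)
    · have hi : parity (iY Z f) = iY Z f := by rw [← neg_inj, ← iY_parity, h, map_neg]
      have : iY Z (f * g - parity g * f) =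
          (iY Z f * g - g * iY Z f) - (f * iY Z g - parity (iY Z g) * f) := by
        simp only [map_sub, iY_mul, h, iY_parity, parity_parity, neg_mul]; abel
      rw [this]
      exact sub_mem (AddSubgroup.subset_closure ⟨_, _, Or.inl ⟨hi, rfl⟩⟩)
        (AddSubgroup.subset_closure ⟨_, _, Or.inr ⟨h, rfl⟩⟩)
  · rintro _ ⟨f, g, ⟨h, rfl⟩ | ⟨h, rfl⟩⟩ Z
    · have hi : parity (iX Z f) = -iX Z f := by rw [← neg_eq_iff_eq_neg, ← iX_parity, h]
      have : iX Z (f * g - g * f) = (iX Z f * g - parity g * iX Z f) + (f * iX Z g - iX Z g * f) := by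
        simp only [map_sub, iX_mul, h]; abel
      rw [this]
      exact add_mem (AddSubgroup.subset_closure ⟨_, _, Or.inr ⟨hi, rfl⟩⟩)
        (AddSubgroup.subset_closure ⟨_, _, Or.inl ⟨h, rfl⟩⟩)
    · have hi : parity (iX Z f) = iX Z f := by rw [← neg_inj, ← iX_parity, h, map_neg]
      have : iX Z (f * g - parity g * f) =
          (iX Z f * g - g * iX Z f) - (f * iX Z g - parity (iX Z g) * f) := by
        simp only [map_sub, iX_mul, h, iX_parity, parity_parity, neg_mul]; abel
      rw [this]
      exact sub_mem (AddSubgroup.subset_closure ⟨_, _, Or.inl ⟨hi, rfl⟩⟩)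
        (AddSubgroup.subset_closure ⟨_, _, Or.inr ⟨h, rfl⟩⟩)

end CochainAlg

end CochainAlgebra

end

end BRS

namespace BRS

noncomputable section

/-! ### Vector fields as derivations and their Lie algebra -/

section VectorFields

variable {E : Type*} [NormedAddCommGroup E] [NormedSpace ℝ E]
  {N : Type*} [TopologicalSpace N] [ChartedSpace E N] [IsManifold 𝓘(ℝ, E) ∞ N]
  {𝕜 : Type*} [RCLike 𝕜]

namespace VField

theorem deriv_mul (X : VField E N) (f g : SmoothFun E N 𝕜) :
    X.deriv (f * g) = X.deriv f * g + f * X.deriv g := by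
  ext p
  have hf : HasMFDerivAt 𝓘(ℝ, E) 𝓘(ℝ, 𝕜) f p _ :=
    (f.contMDiff.mdifferentiableAt (x := p) (by simp)).hasMFDerivAt
  have hg : HasMFDerivAt 𝓘(ℝ, E) 𝓘(ℝ, 𝕜) g p _ :=
    (g.contMDiff.mdifferentiableAt (x := p) (by simp)).hasMFDerivAt
  have h := (hf.mul' hg).mfderiv
  have h2 := congrArg (fun T => T (X p)) h
  refine Eq.trans (b := f p * X.deriv g p + X.deriv f p * g p) h2 ?_
  change _ = X.deriv f p * g p + f p * X.deriv g p
  exact add_comm _ _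

theorem deriv_smul (X : VField E N) (φ : SmoothFun E N ℝ) (f : SmoothFun E N 𝕜) :
    X.deriv (φ • f) = X.deriv φ • f + φ • X.deriv f := by
  ext p
  have hf := f.contMDiff.mdifferentiableAt (x := p) (by simp)
  have hφ := φ.contMDiff.mdifferentiableAt (x := p) (by simp)
  have h := congrArg (fun T => T (X p)) (mvfderiv_smul hφ hf)
  refine Eq.trans (b := φ p • X.deriv f p + X.deriv φ p • f p) h ?_
  change _ = X.deriv φ p • f p + φ p • X.deriv f p
  exact add_comm _ _

theorem smul_deriv (φ : SmoothFun E N ℝ) (X : VField E N) (f : SmoothFun E N 𝕜) :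
    (φ • X).deriv f = φ • X.deriv f := by
  ext p
  exact map_smul (mvfderiv 𝓘(ℝ, E) f p) (φ p) (X p)

theorem add_deriv (X Y : VField E N) (f : SmoothFun E N 𝕜) :
    (X + Y).deriv f = X.deriv f + Y.deriv f := by
  ext p
  exact map_add (mvfderiv 𝓘(ℝ, E) f p) (X p) (Y p)

theorem real_smul_deriv (c : ℝ) (X : VField E N) (f : SmoothFun E N 𝕜) :
    (c • X).deriv f = c • X.deriv f := by
  ext p
  exact map_smul (mvfderiv 𝓘(ℝ, E) f p) c (X p)

theorem zero_deriv (f : SmoothFun E N 𝕜) : (0 : VField E N).deriv f = 0 := by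
  ext p
  exact map_zero (mvfderiv 𝓘(ℝ, E) f p)

theorem neg_deriv (X : VField E N) (f : SmoothFun E N 𝕜) : (-X).deriv f = -X.deriv f := by
  ext p
  exact map_neg (mvfderiv 𝓘(ℝ, E) f p) (X p)

theorem deriv_const (X : VField E N) (c : 𝕜) :
    X.deriv (ContMDiffMap.const c : SmoothFun E N 𝕜) = 0 := by
  ext p
  have : mvfderiv 𝓘(ℝ, E) (fun _ : N => c) p = 0 := mvfderiv_const c
  exact congrArg (fun T => T (X p)) this

end VField

variable [FiniteDimensional ℝ E]

/-- In a chart the bracket is a difference of first derivatives of the coefficients; the second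
derivatives of `f` cancel by symmetry. Only local equalities for the derivatives of `f` are needed.
-/
theorem mvfderiv_bracket {F : Type*} [NormedAddCommGroup F] [NormedSpace ℝ F]
    {f gX gY : N → F} {p : N} (hf : ContMDiffAt 𝓘(ℝ, E) 𝓘(ℝ, F) 2 f p) (X Y : VField E N)
    (hX : ∀ᶠ q in 𝓝 p, mvfderiv 𝓘(ℝ, E) f q (X q) = gX q)
    (hY : ∀ᶠ q in 𝓝 p, mvfderiv 𝓘(ℝ, E) f q (Y q) = gY q)
    (dX : MDifferentiableAt 𝓘(ℝ, E) 𝓘(ℝ, F) gX p) (dY : MDifferentiableAt 𝓘(ℝ, E) 𝓘(ℝ, F) gY p) :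
    mvfderiv 𝓘(ℝ, E) f p (⁅X, Y⁆ p) =
      mvfderiv 𝓘(ℝ, E) gY p (X p) - mvfderiv 𝓘(ℝ, E) gX p (Y p) := by
  have : CompleteSpace E := FiniteDimensional.complete ℝ E
  have : IsManifold 𝓘(ℝ, E) 2 N := .of_le (m := 2) (n := ∞) (by norm_cast)
  set φ := extChartAt 𝓘(ℝ, E) p with hφ
  let H : VField E N → E → E := fun Z =>
    mpullbackWithin 𝓘(ℝ, E) 𝓘(ℝ, E) φ.symm Z (Set.range 𝓘(ℝ, E))
  have hr : Set.range 𝓘(ℝ, E) = Set.univ := by simp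
  have dZ : ∀ Z : VField E N, DifferentiableAt ℝ (H Z) (φ p) := by
    intro Z
    have h0 := MDifferentiableWithinAt.differentiableWithinAt_mpullbackWithin_vectorField
      (Z.mdifferentiableAt (x := p)).mdifferentiableWithinAt (s := Set.univ)
    rw [Set.preimage_univ, Set.univ_inter] at h0
    have h1 : DifferentiableWithinAt ℝ (H Z) (Set.range 𝓘(ℝ, E)) (φ p) := h0
    rwa [hr, differentiableWithinAt_univ] at h1
  have hsymm : ∀ y ∈ φ.target, ContMDiffAt 𝓘(ℝ, E) 𝓘(ℝ, E) 2 φ.symm y := by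
    intro y hy
    have := contMDiffWithinAt_extChartAt_symm_range (I := 𝓘(ℝ, E)) (n := 2) p hy
    rwa [hr, contMDiffWithinAt_univ] at this
  have hp : φ p ∈ φ.target := mem_extChartAt_target p
  have hpp : φ.symm (φ p) = p := extChartAt_to_inv p
  have dg : ContDiffAt ℝ 2 (f ∘ φ.symm) (φ p) := by
    rw [← contMDiffAt_iff_contDiffAt]
    exact ContMDiffAt.comp _ (by rw [hpp]; exact hf) (hsymm _ hp)
  have chain : ∀ (h : N → F), ∀ y ∈ φ.target, MDifferentiableAt 𝓘(ℝ, E) 𝓘(ℝ, F) h (φ.symm y) →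
      ∀ v : E, fderiv ℝ (h ∘ φ.symm) y v
        = mvfderiv 𝓘(ℝ, E) h (φ.symm y) (mfderiv 𝓘(ℝ, E) 𝓘(ℝ, E) φ.symm y v) := by
    intro h y hy hfy v
    rw [← mfderiv_eq_fderiv, mfderiv_comp y hfy ((hsymm y hy).mdifferentiableAt (by norm_num))]
    rfl
  have eH : ∀ (Z : VField E N), ∀ y ∈ φ.target,
      mfderiv 𝓘(ℝ, E) 𝓘(ℝ, E) φ.symm y (H Z y) = Z (φ.symm y) := by
    intro Z y hy
    have inv := isInvertible_mfderivWithin_extChartAt_symm (I := 𝓘(ℝ, E)) hy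
    have := congrArg (fun T => T (Z (φ.symm y))) inv.self_comp_inverse
    rw [← mfderivWithin_univ, ← hr]
    exact this
  have key : ∀ (Z : VField E N) (g : N → F), (∀ᶠ q in 𝓝 p, mvfderiv 𝓘(ℝ, E) f q (Z q) = g q) →
      (fun y => fderiv ℝ (f ∘ φ.symm) y (H Z y)) =ᶠ[𝓝 (φ p)] g ∘ φ.symm := by
    intro Z g hZ
    have c : Filter.Tendsto φ.symm (𝓝 (φ p)) (𝓝 p) := by
      have := (hsymm _ hp).continuousAt.tendsto
      rwa [hpp] at this
    filter_upwards [c.eventually hZ,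
      c.eventually (contMDiffAt_iff_contMDiffAt_nhds (by simp) |>.1 hf),
      extChartAt_target_mem_nhds (I := 𝓘(ℝ, E)) p] with y h1 h2 h3
    rw [chain f y h3 (h2.mdifferentiableAt (by norm_num))]
    exact (congrArg _ (eH Z y h3)).trans h1
  have e1 := fderiv_lieBracket (F := F) dg (dZ X) (dZ Y)
  rw [(key Y gY hY).fderiv_eq, (key X gX hX).fderiv_eq,
    chain f _ hp (by rw [hpp]; exact hf.mdifferentiableAt (by norm_num)),
    chain gY _ hp (by rw [hpp]; exact dY), chain gX _ hp (by rw [hpp]; exact dX)] at e1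
  have e2 : (⁅X, Y⁆ p : E) = mfderiv 𝓘(ℝ, E) 𝓘(ℝ, E) φ.symm (φ p)
      (lieBracket ℝ (E := E) (H X) (H Y) (φ p)) := by
    have h0 : (⁅X, Y⁆ p : E) = (mfderiv 𝓘(ℝ, E) 𝓘(ℝ, E) φ p).inverse
        (lieBracketWithin ℝ (E := E) (H X) (H Y)
          (φ.symm ⁻¹' Set.univ ∩ Set.range 𝓘(ℝ, E)) (φ p)) := rfl
    rw [h0, hr, Set.preimage_univ, Set.univ_inter, lieBracketWithin_univ]
    have i1 := mfderivWithin_extChartAt_symm_comp_mfderiv_extChartAt' (I := 𝓘(ℝ, E))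
      (mem_extChartAt_source (I := 𝓘(ℝ, E)) p)
    have i2 := mfderiv_extChartAt_comp_mfderivWithin_extChartAt_symm' (I := 𝓘(ℝ, E))
      (mem_extChartAt_source (I := 𝓘(ℝ, E)) p)
    rw [hr, mfderivWithin_univ] at i1 i2
    have i3 := ContinuousLinearMap.inverse_eq i2 i1
    rw [i3]
    rfl
  have eX : (mfderiv 𝓘(ℝ, E) 𝓘(ℝ, E) φ.symm (φ p) (H X (φ p)) : E) = X (φ.symm (φ p)) :=
    eH X _ hp
  have eY : (mfderiv 𝓘(ℝ, E) 𝓘(ℝ, E) φ.symm (φ p) (H Y (φ p)) : E) = Y (φ.symm (φ p)) :=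
    eH Y _ hp
  have e1' : (mvfderiv 𝓘(ℝ, E) f (φ.symm (φ p)) (⁅X, Y⁆ p : E) : F) =
      mvfderiv 𝓘(ℝ, E) gY (φ.symm (φ p)) (X (φ.symm (φ p)) : E) -
        mvfderiv 𝓘(ℝ, E) gX (φ.symm (φ p)) (Y (φ.symm (φ p)) : E) := by
    rw [← eX, ← eY, e2]; exact e1
  rwa [hpp] at e1'

/-- With `VField.ext_deriv` this reduces every identity between brackets, including the Jacobi
identity, to one between commutators of operators on functions. -/
theorem VField.bracket_deriv (X Y : VField E N) (f : SmoothFun E N 𝕜) :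
    ⁅X, Y⁆.deriv f = X.deriv (Y.deriv f) - Y.deriv (X.deriv f) := by
  ext p
  exact mvfderiv_bracket (gX := X.deriv f) (gY := Y.deriv f)
    (f.contMDiff.contMDiffAt.of_le (by norm_cast)) X Y (.of_forall fun _ => rfl)
    (.of_forall fun _ => rfl)
    ((X.deriv f).contMDiff.mdifferentiableAt (by simp))
    ((Y.deriv f).contMDiff.mdifferentiableAt (by simp))

variable [T2Space N]

/-- Tangent vectors are determined by the derivatives of smooth functions. -/
theorem tangent_eq_zero {p : N} {v : TangentSpace 𝓘(ℝ, E) p}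
    (h : ∀ φ : SmoothFun E N ℝ, mvfderiv 𝓘(ℝ, E) φ p v = 0) : v = 0 := by
  have inv := isInvertible_mfderiv_extChartAt (I := 𝓘(ℝ, E)) (mem_extChartAt_source (I := 𝓘(ℝ, E)) p)
  refine inv.injective ((?_ : (mfderiv 𝓘(ℝ, E) 𝓘(ℝ, E) (extChartAt 𝓘(ℝ, E) p) p v : E) = 0).trans
    (map_zero _).symm)
  by_contra hne
  obtain ⟨ℓ, hℓ⟩ : ∃ ℓ : E →L[ℝ] ℝ,
      ℓ (mfderiv 𝓘(ℝ, E) 𝓘(ℝ, E) (extChartAt 𝓘(ℝ, E) p) p v : E) ≠ 0 :=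
    SeparatingDual.exists_ne_zero (V := E) hne
  -- The functional `ℓ` detects the vector in the chart. A bump function, for which the manifold
  -- must be Hausdorff, cuts the local coordinate function off to a global smooth one with the same
  -- derivative at `p`.
  let ρ : SmoothBumpFunction 𝓘(ℝ, E) p := Classical.arbitrary _
  let f : N → ℝ := fun q => ℓ (extChartAt 𝓘(ℝ, E) p q)
  have hf : ContMDiffOn 𝓘(ℝ, E) 𝓘(ℝ, ℝ) ∞ f (chartAt E p).source :=
    ℓ.contDiff.contMDiff.comp_contMDiffOn (contMDiffOn_extChartAt (I := 𝓘(ℝ, E)) (x := p))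
  let φ : SmoothFun E N ℝ := ⟨fun q => ρ q • f q, ρ.contMDiff_smul hf⟩
  have e : (φ : N → ℝ) =ᶠ[𝓝 p] f := by
    filter_upwards [ρ.eventuallyEq_one] with q hq
    change ρ q • f q = f q
    rw [hq]; simp
  have h1 := h φ
  have hd : MDifferentiableAt 𝓘(ℝ, E) 𝓘(ℝ, E) (extChartAt 𝓘(ℝ, E) p) p :=
    mdifferentiableAt_extChartAt (mem_chart_source E p)
  have e2 : mfderiv 𝓘(ℝ, E) 𝓘(ℝ, ℝ) φ p = mfderiv 𝓘(ℝ, E) 𝓘(ℝ, ℝ) f p := e.mfderiv_eq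
  have e3 : mfderiv 𝓘(ℝ, E) 𝓘(ℝ, ℝ) f p = (ℓ : E →L[ℝ] ℝ).comp
      (mfderiv 𝓘(ℝ, E) 𝓘(ℝ, E) (extChartAt 𝓘(ℝ, E) p) p) := by
    have := mfderiv_comp (I := 𝓘(ℝ, E)) (I' := 𝓘(ℝ, E)) (I'' := 𝓘(ℝ, ℝ)) p
      (g := ℓ) (f := extChartAt 𝓘(ℝ, E) p) ℓ.mdifferentiableAt hd
    rw [ℓ.mfderiv_eq] at this
    exact this
  have h2 : mfderiv 𝓘(ℝ, E) 𝓘(ℝ, ℝ) φ p v = 0 := h1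
  rw [e2, e3] at h2
  exact hℓ h2

theorem VField.ext_deriv {X Y : VField E N}
    (h : ∀ φ : SmoothFun E N ℝ, X.deriv φ = Y.deriv φ) : X = Y := by
  ext p
  rw [← sub_eq_zero]
  refine tangent_eq_zero fun φ => ?_
  have := congrArg (fun a : SmoothFun E N ℝ => a p) (h φ)
  rw [map_sub, sub_eq_zero]
  exact this

instance : LieRing (VField E N) where
  add_lie X Y Z := VField.ext_deriv fun φ => by
    simp only [VField.bracket_deriv, VField.add_deriv, map_add]; abel
  lie_add X Y Z := VField.ext_deriv fun φ => by
    simp only [VField.bracket_deriv, VField.add_deriv, map_add]; abel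
  lie_self X := VField.ext_deriv fun φ => by
    simp only [VField.bracket_deriv, VField.zero_deriv, sub_self]
  leibniz_lie X Y Z := VField.ext_deriv fun φ => by
    simp only [VField.bracket_deriv, VField.add_deriv, map_sub]; abel

theorem VField.lie_smul_smooth (X Y : VField E N) (φ : SmoothFun E N ℝ) :
    ⁅X, φ • Y⁆ = φ • ⁅X, Y⁆ + X.deriv φ • Y := VField.ext_deriv fun ψ => by
  simp only [VField.bracket_deriv, VField.add_deriv, VField.smul_deriv, VField.deriv_smul, smul_sub]
  abel

theorem VField.smul_lie_smooth (X Y : VField E N) (φ : SmoothFun E N ℝ) :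
    ⁅φ • X, Y⁆ = φ • ⁅X, Y⁆ - Y.deriv φ • X := VField.ext_deriv fun ψ => by
  rw [sub_eq_add_neg]
  simp only [VField.bracket_deriv, VField.add_deriv, VField.smul_deriv, VField.deriv_smul, smul_sub,
    VField.neg_deriv]
  abel

theorem VField.smul_lie_real (c : ℝ) (X Y : VField E N) : ⁅c • X, Y⁆ = c • ⁅X, Y⁆ :=
  VField.ext_deriv fun ψ => by
    simp only [VField.bracket_deriv, VField.real_smul_deriv, map_smul, smul_sub]

theorem VField.lie_smul_real (c : ℝ) (X Y : VField E N) : ⁅X, c • Y⁆ = c • ⁅X, Y⁆ :=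
  VField.ext_deriv fun ψ => by
    simp only [VField.bracket_deriv, VField.real_smul_deriv, map_smul, smul_sub]

end VectorFields

end

end BRS

namespace BRS

noncomputable section

/-! ### Cartan calculus for a Lie ring acting with an anchor -/

section ChevalleyEilenberg

/-- An action of a Lie ring `α` on a module `W` over `R`, compatible with an action of `α` on `R`
by derivations. -/
structure LieAction (R α W : Type*) [CommRing R] [LieRing α] [Module R α] [AddCommGroup W]
    [Module R W] where
  act : α → W →+ W
  anchor : α → R → R
  add_act : ∀ (z z' : α) (w : W), act (z + z') w = act z w + act z' w
  smul_act : ∀ (r : R) (z : α) (w : W), act (r • z) w = r • act z w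
  act_smul : ∀ (z : α) (r : R) (w : W), act z (r • w) = r • act z w + anchor z r • w
  lie_act : ∀ (z z' : α) (w : W), act ⁅z, z'⁆ w = act z (act z' w) - act z' (act z w)
  lie_smul : ∀ (z : α) (r : R) (z' : α), ⁅z, r • z'⁆ = r • ⁅z, z'⁆ + anchor z r • z'
  smul_lie : ∀ (r : R) (z z' : α), ⁅r • z, z'⁆ = r • ⁅z, z'⁆ - anchor z' r • z

variable {R α W : Type*} [CommRing R] [LieRing α] [Module R α] [AddCommGroup W] [Module R W]

/-- Contraction of a family of functions. -/
def famI (z : α) (f : ∀ k : ℕ, (Fin k → α) → W) : ∀ k : ℕ, (Fin k → α) → W :=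
  fun k x => f (k + 1) (Fin.cons z x)

variable (R) in
/-- All members of the family are alternating. -/
def FamAlt (f : ∀ k : ℕ, (Fin k → α) → W) : Prop := ∀ k, IsAlt R (f k)

theorem FamAlt.famI {f : ∀ k : ℕ, (Fin k → α) → W} (hf : FamAlt R f) (z : α) :
    FamAlt R (famI z f) := fun k => (hf (k + 1)).cons z

theorem FamAlt.famI_add_left {f : ∀ k : ℕ, (Fin k → α) → W} (hf : FamAlt R f) (z z' : α) :
    BRS.famI (z + z') f = BRS.famI z f + BRS.famI z' f :=
  funext fun k => funext fun x => (hf (k + 1)).map_cons_add z z' x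

theorem FamAlt.famI_smul_left {f : ∀ k : ℕ, (Fin k → α) → W} (hf : FamAlt R f) (r : R) (z : α) :
    BRS.famI (r • z) f = r • BRS.famI z f :=
  funext fun k => funext fun x => (hf (k + 1)).map_cons_smul r z x

theorem FamAlt.famI_zero_left {f : ∀ k : ℕ, (Fin k → α) → W} (hf : FamAlt R f) :
    BRS.famI (0 : α) f = 0 :=
  funext fun k => funext fun _ => (hf (k + 1)).map_coord_zero 0 rfl

theorem FamAlt.famI_neg_left {f : ∀ k : ℕ, (Fin k → α) → W} (hf : FamAlt R f) (z : α) :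
    BRS.famI (-z) f = -BRS.famI z f := by
  rw [eq_neg_iff_add_eq_zero, ← hf.famI_add_left, neg_add_cancel, hf.famI_zero_left]

theorem FamAlt.famI_self {f : ∀ k : ℕ, (Fin k → α) → W} (hf : FamAlt R f) (z : α) :
    BRS.famI z (BRS.famI z f) = 0 :=
  funext fun k => funext fun x => (hf (k + 2)).map_cons_cons z x

theorem FamAlt.famI_swap {f : ∀ k : ℕ, (Fin k → α) → W} (hf : FamAlt R f) (z w : α) :
    BRS.famI z (BRS.famI w f) = -BRS.famI w (BRS.famI z f) :=
  funext fun k => funext fun x => (hf (k + 2)).map_cons_swap w z x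

theorem FamAlt.add {f g : ∀ k : ℕ, (Fin k → α) → W} (hf : FamAlt R f) (hg : FamAlt R g) :
    FamAlt R (f + g) := fun k => (hf k).add (hg k)

/-- Pairs that contain the first position produce the bracket terms of the Lie derivative along `z`,
since moving the bracket back to its place costs a sign. The remaining pairs form the bracket sum of
the contraction, with `z` exchanged with the bracket, hence the second minus sign. -/
theorem bracketSum_cons {k : ℕ} {f : (Fin (k + 1) → α) → W} (hf : IsAlt R f) (z : α)
    (x : Fin (k + 1) → α) :
    bracketSum f (Fin.cons z x : Fin (k + 2) → α) =
      -∑ j, f (Function.update x j ⁅z, x j⁆) - bracketSum (fun y => f (Fin.cons z y)) x := by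
  have h0 : ∑ j ∈ Finset.Ici (0 : Fin (k + 1)), (-1 : ℤ) ^ ((0 : Fin (k + 1)) + (j + 1) : ℕ) •
      f (Fin.cons ⁅(Fin.cons z x : Fin (k + 2) → α) (Fin.castSucc 0),
        (Fin.cons z x : Fin (k + 2) → α) j.succ⁆
        (j.removeNth ((Fin.castSucc 0).removeNth (Fin.cons z x : Fin (k + 2) → α)))) =
      -∑ j, f (Function.update x j ⁅z, x j⁆) := by
    have : Finset.Ici (0 : Fin (k + 1)) = Finset.univ := by ext; simp
    rw [this, ← Finset.sum_neg_distrib]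
    refine Finset.sum_congr rfl fun j _ => ?_
    rw [hf.map_removeNth, ← neg_smul]
    congr 1
    · simp [pow_succ]
  rw [sub_eq_add_neg, bracketSum, Fin.sum_univ_succ, h0]
  congr 1
  cases k with
  | zero => simp [bracketSum]
  | succ k =>
    rw [bracketSum, ← Finset.sum_neg_distrib]
    refine Finset.sum_congr rfl fun i _ => ?_
    rw [← Finset.sum_neg_distrib]
    have : Finset.Ici i.succ = (Finset.Ici i).map (Fin.succEmb _) := by
      ext j
      cases j using Fin.cases with
      | zero => simp
      | succ j => simp
    rw [this, Finset.sum_map]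
    refine Finset.sum_congr rfl fun j _ => ?_
    have e : (Fin.removeNth j.succ (Fin.removeNth i.succ.castSucc (Fin.cons z x : Fin (k + 3) → α)))
        = Fin.cons z (Fin.removeNth j (Fin.removeNth i.castSucc x)) := by
      ext l
      cases l using Fin.cases with
      | zero => simp [Fin.removeNth]
      | succ l => simp [Fin.removeNth]
    simp only [Fin.coe_succEmb, e]
    simp only [Fin.cons_succ, ← Fin.succ_castSucc]
    rw [hf.map_cons_swap, smul_neg]
    congr 2
    simp only [Fin.val_succ]
    ring

namespace LieAction

variable (ρ : LieAction R α W)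

/-- The Lie derivative of a family. -/
def famL (z : α) (f : ∀ k : ℕ, (Fin k → α) → W) : ∀ k : ℕ, (Fin k → α) → W :=
  fun k x => ρ.act z (f k x) - ∑ i, f k (Function.update x i ⁅z, x i⁆)

/-- The Chevalley–Eilenberg differential. -/
def ce {k : ℕ} (f : (Fin k → α) → W) (x : Fin (k + 1) → α) : W :=
  ∑ i : Fin (k + 1), (-1 : ℤ) ^ (i : ℕ) • ρ.act (x i) (f (i.removeNth x)) + bracketSum f x

/-- The Chevalley–Eilenberg differential of a family. -/
def famD (f : ∀ k : ℕ, (Fin k → α) → W) : ∀ k : ℕ, (Fin k → α) → W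
  | 0 => 0
  | k + 1 => ρ.ce (f k)

theorem famL_add (z : α) (f g : ∀ k : ℕ, (Fin k → α) → W) :
    ρ.famL z (f + g) = ρ.famL z f + ρ.famL z g := by
  funext k x
  simp only [famL, Pi.add_apply, map_add, Finset.sum_add_distrib]
  abel

theorem famL_sub (z : α) (f g : ∀ k : ℕ, (Fin k → α) → W) :
    ρ.famL z (f - g) = ρ.famL z f - ρ.famL z g := by
  funext k x
  simp only [famL, Pi.sub_apply, map_sub, Finset.sum_sub_distrib]
  abel

theorem famL_smul (z : α) (r : R) (f : ∀ k : ℕ, (Fin k → α) → W) :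
    ρ.famL z (r • f) = r • ρ.famL z f + ρ.anchor z r • f := by
  funext k x
  simp only [famL, Pi.smul_apply, Pi.add_apply, ρ.act_smul, smul_sub, Finset.smul_sum]
  abel

theorem famL_zero (z : α) : ρ.famL z 0 = 0 := by
  funext k x
  simp [famL]

theorem famD_zero : ρ.famD 0 = 0 := by
  funext k x
  cases k with
  | zero => rfl
  | succ k =>
    cases k <;> simp [famD, ce, bracketSum]

theorem bracketSum_rsmul {k : ℕ} (r : R) (f : (Fin k → α) → W) (x : Fin (k + 1) → α) :
    bracketSum (r • f) x = r • bracketSum f x := by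
  cases k with
  | zero => simp [bracketSum]
  | succ q => simp [bracketSum, Finset.smul_sum, smul_comm r]

theorem famD_add (f g : ∀ k : ℕ, (Fin k → α) → W) : ρ.famD (f + g) = ρ.famD f + ρ.famD g := by
  funext k x
  cases k with
  | zero => simp [famD]
  | succ k =>
    simp only [famD, ce, Pi.add_apply, map_add, smul_add, Finset.sum_add_distrib, bracketSum_add]
    abel

theorem famD_neg (f : ∀ k : ℕ, (Fin k → α) → W) : ρ.famD (-f) = -ρ.famD f := by
  rw [eq_neg_iff_add_eq_zero, ← famD_add, neg_add_cancel, famD_zero]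

theorem famD_sub (f g : ∀ k : ℕ, (Fin k → α) → W) : ρ.famD (f - g) = ρ.famD f - ρ.famD g := by
  rw [sub_eq_add_neg, famD_add, famD_neg, sub_eq_add_neg]

/-- Used to move equivariant operations on the values, such as `d`, the sign operator and
contractions with commuting fields, through the coboundary `s`. -/
theorem famD_map (T : W →+ W) (hT : ∀ z w, T (ρ.act z w) = ρ.act z (T w))
    (f : ∀ k : ℕ, (Fin k → α) → W) :
    ρ.famD (fun k x => T (f k x)) = fun k x => T (ρ.famD f k x) := by
  funext k x
  cases k with
  | zero => simp [famD]
  | succ k =>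
    have : bracketSum (fun x => T (f k x)) x = T (bracketSum (f k) x) := by
      cases k with
      | zero => simp [bracketSum]
      | succ q => simp only [bracketSum, map_sum, map_zsmul]
    simp only [famD, ce, map_add, map_sum, map_zsmul, hT, this]

theorem famI_famL (z w : α) (f : ∀ k : ℕ, (Fin k → α) → W) :
    famI w (ρ.famL z f) = ρ.famL z (famI w f) - famI ⁅z, w⁆ f := by
  funext k x
  simp only [famI, famL, Pi.sub_apply, Fin.sum_univ_succ, Fin.cons_zero, Fin.cons_succ,
    Fin.update_cons_zero, Fin.cons_update]
  abel

/-- Cartan's formula. It determines the differential recursively in the degree, and the properties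
of `famD` below follow from it by induction. -/
theorem famI_famD {f : ∀ k : ℕ, (Fin k → α) → W} (hf : FamAlt R f) (z : α) :
    famI z (ρ.famD f) = ρ.famL z f - ρ.famD (famI z f) := by
  funext k x
  cases k with
  | zero =>
    simp only [famI, famD, ce, famL, bracketSum, Pi.sub_apply]
    simp
  | succ k =>
    simp only [famI, famD, ce, famL, Pi.sub_apply, Fin.sum_univ_succ (n := k + 1)]
    rw [bracketSum_cons (hf _)]
    have : ∀ i : Fin (k + 1), (-1 : ℤ) ^ (i.succ : ℕ) • ρ.act ((Fin.cons z x : Fin (k + 2) → α) i.succ)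
        (f (k + 1) (i.succ.removeNth (Fin.cons z x : Fin (k + 2) → α))) =
        -((-1 : ℤ) ^ (i : ℕ) • ρ.act (x i) (f (k + 1) (Fin.cons z (i.removeNth x)))) := by
      intro i
      have e : i.succ.removeNth (Fin.cons z x : Fin (k + 2) → α) = Fin.cons z (i.removeNth x) := by
        ext l
        cases l using Fin.cases with
        | zero => simp [Fin.removeNth]
        | succ l => simp [Fin.removeNth]
      rw [e, Fin.cons_succ, ← neg_smul]
      congr 1
      simp [pow_succ]
    simp only [this, Finset.sum_neg_distrib]
    simp only [Fin.val_zero, pow_zero, one_smul, Fin.cons_zero, Fin.removeNth_zero, Fin.tail_cons]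
    abel

theorem famAlt_famL {f : ∀ k : ℕ, (Fin k → α) → W} (hf : FamAlt R f) (z : α) :
    FamAlt R (ρ.famL z f) := by
  intro k
  induction k generalizing f with
  | zero => exact IsAlt.of_isEmpty _
  | succ k ih =>
    have cs : ∀ w x, ρ.famL z f (k + 1) (Fin.cons w x) =
        (ρ.famL z (famI w f) - famI ⁅z, w⁆ f) k x :=
      fun w x => congrFun (congrFun (ρ.famI_famL z w f) k) x
    have h1 : ∀ w, IsAlt R fun x => ρ.famL z f (k + 1) (Fin.cons w x) := by
      intro w
      simp only [cs]
      exact (ih (hf.famI w)).sub (hf.famI _ k)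
    have hadd : ∀ w w' x, ρ.famL z f (k + 1) (Fin.cons (w + w') x) =
        ρ.famL z f (k + 1) (Fin.cons w x) + ρ.famL z f (k + 1) (Fin.cons w' x) := by
      intro w w' x
      simp only [cs, hf.famI_add_left, lie_add, famL_add, Pi.sub_apply, Pi.add_apply]
      abel
    have hsmul : ∀ (r : R) w x, ρ.famL z f (k + 1) (Fin.cons (r • w) x) =
        r • ρ.famL z f (k + 1) (Fin.cons w x) := by
      intro r w x
      simp only [cs, hf.famI_smul_left, hf.famI_add_left, ρ.lie_smul, famL_smul, Pi.sub_apply,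
        Pi.add_apply, Pi.smul_apply, smul_sub]
      abel
    cases k with
    | zero => exact IsAlt.of_cons_one hadd hsmul
    | succ k =>
      refine IsAlt.of_cons_cons h1 hadd hsmul fun w x => ?_
      have e : famI w (famI w (ρ.famL z f)) = 0 := by
        have sub : ∀ f g : ∀ k : ℕ, (Fin k → α) → W, famI w (f - g) = famI w f - famI w g :=
          fun _ _ => rfl
        rw [famI_famL, sub, famI_famL, hf.famI_self, famL_zero, hf.famI_swap w]
        simp
      exact congrFun (congrFun e k) x

/-- The Lie derivative is not `R`-linear in the field. The extra terms are exactly those by which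
`famD (r • famI z f)` differs from `r • famD (famI z f)`, so they cancel in Cartan's formula. -/
theorem famL_smul_left {f : ∀ k : ℕ, (Fin k → α) → W} (hf : FamAlt R f) (r : R) (z : α) (k : ℕ)
    (x : Fin k → α) : ρ.famL (r • z) f k x =
      r • ρ.famL z f k x + ∑ i, ρ.anchor (x i) r • f k (Function.update x i z) := by
  have e : ∀ i, f k (Function.update x i ⁅r • z, x i⁆) =
      r • f k (Function.update x i ⁅z, x i⁆) - ρ.anchor (x i) r • f k (Function.update x i z) := by
    intro i
    rw [ρ.smul_lie, sub_eq_add_neg, ← neg_smul, (hf k).map_update_add, (hf k).map_update_smul,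
      (hf k).map_update_smul, neg_smul, sub_eq_add_neg]
  simp only [famL, ρ.smul_act, e, Finset.sum_sub_distrib, Finset.smul_sum, smul_sub]
  abel

theorem famL_add_left {f : ∀ k : ℕ, (Fin k → α) → W} (hf : FamAlt R f) (z z' : α) :
    ρ.famL (z + z') f = ρ.famL z f + ρ.famL z' f := by
  funext k x
  simp only [famL, ρ.add_act, add_lie, (hf k).map_update_add, Finset.sum_add_distrib, Pi.add_apply]
  abel

theorem famD_smul (r : R) (f : ∀ k : ℕ, (Fin k → α) → W) (k : ℕ) (x : Fin (k + 1) → α) :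
    ρ.famD (r • f) (k + 1) x = r • ρ.famD f (k + 1) x +
      ∑ i : Fin (k + 1), (-1 : ℤ) ^ (i : ℕ) • ρ.anchor (x i) r • f k (i.removeNth x) := by
  simp only [famD, ce, Pi.smul_apply, ρ.act_smul, smul_add, Finset.sum_add_distrib,
    bracketSum_rsmul, Finset.smul_sum, smul_comm r]
  abel

theorem famAlt_famD {f : ∀ k : ℕ, (Fin k → α) → W} (hf : FamAlt R f) :
    FamAlt R (ρ.famD f) := by
  intro k
  induction k generalizing f with
  | zero => exact IsAlt.of_isEmpty _
  | succ k ih =>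
    have cs : ∀ w x, ρ.famD f (k + 1) (Fin.cons w x) =
        ρ.famL w f k x - ρ.famD (famI w f) k x :=
      fun w x => congrFun (congrFun (ρ.famI_famD hf w) k) x
    have h1 : ∀ w, IsAlt R fun x => ρ.famD f (k + 1) (Fin.cons w x) := by
      intro w
      simp only [cs]
      exact (ρ.famAlt_famL hf w k).sub (ih (hf.famI w))
    have hadd : ∀ w w' x, ρ.famD f (k + 1) (Fin.cons (w + w') x) =
        ρ.famD f (k + 1) (Fin.cons w x) + ρ.famD f (k + 1) (Fin.cons w' x) := by
      intro w w' x
      simp only [cs, hf.famI_add_left, famD_add, ρ.famL_add_left hf, Pi.add_apply]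
      abel
    have hsmul : ∀ (r : R) w x, ρ.famD f (k + 1) (Fin.cons (r • w) x) =
        r • ρ.famD f (k + 1) (Fin.cons w x) := by
      intro r w x
      simp only [cs, hf.famI_smul_left, ρ.famL_smul_left hf, smul_sub]
      cases k with
      | zero => simp [famD]
      | succ k =>
        rw [famD_smul]
        have : ∀ i : Fin (k + 1), (-1 : ℤ) ^ (i : ℕ) • ρ.anchor (x i) r • famI w f k (i.removeNth x) =
            ρ.anchor (x i) r • f (k + 1) (Function.update x i w) := by
          intro i
          rw [(hf (k + 1)).map_removeNth, smul_comm]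
          rfl
        simp only [this]
        abel
    cases k with
    | zero => exact IsAlt.of_cons_one hadd hsmul
    | succ k =>
      refine IsAlt.of_cons_cons h1 hadd hsmul fun w x => ?_
      have e : famI w (famI w (ρ.famD f)) = 0 := by
        have sub : ∀ f g : ∀ k : ℕ, (Fin k → α) → W, famI w (f - g) = famI w f - famI w g :=
          fun _ _ => rfl
        rw [ρ.famI_famD hf, sub, ρ.famI_famD (hf.famI w), famI_famL, hf.famI_self, famD_zero,
          lie_self, hf.famI_zero_left]
        simp
      exact congrFun (congrFun e k) x

/-- Contracting with `v` turns the claim into the same claim for `famI v f`, up to terms that match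
by the Jacobi identity. -/
theorem famL_famL {f : ∀ k : ℕ, (Fin k → α) → W} (hf : FamAlt R f) (z w : α) :
    ρ.famL z (ρ.famL w f) - ρ.famL w (ρ.famL z f) = ρ.famL ⁅z, w⁆ f := by
  funext k
  induction k generalizing f with
  | zero =>
    funext x
    simp [famL, ρ.lie_act]
  | succ k ih =>
    funext x
    rw [← Fin.cons_self_tail x]
    generalize x 0 = v
    generalize Fin.tail x = x
    change famI v (ρ.famL z (ρ.famL w f) - ρ.famL w (ρ.famL z f)) k x = famI v (ρ.famL ⁅z, w⁆ f) k x
    have e : famI v (ρ.famL z (ρ.famL w f) - ρ.famL w (ρ.famL z f)) =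
        (ρ.famL z (ρ.famL w (famI v f)) - ρ.famL w (ρ.famL z (famI v f))) - famI ⁅⁅z, w⁆, v⁆ f := by
      have sub : ∀ f g : ∀ k : ℕ, (Fin k → α) → W, famI v (f - g) = famI v f - famI v g :=
        fun _ _ => rfl
      have j : ⁅⁅z, w⁆, v⁆ = ⁅z, ⁅w, v⁆⁆ + -⁅w, ⁅z, v⁆⁆ := by rw [lie_lie, sub_eq_add_neg]
      simp only [sub, famI_famL, famL_sub, j, hf.famI_add_left, hf.famI_neg_left]
      abel
    rw [e, Pi.sub_apply, Pi.sub_apply, ih (hf.famI v), famI_famL]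
    rfl

theorem famD_famL {f : ∀ k : ℕ, (Fin k → α) → W} (hf : FamAlt R f) (z : α) :
    ρ.famD (ρ.famL z f) = ρ.famL z (ρ.famD f) := by
  funext k
  induction k generalizing f with
  | zero => funext x; simp [famL, famD]
  | succ k ih =>
    funext x
    rw [← Fin.cons_self_tail x]
    generalize x 0 = v
    generalize Fin.tail x = x
    change famI v (ρ.famD (ρ.famL z f)) k x = famI v (ρ.famL z (ρ.famD f)) k x
    rw [ρ.famI_famD (ρ.famAlt_famL hf z), famI_famL, famI_famL, ρ.famI_famD hf, ρ.famI_famD hf,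
      famD_sub, famL_sub, ← ρ.famL_famL hf]
    simp only [Pi.sub_apply, ih (hf.famI v)]
    abel

/-- By Cartan's formula and the commutation of `famD` with `famL`, contracting the square of the
differential with `v` gives the square applied to `famI v f`, which has lower degree. -/
theorem famD_famD {f : ∀ k : ℕ, (Fin k → α) → W} (hf : FamAlt R f) :
    ρ.famD (ρ.famD f) = 0 := by
  funext k
  induction k generalizing f with
  | zero => rfl
  | succ k ih =>
    funext x
    rw [← Fin.cons_self_tail x]
    generalize x 0 = v
    generalize Fin.tail x = x
    change famI v (ρ.famD (ρ.famD f)) k x = 0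
    rw [ρ.famI_famD (ρ.famAlt_famD hf), ρ.famI_famD hf, famD_sub, ρ.famD_famL hf]
    simp [ih (hf.famI v)]

end LieAction

end ChevalleyEilenberg

end

end BRS

namespace BRS

noncomputable section

/-! ### Differential forms, the de Rham differential and Lie derivatives on cochains -/

section Forms

variable {E : Type*} [NormedAddCommGroup E] [NormedSpace ℝ E] [FiniteDimensional ℝ E]
  {N : Type*} [TopologicalSpace N] [ChartedSpace E N] [IsManifold 𝓘(ℝ, E) ∞ N] [T2Space N]
  {𝕜 : Type*} [RCLike 𝕜]

theorem bracketSum_zsmul {α V : Type*} [Bracket α α] [AddCommGroup V] {k : ℕ} (c : ℤ)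
    (f : (Fin k → α) → V) (x : Fin (k + 1) → α) :
    bracketSum (fun y => c • f y) x = c • bracketSum f x := by
  cases k with
  | zero => simp [bracketSum]
  | succ k => simp only [bracketSum, Finset.smul_sum, smul_comm c]

variable (E N 𝕜) in
/-- Vector fields act on smooth functions by derivations. -/
def derivAction : LieAction (SmoothFun E N ℝ) (VField E N) (SmoothFun E N 𝕜) where
  act X := X.deriv.toAddMonoidHom
  anchor X φ := X.deriv φ
  add_act := VField.add_deriv
  smul_act := VField.smul_deriv
  act_smul X φ f := (VField.deriv_smul X φ f).trans (add_comm _ _)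
  lie_act := VField.bracket_deriv
  lie_smul X φ Y := VField.lie_smul_smooth X Y φ
  smul_lie φ X Y := VField.smul_lie_smooth X Y φ

variable (E N 𝕜) in
/-- Families of differential forms. -/
def FormFam : Type _ := {g : ∀ q : ℕ, RawForm E N 𝕜 q // FamAlt (SmoothFun E N ℝ) g}

namespace FormFam

@[ext] theorem ext {f g : FormFam E N 𝕜} (h : ∀ q Y, f.1 q Y = g.1 q Y) : f = g :=
  Subtype.ext (funext fun q => funext fun Y => h q Y)

variable (E N 𝕜) in
/-- The families of differential forms as a submodule. -/
def submodule : Submodule ℝ (∀ q : ℕ, RawForm E N 𝕜 q) where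
  carrier := {g | FamAlt (SmoothFun E N ℝ) g}
  add_mem' hf hg := hf.add hg
  zero_mem' _ := IsAlt.zero
  smul_mem' c _ hf k := (hf k).map (c • LinearMap.id : SmoothFun E N 𝕜 →ₗ[ℝ] SmoothFun E N 𝕜)
    fun φ a => (smul_comm φ c a).symm

instance : AddCommGroup (FormFam E N 𝕜) := inferInstanceAs (AddCommGroup (submodule E N 𝕜))
instance : Module ℝ (FormFam E N 𝕜) := inferInstanceAs (Module ℝ (submodule E N 𝕜))

@[simp] theorem val_add (f g : FormFam E N 𝕜) : (f + g).1 = f.1 + g.1 := rfl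
@[simp] theorem val_zero : (0 : FormFam E N 𝕜).1 = 0 := rfl
@[simp] theorem val_smul (c : ℝ) (f : FormFam E N 𝕜) : (c • f).1 = c • f.1 := rfl

/-- The value of the member of degree `q`. -/
def eval (q : ℕ) (Y : Fin q → VField E N) : FormFam E N 𝕜 →ₗ[ℝ] SmoothFun E N 𝕜 where
  toFun f := f.1 q Y
  map_add' _ _ := rfl
  map_smul' _ _ := rfl

/-- Lets a cochain be read as an alternating map with values in families of forms, so that the
general Cartan calculus applies to `s` with the forms as its module. -/
theorem isAlt_iff {L : Type*} [AddCommGroup L] [Module ℝ L] {k : ℕ}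
    {u : (Fin k → L) → FormFam E N 𝕜} :
    IsAlt ℝ u ↔ ∀ q Y, IsAlt ℝ (fun X => (u X).1 q Y) := by
  constructor
  · exact fun h q Y => h.map (eval q Y) (map_smul _)
  · intro h
    refine ⟨{ toFun := u, map_update_add' := ?_, map_update_smul' := ?_,
              map_eq_zero_of_eq' := ?_ }, fun _ => rfl⟩
    · intro inst m i x y
      rw [Subsingleton.elim inst (instDecidableEqFin _)]
      exact ext fun q Y => (h q Y).map_update_add m i x y
    · intro inst m i c x
      rw [Subsingleton.elim inst (instDecidableEqFin _)]
      exact ext fun q Y => (h q Y).map_update_smul m i c x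
    · intro m i j hm hij
      exact ext fun q Y => (h q Y).map_eq_zero m hij hm

/-- The Lie derivative of families of forms. -/
def lie (Z : VField E N) : FormFam E N 𝕜 →+ FormFam E N 𝕜 where
  toFun f := ⟨(derivAction E N 𝕜).famL Z f.1, (derivAction E N 𝕜).famAlt_famL f.2 Z⟩
  map_zero' := Subtype.ext ((derivAction E N 𝕜).famL_zero Z)
  map_add' f g := Subtype.ext ((derivAction E N 𝕜).famL_add Z f.1 g.1)

/-- The exterior derivative of families of forms. -/
def d : FormFam E N 𝕜 →+ FormFam E N 𝕜 where
  toFun f := ⟨(derivAction E N 𝕜).famD f.1, (derivAction E N 𝕜).famAlt_famD f.2⟩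
  map_zero' := Subtype.ext (derivAction E N 𝕜).famD_zero
  map_add' f g := Subtype.ext ((derivAction E N 𝕜).famD_add f.1 g.1)

/-- Multiplication by `(-1)^q` in degree `q`. -/
def sign : FormFam E N 𝕜 →+ FormFam E N 𝕜 where
  toFun f := ⟨fun q Y => (-1 : ℤ) ^ q • f.1 q Y, fun q => (f.2 q).zsmul _⟩
  map_zero' := by ext1 q Y; simp
  map_add' f g := FormFam.ext fun _ _ => smul_add _ _ _

theorem d_lie (Z : VField E N) (f : FormFam E N 𝕜) : d (lie Z f) = lie Z (d f) :=
  Subtype.ext ((derivAction E N 𝕜).famD_famL f.2 Z)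

theorem sign_lie (Z : VField E N) (f : FormFam E N 𝕜) : sign (lie Z f) = lie Z (sign f) := by
  ext1 q Y
  change (-1 : ℤ) ^ q • (Z.deriv (f.1 q Y) - ∑ i, _) = Z.deriv ((-1 : ℤ) ^ q • f.1 q Y) - ∑ i, _
  rw [map_zsmul, smul_sub, Finset.smul_sum]
  rfl

theorem d_sign (f : FormFam E N 𝕜) : d (sign f) = -sign (d f) := by
  ext1 q Y
  cases q with
  | zero =>
    change (0 : SmoothFun E N 𝕜) = -((-1 : ℤ) ^ 0 • 0)
    simp
  | succ q =>
    change ∑ i : Fin (q + 1), (-1 : ℤ) ^ (i : ℕ) • (Y i).deriv ((-1 : ℤ) ^ q •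
          f.1 q (i.removeNth Y)) + bracketSum (fun y => (-1 : ℤ) ^ q • f.1 q y) Y =
        -((-1 : ℤ) ^ (q + 1) • (∑ i : Fin (q + 1), (-1 : ℤ) ^ (i : ℕ) • (Y i).deriv (
          f.1 q (i.removeNth Y)) + bracketSum (f.1 q) Y))
    simp only [map_zsmul, bracketSum_zsmul, smul_comm _ ((-1 : ℤ) ^ q), ← Finset.smul_sum,
      ← smul_add, ← neg_smul]
    congr 1
    ring

theorem sign_sign (f : FormFam E N 𝕜) : sign (sign f) = f := by
  ext1 q Y
  change (-1 : ℤ) ^ q • (-1 : ℤ) ^ q • f.1 q Y = f.1 q Y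
  rw [smul_smul, ← mul_pow]
  simp

theorem d_smul (c : ℝ) (f : FormFam E N 𝕜) : d (c • f) = c • d f := by
  ext1 q Y
  cases q with
  | zero => exact (smul_zero c).symm
  | succ q => exact congrFun ((extD q).map_smul c (f.1 q)) Y

theorem lie_smul_left (c : ℝ) (Z : VField E N) (f : FormFam E N 𝕜) :
    lie (c • Z) f = c • lie Z f := by
  ext1 q Y
  change (c • Z).deriv (f.1 q Y) - ∑ i, f.1 q (Function.update Y i ⁅c • Z, Y i⁆) =
    c • (Z.deriv (f.1 q Y) - ∑ i, f.1 q (Function.update Y i ⁅Z, Y i⁆))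
  rw [smul_sub, VField.real_smul_deriv, Finset.smul_sum]
  congr 1
  refine Finset.sum_congr rfl fun i _ => ?_
  have e : ⁅c • Z, Y i⁆ = (ContMDiffMap.const c : SmoothFun E N ℝ) • ⁅Z, Y i⁆ :=
    VField.smul_lie_real c Z (Y i)
  rw [e, (f.2 q).map_update_smul]
  rfl

theorem lie_smul_right (c : ℝ) (Z : VField E N) (f : FormFam E N 𝕜) :
    lie Z (c • f) = c • lie Z f := by
  ext1 q Y
  change Z.deriv (c • f.1 q Y) - ∑ i, c • f.1 q (Function.update Y i ⁅Z, Y i⁆) =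
    c • (Z.deriv (f.1 q Y) - ∑ i, f.1 q (Function.update Y i ⁅Z, Y i⁆))
  rw [smul_sub, map_smul, Finset.smul_sum]

end FormFam

namespace CochainAlg

variable {L : Type*} [AddCommGroup L] [Module ℝ L]

theorem famAlt (f : CochainAlg E N 𝕜 L) (k : ℕ) (X : Fin k → L) :
    FamAlt (SmoothFun E N ℝ) (fun q => f q k X) := fun q => f.2.altY q k X

/-- A family of cochains as a family of functions with values in families of forms. -/
def fam (f : CochainAlg E N 𝕜 L) : ∀ k : ℕ, (Fin k → L) → FormFam E N 𝕜 :=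
  fun k X => ⟨fun q => f q k X, f.famAlt k X⟩

theorem isAlt_fam (f : CochainAlg E N 𝕜 L) (k : ℕ) : IsAlt ℝ (f.fam k) :=
  FormFam.isAlt_iff.2 fun q Y => f.2.altX q k Y

/-- The family of cochains given by a family of functions with values in families of forms. -/
def ofFam (u : ∀ k : ℕ, (Fin k → L) → FormFam E N 𝕜) (hu : ∀ k, IsAlt ℝ (u k)) : CochainAlg E N 𝕜 L :=
  ⟨fun q k X Y => (u k X).1 q Y, fun q k => mem_cochains_iff.2
    ⟨fun X => (u k X).2 q, fun Y => FormFam.isAlt_iff.1 (hu k) q Y⟩⟩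

theorem fam_injective {f g : CochainAlg E N 𝕜 L} (h : f.fam = g.fam) : f = g := by
  refine CochainAlg.ext fun q k X Y => ?_
  exact congrArg (fun u : ∀ k : ℕ, (Fin k → L) → FormFam E N 𝕜 => (u k X).1 q Y) h

/-- Apply an additive map to all families of forms. -/
def mapFam (T : FormFam E N 𝕜 →+ FormFam E N 𝕜) (hT : ∀ (c : ℝ) f, T (c • f) = c • T f)
    (f : CochainAlg E N 𝕜 L) : CochainAlg E N 𝕜 L :=
  ofFam (fun k X => T (f.fam k X)) fun k => (f.isAlt_fam k).map T hT

theorem const_mul_deriv (Z : VField E N) (c : 𝕜) (a : SmoothFun E N 𝕜) :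
    Z.deriv (ContMDiffMap.const c * a) = ContMDiffMap.const c * Z.deriv a := by
  rw [VField.deriv_mul, VField.deriv_const, zero_mul, zero_add]

theorem const_mul_bracketSum {α : Type*} [Bracket α α] {k : ℕ} (c : 𝕜)
    (f : (Fin k → α) → SmoothFun E N 𝕜) (x : Fin (k + 1) → α) :
    bracketSum (fun y => ContMDiffMap.const c * f y) x = ContMDiffMap.const c * bracketSum f x := by
  cases k with
  | zero => simp [bracketSum]
  | succ k => simp only [bracketSum, Finset.mul_sum, mul_smul_comm]

/-- The de Rham differential, as a function. -/
def dFun (f : CochainAlg E N 𝕜 L) : CochainAlg E N 𝕜 L :=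
  mapFam FormFam.d FormFam.d_smul f

/-- The Lie derivative along a vector field, acting on the values only, as a function. -/
def lieFun (Z : VField E N) (f : CochainAlg E N 𝕜 L) : CochainAlg E N 𝕜 L :=
  mapFam (FormFam.lie Z) (fun c f => FormFam.lie_smul_right c Z f) f

theorem dFun_succ (f : CochainAlg E N 𝕜 L) (q k : ℕ) (X : Fin k → L)
    (Y : Fin (q + 1) → VField E N) : dFun f (q + 1) k X Y =
      ∑ i : Fin (q + 1), (-1 : ℤ) ^ (i : ℕ) • (Y i).deriv (f q k X (i.removeNth Y)) +
        bracketSum (f q k X) Y := rfl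

theorem lieFun_apply (Z : VField E N) (f : CochainAlg E N 𝕜 L) (q k : ℕ) (X : Fin k → L)
    (Y : Fin q → VField E N) : lieFun Z f q k X Y =
      Z.deriv (f q k X Y) - ∑ i, f q k X (Function.update Y i ⁅Z, Y i⁆) := rfl

theorem dFun_add (f g : CochainAlg E N 𝕜 L) : dFun (f + g) = dFun f + dFun g := by
  ext1 q k X Y
  cases q with
  | zero => exact (add_zero (0 : SmoothFun E N 𝕜)).symm
  | succ q =>
    rw [val_add, Pi.add_apply, Pi.add_apply, Pi.add_apply, Pi.add_apply]
    simp only [dFun_succ, val_add, Pi.add_apply, map_add, smul_add, Finset.sum_add_distrib,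
      bracketSum_add]
    abel

theorem dFun_smul (c : 𝕜) (f : CochainAlg E N 𝕜 L) : dFun (c • f) = c • dFun f := by
  ext1 q k X Y
  rw [smul_apply]
  cases q with
  | zero => exact (mul_zero _).symm
  | succ q =>
    have : (c • f) q k X = fun y => ContMDiffMap.const c * f q k X y := rfl
    simp only [dFun_succ, this, const_mul_bracketSum, const_mul_deriv, mul_add, Finset.mul_sum,
      mul_smul_comm]

theorem lieFun_add (Z : VField E N) (f g : CochainAlg E N 𝕜 L) :
    lieFun Z (f + g) = lieFun Z f + lieFun Z g := by
  ext1 q k X Y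
  rw [val_add, Pi.add_apply, Pi.add_apply, Pi.add_apply, Pi.add_apply]
  simp only [lieFun_apply, val_add, Pi.add_apply, map_add, Finset.sum_add_distrib]
  abel

theorem lieFun_smul (Z : VField E N) (c : 𝕜) (f : CochainAlg E N 𝕜 L) :
    lieFun Z (c • f) = c • lieFun Z f := by
  ext1 q k X Y
  rw [smul_apply]
  simp only [lieFun_apply, smul_apply, const_mul_deriv, mul_sub, Finset.mul_sum]

/-- The de Rham differential. -/
def d : CochainAlg E N 𝕜 L →ₗ[𝕜] CochainAlg E N 𝕜 L where
  toFun := dFun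
  map_add' := dFun_add
  map_smul' := dFun_smul

/-- The Lie derivative along a vector field, acting on the values only. -/
def lieY (Z : VField E N) : CochainAlg E N 𝕜 L →ₗ[𝕜] CochainAlg E N 𝕜 L where
  toFun := lieFun Z
  map_add' := lieFun_add Z
  map_smul' := lieFun_smul Z

theorem d_apply_zero (f : CochainAlg E N 𝕜 L) (k : ℕ) (X : Fin k → L) (Y : Fin 0 → VField E N) :
    d f 0 k X Y = 0 := rfl

theorem d_apply_succ (f : CochainAlg E N 𝕜 L) (q k : ℕ) (X : Fin k → L)
    (Y : Fin (q + 1) → VField E N) : d f (q + 1) k X Y =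
      ∑ i : Fin (q + 1), (-1 : ℤ) ^ (i : ℕ) • (Y i).deriv (f q k X (i.removeNth Y)) +
        bracketSum (f q k X) Y := rfl

theorem lieY_apply (Z : VField E N) (f : CochainAlg E N 𝕜 L) (q k : ℕ) (X : Fin k → L)
    (Y : Fin q → VField E N) : lieY Z f q k X Y =
      Z.deriv (f q k X Y) - ∑ i, f q k X (Function.update Y i ⁅Z, Y i⁆) := rfl

theorem iY_lieY (Z W : VField E N) (f : CochainAlg E N 𝕜 L) :
    iY W (lieY Z f) = lieY Z (iY W f) - iY ⁅Z, W⁆ f :=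
  CochainAlg.ext fun q k X Y => congrFun (congrFun
    ((derivAction E N 𝕜).famI_famL Z W (fun q => f q k X)) q) Y

theorem iX_lieY (Z : VField E N) (ξ : L) (f : CochainAlg E N 𝕜 L) :
    iX ξ (lieY Z f) = lieY Z (iX ξ f) := CochainAlg.ext fun q k X Y => by
  simp only [iX_apply, lieY_apply, map_zsmul, smul_sub, Finset.smul_sum]

theorem parity_lieY (Z : VField E N) (f : CochainAlg E N 𝕜 L) :
    parity (lieY Z f) = lieY Z (parity f) := CochainAlg.ext fun q k X Y => by
  simp only [parity_apply, lieY_apply, map_zsmul, smul_sub, Finset.smul_sum]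

theorem iY_d (Z : VField E N) (f : CochainAlg E N 𝕜 L) :
    iY Z (d f) = lieY Z f - d (iY Z f) :=
  CochainAlg.ext fun q k X Y => congrFun (congrFun
    ((derivAction E N 𝕜).famI_famD (f.famAlt k X) Z) q) Y

theorem d_d (f : CochainAlg E N 𝕜 L) : d (d f) = 0 :=
  CochainAlg.ext fun q k X Y => congrFun (congrFun
    ((derivAction E N 𝕜).famD_famD (f.famAlt k X)) q) Y

theorem parity_d (f : CochainAlg E N 𝕜 L) : parity (d f) = -d (parity f) := by
  ext1 q k X Y
  rw [val_neg, Pi.neg_apply, Pi.neg_apply, Pi.neg_apply, Pi.neg_apply]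
  cases q with
  | zero => simp only [parity_apply, d_apply_zero, smul_zero, neg_zero]
  | succ q =>
    have : parity f q k X = fun y => (-1 : ℤ) ^ (q + k) • f q k X y := rfl
    simp only [parity_apply, d_apply_succ, this, map_zsmul, bracketSum_zsmul,
      smul_comm _ ((-1 : ℤ) ^ (q + k)), ← Finset.smul_sum, ← smul_add, ← neg_smul]
    congr 1
    ring

/-- The defect of the Leibniz rule contracts to defects of the same kind, the commutator terms `iY
⁅Z, W⁆` cancelling because that contraction is itself an antiderivation. In bidegree `(0, 0)` this
is the product rule for functions. -/
theorem lieY_mul (Z : VField E N) (f g : CochainAlg E N 𝕜 L) :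
    lieY Z (f * g) = lieY Z f * g + f * lieY Z g := by
  refine sub_eq_zero.1 (eq_zero_of_iY_iX {x | ∃ f g : CochainAlg E N 𝕜 L,
    x = lieY Z (f * g) - (lieY Z f * g + f * lieY Z g)} ?_ ?_ ?_ _ ⟨f, g, rfl⟩)
  · rintro _ ⟨f, g, rfl⟩ X Y
    simp only [val_sub, val_add, Pi.sub_apply, Pi.add_apply, lieY_apply, mul_apply_zero,
      VField.deriv_mul]
    simp
  · rintro _ ⟨f, g, rfl⟩ W
    have : iY W (lieY Z (f * g) - (lieY Z f * g + f * lieY Z g)) =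
        (lieY Z (iY W f * g) - (lieY Z (iY W f) * g + iY W f * lieY Z g)) +
        (lieY Z (parity f * iY W g) - (lieY Z (parity f) * iY W g + parity f * lieY Z (iY W g))) := by
      simp only [map_sub, map_add, iY_mul, iY_lieY, parity_lieY, sub_mul, mul_sub]
      abel
    rw [this]
    exact add_mem (AddSubgroup.subset_closure ⟨_, _, rfl⟩) (AddSubgroup.subset_closure ⟨_, _, rfl⟩)
  · rintro _ ⟨f, g, rfl⟩ W
    have : iX W (lieY Z (f * g) - (lieY Z f * g + f * lieY Z g)) =
        (lieY Z (iX W f * g) - (lieY Z (iX W f) * g + iX W f * lieY Z g)) +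
        (lieY Z (parity f * iX W g) - (lieY Z (parity f) * iX W g + parity f * lieY Z (iX W g))) := by
      simp only [map_sub, map_add, iX_mul, iX_lieY, parity_lieY]
      abel
    rw [this]
    exact add_mem (AddSubgroup.subset_closure ⟨_, _, rfl⟩) (AddSubgroup.subset_closure ⟨_, _, rfl⟩)

theorem mul_apply_form_zero_of_left {f : CochainAlg E N 𝕜 L} (hf : ∀ k, f.1 0 k = 0)
    (g : CochainAlg E N 𝕜 L) (k : ℕ) (X : Fin k → L) (Y : Fin 0 → VField E N) :
    (f * g) 0 k X Y = 0 := by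
  have := Total.mul_form_zero_congr (f' := 0) (g' := g.1) hf (fun _ => rfl) k
  rw [Total.zero_mul] at this
  exact congrFun (congrFun this X) Y

theorem mul_apply_form_zero_of_right {g : CochainAlg E N 𝕜 L} (hg : ∀ k, g.1 0 k = 0)
    (f : CochainAlg E N 𝕜 L) (k : ℕ) (X : Fin k → L) (Y : Fin 0 → VField E N) :
    (f * g) 0 k X Y = 0 := by
  have := Total.mul_form_zero_congr (f := f.1) (g' := 0) (fun _ => rfl) hg k
  rw [Total.mul_zero] at this
  exact congrFun (congrFun this X) Y

theorem mul_apply_ghost_zero_of_left {f : CochainAlg E N 𝕜 L} (hf : ∀ q, f.1 q 0 = 0)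
    (g : CochainAlg E N 𝕜 L) (q : ℕ) (X : Fin 0 → L) (Y : Fin q → VField E N) :
    (f * g) q 0 X Y = 0 := by
  have := Total.mul_ghost_zero_congr (f' := 0) (g' := g.1) hf (fun _ => rfl) q
  rw [Total.zero_mul] at this
  exact congrFun (congrFun this X) Y

theorem mul_apply_ghost_zero_of_right {g : CochainAlg E N 𝕜 L} (hg : ∀ q, g.1 q 0 = 0)
    (f : CochainAlg E N 𝕜 L) (q : ℕ) (X : Fin 0 → L) (Y : Fin q → VField E N) :
    (f * g) q 0 X Y = 0 := by
  have := Total.mul_ghost_zero_congr (f := f.1) (g' := 0) (fun _ => rfl) hg q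
  rw [Total.mul_zero] at this
  exact congrFun (congrFun this X) Y

/-- Contractions with vector fields suffice here: `d` raises the form degree, so all terms vanish in
form degree zero. Contracting the defect gives such defects again, once the Lie derivatives cancel
by `lieY_mul`. -/
theorem d_mul (f g : CochainAlg E N 𝕜 L) : d (f * g) = d f * g + parity f * d g := by
  refine sub_eq_zero.1 (eq_zero_of_iY {x | ∃ f g : CochainAlg E N 𝕜 L,
    x = d (f * g) - (d f * g + parity f * d g)} ?_ ?_ _ ⟨f, g, rfl⟩)
  · rintro _ ⟨f, g, rfl⟩ k X Y
    simp only [val_sub, val_add, Pi.sub_apply, Pi.add_apply, d_apply_zero]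
    rw [mul_apply_form_zero_of_left (fun _ => rfl), mul_apply_form_zero_of_right (fun _ => rfl)]
    simp
  · rintro _ ⟨f, g, rfl⟩ Z
    have : iY Z (d (f * g) - (d f * g + parity f * d g)) =
        -(d (iY Z f * g) - (d (iY Z f) * g + parity (iY Z f) * d g)) -
        (d (parity f * iY Z g) - (d (parity f) * iY Z g + parity (parity f) * d (iY Z g))) := by
      simp only [map_sub, map_add, iY_mul, iY_d, iY_parity, parity_parity, parity_d, sub_mul, mul_sub,
        lieY_mul, neg_mul]
      abel
    rw [this]
    exact sub_mem (neg_mem (AddSubgroup.subset_closure ⟨_, _, rfl⟩))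
      (AddSubgroup.subset_closure ⟨_, _, rfl⟩)

end CochainAlg

end Forms

end

end BRS

/-! ### The coboundary `s` and the total differential `D = s + d` on `P` -/

namespace BRS

noncomputable section

theorem bracketSum_map {α V W : Type*} [Bracket α α] [AddCommGroup V] [AddCommGroup W] (T : V →+ W)
    {k : ℕ} (f : (Fin k → α) → V) (x : Fin (k + 1) → α) :
    T (bracketSum f x) = bracketSum (fun y => T (f y)) x := by
  cases k with
  | zero => simp [bracketSum]
  | succ k => simp only [bracketSum, map_sum, map_zsmul]

namespace FormFam

variable {E : Type*} [NormedAddCommGroup E] [NormedSpace ℝ E] [FiniteDimensional ℝ E]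
  {N : Type*} [TopologicalSpace N] [ChartedSpace E N] [IsManifold 𝓘(ℝ, E) ∞ N] [T2Space N]
  {𝕜 : Type*} [RCLike 𝕜]

theorem lie_add_left (Z W : VField E N) (f : FormFam E N 𝕜) :
    lie (Z + W) f = lie Z f + lie W f :=
  Subtype.ext ((derivAction E N 𝕜).famL_add_left f.2 Z W)

theorem lie_bracket (Z W : VField E N) (f : FormFam E N 𝕜) :
    lie ⁅Z, W⁆ f = lie Z (lie W f) - lie W (lie Z f) :=
  Subtype.ext ((derivAction E N 𝕜).famL_famL f.2 Z W).symm

theorem sign_smul (c : ℝ) (f : FormFam E N 𝕜) : sign (c • f) = c • sign f :=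
  ext fun q Y => smul_comm ((-1 : ℤ) ^ q) c (f.1 q Y)

end FormFam

namespace PrincipalBundle

variable
    {EM : Type*} [NormedAddCommGroup EM] [NormedSpace ℝ EM] [FiniteDimensional ℝ EM]
    {M : Type*} [TopologicalSpace M] [ChartedSpace EM M] [IsManifold 𝓘(ℝ, EM) ∞ M]
    {EG : Type*} [NormedAddCommGroup EG] [NormedSpace ℝ EG] [FiniteDimensional ℝ EG]
    {G : Type*} [TopologicalSpace G] [ChartedSpace EG G] [Group G]
    {EP : Type*} [NormedAddCommGroup EP] [NormedSpace ℝ EP] [FiniteDimensional ℝ EP]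
    {P : Type*} [TopologicalSpace P] [ChartedSpace EP P] [IsManifold 𝓘(ℝ, EP) ∞ P] [T2Space P]
    (B : PrincipalBundle EM M EG G EP P) {𝕜 : Type*} [RCLike 𝕜]

instance : LieRing B.gaugeAlg where
  add_lie X Y Z := Subtype.ext (add_lie (X : VField EP P) (Y : VField EP P) (Z : VField EP P))
  lie_add X Y Z := Subtype.ext (lie_add (X : VField EP P) (Y : VField EP P) (Z : VField EP P))
  lie_self X := Subtype.ext (lie_self (X : VField EP P))
  leibniz_lie X Y Z :=
    Subtype.ext (leibniz_lie (X : VField EP P) (Y : VField EP P) (Z : VField EP P))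

variable (𝕜) in
/-- The gauge algebra acts on differential forms by Lie derivatives. -/
def gaugeAction : LieAction ℝ B.gaugeAlg (FormFam EP P 𝕜) where
  act X := FormFam.lie (X : VField EP P)
  anchor _ _ := 0
  add_act X Y f := FormFam.lie_add_left (X : VField EP P) Y f
  smul_act c X f := FormFam.lie_smul_left c (X : VField EP P) f
  act_smul X c f := by rw [FormFam.lie_smul_right, zero_smul, add_zero]
  lie_act X Y f := FormFam.lie_bracket (X : VField EP P) Y f
  lie_smul X c Y := by
    rw [zero_smul, add_zero]
    exact Subtype.ext (VField.lie_smul_real c (X : VField EP P) (Y : VField EP P))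
  smul_lie c X Y := by
    rw [zero_smul, sub_zero]
    exact Subtype.ext (VField.smul_lie_real c (X : VField EP P) (Y : VField EP P))

variable (𝕜) in
/-- The algebra of BRS cochains on `P`. -/
abbrev Alg : Type _ := CochainAlg EP P 𝕜 B.gaugeAlg

variable {B}
open CochainAlg

/-- The coboundary `s`, as a function. -/
def sFun (f : B.Alg 𝕜) : B.Alg 𝕜 :=
  ofFam (fun k X => FormFam.sign ((B.gaugeAction 𝕜).famD f.fam k X)) fun k =>
    ((B.gaugeAction 𝕜).famAlt_famD f.isAlt_fam k).map FormFam.sign FormFam.sign_smul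

/-- The Lie derivative along an element of the gauge algebra, as a function. -/
def lieXFun (ξ : B.gaugeAlg) (f : B.Alg 𝕜) : B.Alg 𝕜 :=
  ofFam ((B.gaugeAction 𝕜).famL ξ f.fam) ((B.gaugeAction 𝕜).famAlt_famL f.isAlt_fam ξ)

theorem fam_sub (f g : B.Alg 𝕜) : (f - g).fam = f.fam - g.fam := rfl

/-- The coboundary `s`. -/
def sHom : B.Alg 𝕜 →+ B.Alg 𝕜 where
  toFun := sFun
  map_zero' := fam_injective <| by
    funext k X
    change FormFam.sign ((B.gaugeAction 𝕜).famD 0 k X) = 0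
    rw [LieAction.famD_zero]
    exact map_zero _
  map_add' f g := fam_injective <| by
    funext k X
    change FormFam.sign ((B.gaugeAction 𝕜).famD (f.fam + g.fam) k X) =
      FormFam.sign ((B.gaugeAction 𝕜).famD f.fam k X) + FormFam.sign ((B.gaugeAction 𝕜).famD g.fam k X)
    rw [LieAction.famD_add]
    exact map_add _ _ _

/-- The Lie derivative along an element of the gauge algebra. -/
def lieX (ξ : B.gaugeAlg) : B.Alg 𝕜 →+ B.Alg 𝕜 where
  toFun := lieXFun ξ
  map_zero' := fam_injective ((B.gaugeAction 𝕜).famL_zero ξ)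
  map_add' f g := fam_injective ((B.gaugeAction 𝕜).famL_add ξ f.fam g.fam)

theorem fam_sHom (f : B.Alg 𝕜) :
    (sHom f).fam = fun k X => FormFam.sign ((B.gaugeAction 𝕜).famD f.fam k X) := rfl

theorem fam_lieX (ξ : B.gaugeAlg) (f : B.Alg 𝕜) :
    (lieX ξ f).fam = (B.gaugeAction 𝕜).famL ξ f.fam := rfl

theorem fam_iX (ξ : B.gaugeAlg) (f : B.Alg 𝕜) :
    (iX ξ f).fam = fun k X => FormFam.sign (famI ξ f.fam k X) := rfl

/-- Cartan's formula for `s`. The signs `(-1)^q` contained in `s` and in `iX` cancel on the left,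
and the sign operator commutes with Lie derivatives on the right. -/
theorem iX_sHom (ξ : B.gaugeAlg) (f : B.Alg 𝕜) :
    iX ξ (sHom f) = lieX ξ f - sHom (iX ξ f) := by
  apply fam_injective
  have h1 : famI ξ (sHom f).fam =
      fun k X => FormFam.sign (famI ξ ((B.gaugeAction 𝕜).famD f.fam) k X) := rfl
  have h2 : (B.gaugeAction 𝕜).famD (fun k X => FormFam.sign (famI ξ f.fam k X)) =
      fun k X => FormFam.sign ((B.gaugeAction 𝕜).famD (famI ξ f.fam) k X) :=
    (B.gaugeAction 𝕜).famD_map FormFam.sign (fun z w => FormFam.sign_lie _ _) _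
  rw [fam_iX, fam_sub, fam_lieX, fam_sHom (iX ξ f), fam_iX, h1, h2,
    (B.gaugeAction 𝕜).famI_famD f.isAlt_fam]
  funext k X
  simp only [FormFam.sign_sign, Pi.sub_apply]

theorem iX_lieX (ξ η : B.gaugeAlg) (f : B.Alg 𝕜) :
    iX η (lieX ξ f) = lieX ξ (iX η f) - iX ⁅ξ, η⁆ f := by
  apply fam_injective
  rw [fam_sub, fam_lieX, fam_iX, fam_iX, fam_iX, fam_lieX, LieAction.famI_famL]
  funext k X
  simp only [Pi.sub_apply, map_sub, LieAction.famL, map_sum]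
  congr 2
  exact FormFam.sign_lie _ _

theorem parity_lieX (ξ : B.gaugeAlg) (f : B.Alg 𝕜) : parity (lieX ξ f) = lieX ξ (parity f) := by
  refine sub_eq_zero.1 (eq_zero_of_iX {x | ∃ f : B.Alg 𝕜,
    x = parity (lieX ξ f) - lieX ξ (parity f)} ?_ ?_ _ ⟨f, rfl⟩)
  · rintro _ ⟨f, rfl⟩ q X Y
    have h : ∀ g : B.Alg 𝕜, lieX ξ g q 0 X Y = lieY (ξ : VField EP P) g q 0 X Y := fun g => by
      change ((FormFam.lie (ξ : VField EP P) (g.fam 0 X) - ∑ i : Fin 0, _).1 q Y) = _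
      rw [Fin.sum_univ_zero, sub_zero]
      rfl
    rw [val_sub, Pi.sub_apply, Pi.sub_apply, Pi.sub_apply, Pi.sub_apply, parity_apply, h, h,
      ← parity_lieY, parity_apply, sub_self]
  · rintro _ ⟨f, rfl⟩ η
    have : iX η (parity (lieX ξ f) - lieX ξ (parity f)) =
        -(parity (lieX ξ (iX η f)) - lieX ξ (parity (iX η f))) := by
      simp only [map_sub, iX_parity, iX_lieX, map_neg]
      abel
    rw [this]
    exact neg_mem (AddSubgroup.subset_closure ⟨_, rfl⟩)

theorem lieX_apply_ghost_zero (ξ : B.gaugeAlg) (f : B.Alg 𝕜) (q : ℕ) :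
    (lieX ξ f).1 q 0 = (lieY (ξ : VField EP P) f).1 q 0 := by
  funext X Y
  change ((FormFam.lie (ξ : VField EP P) (f.fam 0 X) - ∑ i : Fin 0, _).1 q Y) = _
  rw [Fin.sum_univ_zero, sub_zero]
  rfl

/-- Without ghost arguments `lieX` acts on the values only and agrees with `lieY`, whose Leibniz
rule is known. Contractions with the gauge algebra carry this to all ghost degrees. -/
theorem lieX_mul (ξ : B.gaugeAlg) (f g : B.Alg 𝕜) :
    lieX ξ (f * g) = lieX ξ f * g + f * lieX ξ g := by
  refine sub_eq_zero.1 (eq_zero_of_iX {x | ∃ f g : B.Alg 𝕜,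
    x = lieX ξ (f * g) - (lieX ξ f * g + f * lieX ξ g)} ?_ ?_ _ ⟨f, g, rfl⟩)
  · rintro _ ⟨f, g, rfl⟩ q X Y
    have h1 : (lieX ξ f * g) q 0 = (lieY (ξ : VField EP P) f * g) q 0 :=
      Total.mul_ghost_zero_congr (lieX_apply_ghost_zero ξ f) (fun _ => rfl) q
    have h2 : (f * lieX ξ g) q 0 = (f * lieY (ξ : VField EP P) g) q 0 :=
      Total.mul_ghost_zero_congr (fun _ => rfl) (lieX_apply_ghost_zero ξ g) q
    have h3 := lieX_apply_ghost_zero ξ (f * g) q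
    rw [val_sub, val_add, Pi.sub_apply, Pi.add_apply, Pi.sub_apply, Pi.add_apply, h1, h2, h3, lieY_mul]
    exact sub_self _
  · rintro _ ⟨f, g, rfl⟩ η
    have : iX η (lieX ξ (f * g) - (lieX ξ f * g + f * lieX ξ g)) =
        (lieX ξ (iX η f * g) - (lieX ξ (iX η f) * g + iX η f * lieX ξ g)) +
        (lieX ξ (parity f * iX η g) - (lieX ξ (parity f) * iX η g + parity f * lieX ξ (iX η g))) := by
      simp only [map_sub, map_add, iX_mul, iX_lieX, parity_lieX, sub_mul, mul_sub]
      abel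
    rw [this]
    exact add_mem (AddSubgroup.subset_closure ⟨_, _, rfl⟩) (AddSubgroup.subset_closure ⟨_, _, rfl⟩)

theorem sHom_apply_zero (f : B.Alg 𝕜) (q : ℕ) : (sHom f).1 q 0 = 0 := by
  funext X Y
  change (FormFam.sign (0 : FormFam EP P 𝕜)).1 q Y = 0
  rw [map_zero]
  rfl

theorem parity_sHom (f : B.Alg 𝕜) : parity (sHom f) = -sHom (parity f) := by
  refine eq_neg_of_add_eq_zero_left (eq_zero_of_iX {x | ∃ f : B.Alg 𝕜,
    x = parity (sHom f) + sHom (parity f)} ?_ ?_ _ ⟨f, rfl⟩)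
  · rintro _ ⟨f, rfl⟩ q X Y
    rw [val_add, Pi.add_apply, Pi.add_apply, Pi.add_apply, Pi.add_apply, parity_apply,
      sHom_apply_zero, sHom_apply_zero]
    simp
  · rintro _ ⟨f, rfl⟩ η
    have : iX η (parity (sHom f) + sHom (parity f)) =
        parity (sHom (iX η f)) + sHom (parity (iX η f)) := by
      simp only [map_sub, map_add, iX_parity, iX_sHom, parity_lieX, map_neg]
      abel
    rw [this]
    exact AddSubgroup.subset_closure ⟨_, rfl⟩

/-- In ghost degree zero everything vanishes since `s` raises the ghost degree; Cartan's formula and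
`lieX_mul` provide the induction. -/
theorem sHom_mul (f g : B.Alg 𝕜) : sHom (f * g) = sHom f * g + parity f * sHom g := by
  refine sub_eq_zero.1 (eq_zero_of_iX {x | ∃ f g : B.Alg 𝕜,
    x = sHom (f * g) - (sHom f * g + parity f * sHom g)} ?_ ?_ _ ⟨f, g, rfl⟩)
  · rintro _ ⟨f, g, rfl⟩ k X Y
    rw [val_sub, val_add, Pi.sub_apply, Pi.add_apply, Pi.sub_apply, Pi.add_apply, Pi.sub_apply,
      Pi.add_apply, Pi.sub_apply, Pi.add_apply, mul_apply_ghost_zero_of_left (sHom_apply_zero f),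
      mul_apply_ghost_zero_of_right (sHom_apply_zero g), sHom_apply_zero]
    simp
  · rintro _ ⟨f, g, rfl⟩ ξ
    have : iX ξ (sHom (f * g) - (sHom f * g + parity f * sHom g)) =
        -(sHom (iX ξ f * g) - (sHom (iX ξ f) * g + parity (iX ξ f) * sHom g)) -
        (sHom (parity f * iX ξ g) -
          (sHom (parity f) * iX ξ g + parity (parity f) * sHom (iX ξ g))) := by
      simp only [map_sub, map_add, iX_mul, iX_sHom, iX_parity, parity_parity, parity_sHom, sub_mul,
        mul_sub, lieX_mul, neg_mul]
      abel
    rw [this]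
    exact sub_mem (neg_mem (AddSubgroup.subset_closure ⟨_, _, rfl⟩))
      (AddSubgroup.subset_closure ⟨_, _, rfl⟩)

theorem sHom_sHom (f : B.Alg 𝕜) : sHom (sHom f) = 0 := by
  apply fam_injective
  have h : (B.gaugeAction 𝕜).famD (fun k X => FormFam.sign ((B.gaugeAction 𝕜).famD f.fam k X)) =
      fun k X => FormFam.sign ((B.gaugeAction 𝕜).famD ((B.gaugeAction 𝕜).famD f.fam) k X) :=
    (B.gaugeAction 𝕜).famD_map FormFam.sign (fun z w => FormFam.sign_lie _ _) _
  rw [fam_sHom, fam_sHom, h, LieAction.famD_famD _ f.isAlt_fam]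
  funext k X
  simp only [Pi.zero_apply, map_zero]
  rfl

/-- The coboundary without its sign commutes with `d`, because Lie derivatives do. The factor
`(-1)^q` in `s` turns this into anticommutation, so that `D` squares to zero. -/
theorem d_sHom (f : B.Alg 𝕜) : d (sHom f) = -sHom (d f) := by
  apply fam_injective
  have h1 : (d (sHom f)).fam = fun k X => FormFam.d ((sHom f).fam k X) := rfl
  have h2 : (d f).fam = fun k X => FormFam.d (f.fam k X) := rfl
  have h3 : (-sHom (d f)).fam = -(sHom (d f)).fam := rfl
  have h : (B.gaugeAction 𝕜).famD (fun k X => FormFam.d (f.fam k X)) =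
      fun k X => FormFam.d ((B.gaugeAction 𝕜).famD f.fam k X) :=
    (B.gaugeAction 𝕜).famD_map FormFam.d (fun z w => FormFam.d_lie _ _) _
  rw [h1, h3, fam_sHom, fam_sHom, h2, h]
  funext k X
  simp only [Pi.neg_apply, FormFam.d_sign]

theorem sHom_apply_succ (f : B.Alg 𝕜) (q k : ℕ) : (sHom f).1 q (k + 1) = B.sP q k (f q k) := by
  funext X Y
  change (-1 : ℤ) ^ q • (FormFam.eval q Y).toAddMonoidHom
    (∑ i : Fin (k + 1), (-1 : ℤ) ^ (i : ℕ) • FormFam.lie (X i : VField EP P)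
      (f.fam k (i.removeNth X)) + bracketSum (f.fam k) X) =
    (-1 : ℤ) ^ q • Pi.evalAddMonoidHom (fun _ => SmoothFun EP P 𝕜) Y
      (∑ i : Fin (k + 1), (-1 : ℤ) ^ (i : ℕ) • lieD q (X i : VField EP P)
        (f q k (i.removeNth X)) + bracketSum (f q k) X)
  simp only [map_add, map_sum, map_zsmul, bracketSum_map]
  rfl

theorem lieY_one (Z : VField EP P) : lieY Z (1 : B.Alg 𝕜) = 0 := by
  have := lieY_mul Z (1 : B.Alg 𝕜) 1
  rwa [mul_one, one_mul, mul_one, left_eq_add] at this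

theorem iX_algebraMap (ξ : B.gaugeAlg) (c : 𝕜) : iX ξ (algebraMap 𝕜 (B.Alg 𝕜) c) = 0 := by
  rw [Algebra.algebraMap_eq_smul_one, LinearMap.map_smul, iX_one, smul_zero]

theorem parity_algebraMap (c : 𝕜) :
    parity (algebraMap 𝕜 (B.Alg 𝕜) c) = algebraMap 𝕜 (B.Alg 𝕜) c := by
  rw [Algebra.algebraMap_eq_smul_one, LinearMap.map_smul, parity_one]

theorem lieX_algebraMap (ξ : B.gaugeAlg) (c : 𝕜) : lieX ξ (algebraMap 𝕜 (B.Alg 𝕜) c) = 0 := by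
  refine eq_zero_of_iX {x | x = 0 ∨ ∃ ξ : B.gaugeAlg, x = lieX ξ (algebraMap 𝕜 (B.Alg 𝕜) c)} ?_ ?_ _
    (Or.inr ⟨ξ, rfl⟩)
  · rintro _ (rfl | ⟨ξ, rfl⟩) q X Y
    · rfl
    rw [lieX_apply_ghost_zero, Algebra.algebraMap_eq_smul_one, LinearMap.map_smul, lieY_one, smul_zero]
    rfl
  · rintro _ (rfl | ⟨ξ, rfl⟩) η
    · simp
    rw [iX_lieX, iX_algebraMap, iX_algebraMap]
    simp

/-- `sHom` is constructed as an additive map only. Since it kills constants, the Leibniz rule makes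
`D` linear over `𝕜`. -/
theorem sHom_algebraMap (c : 𝕜) : sHom (algebraMap 𝕜 (B.Alg 𝕜) c) = 0 := by
  refine eq_zero_of_iX {x | x = sHom (algebraMap 𝕜 (B.Alg 𝕜) c)} ?_ ?_ _ rfl
  · rintro _ rfl q X Y
    rw [sHom_apply_zero]
    rfl
  · rintro _ rfl η
    rw [iX_sHom, lieX_algebraMap, iX_algebraMap]
    simp

/-- The total differential. -/
def D : B.Alg 𝕜 →ₗ[𝕜] B.Alg 𝕜 where
  toFun f := sHom f + d f
  map_add' f g := by rw [map_add, map_add]; abel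
  map_smul' c f := by
    rw [LinearMap.map_smul, RingHom.id_apply, smul_add, Algebra.smul_def, sHom_mul, sHom_algebraMap,
      zero_mul, zero_add, parity_algebraMap, ← Algebra.smul_def]

theorem D_apply (f : B.Alg 𝕜) : D f = sHom f + d f := rfl

theorem D_mul (f g : B.Alg 𝕜) : D (f * g) = D f * g + parity f * D g := by
  simp only [D_apply, sHom_mul, d_mul, add_mul, mul_add]
  abel

theorem parity_D (f : B.Alg 𝕜) : parity (D f) = -D (parity f) := by
  simp only [D_apply, map_add, parity_sHom, parity_d]
  abel

theorem D_D (f : B.Alg 𝕜) : D (D f) = 0 := by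
  simp only [D_apply, map_add, sHom_sHom, d_d, d_sHom]
  abel

/-- Identifies the abstract differential with the explicit one that enters the definition of the
curvature. -/
theorem D_val (f : B.Alg 𝕜) : (D f).1 = B.totalD f.1 := by
  funext q k
  have h : (D f).1 q k = (sHom f).1 q k + (d f).1 q k := rfl
  rw [h]
  rcases q with _ | q <;> rcases k with _ | k
  · rw [sHom_apply_zero]; exact add_zero _
  · rw [sHom_apply_succ]; exact add_zero _
  · rw [sHom_apply_zero]; exact zero_add _
  · rw [sHom_apply_succ]; rfl

end PrincipalBundle

end

end BRS

/-! ### Chern–Weil theory in a super-commutative differential algebra -/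

namespace BRS

noncomputable section

open MvPolynomial (pderiv)

/-- A super-commutative differential algebra: `ε` is the parity and `D` an odd differential. -/
structure SuperDGA (𝕜 A : Type*) [Field 𝕜] [Ring A] [Algebra 𝕜 A] where
  ε : A →ₐ[𝕜] A
  D : A →ₗ[𝕜] A
  D_mul : ∀ x y, D (x * y) = D x * y + ε x * D y
  ε_D : ∀ x, ε (D x) = -D (ε x)
  D_D : ∀ x, D (D x) = 0
  comm : ∀ x y, ε x = x → x * y = y * x
  anti : ∀ x y, ε x = -x → x * y = ε y * x

namespace SuperDGA

variable {𝕜 A : Type*} [Field 𝕜] [Ring A] [Algebra 𝕜 A] (S : SuperDGA 𝕜 A)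
  {ι : Type*}

/-- All entries are even. -/
def IsEven (F : ι → A) : Prop := ∀ a, S.ε (F a) = F a

/-- All entries are odd. -/
def IsOdd (θ : ι → A) : Prop := ∀ a, S.ε (θ a) = -θ a

theorem IsOdd.add {S : SuperDGA 𝕜 A} {θ η : ι → A} (hθ : S.IsOdd θ) (hη : S.IsOdd η) :
    S.IsOdd (θ + η) := fun a => by
  rw [Pi.add_apply, map_add, hθ, hη]; abel

theorem IsOdd.zero {S : SuperDGA 𝕜 A} : S.IsOdd (0 : ι → A) := fun a => by
  rw [Pi.zero_apply, map_zero, neg_zero]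

theorem IsOdd.sub {S : SuperDGA 𝕜 A} {θ η : ι → A} (hθ : S.IsOdd θ) (hη : S.IsOdd η) :
    S.IsOdd (θ - η) := fun a => by
  rw [Pi.sub_apply, map_sub, hθ, hη]; abel

theorem IsOdd.smul {S : SuperDGA 𝕜 A} {θ : ι → A} (hθ : S.IsOdd θ) (c : 𝕜) :
    S.IsOdd (c • θ) := fun a => by
  rw [Pi.smul_apply, map_smul, hθ, smul_neg]

/-- The even subalgebra. -/
def even : Subalgebra 𝕜 A where
  carrier := {x | S.ε x = x}
  mul_mem' {x y} hx hy := by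
    change S.ε (x * y) = x * y
    rw [map_mul, show S.ε x = x from hx, show S.ε y = y from hy]
  add_mem' {x y} hx hy := by
    change S.ε (x + y) = x + y
    rw [map_add, show S.ε x = x from hx, show S.ε y = y from hy]
  algebraMap_mem' c := S.ε.commutes c

instance : CommRing S.even :=
  { (inferInstance : Ring S.even) with
    mul_comm := fun x y => Subtype.ext (S.comm x y x.2) }

open Classical in
/-- The value of a polynomial at even elements. -/
def peval (F : ι → A) (p : MvPolynomial ι 𝕜) : A :=
  if h : S.IsEven F then (MvPolynomial.aeval (fun a => (⟨F a, h a⟩ : S.even)) p : S.even) else 0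

variable {S} {F : ι → A}

theorem peval_eq (hF : S.IsEven F) (p : MvPolynomial ι 𝕜) :
    S.peval F p = (MvPolynomial.aeval (fun a => (⟨F a, hF a⟩ : S.even)) p : S.even) := dif_pos hF

theorem peval_even (hF : S.IsEven F) (p : MvPolynomial ι 𝕜) : S.ε (S.peval F p) = S.peval F p := by
  rw [peval_eq hF]
  exact (MvPolynomial.aeval (fun a => (⟨F a, hF a⟩ : S.even)) p : S.even).2

theorem peval_add (hF : S.IsEven F) (p q : MvPolynomial ι 𝕜) :
    S.peval F (p + q) = S.peval F p + S.peval F q := by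
  simp only [peval_eq hF, map_add, Subalgebra.coe_add]

theorem peval_zero (hF : S.IsEven F) : S.peval F (0 : MvPolynomial ι 𝕜) = 0 := by
  simp only [peval_eq hF, map_zero, Subalgebra.coe_zero]

theorem peval_neg (hF : S.IsEven F) (p : MvPolynomial ι 𝕜) : S.peval F (-p) = -S.peval F p := by
  rw [eq_neg_iff_add_eq_zero, ← peval_add hF, neg_add_cancel, peval_zero hF]

theorem peval_sum (hF : S.IsEven F) {J : Type*} (s : Finset J) (p : J → MvPolynomial ι 𝕜) :
    S.peval F (∑ j ∈ s, p j) = ∑ j ∈ s, S.peval F (p j) := by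
  simp only [peval_eq hF, map_sum, AddSubmonoidClass.coe_finsetSum]

theorem peval_mul (hF : S.IsEven F) (p q : MvPolynomial ι 𝕜) :
    S.peval F (p * q) = S.peval F p * S.peval F q := by
  simp only [peval_eq hF, map_mul, Subalgebra.coe_mul]

theorem peval_C (hF : S.IsEven F) (c : 𝕜) : S.peval F (MvPolynomial.C c) = algebraMap 𝕜 A c := by
  simp only [peval_eq hF, MvPolynomial.aeval_C, Subalgebra.coe_algebraMap]

theorem peval_C_mul (hF : S.IsEven F) (c : 𝕜) (p : MvPolynomial ι 𝕜) :
    S.peval F (MvPolynomial.C c * p) = c • S.peval F p := by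
  rw [peval_mul hF, peval_C hF, Algebra.smul_def]

theorem peval_X (hF : S.IsEven F) (a : ι) : S.peval F (MvPolynomial.X a) = F a := by
  simp only [peval_eq hF, MvPolynomial.aeval_X]

/-- Homomorphisms commute with the evaluation of polynomials. -/
theorem map_peval {B : Type*} [Ring B] [Algebra 𝕜 B] {T : SuperDGA 𝕜 B} (φ : A →ₐ[𝕜] B)
    (hF : S.IsEven F) (hF' : T.IsEven fun a => φ (F a)) (p : MvPolynomial ι 𝕜) :
    φ (S.peval F p) = T.peval (fun a => φ (F a)) p := by
  induction p using MvPolynomial.induction_on with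
  | C c => rw [peval_C hF, peval_C hF', AlgHom.commutes]
  | add p q hp hq => rw [peval_add hF, peval_add hF', map_add, hp, hq]
  | mul_X p a hp => rw [peval_mul hF, peval_mul hF', map_mul, hp, peval_X hF, peval_X hF']

variable [Fintype ι]

/-- The Leibniz rule is required only for an even left factor. This covers the even derivations
along paths as well as the odd operators `D` and contractions, which behave as derivations on even
elements. -/
theorem chain_rule [DecidableEq ι] (hF : S.IsEven F) (δ : A →ₗ[𝕜] A)
    (hδ : ∀ x y, S.ε x = x → δ (x * y) = δ x * y + x * δ y) (p : MvPolynomial ι 𝕜) :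
    δ (S.peval F p) = ∑ a, δ (F a) * S.peval F (pderiv a p) := by
  have h1 : δ 1 = 0 := by
    have := hδ 1 1 (map_one _)
    rwa [mul_one, mul_one, one_mul, left_eq_add] at this
  induction p using MvPolynomial.induction_on with
  | C c =>
    rw [peval_C hF, Algebra.algebraMap_eq_smul_one, map_smul, h1, smul_zero]
    simp [peval_zero hF]
  | add p q hp hq =>
    rw [peval_add hF, map_add, hp, hq, ← Finset.sum_add_distrib]
    refine Finset.sum_congr rfl fun a _ => ?_
    rw [map_add, peval_add hF, mul_add]
  | mul_X p i hp =>
    rw [peval_mul hF, hδ _ _ (peval_even hF p), hp, peval_X hF]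
    have : ∀ a, δ (F a) * S.peval F (pderiv a (p * MvPolynomial.X i)) =
        δ (F a) * S.peval F (pderiv a p) * F i + if a = i then S.peval F p * δ (F a) else 0 := by
      intro a
      rw [Derivation.leibniz, smul_eq_mul, smul_eq_mul, peval_add hF, peval_mul hF, peval_mul hF,
        peval_X hF, MvPolynomial.pderiv_X, mul_add, S.comm (F i) _ (hF i), mul_assoc, add_comm]
      congr 1
      by_cases h : a = i
      · subst h
        rw [Pi.single_eq_same, if_pos rfl, ← MvPolynomial.C_1, peval_C hF, map_one, mul_one,
          ← S.comm _ _ (peval_even hF p)]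
      · rw [if_neg h, Pi.single_eq_of_ne (Ne.symm h), peval_zero hF, mul_zero, mul_zero]
    simp only [this, Finset.sum_add_distrib, Finset.sum_mul, Finset.sum_ite_eq', Finset.mem_univ,
      if_true]

variable (S) in
/-- The first order term of the expansion of `p` at `F` in the direction `η`. -/
def trans (F η : ι → A) (p : MvPolynomial ι 𝕜) : A := ∑ a, η a * S.peval F (pderiv a p)

variable (S) in
/-- The second order term of the expansion of `p` at `F` in the directions `η`, `ζ`. -/
def trans₂ (F η ζ : ι → A) (p : MvPolynomial ι 𝕜) : A :=
  ∑ a, ∑ b, η a * ζ b * S.peval F (pderiv a (pderiv b p))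

/-- The bracket with structure constants `f`. -/
def br (f : ι → ι → ι → 𝕜) (χ ψ : ι → A) (c : ι) : A := ∑ a, ∑ b, f a b c • (χ a * ψ b)

variable (S) in
/-- The curvature of `D + θ`. -/
def curv (f : ι → ι → ι → 𝕜) (θ : ι → A) (c : ι) : A :=
  S.D (θ c) + (1 / 2 : 𝕜) • br f θ θ c

variable (S) in
/-- The covariant derivative. -/
def cov (f : ι → ι → ι → 𝕜) (θ η : ι → A) (c : ι) : A := S.D (η c) + br f θ η c

variable {f : ι → ι → ι → 𝕜} {θ η ζ : ι → A}

theorem br_apply (χ ψ : ι → A) (c : ι) : br f χ ψ c = ∑ a, ∑ b, f a b c • (χ a * ψ b) := rfl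

theorem br_smul_left (r : 𝕜) (χ ψ : ι → A) (c : ι) : br f (r • χ) ψ c = r • br f χ ψ c := by
  simp only [br, Finset.smul_sum]
  refine Finset.sum_congr rfl fun a _ => Finset.sum_congr rfl fun b _ => ?_
  rw [Pi.smul_apply, smul_mul_assoc, smul_comm]

theorem odd_mul_odd {x y : A} (hx : S.ε x = -x) (hy : S.ε y = -y) : x * y = -(y * x) := by
  rw [S.anti x y hx, hy, neg_mul]

theorem br_add_left (χ χ' ψ : ι → A) (c : ι) : br f (χ + χ') ψ c = br f χ ψ c + br f χ' ψ c := by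
  simp only [br, Pi.add_apply, add_mul, smul_add, Finset.sum_add_distrib]

theorem br_comm_odd (hf : ∀ a b c, f a b c = -f b a c) (hη : S.IsOdd η) (hζ : S.IsOdd ζ) (c : ι) :
    br f η ζ c = br f ζ η c := by
  rw [br, Finset.sum_comm]
  refine Finset.sum_congr rfl fun b _ => Finset.sum_congr rfl fun a _ => ?_
  rw [odd_mul_odd (hη a) (hζ b), hf a b c, neg_smul_neg]

theorem curv_even (hθ : S.IsOdd θ) : S.IsEven (S.curv f θ) := by
  intro c
  simp only [curv, br, map_add, map_smul, map_sum, map_mul, S.ε_D, hθ _, neg_mul_neg, map_neg, neg_neg]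

theorem cov_even (hθ : S.IsOdd θ) (hη : S.IsOdd η) : S.IsEven (S.cov f θ η) := by
  intro c
  simp only [cov, br, map_add, map_smul, map_sum, map_mul, S.ε_D, hθ _, hη _, neg_mul_neg, map_neg,
    neg_neg]

/-- The curvature changes by the covariant derivative. -/
theorem deriv_curv [CharZero 𝕜] (hf : ∀ a b c, f a b c = -f b a c) (hθ : S.IsOdd θ) (δ : A →ₗ[𝕜] A)
    (hδ : ∀ x y, δ (x * y) = δ x * y + x * δ y) (hD : ∀ x, δ (S.D x) = S.D (δ x))
    (hε : ∀ x, S.ε (δ x) = δ (S.ε x)) (c : ι) :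
    δ (S.curv f θ c) = S.cov f θ (fun a => δ (θ a)) c := by
  have hη : S.IsOdd fun a => δ (θ a) := fun a => by rw [hε, hθ, map_neg]
  have h : δ (br f θ θ c) = br f (fun a => δ (θ a)) θ c + br f θ (fun a => δ (θ a)) c := by
    simp only [br, map_sum, map_smul, hδ, smul_add, Finset.sum_add_distrib]
  rw [curv, map_add, map_smul, h, hD, br_comm_odd hf hη hθ, ← two_smul 𝕜, smul_smul,
    one_div, inv_mul_cancel₀ two_ne_zero, one_smul, cov]

section Invariant

theorem D_br_odd (hf : ∀ a b c, f a b c = -f b a c) (hθ : S.IsOdd θ) (c : ι) :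
    S.D (br f θ θ c) = (2 : 𝕜) • br f (fun a => S.D (θ a)) θ c := by
  have h : S.D (br f θ θ c) = br f (fun a => S.D (θ a)) θ c - br f θ (fun a => S.D (θ a)) c := by
    simp only [br, map_sum, map_smul, S.D_mul, hθ _, smul_add, Finset.sum_add_distrib, neg_mul,
      smul_neg, Finset.sum_neg_distrib, sub_eq_add_neg]
  have h2 : br f θ (fun a => S.D (θ a)) c = -br f (fun a => S.D (θ a)) θ c := by
    rw [br, Finset.sum_comm, br, ← Finset.sum_neg_distrib]
    refine Finset.sum_congr rfl fun b _ => ?_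
    rw [← Finset.sum_neg_distrib]
    refine Finset.sum_congr rfl fun a _ => ?_
    have : S.ε (S.D (θ b)) = S.D (θ b) := by rw [S.ε_D, hθ, map_neg, neg_neg]
    rw [← S.comm _ _ this, hf a b c, neg_smul]
  rw [h, h2, sub_neg_eq_add, two_smul]

/-- The Jacobi identity for structure constants. -/
def Jacobi (f : ι → ι → ι → 𝕜) : Prop := ∀ d e b c,
  ∑ a, (f d e a * f a b c + f e b a * f a d c + f b d a * f a e c) = 0

theorem sum_rotate {V : Type*} [AddCommMonoid V] (g : ι → ι → ι → V) :
    ∑ a, ∑ b, ∑ c, g a b c = ∑ b, ∑ c, ∑ a, g a b c := by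
  rw [Finset.sum_comm]
  exact Finset.sum_congr rfl fun b _ => Finset.sum_comm

/-- A cyclic rotation of three odd elements moves one of them past an even product and costs no
sign. Adding the three rotated expressions produces the Jacobi sum as coefficient, and `3` is
invertible in characteristic zero. -/
theorem br_br_odd [CharZero 𝕜] (hJ : Jacobi f) (hθ : S.IsOdd θ) (c : ι) :
    br f (br f θ θ) θ c = 0 := by
  let K : ι → ι → ι → 𝕜 := fun d e b => ∑ a, f d e a * f a b c
  have expand : br f (br f θ θ) θ c = ∑ d, ∑ e, ∑ b, K d e b • (θ d * θ e * θ b) := by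
    simp only [K, br, Finset.sum_mul, Finset.smul_sum, Finset.sum_smul, smul_mul_assoc, smul_smul]
    rw [Finset.sum_comm]
    refine Eq.trans ?_ (sum_rotate _)
    refine Finset.sum_congr rfl fun b _ => ?_
    rw [sum_rotate]
    refine Finset.sum_congr rfl fun d _ => Finset.sum_congr rfl fun e _ =>
      Finset.sum_congr rfl fun a _ => ?_
    rw [mul_comm]
  have rot : ∀ d e b, θ e * θ b * θ d = θ d * θ e * θ b := fun d e b => by
    rw [S.comm (θ e * θ b) (θ d) (by rw [map_mul, hθ, hθ, neg_mul_neg]), mul_assoc]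
  have h1 : br f (br f θ θ) θ c = ∑ d, ∑ e, ∑ b, K e b d • (θ d * θ e * θ b) := by
    rw [expand, ← sum_rotate]
    simp only [rot]
  have h2 : br f (br f θ θ) θ c = ∑ d, ∑ e, ∑ b, K b d e • (θ d * θ e * θ b) := by
    rw [h1, ← sum_rotate]
    simp only [rot]
  have h3 : (3 : 𝕜) • br f (br f θ θ) θ c = 0 := by
    have : (3 : 𝕜) = 1 + 1 + 1 := by norm_num
    rw [this, add_smul, add_smul, one_smul]
    nth_rewrite 1 [expand]
    nth_rewrite 1 [h1]
    rw [h2]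
    simp only [← Finset.sum_add_distrib, ← add_smul]
    refine Finset.sum_eq_zero fun d _ => Finset.sum_eq_zero fun e _ => Finset.sum_eq_zero fun b _ => ?_
    rw [show K d e b + K e b d + K b d e = 0 by
      simp only [K, ← Finset.sum_add_distrib]; exact hJ d e b c, zero_smul]
  exact (smul_eq_zero_iff_right (by norm_num)).1 h3

/-- The Bianchi identity. -/
theorem D_curv [CharZero 𝕜] (hf : ∀ a b c, f a b c = -f b a c) (hJ : Jacobi f) (hθ : S.IsOdd θ)
    (c : ι) : S.D (S.curv f θ c) = -br f θ (S.curv f θ) c := by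
  have h1 : S.D (S.curv f θ c) = br f (S.curv f θ) θ c := by
    have e : S.curv f θ = (fun a => S.D (θ a)) + (1 / 2 : 𝕜) • br f θ θ := rfl
    rw [curv, map_add, S.D_D, zero_add, map_smul, D_br_odd hf hθ, smul_smul, one_div,
      inv_mul_cancel₀ two_ne_zero, one_smul, e, br_add_left, br_smul_left, br_br_odd hJ hθ, smul_zero, add_zero]
  rw [h1, br, Finset.sum_comm, br, ← Finset.sum_neg_distrib]
  refine Finset.sum_congr rfl fun b _ => ?_
  rw [← Finset.sum_neg_distrib]
  refine Finset.sum_congr rfl fun a _ => ?_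
  rw [S.comm _ (θ b) (curv_even hθ a), hf a b c, neg_smul]

open MvPolynomial (C X)

/-- Invariance of a polynomial under the Lie algebra with structure constants `f`. -/
def Invariant (f : ι → ι → ι → 𝕜) (p : MvPolynomial ι 𝕜) : Prop :=
  ∀ a, ∑ b, ∑ e, C (f a b e) * (X b * pderiv e p) = 0

theorem pderiv_comm (a b : ι) (p : MvPolynomial ι 𝕜) :
    pderiv a (pderiv b p) = pderiv b (pderiv a p) := by
  classical
  have : ⁅(pderiv a : Derivation 𝕜 (MvPolynomial ι 𝕜) (MvPolynomial ι 𝕜)),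
      (pderiv b : Derivation 𝕜 (MvPolynomial ι 𝕜) (MvPolynomial ι 𝕜))⁆ = 0 := by
    apply MvPolynomial.derivation_ext
    intro i
    rw [Derivation.commutator_apply, MvPolynomial.pderiv_X, MvPolynomial.pderiv_X]
    simp [Pi.single_apply, apply_ite]
  have h := congrArg (fun δ => δ p) this
  exact sub_eq_zero.1 h

/-- The derivative of the invariance identity: the gradient of an invariant polynomial transforms in
the coadjoint representation. It converts the connection terms coming from the Bianchi identity into
those of a covariant derivative. -/
theorem Invariant.pderiv [DecidableEq ι] {p : MvPolynomial ι 𝕜} (hp : Invariant f p) (a c : ι) :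
    ∑ b, ∑ e, C (f a b e) * (X b * pderiv e (pderiv c p)) = -∑ e, C (f a c e) * pderiv e p := by
  have h := congrArg (MvPolynomial.pderiv c) (hp a)
  have h1 : ∀ b e, MvPolynomial.pderiv c (C (f a b e) * (X b * MvPolynomial.pderiv e p)) =
      C (f a b e) * (X b * MvPolynomial.pderiv e (MvPolynomial.pderiv c p)) +
        if b = c then C (f a b e) * MvPolynomial.pderiv e p else 0 := by
    intro b e
    rw [MvPolynomial.pderiv_C_mul, Derivation.leibniz, MvPolynomial.pderiv_X, smul_eq_mul,
      smul_eq_mul, pderiv_comm, mul_add]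
    congr 1
    by_cases h : b = c
    · subst h; simp
    · rw [if_neg h, Pi.single_eq_of_ne h]; simp
  simp only [map_sum, h1, Finset.sum_add_distrib, map_zero] at h
  rw [Finset.sum_comm (s := Finset.univ) (t := Finset.univ)
    (f := fun b e => if b = c then C (f a b e) * MvPolynomial.pderiv e p else 0)] at h
  simp only [Finset.sum_ite_eq', Finset.mem_univ, if_true] at h
  exact eq_neg_of_add_eq_zero_left h

theorem Invariant.pderiv₂ [DecidableEq ι] {p : MvPolynomial ι 𝕜} (hp : Invariant f p) (a c d : ι) :
    ∑ b, ∑ e, C (f a b e) * (X b * MvPolynomial.pderiv e (MvPolynomial.pderiv d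
      (MvPolynomial.pderiv c p))) =
      -∑ e, C (f a c e) * MvPolynomial.pderiv d (MvPolynomial.pderiv e p) -
        ∑ e, C (f a d e) * MvPolynomial.pderiv e (MvPolynomial.pderiv c p) := by
  have h := congrArg (MvPolynomial.pderiv d) (hp.pderiv a c)
  have h1 : ∀ b e, MvPolynomial.pderiv d (C (f a b e) * (X b * MvPolynomial.pderiv e
        (MvPolynomial.pderiv c p))) =
      C (f a b e) * (X b * MvPolynomial.pderiv e (MvPolynomial.pderiv d (MvPolynomial.pderiv c p))) +
        if b = d then C (f a b e) * MvPolynomial.pderiv e (MvPolynomial.pderiv c p) else 0 := by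
    intro b e
    rw [MvPolynomial.pderiv_C_mul, Derivation.leibniz, MvPolynomial.pderiv_X, smul_eq_mul,
      smul_eq_mul, pderiv_comm, mul_add]
    congr 1
    by_cases h : b = d
    · subst h; simp
    · rw [if_neg h, Pi.single_eq_of_ne h]; simp
  simp only [map_sum, h1, Finset.sum_add_distrib, map_neg, MvPolynomial.pderiv_C_mul] at h
  rw [Finset.sum_comm (s := Finset.univ) (t := Finset.univ)
    (f := fun b e => if b = d then C (f a b e) * MvPolynomial.pderiv e (MvPolynomial.pderiv c p)
      else 0)] at h
  simp only [Finset.sum_ite_eq', Finset.mem_univ, if_true] at h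
  exact eq_sub_of_add_eq h

theorem D_even_mul (x y : A) (hx : S.ε x = x) : S.D (x * y) = S.D x * y + x * S.D y := by
  rw [S.D_mul, hx]

variable [DecidableEq ι] [CharZero 𝕜] {p : MvPolynomial ι 𝕜}

/-- Chain rule and Bianchi identity: `D` acts on polynomials in the curvature as the infinitesimal
adjoint action of `-θ`. It is stated for every polynomial because it is applied to partial
derivatives of the invariant one. -/
theorem D_peval (hf : ∀ a b c, f a b c = -f b a c) (hJ : Jacobi f) (hθ : S.IsOdd θ)
    (p : MvPolynomial ι 𝕜) : S.D (S.peval (S.curv f θ) p) =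
      -∑ a, θ a * S.peval (S.curv f θ) (∑ b, ∑ e, C (f a b e) * (X b * MvPolynomial.pderiv e p)) := by
  have hF := curv_even (f := f) hθ
  rw [chain_rule hF S.D D_even_mul]
  simp only [D_curv hf hJ hθ, peval_sum hF, peval_C_mul hF, peval_mul hF, peval_X hF, br_apply,
    neg_mul, Finset.sum_neg_distrib, Finset.sum_mul, Finset.mul_sum, neg_inj, mul_smul_comm,
    smul_mul_assoc, mul_assoc]
  exact sum_rotate _

/-- The bracket with `θ` that is missing in `D η` is supplied by the action of `D` on the gradient
of `p`, through the invariance of `p`. -/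
theorem D_trans (hf : ∀ a b c, f a b c = -f b a c) (hJ : Jacobi f) (hp : Invariant f p)
    (hθ : S.IsOdd θ) (hη : S.IsOdd η) :
    S.D (S.trans (S.curv f θ) η p) = S.trans (S.curv f θ) (S.cov f θ η) p := by
  have hF := curv_even (f := f) hθ
  have h1 : ∀ c, S.D (η c * S.peval (S.curv f θ) (MvPolynomial.pderiv c p)) =
      S.D (η c) * S.peval (S.curv f θ) (MvPolynomial.pderiv c p) +
        ∑ a, ∑ e, f a c e • (θ a * η c * S.peval (S.curv f θ) (MvPolynomial.pderiv e p)) := by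
    intro c
    rw [S.D_mul, D_peval hf hJ hθ, hη]
    simp only [hp.pderiv, peval_neg hF, peval_sum hF, peval_C_mul hF, mul_neg, neg_mul, neg_neg,
      Finset.sum_neg_distrib, Finset.mul_sum, mul_smul_comm, add_right_inj]
    refine Finset.sum_congr rfl fun a _ => Finset.sum_congr rfl fun e _ => ?_
    rw [← mul_assoc, odd_mul_odd (hη c) (hθ a), neg_mul, neg_neg]
  simp only [trans, map_sum, h1, cov, br_apply, add_mul, Finset.sum_add_distrib, Finset.sum_mul,
    smul_mul_assoc, add_right_inj]
  rw [Finset.sum_comm]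
  exact (sum_rotate _).symm

/-- As for `D_trans`, with the second derivatives of `p`. The minus sign arises because `D` passes
the odd element `η`. -/
theorem D_trans₂ (hf : ∀ a b c, f a b c = -f b a c) (hJ : Jacobi f) (hp : Invariant f p)
    (hθ : S.IsOdd θ) (hη : S.IsOdd η) (hζ : S.IsOdd ζ) :
    S.D (S.trans₂ (S.curv f θ) η ζ p) =
      S.trans₂ (S.curv f θ) (S.cov f θ η) ζ p - S.trans₂ (S.curv f θ) η (S.cov f θ ζ) p := by
  have hF := curv_even (f := f) hθ
  have h1 : ∀ a b, S.D (η a * ζ b * S.peval (S.curv f θ) (MvPolynomial.pderiv a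
        (MvPolynomial.pderiv b p))) =
      S.D (η a) * ζ b * S.peval (S.curv f θ) (MvPolynomial.pderiv a (MvPolynomial.pderiv b p)) -
      η a * S.D (ζ b) * S.peval (S.curv f θ) (MvPolynomial.pderiv a (MvPolynomial.pderiv b p)) +
      (∑ d, ∑ e, f d a e • (θ d * η a * ζ b * S.peval (S.curv f θ) (MvPolynomial.pderiv e
        (MvPolynomial.pderiv b p))) -
      ∑ d, ∑ e, f d b e • (η a * (θ d * ζ b) * S.peval (S.curv f θ) (MvPolynomial.pderiv a
        (MvPolynomial.pderiv e p)))) := by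
    intro a b
    have e1 : ∀ d x, η a * ζ b * (θ d * x) = θ d * η a * ζ b * x := fun d x => by
      rw [← mul_assoc, S.comm (η a * ζ b) (θ d) (by rw [map_mul, hη, hζ, neg_mul_neg]), ← mul_assoc (θ d)]
    have e2 : ∀ d x, η a * ζ b * (θ d * x) = -(η a * (θ d * ζ b) * x) := fun d x => by
      rw [← mul_assoc, mul_assoc (η a), odd_mul_odd (hζ b) (hθ d), mul_neg, neg_mul]
    rw [S.D_mul, S.D_mul, D_peval hf hJ hθ, map_mul, hη, hζ, neg_mul_neg, neg_mul, add_mul, neg_mul,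
      ← sub_eq_add_neg, add_right_inj]
    simp only [hp.pderiv₂, sub_eq_add_neg, peval_add hF, peval_neg hF, peval_sum hF, peval_C_mul hF,
      mul_neg, mul_add, neg_add, neg_neg, Finset.mul_sum, Finset.sum_add_distrib, mul_smul_comm,
      Finset.sum_neg_distrib]
    rw [add_comm]
    congr 1
    · simp only [e1]
    · simp only [e2, smul_neg, Finset.sum_neg_distrib]
  simp only [trans₂, map_sum, h1, cov, br_apply, add_mul, mul_add, Finset.sum_add_distrib,
    Finset.sum_sub_distrib, Finset.sum_mul, Finset.mul_sum, smul_mul_assoc, mul_smul_comm]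
  rw [add_sub_add_comm]
  congr 2
  · rw [Finset.sum_comm]
    refine Eq.trans ?_ Finset.sum_comm
    refine Finset.sum_congr rfl fun b _ => ?_
    rw [Finset.sum_comm]
    exact (sum_rotate _).symm
  · refine Finset.sum_congr rfl fun a _ => ?_
    rw [Finset.sum_comm]
    exact (sum_rotate _).symm

theorem deriv_trans (hF : S.IsEven F) (δ : A →ₗ[𝕜] A)
    (hδ : ∀ x y, δ (x * y) = δ x * y + x * δ y) (hε : ∀ x, S.ε (δ x) = δ (S.ε x)) :
    δ (S.trans F ζ p) = S.trans F (fun a => δ (ζ a)) p + S.trans₂ F ζ (fun a => δ (F a)) p := by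
  have hd : S.IsEven fun a => δ (F a) := fun a => by rw [hε, hF]
  simp only [trans, trans₂, map_sum, hδ, Finset.sum_add_distrib, add_right_inj]
  refine Finset.sum_congr rfl fun a _ => ?_
  rw [chain_rule hF δ fun x y _ => hδ x y, Finset.mul_sum]
  refine Finset.sum_congr rfl fun b _ => ?_
  rw [mul_assoc, pderiv_comm]

/-- One direction is even after a covariant derivative has been taken, so the symmetry of second
derivatives makes the two mixed terms in `deriv_trans_curv_sub` cancel. -/
theorem trans₂_even_swap (hη : S.IsEven η) : S.trans₂ F η ζ p = S.trans₂ F ζ η p := by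
  rw [trans₂, Finset.sum_comm]
  refine Finset.sum_congr rfl fun b _ => Finset.sum_congr rfl fun a _ => ?_
  rw [S.comm _ _ (hη a), pderiv_comm]

/-- The transgression formula for a derivation `δ`, thought of as the derivative along a path. -/
theorem deriv_peval_curv (hf : ∀ a b c, f a b c = -f b a c) (hJ : Jacobi f) (hp : Invariant f p)
    (hθ : S.IsOdd θ) (δ : A →ₗ[𝕜] A)
    (hδ : ∀ x y, δ (x * y) = δ x * y + x * δ y) (hD : ∀ x, δ (S.D x) = S.D (δ x))
    (hε : ∀ x, S.ε (δ x) = δ (S.ε x)) :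
    δ (S.peval (S.curv f θ) p) = S.D (S.trans (S.curv f θ) (fun a => δ (θ a)) p) := by
  have hη : S.IsOdd fun a => δ (θ a) := fun a => by rw [hε, hθ, map_neg]
  rw [D_trans hf hJ hp hθ hη, chain_rule (curv_even hθ) δ fun x y _ => hδ x y]
  simp only [deriv_curv hf hθ δ hδ hD hε, trans]

/-- The transgression formula for two commuting derivations. -/
theorem deriv_trans_curv_sub (hf : ∀ a b c, f a b c = -f b a c) (hJ : Jacobi f)
    (hp : Invariant f p) (hθ : S.IsOdd θ) (δ δ' : A →ₗ[𝕜] A)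
    (hδ : ∀ x y, δ (x * y) = δ x * y + x * δ y) (hD : ∀ x, δ (S.D x) = S.D (δ x))
    (hε : ∀ x, S.ε (δ x) = δ (S.ε x))
    (hδ' : ∀ x y, δ' (x * y) = δ' x * y + x * δ' y) (hD' : ∀ x, δ' (S.D x) = S.D (δ' x))
    (hε' : ∀ x, S.ε (δ' x) = δ' (S.ε x)) (hδδ : ∀ x, δ (δ' x) = δ' (δ x)) :
    δ (S.trans (S.curv f θ) (fun a => δ' (θ a)) p) - δ' (S.trans (S.curv f θ) (fun a => δ (θ a)) p) =
      S.D (S.trans₂ (S.curv f θ) (fun a => δ (θ a)) (fun a => δ' (θ a)) p) := by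
  have hη : S.IsOdd fun a => δ (θ a) := fun a => by rw [hε, hθ, map_neg]
  have hζ : S.IsOdd fun a => δ' (θ a) := fun a => by rw [hε', hθ, map_neg]
  rw [D_trans₂ hf hJ hp hθ hη hζ, deriv_trans (curv_even hθ) δ hδ hε,
    deriv_trans (curv_even hθ) δ' hδ' hε']
  simp only [deriv_curv hf hθ δ hδ hD hε, deriv_curv hf hθ δ' hδ' hD' hε', hδδ]
  have e := trans₂_even_swap (F := S.curv f θ) (ζ := fun a => δ' (θ a)) (p := p)
    (cov_even (f := f) hθ hη)
  rw [show S.cov f θ (fun a => δ (θ a)) = fun c => S.cov f θ (fun a => δ (θ a)) c from rfl] at e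
  rw [e]
  abel

end Invariant

end SuperDGA

end

end BRS

namespace BRS

noncomputable section

open MvPolynomial (pderiv)

namespace SuperDGA

/-! ### Contractions, connections and basic elements -/

section Contraction

variable {𝕜 A : Type*} [Field 𝕜] [CharZero 𝕜] [Ring A] [Algebra 𝕜 A] {S : SuperDGA 𝕜 A}
  {ι : Type*} [Fintype ι] [DecidableEq ι] {f : ι → ι → ι → 𝕜} {θ η ζ F : ι → A}
  {p : MvPolynomial ι 𝕜}

theorem D_algebraMap (c : 𝕜) : S.D (algebraMap 𝕜 A c) = 0 := by
  have h : S.D 1 = 0 := by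
    have := S.D_mul 1 1
    rwa [map_one S.ε, mul_one, mul_one, one_mul, left_eq_add] at this
  rw [Algebra.algebraMap_eq_smul_one, map_smul, h, smul_zero]

/-- The adjoint action with structure constants `f`. -/
def adj (f : ι → ι → ι → 𝕜) (v : ι → 𝕜) (χ : ι → A) (c : ι) : A := ∑ a, ∑ b, (v a * f a b c) • χ b

variable (S) in
/-- A contraction `i` with its Lie derivative `L`. -/
structure Contraction (i L : A →ₗ[𝕜] A) : Prop where
  i_mul : ∀ x y, i (x * y) = i x * y + S.ε x * i y
  L_mul : ∀ x y, L (x * y) = L x * y + x * L y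
  i_D : ∀ x, i (S.D x) = L x - S.D (i x)

variable {i L : A →ₗ[𝕜] A} {v : ι → 𝕜}

/-- Since `i θ` is the constant `v`, contracting `D θ` leaves `L θ = -ad_v θ`, while contracting
`½[θ, θ]` gives `ad_v θ`. -/
theorem Contraction.i_curv (h : S.Contraction i L) (hf : ∀ a b c, f a b c = -f b a c)
    (hθ : S.IsOdd θ) (hi : ∀ a, i (θ a) = algebraMap 𝕜 A (v a))
    (hL : ∀ c, L (θ c) = -adj f v θ c) (c : ι) : i (S.curv f θ c) = 0 := by
  have h1 : i (br f θ θ c) = (2 : 𝕜) • adj f v θ c := by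
    have e1 : i (br f θ θ c) = adj f v θ c - ∑ a, ∑ b, (v b * f a b c) • θ a := by
      simp only [br, adj, map_sum, map_smul, h.i_mul, hi, hθ _, smul_add, Finset.sum_add_distrib,
        neg_mul, smul_neg, Finset.sum_neg_distrib, sub_eq_add_neg]
      congr 1
      · refine Finset.sum_congr rfl fun a _ => Finset.sum_congr rfl fun b _ => ?_
        rw [← Algebra.smul_def, smul_smul, mul_comm]
      · refine congrArg _ (Finset.sum_congr rfl fun a _ => Finset.sum_congr rfl fun b _ => ?_)
        rw [← Algebra.commutes, ← Algebra.smul_def, smul_smul, mul_comm]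
    have e2 : ∑ a, ∑ b, (v b * f a b c) • θ a = -adj f v θ c := by
      rw [adj, Finset.sum_comm, ← Finset.sum_neg_distrib]
      refine Finset.sum_congr rfl fun b _ => ?_
      rw [← Finset.sum_neg_distrib]
      refine Finset.sum_congr rfl fun a _ => ?_
      rw [hf a b c, mul_neg, neg_smul]
    rw [e1, e2, sub_neg_eq_add, two_smul]
  rw [curv, map_add, map_smul, h.i_D, hi, D_algebraMap, hL, h1, smul_smul, one_div,
    inv_mul_cancel₀ two_ne_zero, one_smul, sub_zero, neg_add_cancel]

/-- Contract the Bianchi identity. As `i F = 0`, the left side becomes `L F` and on the right only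
`i θ = v` survives in the bracket. -/
theorem Contraction.L_curv (h : S.Contraction i L) (hf : ∀ a b c, f a b c = -f b a c)
    (hJ : Jacobi f) (hθ : S.IsOdd θ) (hi : ∀ a, i (θ a) = algebraMap 𝕜 A (v a))
    (hL : ∀ c, L (θ c) = -adj f v θ c) (c : ι) :
    L (S.curv f θ c) = -adj f v (S.curv f θ) c := by
  have h1 := h.i_D (S.curv f θ c)
  rw [h.i_curv hf hθ hi hL, map_zero, sub_zero, D_curv hf hJ hθ, map_neg] at h1
  rw [← h1, neg_inj]
  simp only [br, adj, map_sum, map_smul, h.i_mul, hi, h.i_curv hf hθ hi hL, mul_zero, add_zero,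
    ← Algebra.smul_def, smul_smul]
  refine Finset.sum_congr rfl fun a _ => Finset.sum_congr rfl fun b _ => ?_
  rw [mul_comm]

theorem Contraction.i_peval (h : S.Contraction i L) (hF : S.IsEven F) (hi : ∀ a, i (F a) = 0) :
    i (S.peval F p) = 0 := by
  rw [chain_rule hF i fun x y hx => by rw [h.i_mul, hx]]
  simp only [hi, zero_mul, Finset.sum_const_zero]

theorem Contraction.i_trans (h : S.Contraction i L) (hF : S.IsEven F) (hi : ∀ a, i (F a) = 0)
    (hη : ∀ a, i (η a) = 0) : i (S.trans F η p) = 0 := by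
  simp only [trans, map_sum, h.i_mul, hη, h.i_peval hF hi, zero_mul, mul_zero, add_zero,
    Finset.sum_const_zero]

theorem Contraction.i_trans₂ (h : S.Contraction i L) (hF : S.IsEven F) (hi : ∀ a, i (F a) = 0)
    (hη : ∀ a, i (η a) = 0) (hζ : ∀ a, i (ζ a) = 0) : i (S.trans₂ F η ζ p) = 0 := by
  simp only [trans₂, map_sum, h.i_mul, hη, hζ, h.i_peval hF hi, zero_mul, mul_zero, add_zero,
    Finset.sum_const_zero]

theorem Contraction.L_peval (h : S.Contraction i L) (hF : S.IsEven F)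
    (hL : ∀ c, L (F c) = -adj f v F c) (p : MvPolynomial ι 𝕜) : L (S.peval F p) =
      -∑ a, v a • S.peval F (∑ b, ∑ e, MvPolynomial.C (f a b e) * (MvPolynomial.X b * pderiv e p)) := by
  rw [chain_rule hF L fun x y _ => h.L_mul x y]
  simp only [hL, adj, peval_sum hF, peval_C_mul hF, peval_mul hF, peval_X hF, neg_mul,
    Finset.sum_neg_distrib, Finset.sum_mul, Finset.smul_sum, smul_mul_assoc, smul_smul]
  exact congrArg _ (sum_rotate _)

/-- The rotation of `η` by `ad_v` cancels the rotation of the gradient of `p`, by invariance. -/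
theorem Contraction.L_trans (h : S.Contraction i L) (hp : Invariant f p) (hF : S.IsEven F)
    (hL : ∀ c, L (F c) = -adj f v F c) (hη : ∀ c, L (η c) = -adj f v η c) :
    L (S.trans F η p) = 0 := by
  simp only [trans, map_sum, h.L_mul, h.L_peval hF hL, hp.pderiv, hη, adj, peval_neg hF,
    peval_sum hF, peval_C_mul hF, smul_neg, neg_neg, Finset.sum_neg_distrib, neg_mul,
    Finset.sum_add_distrib, Finset.sum_mul, Finset.mul_sum, Finset.smul_sum, smul_mul_assoc,
    mul_smul_comm, smul_smul]
  rw [neg_add_eq_zero]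
  rw [sum_rotate, Finset.sum_comm]

theorem sum_reverse {V : Type*} [AddCommMonoid V] (g : ι → ι → ι → V) :
    ∑ a, ∑ b, ∑ c, g a b c = ∑ c, ∑ b, ∑ a, g a b c := by
  rw [sum_rotate, Finset.sum_comm]

theorem Contraction.L_trans₂ (h : S.Contraction i L) (hp : Invariant f p) (hF : S.IsEven F)
    (hL : ∀ c, L (F c) = -adj f v F c) (hη : ∀ c, L (η c) = -adj f v η c)
    (hζ : ∀ c, L (ζ c) = -adj f v ζ c) : L (S.trans₂ F η ζ p) = 0 := by
  simp only [trans₂, map_sum, h.L_mul, h.L_peval hF hL, hp.pderiv₂, hη, hζ, adj, peval_neg hF,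
    peval_add hF, sub_eq_add_neg, neg_add, smul_add, mul_add, add_mul,
    peval_sum hF, peval_C_mul hF, smul_neg, neg_neg, mul_neg, Finset.sum_neg_distrib, neg_mul,
    Finset.sum_add_distrib, Finset.sum_mul, Finset.mul_sum, Finset.smul_sum, smul_mul_assoc,
    mul_smul_comm, smul_smul]
  have e1 : ∀ g : ι → ι → ι → ι → A, ∑ x, ∑ y, ∑ z, ∑ w, g x y z w =
      ∑ x, ∑ y, ∑ z, ∑ w, g w y z x := fun g => by
    rw [Finset.sum_comm]
    refine Eq.trans ?_ Finset.sum_comm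
    exact Finset.sum_congr rfl fun y _ => sum_reverse _
  have e2 : ∀ g : ι → ι → ι → ι → A, ∑ x, ∑ y, ∑ z, ∑ w, g x y z w =
      ∑ x, ∑ y, ∑ z, ∑ w, g x w z y := fun g =>
    Finset.sum_congr rfl fun x _ => sum_reverse _
  rw [e1 fun x y z w => (v z * f z w x) • (η w * ζ y * S.peval F ((pderiv x) ((pderiv y) p))),
    e2 fun x y z w => (v z * f z w y) • (η x * ζ w * S.peval F ((pderiv x) ((pderiv y) p)))]
  abel

end Contraction

/-! ### Paths and squares as polynomials with formal integration -/

section Polynomials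

open Polynomial

variable {𝕜 A B : Type*} [Field 𝕜] [Ring A] [Algebra 𝕜 A] [Ring B] [Algebra 𝕜 B]

theorem linearMap_ext {M : Type*} [AddCommMonoid M] [Module 𝕜 M] {φ ψ : A[X] →ₗ[𝕜] M}
    (h : ∀ n a, φ (monomial n a) = ψ (monomial n a)) (g : A[X]) : φ g = ψ g := by
  induction g using Polynomial.induction_on' with
  | add g g' hg hg' => rw [map_add, map_add, hg, hg']
  | monomial n a => exact h n a

/-- The coefficientwise extension of a linear map. -/
def coeffMap (T : A →ₗ[𝕜] B) : A[X] →ₗ[𝕜] B[X] :=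
  lsum fun n => ((monomial n : B →ₗ[B] B[X]).restrictScalars 𝕜).comp T

/-- Evaluation at a scalar. -/
def evalAt (t : 𝕜) : A[X] →ₗ[𝕜] A := lsum fun n => t ^ n • LinearMap.id

variable (𝕜) in
/-- The integral of a polynomial over `[0, 1]`. -/
def integral : A[X] →ₗ[𝕜] A := lsum fun n => ((n : 𝕜) + 1)⁻¹ • LinearMap.id

theorem coeffMap_monomial (T : A →ₗ[𝕜] B) (n : ℕ) (a : A) :
    coeffMap T (monomial n a) = monomial n (T a) := by
  simp [coeffMap, lsum_apply]

theorem evalAt_monomial (t : 𝕜) (n : ℕ) (a : A) : evalAt t (monomial n a) = t ^ n • a := by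
  simp [evalAt, lsum_apply]

theorem integral_monomial (n : ℕ) (a : A) :
    integral 𝕜 (monomial n a : A[X]) = ((n : 𝕜) + 1)⁻¹ • a := by
  simp [integral, lsum_apply]

theorem coeff_coeffMap (T : A →ₗ[𝕜] B) (g : A[X]) (n : ℕ) :
    (coeffMap T g).coeff n = T (g.coeff n) := by
  induction g using Polynomial.induction_on' with
  | add g g' hg hg' => rw [map_add, coeff_add, coeff_add, map_add, hg, hg']
  | monomial m a =>
    rw [coeffMap_monomial, coeff_monomial, coeff_monomial]
    split_ifs <;> simp

theorem evalAt_coeffMap (T : A →ₗ[𝕜] B) (t : 𝕜) (g : A[X]) :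
    evalAt t (coeffMap T g) = T (evalAt t g) := by
  refine linearMap_ext (φ := evalAt t ∘ₗ coeffMap T) (ψ := T ∘ₗ evalAt t) (fun n a => ?_) g
  simp only [LinearMap.comp_apply, coeffMap_monomial, evalAt_monomial, map_smul]

theorem integral_coeffMap (T : A →ₗ[𝕜] B) (g : A[X]) :
    integral 𝕜 (coeffMap T g) = T (integral 𝕜 g) := by
  refine linearMap_ext (φ := integral 𝕜 ∘ₗ coeffMap T) (ψ := T ∘ₗ integral 𝕜) (fun n a => ?_) g
  simp only [LinearMap.comp_apply, coeffMap_monomial, integral_monomial, map_smul]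

variable (𝕜) in
/-- The formal derivative as a linear map over the scalars. -/
def ddt : A[X] →ₗ[𝕜] A[X] := (derivative : A[X] →ₗ[A] A[X]).restrictScalars 𝕜

theorem ddt_apply (g : A[X]) : ddt 𝕜 g = derivative g := rfl

theorem ddt_mul (g h : A[X]) : ddt 𝕜 (g * h) = ddt 𝕜 g * h + g * ddt 𝕜 h :=
  derivative_mul

theorem ddt_coeffMap (T : A →ₗ[𝕜] B) (g : A[X]) :
    ddt 𝕜 (coeffMap T g) = coeffMap T (ddt 𝕜 g) := by
  refine linearMap_ext (φ := ddt 𝕜 ∘ₗ coeffMap T) (ψ := coeffMap T ∘ₗ ddt 𝕜) (fun n a => ?_) g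
  simp only [LinearMap.comp_apply, coeffMap_monomial, ddt_apply, derivative_monomial]
  rw [← nsmul_eq_mul', ← nsmul_eq_mul', map_nsmul T]

/-- The fundamental theorem of calculus, checked on monomials. It replaces analysis in all
transgression arguments; actual integrals return only in `integrate_evalAt`. -/
theorem integral_ddt [CharZero 𝕜] (g : A[X]) :
    integral 𝕜 (ddt 𝕜 g) = evalAt (1 : 𝕜) g - evalAt (0 : 𝕜) g := by
  refine linearMap_ext (φ := integral 𝕜 ∘ₗ ddt 𝕜) (ψ := evalAt (1 : 𝕜) - evalAt (0 : 𝕜))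
    (fun n a => ?_) g
  simp only [LinearMap.comp_apply, LinearMap.sub_apply, ddt_apply, derivative_monomial,
    evalAt_monomial, integral_monomial]
  cases n with
  | zero => simp
  | succ n =>
    rw [← nsmul_eq_mul', ← Nat.cast_smul_eq_nsmul 𝕜, smul_smul]
    have : (n : 𝕜) + 1 ≠ 0 := by exact_mod_cast n.succ_ne_zero
    simp [this]

/-- The coefficientwise extension of a twisted derivation is a twisted derivation. -/
theorem coeffMap_twisted (T : A →ₗ[𝕜] A) (U : A →ₗ[𝕜] A)
    (h : ∀ x y, T (x * y) = T x * y + U x * T y) (g g' : A[X]) :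
    coeffMap T (g * g') = coeffMap T g * g' + coeffMap U g * coeffMap T g' := by
  induction g using Polynomial.induction_on' with
  | add g₁ g₂ h₁ h₂ => simp only [add_mul, map_add, h₁, h₂]; abel
  | monomial m a =>
    induction g' using Polynomial.induction_on' with
    | add g₁ g₂ h₁ h₂ => simp only [mul_add, map_add, h₁, h₂]; abel
    | monomial n b =>
      simp only [monomial_mul_monomial, coeffMap_monomial, h, map_add]

theorem coeffMap_id (g : A[X]) : coeffMap (LinearMap.id : A →ₗ[𝕜] A) g = g :=
  linearMap_ext (φ := coeffMap (LinearMap.id : A →ₗ[𝕜] A)) (ψ := LinearMap.id)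
    (fun _ _ => coeffMap_monomial _ _ _) g

theorem coeffMap_derivation (T : A →ₗ[𝕜] A)
    (h : ∀ x y, T (x * y) = T x * y + x * T y) (g g' : A[X]) :
    coeffMap T (g * g') = coeffMap T g * g' + g * coeffMap T g' := by
  rw [coeffMap_twisted T LinearMap.id h, coeffMap_id]

/-- The coefficientwise extension of a homomorphism. -/
def coeffHom (φ : A →ₐ[𝕜] B) : A[X] →ₐ[𝕜] B[X] :=
  AlgHom.ofLinearMap (coeffMap φ.toLinearMap)
    (by rw [← C_1, ← monomial_zero_left, coeffMap_monomial]; simp) fun g g' => by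
    induction g using Polynomial.induction_on' with
    | add g₁ g₂ h₁ h₂ => simp only [add_mul, map_add, h₁, h₂]
    | monomial m a =>
      induction g' using Polynomial.induction_on' with
      | add g₁ g₂ h₁ h₂ => simp only [mul_add, map_add, h₁, h₂]
      | monomial n b => simp [monomial_mul_monomial, coeffMap_monomial]

theorem coeffHom_apply (φ : A →ₐ[𝕜] B) (g : A[X]) : coeffHom φ g = coeffMap φ.toLinearMap g := rfl

/-- Evaluation at a scalar is a homomorphism. -/
def evalHom (t : 𝕜) : A[X] →ₐ[𝕜] A :=
  AlgHom.ofLinearMap (evalAt t) (by rw [← C_1, ← monomial_zero_left, evalAt_monomial]; simp)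
    fun g g' => by
    induction g using Polynomial.induction_on' with
    | add g₁ g₂ h₁ h₂ => simp only [add_mul, map_add, h₁, h₂]
    | monomial m a =>
      induction g' using Polynomial.induction_on' with
      | add g₁ g₂ h₁ h₂ => simp only [mul_add, map_add, h₁, h₂]
      | monomial n b =>
        rw [monomial_mul_monomial, evalAt_monomial, evalAt_monomial, evalAt_monomial,
          smul_mul_smul_comm, pow_add]

theorem evalHom_apply (t : 𝕜) (g : A[X]) : evalHom t g = evalAt t g := rfl

variable (S : SuperDGA 𝕜 A)

/-- The polynomials over a super-commutative differential algebra. -/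
def poly : SuperDGA 𝕜 A[X] where
  ε := coeffHom S.ε
  D := coeffMap S.D
  D_mul := coeffMap_twisted S.D S.ε.toLinearMap S.D_mul
  ε_D g := by
    ext n
    rw [coeffHom_apply, coeffHom_apply, coeff_coeffMap, coeff_coeffMap, coeff_neg, coeff_coeffMap,
      coeff_coeffMap]
    exact S.ε_D _
  D_D g := by
    ext n
    rw [coeff_coeffMap, coeff_coeffMap, S.D_D, coeff_zero]
  comm g g' h := by
    have h' : ∀ n, S.ε (g.coeff n) = g.coeff n := fun n => by
      have := congrArg (fun x => x.coeff n) h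
      rwa [coeffHom_apply, coeff_coeffMap] at this
    ext n
    rw [coeff_mul, coeff_mul, ← Finset.Nat.sum_antidiagonal_swap]
    exact Finset.sum_congr rfl fun x _ => S.comm _ _ (h' _)
  anti g g' h := by
    have h' : ∀ n, S.ε (g.coeff n) = -g.coeff n := fun n => by
      have := congrArg (fun x => x.coeff n) h
      rwa [coeffHom_apply, coeff_coeffMap, coeff_neg] at this
    ext n
    rw [coeff_mul, coeff_mul, ← Finset.Nat.sum_antidiagonal_swap]
    refine Finset.sum_congr rfl fun x _ => ?_
    rw [coeffHom_apply, coeff_coeffMap]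
    exact S.anti _ _ (h' _)

theorem poly_D (g : A[X]) : S.poly.D g = coeffMap S.D g := rfl

theorem poly_ε (g : A[X]) : S.poly.ε g = coeffMap S.ε.toLinearMap g := rfl

variable {S}

/-- Homomorphisms of super-commutative differential algebras. -/
structure IsHom (S : SuperDGA 𝕜 A) (T : SuperDGA 𝕜 B) (φ : A →ₐ[𝕜] B) : Prop where
  map_ε : ∀ x, φ (S.ε x) = T.ε (φ x)
  map_D : ∀ x, φ (S.D x) = T.D (φ x)

theorem isHom_evalHom (t : 𝕜) : IsHom S.poly S (evalHom t) :=
  ⟨fun g => evalAt_coeffMap S.ε.toLinearMap t g, fun g => evalAt_coeffMap S.D t g⟩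

theorem IsHom.coeffHom {T : SuperDGA 𝕜 B} {φ : A →ₐ[𝕜] B} (h : IsHom S T φ) :
    IsHom S.poly T.poly (coeffHom φ) where
  map_ε g := by
    ext n
    simp only [coeffHom_apply, poly_ε, coeff_coeffMap]
    exact h.map_ε _
  map_D g := by
    ext n
    simp only [coeffHom_apply, poly_D, coeff_coeffMap]
    exact h.map_D _

variable {T : SuperDGA 𝕜 B} {φ : A →ₐ[𝕜] B} {ι : Type*}

theorem IsHom.isEven (h : IsHom S T φ) {F : ι → A} (hF : S.IsEven F) :
    T.IsEven fun a => φ (F a) := fun a => by rw [← h.map_ε, hF]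

variable [Fintype ι] {f : ι → ι → ι → 𝕜}

theorem IsHom.map_curv (h : IsHom S T φ) (θ : ι → A) (c : ι) :
    φ (S.curv f θ c) = T.curv f (fun a => φ (θ a)) c := by
  simp only [curv, br, map_add, map_smul, map_sum, map_mul, h.map_D]

theorem IsHom.map_trans (h : IsHom S T φ) {F η : ι → A} (hF : S.IsEven F) (p : MvPolynomial ι 𝕜) :
    φ (S.trans F η p) = T.trans (fun a => φ (F a)) (fun a => φ (η a)) p := by
  simp only [trans, map_sum, map_mul, map_peval φ hF (h.isEven hF)]

theorem IsHom.map_trans_curv (h : IsHom S T φ) {θ η : ι → A} (hθ : S.IsOdd θ)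
    (p : MvPolynomial ι 𝕜) : φ (S.trans (S.curv f θ) η p) =
      T.trans (T.curv f fun a => φ (θ a)) (fun a => φ (η a)) p := by
  rw [h.map_trans (curv_even hθ)]
  congr 1
  funext c
  exact h.map_curv θ c

/-- The path `x + t y`. -/
def path (x y : A) : A[X] := monomial 0 x + monomial 1 y

theorem coeffMap_path (T : A →ₗ[𝕜] B) (x y : A) : coeffMap T (path x y) = path (T x) (T y) := by
  simp only [path, map_add, coeffMap_monomial]

theorem coeffMap_const (T : A →ₗ[𝕜] B) (x : A) :
    coeffMap T (monomial 0 x) = monomial 0 (T x) := coeffMap_monomial _ _ _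

theorem evalAt_path (t : 𝕜) (x y : A) : evalAt t (path x y) = x + t • y := by
  simp only [path, map_add, evalAt_monomial, pow_zero, pow_one, one_smul]

theorem evalAt_const (t : 𝕜) (x : A) : evalAt t (monomial 0 x : A[X]) = x := by
  rw [evalAt_monomial, pow_zero, one_smul]

theorem ddt_path (x y : A) : ddt 𝕜 (path x y) = monomial 0 y := by
  simp [path, ddt_apply]

theorem ε_path (x y : A) : S.poly.ε (path x y) = path (S.ε x) (S.ε y) :=
  coeffMap_path S.ε.toLinearMap x y

theorem path_neg (x y : A) : path (-x) (-y) = -path x y := by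
  simp only [path, map_neg, neg_add]

theorem isOdd_path {θ η : ι → A} (hθ : S.IsOdd θ) (hη : S.IsOdd η) :
    S.poly.IsOdd fun a => path (θ a) (η a) := fun a => by
  rw [ε_path, hθ, hη, path_neg]

variable (S) in
/-- The integrand of the transgression along the path `θ + t η`. -/
def transPath (f : ι → ι → ι → 𝕜) (p : MvPolynomial ι 𝕜) (θ η : ι → A) : A[X] :=
  S.poly.trans (S.poly.curv f fun a => path (θ a) (η a)) (fun a => monomial 0 (η a)) p

variable (S) in
/-- The transgression along the path `θ + t η`. -/
def transgr (f : ι → ι → ι → 𝕜) (p : MvPolynomial ι 𝕜) (θ η : ι → A) : A :=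
  integral 𝕜 (S.transPath f p θ η)

/-- Evaluation at a scalar is a homomorphism of differential algebras, so the formal integrand
specialises to the integrand of the definition. -/
theorem evalAt_transPath {θ η : ι → A} (hθ : S.IsOdd θ) (hη : S.IsOdd η) (p : MvPolynomial ι 𝕜)
    (t : 𝕜) : evalAt t (S.transPath f p θ η) = S.trans (S.curv f (θ + t • η)) η p := by
  have h := (isHom_evalHom (S := S) t).map_trans_curv (f := f) (isOdd_path hθ hη)
    (η := fun a => monomial 0 (η a)) p
  simp only [evalHom_apply, evalAt_path, evalAt_const] at h
  exact h

variable [DecidableEq ι] [CharZero 𝕜] {p : MvPolynomial ι 𝕜}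

/-- Apply `deriv_peval_curv` in the algebra of polynomials in `t`, with the formal derivative as the
derivation, and integrate. -/
theorem D_transgr (hf : ∀ a b c, f a b c = -f b a c) (hJ : Jacobi f) (hp : Invariant f p)
    {θ η : ι → A} (hθ : S.IsOdd θ) (hη : S.IsOdd η) :
    S.D (S.transgr f p θ η) = S.peval (S.curv f (θ + η)) p - S.peval (S.curv f θ) p := by
  have h := deriv_peval_curv hf hJ hp (isOdd_path hθ hη) (ddt 𝕜) ddt_mul
    (fun x => ddt_coeffMap S.D x) (fun x => (ddt_coeffMap S.ε.toLinearMap x).symm)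
  simp only [ddt_path] at h
  have h2 := congrArg (integral 𝕜) h
  rw [integral_ddt, poly_D, integral_coeffMap] at h2
  have e : ∀ t : 𝕜, evalAt t (S.poly.peval (S.poly.curv f fun a => path (θ a) (η a)) p) =
      S.peval (S.curv f (θ + t • η)) p := fun t => by
    have hh := isHom_evalHom (S := S) t
    have hF := curv_even (f := f) (isOdd_path hθ hη)
    have := map_peval (evalHom t) hF (hh.isEven hF) p
    simp only [hh.map_curv, evalHom_apply, evalAt_path] at this
    exact this
  rw [e, e, one_smul, zero_smul, add_zero] at h2
  exact h2.symm

variable (S) in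
/-- The family `θ + t α + u β + t u γ` of two parameters. -/
def square (θ α β γ : ι → A) (a : ι) : A[X][X] :=
  path (path (θ a) (α a)) (path (β a) (γ a))

theorem isOdd_square {θ α β γ : ι → A} (hθ : S.IsOdd θ) (hα : S.IsOdd α) (hβ : S.IsOdd β)
    (hγ : S.IsOdd γ) : S.poly.poly.IsOdd (square θ α β γ) :=
  isOdd_path (isOdd_path hθ hα) (isOdd_path hβ hγ)

variable (S) in
/-- The integrand of the difference of transgressions around a square. -/
def squarePath (f : ι → ι → ι → 𝕜) (p : MvPolynomial ι 𝕜) (θ α β γ : ι → A) : A[X][X] :=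
  S.poly.poly.trans₂ (S.poly.poly.curv f (square θ α β γ))
    (fun a => path (monomial 0 (α a)) (monomial 0 (γ a))) (fun a => monomial 0 (path (β a) (γ a))) p

variable (S) in
/-- The integral over the square. -/
def squareInt (f : ι → ι → ι → 𝕜) (p : MvPolynomial ι 𝕜) (θ α β γ : ι → A) : A :=
  integral 𝕜 (integral 𝕜 (S.squarePath f p θ α β γ))

/-- Apply the formula for two commuting derivations to the partial derivatives in `t` and `u`, and
integrate over both. On the left each derivative is integrated to a difference of endpoint values,
so transgressions along the edges remain. -/
theorem D_squareInt (hf : ∀ a b c, f a b c = -f b a c) (hJ : Jacobi f) (hp : Invariant f p)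
    {θ α β γ : ι → A} (hθ : S.IsOdd θ) (hα : S.IsOdd α) (hβ : S.IsOdd β) (hγ : S.IsOdd γ) :
    S.D (S.squareInt f p θ α β γ) =
      (S.transgr f p (θ + α) (β + γ) - S.transgr f p θ β) -
        (S.transgr f p (θ + β) (α + γ) - S.transgr f p θ α) := by
  have ho := isOdd_square hθ hα hβ hγ
  -- The inner variable is `t` and the outer one `u`: `coeffMap (ddt 𝕜)` differentiates in `t`, and
  -- `ddt 𝕜` in `u`.
  have h := deriv_trans_curv_sub hf hJ hp ho (coeffMap (ddt 𝕜)) (ddt 𝕜)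
    (coeffMap_derivation _ ddt_mul)
    (fun x => by
      ext1 n
      simp only [poly_D, coeff_coeffMap]
      exact ddt_coeffMap S.D _)
    (fun x => by
      ext1 n
      simp only [poly_ε, coeff_coeffMap]
      exact (ddt_coeffMap S.ε.toLinearMap _).symm)
    ddt_mul (fun x => ddt_coeffMap S.poly.D x)
    (fun x => (ddt_coeffMap S.poly.ε.toLinearMap x).symm)
    (fun x => (ddt_coeffMap _ x).symm)
  have e1 : ∀ a, coeffMap (ddt 𝕜) (square θ α β γ a) =
      path (monomial 0 (α a)) (monomial 0 (γ a)) := fun a => by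
    rw [square, coeffMap_path, ddt_path, ddt_path]
  have e2 : ∀ a, ddt 𝕜 (square θ α β γ a) = monomial 0 (path (β a) (γ a)) := fun a => ddt_path _ _
  simp only [e1, e2] at h
  have h2 := congrArg (fun x => integral 𝕜 (integral 𝕜 x)) h
  simp only [map_sub, integral_ddt, integral_coeffMap, poly_D] at h2
  rw [squareInt, squarePath, ← h2]
  -- At fixed `t`, integration over `u` gives the transgression along `u ↦ θ + tα + u(β + tγ)`. In
  -- `hu` below the two parameters exchange their roles.
  have ht : ∀ t : 𝕜, evalAt t (integral 𝕜 (S.poly.poly.trans (S.poly.poly.curv f (square θ α β γ))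
      (fun a => monomial 0 (path (β a) (γ a))) p)) = S.transgr f p (θ + t • α) (β + t • γ) := by
    intro t
    have hh := (isHom_evalHom (S := S) t).coeffHom.map_trans_curv (f := f) ho
      (η := fun a => monomial 0 (path (β a) (γ a))) p
    rw [← integral_coeffMap, transgr, transPath]
    refine congrArg _ (hh.trans ?_)
    simp only [square, coeffHom_apply, coeffMap_path, coeffMap_const, AlgHom.toLinearMap_apply,
      evalHom_apply, evalAt_path, Pi.add_apply, Pi.smul_apply]
  have hu : ∀ u : 𝕜, integral 𝕜 (evalAt u (S.poly.poly.trans (S.poly.poly.curv f (square θ α β γ))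
      (fun a => path (monomial 0 (α a)) (monomial 0 (γ a))) p)) =
      S.transgr f p (θ + u • β) (α + u • γ) := by
    intro u
    have hh := (isHom_evalHom (S := S.poly) u).map_trans_curv (f := f) ho
      (η := fun a => path (monomial 0 (α a)) (monomial 0 (γ a))) p
    rw [transgr, transPath]
    refine congrArg _ (hh.trans ?_)
    have e3 : ∀ a, path (θ a) (α a) + u • path (β a) (γ a) =
        path ((θ + u • β) a) ((α + u • γ) a) := fun a => by
      simp only [path, Pi.add_apply, Pi.smul_apply, map_add, smul_add, smul_monomial]
      abel
    have e4 : ∀ a, monomial 0 (α a) + u • monomial 0 (γ a) = monomial 0 ((α + u • γ) a) :=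
      fun a => by simp only [Pi.add_apply, Pi.smul_apply, map_add, smul_monomial]
    simp only [square, evalHom_apply, evalAt_path, e3, e4]
  rw [ht, ht, hu, hu]
  simp only [one_smul, zero_smul, add_zero]

theorem Contraction.poly {i L : A →ₗ[𝕜] A} (h : S.Contraction i L) :
    S.poly.Contraction (coeffMap i) (coeffMap L) where
  i_mul := coeffMap_twisted i S.ε.toLinearMap h.i_mul
  L_mul := coeffMap_derivation L h.L_mul
  i_D g := by
    ext1 n
    simp only [poly_D, coeff_coeffMap, coeff_sub]
    exact h.i_D _

variable {i L : A →ₗ[𝕜] A} {v : ι → 𝕜} {θ η α β γ : ι → A}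

theorem path_sub_path_zero (x : A) : path x 0 = monomial 0 x := by
  rw [path, map_zero, add_zero]

theorem adj_path (x y : ι → A) (c : ι) :
    adj f v (fun a => path (x a) (y a)) c = path (adj f v x c) (adj f v y c) := by
  simp only [adj, path, smul_add, smul_monomial, Finset.sum_add_distrib, map_sum]

theorem adj_const (x : ι → A) (c : ι) :
    adj f v (fun a => (monomial 0 (x a) : A[X])) c = monomial 0 (adj f v x c) := by
  simp only [adj, smul_monomial, map_sum]

theorem algebraMap_eq_const (c : 𝕜) : algebraMap 𝕜 A[X] c = monomial 0 (algebraMap 𝕜 A c) := by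
  rw [Polynomial.algebraMap_apply, ← monomial_zero_left]

variable (f) in
/-- The conditions on a connection with respect to a contraction. -/
structure IsConn (i L : A →ₗ[𝕜] A) (v : ι → 𝕜) (θ : ι → A) : Prop where
  i_eq : ∀ a, i (θ a) = algebraMap 𝕜 A (v a)
  L_eq : ∀ c, L (θ c) = -adj f v θ c

variable (f) in
/-- The conditions on a tensorial element with respect to a contraction. -/
structure IsTensorial (i L : A →ₗ[𝕜] A) (v : ι → 𝕜) (η : ι → A) : Prop where
  i_eq : ∀ a, i (η a) = 0
  L_eq : ∀ c, L (η c) = -adj f v η c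

theorem IsConn.path (hθ : IsConn f i L v θ) (hη : IsTensorial f i L v η) :
    IsConn f (coeffMap i) (coeffMap L) v fun a => path (θ a) (η a) where
  i_eq a := by
    rw [coeffMap_path, hθ.i_eq, hη.i_eq, path_sub_path_zero, algebraMap_eq_const]
  L_eq c := by rw [coeffMap_path, hθ.L_eq, hη.L_eq, path_neg, adj_path]

theorem IsTensorial.path (hθ : IsTensorial f i L v θ) (hη : IsTensorial f i L v η) :
    IsTensorial f (coeffMap i) (coeffMap L) v fun a => path (θ a) (η a) where
  i_eq a := by rw [coeffMap_path, hθ.i_eq, hη.i_eq, path_sub_path_zero, map_zero]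
  L_eq c := by rw [coeffMap_path, hθ.L_eq, hη.L_eq, path_neg, adj_path]

theorem IsTensorial.const (hη : IsTensorial f i L v η) :
    IsTensorial f (coeffMap i) (coeffMap L) v fun a => (monomial 0 (η a) : A[X]) where
  i_eq a := by rw [coeffMap_const, hη.i_eq, map_zero]
  L_eq c := by rw [coeffMap_const, hη.L_eq, map_neg, adj_const]

/-- The transgression along a path of connections is basic. -/
theorem transgr_basic (h : S.Contraction i L) (hf : ∀ a b c, f a b c = -f b a c) (hJ : Jacobi f)
    (hp : Invariant f p) (hθ : S.IsOdd θ) (hη : S.IsOdd η) (cθ : IsConn f i L v θ)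
    (tη : IsTensorial f i L v η) :
    i (S.transgr f p θ η) = 0 ∧ L (S.transgr f p θ η) = 0 := by
  have ho := isOdd_path hθ hη
  have hc := cθ.path tη
  have hF := curv_even (f := f) ho
  rw [transgr, ← integral_coeffMap, ← integral_coeffMap, transPath,
    h.poly.i_trans hF (h.poly.i_curv hf ho hc.i_eq hc.L_eq) tη.const.i_eq,
    h.poly.L_trans hp hF (h.poly.L_curv hf hJ ho hc.i_eq hc.L_eq) tη.const.L_eq, map_zero]
  exact ⟨rfl, rfl⟩

/-- All members of the family satisfy the connection conditions, because they differ by tensorial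
elements, and both partial derivatives of the family are tensorial. So the integrand is annihilated
before integration. -/
theorem squareInt_basic (h : S.Contraction i L) (hf : ∀ a b c, f a b c = -f b a c) (hJ : Jacobi f)
    (hp : Invariant f p) (hθ : S.IsOdd θ) (hα : S.IsOdd α) (hβ : S.IsOdd β) (hγ : S.IsOdd γ)
    (cθ : IsConn f i L v θ) (tα : IsTensorial f i L v α) (tβ : IsTensorial f i L v β)
    (tγ : IsTensorial f i L v γ) :
    i (S.squareInt f p θ α β γ) = 0 ∧ L (S.squareInt f p θ α β γ) = 0 := by
  have ho := isOdd_square hθ hα hβ hγ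
  have hc := (cθ.path tα).path (tβ.path tγ)
  have hF := curv_even (f := f) ho
  have t1 := tα.const.path tγ.const
  have t2 := (tβ.path tγ).const
  constructor
  · rw [squareInt, ← integral_coeffMap i, ← integral_coeffMap (coeffMap i), squarePath,
      h.poly.poly.i_trans₂ hF (h.poly.poly.i_curv hf ho hc.i_eq hc.L_eq) t1.i_eq t2.i_eq,
      map_zero, map_zero]
  · rw [squareInt, ← integral_coeffMap L, ← integral_coeffMap (coeffMap L), squarePath,
      h.poly.poly.L_trans₂ hp hF (h.poly.poly.L_curv hf hJ ho hc.i_eq hc.L_eq) t1.L_eq t2.L_eq,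
      map_zero, map_zero]

end Polynomials

end SuperDGA

end

end BRS

namespace BRS

noncomputable section

open MvPolynomial (pderiv C X)

/-! ### Invariant forms as polynomials in a basis -/

section InvariantPolynomials

variable {𝕜 : Type*} [RCLike 𝕜] {ι : Type*} [Fintype ι]

theorem derivation_prod {R A : Type*} [CommRing R] [CommRing A] [Algebra R A] (δ : Derivation R A A)
    {n : ℕ} (g : Fin n → A) :
    δ (∏ i, g i) = ∑ j, ∏ i, Function.update g j (δ (g j)) i := by
  induction n with
  | zero => simp
  | succ n ih =>
    rw [Fin.prod_univ_succ, Derivation.leibniz, ih, Fin.sum_univ_succ, add_comm, smul_eq_mul,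
      smul_eq_mul]
    congr 1
    · rw [Fin.prod_univ_succ, Function.update_self, mul_comm]
      refine congrArg _ (Finset.prod_congr rfl fun i _ => ?_)
      rw [Function.update_of_ne (Fin.succ_ne_zero i)]
    · rw [Finset.mul_sum]
      refine Finset.sum_congr rfl fun j _ => ?_
      rw [Fin.prod_univ_succ, Function.update_of_ne (Fin.succ_ne_zero j).symm]
      refine congrArg _ (Finset.prod_congr rfl fun i _ => ?_)
      by_cases h : i = j
      · subst h; rw [Function.update_self, Function.update_self]
      · rw [Function.update_of_ne h, Function.update_of_ne fun h' => h (Fin.succ_injective _ h')]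

section

variable {V : Type*} [AddCommGroup V] [Module ℝ V] (b : Module.Basis ι ℝ V)

variable (𝕜) in
/-- The structure constants of a bracket in a basis. -/
def structConst [Bracket V V] (x y z : ι) : 𝕜 := ((b.repr ⁅b x, b y⁆ z : ℝ) : 𝕜)

/-- The polynomial of a multilinear form in a basis. -/
def formPoly {n : ℕ} (I : MultilinearMap ℝ (fun _ : Fin n => V) 𝕜) : MvPolynomial ι 𝕜 :=
  ∑ m : Fin n → ι, C (I fun i => b (m i)) * ∏ i, X (m i)

/-- Exchange of the value of `m` at `j` with a second value. -/
def exchange [DecidableEq ι] {n : ℕ} (j : Fin n) : (Fin n → ι) × ι ≃ (Fin n → ι) × ι where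
  toFun x := (Function.update x.1 j x.2, x.1 j)
  invFun x := (Function.update x.1 j x.2, x.1 j)
  left_inv x := by simp
  right_inv x := by simp

/-- The expression in `Invariant` is a derivation `δ` of the polynomial ring. On a monomial it
changes one variable at a time; an exchange of summation indices moves this change to the
corresponding argument of `I`, where `hI` makes the sum over the slots vanish. -/
theorem invariant_formPoly [Bracket V V] {n : ℕ} (I : MultilinearMap ℝ (fun _ : Fin n => V) 𝕜)
    (hI : ∀ (u : V) (v : Fin n → V), ∑ i, I (Function.update v i ⁅u, v i⁆) = 0) :
    SuperDGA.Invariant (structConst 𝕜 b) (formPoly b I) := by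
  classical
  intro a
  let δ : Derivation 𝕜 (MvPolynomial ι 𝕜) (MvPolynomial ι 𝕜) :=
    ∑ x, ∑ e, (C (structConst 𝕜 b a x e) * X x : MvPolynomial ι 𝕜) • pderiv e
  have hδ : ∀ p, δ p = ∑ x, ∑ e, C (structConst 𝕜 b a x e) * (X x * pderiv e p) := fun p => by
    change Derivation.coeFnAddMonoidHom δ p = _
    simp only [δ, map_sum, Finset.sum_apply]
    exact Finset.sum_congr rfl fun x _ => Finset.sum_congr rfl fun e _ => mul_assoc _ _ _
  have hX : ∀ c, δ (X c) = ∑ x, C (structConst 𝕜 b a x c) * X x := fun c => by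
    rw [hδ]
    refine Finset.sum_congr rfl fun x _ => ?_
    rw [Finset.sum_eq_single c]
    · rw [MvPolynomial.pderiv_X_self, mul_one]
    · intro e _ he
      rw [MvPolynomial.pderiv_X_of_ne he.symm, mul_zero, mul_zero]
    · simp
  have hprod : ∀ m : Fin n → ι, δ (∏ i, X (m i)) =
      ∑ j, ∑ x, C (structConst 𝕜 b a x (m j)) * ∏ i, X (Function.update m j x i) := fun m => by
    rw [derivation_prod]
    refine Finset.sum_congr rfl fun j _ => ?_
    rw [Finset.prod_update_of_mem (Finset.mem_univ j), hX, Finset.sum_mul]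
    refine Finset.sum_congr rfl fun x _ => ?_
    rw [mul_assoc]
    congr 1
    have : (fun i => (X (Function.update m j x i) : MvPolynomial ι 𝕜)) =
        Function.update (fun i => X (m i)) j (X x) := by
      funext i
      by_cases h : i = j
      · subst h; simp
      · simp [Function.update_of_ne h]
    rw [this, Finset.prod_update_of_mem (Finset.mem_univ j)]
  rw [← hδ, formPoly, map_sum]
  have h1 : ∀ m : Fin n → ι, δ (C (I fun i => b (m i)) * ∏ i, X (m i)) =
      ∑ j, ∑ x, C (I (fun i => b (m i)) * structConst 𝕜 b a x (m j)) *
        ∏ i, X (Function.update m j x i) := fun m => by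
    rw [Derivation.leibniz, hprod, ← MvPolynomial.algebraMap_eq, Derivation.map_algebraMap, smul_zero,
      add_zero, smul_eq_mul, Finset.mul_sum]
    simp only [Finset.mul_sum, MvPolynomial.algebraMap_eq, map_mul, mul_assoc]
  have h2 : ∀ j : Fin n, ∑ m : Fin n → ι, ∑ x, C (I (fun i => b (m i)) * structConst 𝕜 b a x (m j)) *
        ∏ i, (X (Function.update m j x i) : MvPolynomial ι 𝕜) =
      ∑ m : Fin n → ι, C (I (Function.update (fun i => b (m i)) j ⁅b a, b (m j)⁆)) *
        ∏ i, X (m i) := fun j => by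
    -- The involution `exchange j` swaps the index in slot `j` with the free index `x`. The monomial
    -- then no longer depends on `x`, and the sum over `x` reassembles `⁅b a, b (m j)⁆` inside `I`.
    rw [← Fintype.sum_prod_type', ← (exchange j).sum_comp, Fintype.sum_prod_type]
    refine Finset.sum_congr rfl fun m _ => ?_
    simp only [exchange, Equiv.coe_fn_mk, Function.update_idem, Function.update_eq_self,
      Function.update_self]
    rw [← Finset.sum_mul, ← map_sum]
    congr 2
    have e : ⁅b a, b (m j)⁆ = ∑ x, b.repr ⁅b a, b (m j)⁆ x • b x := (b.sum_repr _).symm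
    rw [e, I.map_update_sum]
    refine Finset.sum_congr rfl fun x _ => ?_
    rw [I.map_update_smul, structConst, RCLike.real_smul_eq_coe_mul, mul_comm]
    congr 2
    funext i
    by_cases h : i = j
    · subst h; simp
    · simp [Function.update_of_ne h]
  simp only [h1]
  rw [Finset.sum_comm]
  simp only [h2]
  rw [Finset.sum_comm]
  refine Finset.sum_eq_zero fun m _ => ?_
  rw [← Finset.sum_mul, ← map_sum, hI (b a) fun i => b (m i), map_zero, zero_mul]

end

variable {V : Type*} [LieRing V] [LieAlgebra ℝ V] (b : Module.Basis ι ℝ V)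

theorem structConst_antisymm (x y z : ι) : structConst 𝕜 b x y z = -structConst 𝕜 b y x z := by
  rw [structConst, structConst, ← lie_skew, map_neg, Finsupp.neg_apply, RCLike.ofReal_neg]

theorem jacobi_structConst : SuperDGA.Jacobi (structConst 𝕜 b) := by
  intro x y z w
  have key : ∀ x y z, ∑ a, structConst 𝕜 b x y a * structConst 𝕜 b a z w =
      ((b.repr ⁅⁅b x, b y⁆, b z⁆ w : ℝ) : 𝕜) := fun x y z => by
    conv_rhs => rw [← b.sum_repr ⁅b x, b y⁆]
    simp only [sum_lie, smul_lie, map_sum, map_smul,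
      Finsupp.coe_finsetSum, Finset.sum_apply, Finsupp.smul_apply, smul_eq_mul, structConst,
      RCLike.ofReal_mul]
  rw [Finset.sum_add_distrib, Finset.sum_add_distrib, key, key, key, ← RCLike.ofReal_add,
    ← RCLike.ofReal_add, ← Finsupp.add_apply, ← Finsupp.add_apply, ← map_add, ← map_add]
  have : ⁅⁅b x, b y⁆, b z⁆ + ⁅⁅b y, b z⁆, b x⁆ + ⁅⁅b z, b x⁆, b y⁆ = 0 := by
    have := lie_jacobi (b x) (b y) (b z)
    rw [← lie_skew ⁅b x, b y⁆, ← lie_skew ⁅b y, b z⁆, ← lie_skew ⁅b z, b x⁆, ← neg_add, ← neg_add,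
      neg_eq_zero, ← this]
    abel
  rw [this]
  simp

end InvariantPolynomials

/-! ### Polynomial evaluation as a sum of ordered products -/

namespace SuperDGA

variable {𝕜 A : Type*} [RCLike 𝕜] [Ring A] [Algebra 𝕜 A] {S : SuperDGA 𝕜 A}
  {ι : Type*} [Fintype ι] [DecidableEq ι] {F η : ι → A}

theorem peval_one (hF : S.IsEven F) : S.peval F (1 : MvPolynomial ι 𝕜) = 1 := by
  rw [← MvPolynomial.C_1, peval_C hF, map_one]

theorem peval_prod_X (hF : S.IsEven F) {n : ℕ} (m : Fin n → ι) :
    S.peval F (∏ i, X (m i)) = (List.ofFn fun i => F (m i)).prod := by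
  induction n with
  | zero => simp [peval_one hF]
  | succ n ih => rw [Fin.prod_univ_succ, peval_mul hF, peval_X hF, ih, List.ofFn_succ, List.prod_cons]

/-- The gradient sum puts `η` in front, the product puts it in slot `j`. Both agree because `η`
commutes with the even entries of `F` that it has to pass. -/
theorem trans_prod_X (hF : S.IsEven F) {n : ℕ} (m : Fin n → ι) :
    S.trans F η (∏ i, X (m i)) =
      ∑ j, (List.ofFn fun i => Function.update (fun _ => F) j η i (m i)).prod := by
  induction n with
  | zero => simp [trans, peval_zero hF]
  | succ n ih =>
    have h1 : ∀ a, η a * S.peval F (pderiv a (∏ i, X (m i))) =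
        (if a = m 0 then η a * (List.ofFn fun i : Fin n => F (m i.succ)).prod else 0) +
          F (m 0) * (η a * S.peval F (pderiv a (∏ i : Fin n, X (m i.succ)))) := by
      intro a
      rw [Fin.prod_univ_succ, Derivation.leibniz, smul_eq_mul, smul_eq_mul, peval_add hF,
        peval_mul hF, peval_mul hF, peval_X hF, mul_add, add_comm, ← mul_assoc, ← mul_assoc,
        ← S.comm _ (η a) (hF (m 0)), peval_prod_X hF fun i : Fin n => m i.succ]
      congr 1
      by_cases h : a = m 0
      · rw [if_pos h, h, MvPolynomial.pderiv_X_self, peval_one hF, mul_one]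
      · rw [if_neg h, MvPolynomial.pderiv_X_of_ne (Ne.symm h), peval_zero hF, mul_zero]
      · rw [mul_assoc]
    rw [trans]
    simp only [h1, Finset.sum_add_distrib, Finset.sum_ite_eq', Finset.mem_univ, if_true,
      ← Finset.mul_sum]
    rw [← trans, ih, Fin.sum_univ_succ, Finset.mul_sum]
    congr 1
    · rw [List.ofFn_succ, List.prod_cons, Function.update_self]
      simp only [Function.update_of_ne (Fin.succ_ne_zero _)]
    · refine Finset.sum_congr rfl fun j _ => ?_
      rw [List.ofFn_succ, List.prod_cons, Function.update_of_ne (Fin.succ_ne_zero j).symm]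
      congr 3
      funext i
      by_cases h : i = j
      · subst h; rw [Function.update_self, Function.update_self]
      · rw [Function.update_of_ne h, Function.update_of_ne fun h' => h (Fin.succ_injective _ h')]

variable {V : Type*} [AddCommGroup V] [Module ℝ V] (b : Module.Basis ι ℝ V)

theorem peval_formPoly (hF : S.IsEven F) {n : ℕ} (I : MultilinearMap ℝ (fun _ : Fin n => V) 𝕜) :
    S.peval F (formPoly b I) =
      ∑ m : Fin n → ι, (I fun i => b (m i)) • (List.ofFn fun i => F (m i)).prod := by
  simp only [formPoly, peval_sum hF, peval_C_mul hF, peval_prod_X hF]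

theorem trans_formPoly (hF : S.IsEven F) {n : ℕ} (I : MultilinearMap ℝ (fun _ : Fin n => V) 𝕜) :
    S.trans F η (formPoly b I) = ∑ j : Fin n, ∑ m : Fin n → ι, (I fun i => b (m i)) •
      (List.ofFn fun i => Function.update (fun _ => F) j η i (m i)).prod := by
  rw [Finset.sum_comm]
  have : ∀ m : Fin n → ι, ∑ j, (I fun i => b (m i)) •
      (List.ofFn fun i => Function.update (fun _ => F) j η i (m i)).prod =
      (I fun i => b (m i)) • S.trans F η (∏ i, X (m i)) := fun m => by
    rw [trans_prod_X hF, Finset.smul_sum]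
  simp only [this, formPoly, trans, map_sum, MvPolynomial.pderiv_C_mul, peval_sum hF, peval_C_mul hF,
    Finset.mul_sum, Finset.smul_sum, mul_smul_comm]
  exact Finset.sum_comm

end SuperDGA

/-! ### Identification with the transgressions of cochains on `P` -/

namespace PrincipalBundle

variable
    {EM : Type*} [NormedAddCommGroup EM] [NormedSpace ℝ EM] [FiniteDimensional ℝ EM]
    {M : Type*} [TopologicalSpace M] [ChartedSpace EM M] [IsManifold 𝓘(ℝ, EM) ∞ M]
    {EG : Type*} [NormedAddCommGroup EG] [NormedSpace ℝ EG] [FiniteDimensional ℝ EG]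
    {G : Type*} [TopologicalSpace G] [ChartedSpace EG G] [Group G]
    {EP : Type*} [NormedAddCommGroup EP] [NormedSpace ℝ EP] [FiniteDimensional ℝ EP]
    {P : Type*} [TopologicalSpace P] [ChartedSpace EP P] [IsManifold 𝓘(ℝ, EP) ∞ P] [T2Space P]
    (B : PrincipalBundle EM M EG G EP P) (𝕜 : Type*) [RCLike 𝕜]

open CochainAlg

/-- The BRS cochains as a super-commutative differential algebra. -/
def dga : SuperDGA 𝕜 (B.Alg 𝕜) where
  ε := AlgHom.ofLinearMap parity parity_one parity_mul
  D := D
  D_mul := D_mul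
  ε_D := parity_D
  D_D := D_D
  comm f g h := (supercomm_aux f g).1 h
  anti f g h := (supercomm_aux f g).2 h

variable {B 𝕜}

theorem dga_ε (f : B.Alg 𝕜) : (B.dga 𝕜).ε f = parity f := rfl

theorem dga_D (f : B.Alg 𝕜) : (B.dga 𝕜).D f = D f := rfl

/-- The underlying family of components. -/
def valHom : B.Alg 𝕜 →+ B.TotalP 𝕜 where
  toFun f := f.1
  map_zero' := rfl
  map_add' _ _ := rfl

theorem val_finset_sum {J : Type*} (s : Finset J) (f : J → B.Alg 𝕜) :
    (∑ j ∈ s, f j).1 = ∑ j ∈ s, (f j).1 := map_sum valHom f s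

theorem prod_val {n : ℕ} (χ : Fin n → B.Alg 𝕜) :
    Total.prod (fun i => (χ i).1) = (List.ofFn χ).prod.1 := by
  induction n with
  | zero => simp [Total.prod]
  | succ n ih => rw [Total.prod, ih, List.ofFn_succ, List.prod_cons, val_mul]

variable {ι : Type*} [Fintype ι] (b : Module.Basis ι ℝ (GroupLieAlgebra 𝓘(ℝ, EG) G))

theorem br_val (χ ψ : ι → B.Alg 𝕜) (c : ι) : (SuperDGA.br (structConst 𝕜 b) χ ψ c).1 =
    B.totalBracket b (fun a => (χ a).1) (fun a => (ψ a).1) c := by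
  simp only [SuperDGA.br, totalBracket, val_finset_sum, structConst, ofReal_smul_val, val_mul]

theorem curv_val (θ : ι → B.Alg 𝕜) (c : ι) : ((B.dga 𝕜).curv (structConst 𝕜 b) θ c).1 =
    B.curvature b (fun a => (θ a).1) c := by
  have : (1 / 2 : 𝕜) = ((1 / 2 : ℝ) : 𝕜) := by norm_num [RCLike.ofReal_div, RCLike.ofReal_ofNat]
  rw [SuperDGA.curv, curvature, val_add, dga_D, D_val, this, ofReal_smul_val, br_val]

theorem evalPoly_val {n : ℕ}
    (I : MultilinearMap ℝ (fun _ : Fin n => GroupLieAlgebra 𝓘(ℝ, EG) G) 𝕜)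
    (χ : Fin n → ι → B.Alg 𝕜) : B.evalPoly b I (fun i a => (χ i a).1) =
      (∑ m : Fin n → ι, (I fun i => b (m i)) • (List.ofFn fun i => χ i (m i)).prod).1 := by
  funext q k X Y
  rw [val_sum]
  simp only [evalPoly, prod_val, CochainAlg.smul_apply]

theorem sum_evalPoly_trans [DecidableEq ι] {n : ℕ}
    (I : MultilinearMap ℝ (fun _ : Fin n => GroupLieAlgebra 𝓘(ℝ, EG) G) 𝕜)
    {F η : ι → B.Alg 𝕜} (hF : (B.dga 𝕜).IsEven F) :
    ((B.dga 𝕜).trans F η (formPoly b I)).1 = ∑ j : Fin n, B.evalPoly b I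
      (Function.update (fun _ a => (F a).1) j fun a => (η a).1) := by
  rw [SuperDGA.trans_formPoly b hF, val_finset_sum]
  refine Finset.sum_congr rfl fun j _ => ?_
  rw [← evalPoly_val]
  congr 1
  funext i
  by_cases h : i = j
  · subst h; simp
  · simp [Function.update_of_ne h]

variable (𝕜) in
/-- The value of a component at a point. -/
def evalPt (q k : ℕ) (X : Fin k → B.gaugeAlg) (Y : Fin q → VField EP P) (p : P) :
    B.Alg 𝕜 →ₗ[𝕜] 𝕜 where
  toFun f := f q k X Y p
  map_add' _ _ := rfl
  map_smul' _ _ := rfl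

open Polynomial in
-- Links the formal integral with the analytic one: after a scalar-valued functional is applied, the
-- integrand is a polynomial function of the real parameter.
theorem integral_evalAt {A : Type*} [Ring A] [Algebra 𝕜 A] (T : A →ₗ[𝕜] 𝕜) (g : A[X]) :
    Continuous (fun t : ℝ => T (SuperDGA.evalAt (t : 𝕜) g)) ∧
      ∫ t in (0 : ℝ)..1, T (SuperDGA.evalAt (t : 𝕜) g) = T (SuperDGA.integral 𝕜 g) := by
  induction g using Polynomial.induction_on' with
  | add g h hg hh =>
    simp only [map_add]
    refine ⟨hg.1.add hh.1, ?_⟩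
    rw [intervalIntegral.integral_add (hg.1.intervalIntegrable _ _) (hh.1.intervalIntegrable _ _),
      hg.2, hh.2]
  | monomial n a =>
    simp only [SuperDGA.evalAt_monomial, SuperDGA.integral_monomial, map_smul, smul_eq_mul,
      ← RCLike.ofReal_pow]
    constructor
    · exact (RCLike.continuous_ofReal.comp (continuous_pow n)).mul continuous_const
    · rw [intervalIntegral.integral_mul_const]
      have h : ∫ t in (0 : ℝ)..1, ((t ^ n : ℝ) : 𝕜) = ((∫ t in (0 : ℝ)..1, t ^ n : ℝ) : 𝕜) :=
        (RCLike.ofRealCLM (K := 𝕜)).intervalIntegral_comp_comm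
          ((continuous_pow n).intervalIntegrable (μ := MeasureTheory.volume) 0 1)
      rw [h, integral_pow]
      simp

open Polynomial in
-- Pointwise the integral equals the value of the formal integral, which is smooth. Hence
-- `integrate` never takes its default value `0` here.
theorem integrate_evalAt (g : (B.Alg 𝕜)[X]) (q k : ℕ) (X : Fin k → B.gaugeAlg)
    (Y : Fin q → VField EP P) :
    integrate (fun t => (SuperDGA.evalAt (t : 𝕜) g).1 q k X Y) =
      (SuperDGA.integral 𝕜 g).1 q k X Y := by
  have key : (fun p => ∫ t in (0 : ℝ)..1, (SuperDGA.evalAt (t : 𝕜) g).1 q k X Y p) =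
      (SuperDGA.integral 𝕜 g).1 q k X Y :=
    funext fun p => (integral_evalAt (evalPt 𝕜 q k X Y p) g).2
  have h : ContMDiff 𝓘(ℝ, EP) 𝓘(ℝ, 𝕜) ∞
      (fun p => ∫ t in (0 : ℝ)..1, (SuperDGA.evalAt (t : 𝕜) g).1 q k X Y p) := by
    rw [key]
    exact ((SuperDGA.integral 𝕜 g).1 q k X Y).contMDiff
  exact (dif_pos h).trans (ContMDiffMap.ext fun p => congrFun key p)

/-- The transgression is the one of the super-commutative differential algebra of cochains. -/
theorem transgression_val [DecidableEq ι] {n : ℕ}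
    (I : MultilinearMap ℝ (fun _ : Fin n => GroupLieAlgebra 𝓘(ℝ, EG) G) 𝕜)
    {θ η : ι → B.Alg 𝕜} (hθ : (B.dga 𝕜).IsOdd θ) (hη : (B.dga 𝕜).IsOdd η) :
    B.transgression b I (fun a => (θ a).1) (fun a => (η a).1) =
      ((B.dga 𝕜).transgr (structConst 𝕜 b) (formPoly b I) θ η).1 := by
  funext q k X Y
  rw [SuperDGA.transgr, ← integrate_evalAt]
  refine congrArg integrate (funext fun t => ?_)
  rw [SuperDGA.evalAt_transPath hθ hη,
    sum_evalPoly_trans b I (SuperDGA.curv_even (hθ.add (hη.smul (t : 𝕜))))]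
  have e : B.curvature b ((fun a => (θ a).1) + t • fun a => (η a).1) =
      fun a => ((B.dga 𝕜).curv (structConst 𝕜 b) (θ + (t : 𝕜) • η) a).1 := by
    funext a
    rw [curv_val]
    refine congrArg (fun χ => B.curvature b χ a) (funext fun c => ?_)
    rw [Pi.add_apply (θ : ι → B.Alg 𝕜), Pi.smul_apply (t : 𝕜) η, val_add, ofReal_smul_val]
    rfl
  exact congrFun (congrFun (congrFun (congrFun (congrArg (fun F : ι → B.TotalP 𝕜 =>
    ∑ j : Fin n, B.evalPoly b I (Function.update (fun _ => F) j fun a => (η a).1)) e) q) k) X) Y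

end PrincipalBundle

end

end BRS

namespace BRS

noncomputable section

/-! ### Exchange of partial derivatives on a product manifold -/

section MixedPartials

variable {E : Type*} [NormedAddCommGroup E] [NormedSpace ℝ E]
  {N : Type*} [TopologicalSpace N] [ChartedSpace E N] [IsManifold 𝓘(ℝ, E) ∞ N]
  {ES : Type*} [NormedAddCommGroup ES] [NormedSpace ℝ ES]
  {S : Type*} [TopologicalSpace S] [ChartedSpace ES S] [IsManifold 𝓘(ℝ, ES) ∞ S]
  {F : Type*} [NormedAddCommGroup F] [NormedSpace ℝ F]

theorem mvfderiv_eq_fderiv_extChartAt {g : N → F} {p : N}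
    (hg : MDifferentiableAt 𝓘(ℝ, E) 𝓘(ℝ, F) g p) :
    mvfderiv 𝓘(ℝ, E) g p =
      fderiv ℝ (g ∘ (extChartAt 𝓘(ℝ, E) p).symm) (extChartAt 𝓘(ℝ, E) p p) := by
  have : mfderiv 𝓘(ℝ, E) 𝓘(ℝ, F) g p = fderivWithin ℝ
      (writtenInExtChartAt 𝓘(ℝ, E) 𝓘(ℝ, F) p g) (Set.range 𝓘(ℝ, E)) (extChartAt 𝓘(ℝ, E) p p) :=
    if_pos hg
  rw [ModelWithCorners.range_eq_univ, fderivWithin_univ] at this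
  exact this

/-- The derivative of a vector-valued function, as a linear map on the model space. -/
def modelDeriv (g : N → F) (p : N) : E →L[ℝ] F := mvfderiv 𝓘(ℝ, E) g p

theorem modelDeriv_eq {g : N → F} {p : N} (hg : MDifferentiableAt 𝓘(ℝ, E) 𝓘(ℝ, F) g p) :
    modelDeriv g p = fderiv ℝ (g ∘ (extChartAt 𝓘(ℝ, E) p).symm) (extChartAt 𝓘(ℝ, E) p p) :=
  mvfderiv_eq_fderiv_extChartAt hg

variable {h : S × N → F} (hh : ContMDiff (𝓘(ℝ, ES).prod 𝓘(ℝ, E)) 𝓘(ℝ, F) ∞ h)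
include hh

/-- In the product of two charts both sides are the second derivative of the same smooth function on
`ES × E`, with its arguments in opposite order. -/
theorem mixed_partials (s : S) (p : N) :
    MDifferentiableAt 𝓘(ℝ, ES) 𝓘(ℝ, E →L[ℝ] F)
      (fun s' => modelDeriv (E := E) (fun p' => h (s', p')) p) s ∧
    ∀ (v : ES) (y : E),
      modelDeriv (E := ES) (fun s' => modelDeriv (E := E) (fun p' => h (s', p')) p) s v y =
      modelDeriv (E := E) (fun p' => modelDeriv (E := ES) (fun s' => h (s', p')) s v) p y := by
  set χ := extChartAt 𝓘(ℝ, ES) s with hχ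
  set ψ := extChartAt 𝓘(ℝ, E) p with hψ
  let H : ES × E → F := fun x => h (χ.symm x.1, ψ.symm x.2)
  have hχs : ∀ a ∈ χ.target, ContMDiffAt 𝓘(ℝ, ES) 𝓘(ℝ, ES) ∞ χ.symm a := by
    intro a ha
    have := contMDiffWithinAt_extChartAt_symm_range (I := 𝓘(ℝ, ES)) (n := ∞) s ha
    rwa [ModelWithCorners.range_eq_univ, contMDiffWithinAt_univ] at this
  have hψs : ∀ a ∈ ψ.target, ContMDiffAt 𝓘(ℝ, E) 𝓘(ℝ, E) ∞ ψ.symm a := by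
    intro a ha
    have := contMDiffWithinAt_extChartAt_symm_range (I := 𝓘(ℝ, E)) (n := ∞) p ha
    rwa [ModelWithCorners.range_eq_univ, contMDiffWithinAt_univ] at this
  have hH : ∀ a ∈ χ.target, ∀ c ∈ ψ.target, ContDiffAt ℝ ∞ H (a, c) := by
    intro a ha c hc
    have h1 : ContMDiffAt (𝓘(ℝ, ES).prod 𝓘(ℝ, E)) 𝓘(ℝ, F) ∞ H (a, c) :=
      hh.contMDiffAt.comp (a, c) (((hχs a ha).comp (a, c) contMDiffAt_fst).prodMk
        ((hψs c hc).comp (a, c) contMDiffAt_snd))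
    rw [← modelWithCornersSelf_prod, chartedSpaceSelf_prod] at h1
    exact contMDiffAt_iff_contDiffAt.1 h1
  have ha0 : χ s ∈ χ.target := mem_extChartAt_target s
  have hc0 : ψ p ∈ ψ.target := mem_extChartAt_target p
  have hsec : ∀ s', MDifferentiableAt 𝓘(ℝ, E) 𝓘(ℝ, F) (fun p' => h (s', p')) p := fun s' =>
    (hh.comp (contMDiff_const.prodMk contMDiff_id)).mdifferentiableAt (by simp)
  have hsec' : ∀ p', MDifferentiableAt 𝓘(ℝ, ES) 𝓘(ℝ, F) (fun s' => h (s', p')) s := fun p' =>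
    (hh.comp (contMDiff_id.prodMk contMDiff_const)).mdifferentiableAt (by simp)
  have e1 : ∀ a ∈ χ.target, modelDeriv (E := E) (fun p' => h (χ.symm a, p')) p =
      (fderiv ℝ H (a, ψ p)).comp (ContinuousLinearMap.inr ℝ ES E) := by
    intro a ha
    rw [modelDeriv_eq (hsec _)]
    have h1 := ((hH a ha _ hc0).differentiableAt (by simp)).hasFDerivAt
    exact (h1.comp (ψ p) (hasFDerivAt_prodMk_right a (ψ p))).fderiv
  have e2 : ∀ c ∈ ψ.target, ∀ v : ES, modelDeriv (E := ES) (fun s' => h (s', ψ.symm c)) s v =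
      fderiv ℝ H (χ s, c) (v, 0) := by
    intro c hc v
    rw [modelDeriv_eq (hsec' _)]
    have h1 := ((hH _ ha0 c hc).differentiableAt (by simp)).hasFDerivAt
    exact congrArg (fun T : ES →L[ℝ] F => T v)
      (h1.comp (χ s) (hasFDerivAt_prodMk_left (χ s) c)).fderiv
  have d2 : DifferentiableAt ℝ (fderiv ℝ H) (χ s, ψ p) :=
    ((hH _ ha0 _ hc0).fderiv_right (m := 1) (by norm_cast)).differentiableAt (by simp)
  have dT : HasFDerivAt (fun a => (fderiv ℝ H (a, ψ p)).comp (ContinuousLinearMap.inr ℝ ES E))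
      (((ContinuousLinearMap.compL ℝ E (ES × E) F).flip (ContinuousLinearMap.inr ℝ ES E)).comp
        ((fderiv ℝ (fderiv ℝ H) (χ s, ψ p)).comp (ContinuousLinearMap.inl ℝ ES E))) (χ s) :=
    ((ContinuousLinearMap.compL ℝ E (ES × E) F).flip
      (ContinuousLinearMap.inr ℝ ES E)).hasFDerivAt.comp (χ s)
        (d2.hasFDerivAt.comp (χ s) (hasFDerivAt_prodMk_left (χ s) (ψ p)))
  have hχd : MDifferentiableAt 𝓘(ℝ, ES) 𝓘(ℝ, ES) χ s :=
    mdifferentiableAt_extChartAt (mem_chart_source ES s)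
  have eT : (fun s' => modelDeriv (E := E) (fun p' => h (s', p')) p) =ᶠ[𝓝 s]
      (fun a => (fderiv ℝ H (a, ψ p)).comp (ContinuousLinearMap.inr ℝ ES E)) ∘ χ := by
    filter_upwards [extChartAt_source_mem_nhds (I := 𝓘(ℝ, ES)) s] with s' hs'
    have := e1 (χ s') (χ.map_source hs')
    rw [χ.left_inv hs'] at this
    exact this
  have mT : MDifferentiableAt 𝓘(ℝ, ES) 𝓘(ℝ, E →L[ℝ] F)
      (fun s' => modelDeriv (E := E) (fun p' => h (s', p')) p) s :=
    (dT.differentiableAt.mdifferentiableAt.comp s hχd).congr_of_eventuallyEq eT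
  refine ⟨mT, fun v y => ?_⟩
  have e3 : modelDeriv (E := ES) (fun s' => modelDeriv (E := E) (fun p' => h (s', p')) p) s v y = fderiv ℝ (fderiv ℝ H) (χ s, ψ p) (v, 0) (0, y) := by
    rw [modelDeriv_eq mT]
    have : (fun s' => modelDeriv (E := E) (fun p' => h (s', p')) p) ∘ χ.symm
        =ᶠ[𝓝 (χ s)] fun a => (fderiv ℝ H (a, ψ p)).comp (ContinuousLinearMap.inr ℝ ES E) := by
      filter_upwards [extChartAt_target_mem_nhds (I := 𝓘(ℝ, ES)) s] with a ha
      exact e1 a ha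
    rw [this.fderiv_eq, dT.fderiv]
    rfl
  have e4 : modelDeriv (E := E) (fun p' => modelDeriv (E := ES) (fun s' => h (s', p')) s v) p y =
      fderiv ℝ (fderiv ℝ H) (χ s, ψ p) (0, y) (v, 0) := by
    have dU : HasFDerivAt (fun c => fderiv ℝ H (χ s, c) (v, 0))
        ((ContinuousLinearMap.apply ℝ F (v, (0 : E))).comp
          ((fderiv ℝ (fderiv ℝ H) (χ s, ψ p)).comp (ContinuousLinearMap.inr ℝ ES E))) (ψ p) :=
      (ContinuousLinearMap.apply ℝ F (v, (0 : E))).hasFDerivAt.comp (ψ p)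
        (d2.hasFDerivAt.comp (ψ p) (hasFDerivAt_prodMk_right (χ s) (ψ p)))
    have hψd : MDifferentiableAt 𝓘(ℝ, E) 𝓘(ℝ, E) ψ p :=
      mdifferentiableAt_extChartAt (mem_chart_source E p)
    have eU : (fun p' => modelDeriv (E := ES) (fun s' => h (s', p')) s v) =ᶠ[𝓝 p]
        (fun c => fderiv ℝ H (χ s, c) (v, 0)) ∘ ψ := by
      filter_upwards [extChartAt_source_mem_nhds (I := 𝓘(ℝ, E)) p] with p' hp'
      have := e2 (ψ p') (ψ.map_source hp') v
      rw [ψ.left_inv hp'] at this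
      exact this
    have mU : MDifferentiableAt 𝓘(ℝ, E) 𝓘(ℝ, F)
        (fun p' => modelDeriv (E := ES) (fun s' => h (s', p')) s v) p :=
      (dU.differentiableAt.mdifferentiableAt.comp p hψd).congr_of_eventuallyEq eU
    rw [modelDeriv_eq mU]
    have : (fun p' => modelDeriv (E := ES) (fun s' => h (s', p')) s v) ∘ ψ.symm
        =ᶠ[𝓝 (ψ p)] fun c => fderiv ℝ H (χ s, c) (v, 0) := by
      filter_upwards [extChartAt_target_mem_nhds (I := 𝓘(ℝ, E)) p] with c hc
      exact e2 c hc v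
    rw [this.fderiv_eq, dU.fderiv]
    rfl
  rw [e3, e4]
  exact (((hH _ ha0 _ hc0).of_le (by norm_cast : (2 : ℕ∞ω) ≤ ∞)).isSymmSndFDerivAt
    (by simp)) (v, 0) (0, y)

end MixedPartials

/-! ### Derivatives of families of maps and Lie brackets -/

section Flows

variable {E : Type*} [NormedAddCommGroup E] [NormedSpace ℝ E]
  {N : Type*} [TopologicalSpace N] [ChartedSpace E N] [IsManifold 𝓘(ℝ, E) ∞ N]
  {E' : Type*} [NormedAddCommGroup E'] [NormedSpace ℝ E']
  {N' : Type*} [TopologicalSpace N'] [ChartedSpace E' N'] [IsManifold 𝓘(ℝ, E') ∞ N']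
  {ES : Type*} [NormedAddCommGroup ES] [NormedSpace ℝ ES]
  {S : Type*} [TopologicalSpace S] [ChartedSpace ES S] [IsManifold 𝓘(ℝ, ES) ∞ S]
  {F : Type*} [NormedAddCommGroup F] [NormedSpace ℝ F]

theorem modelDeriv_clm_apply {T : S → E →L[ℝ] F} {c : S → E} {s : S}
    (hT : MDifferentiableAt 𝓘(ℝ, ES) 𝓘(ℝ, E →L[ℝ] F) T s)
    (hc : MDifferentiableAt 𝓘(ℝ, ES) 𝓘(ℝ, E) c s) (v : ES) :
    MDifferentiableAt 𝓘(ℝ, ES) 𝓘(ℝ, F) (fun s => T s (c s)) s ∧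
    modelDeriv (E := ES) (fun s => T s (c s)) s v =
      modelDeriv (E := ES) T s v (c s) + T s (modelDeriv (E := ES) c s v) := by
  have h1 : DifferentiableAt ℝ (T ∘ (extChartAt 𝓘(ℝ, ES) s).symm) (extChartAt 𝓘(ℝ, ES) s s) := by
    have := ((mdifferentiableAt_iff _ _).1 hT).2
    rwa [ModelWithCorners.range_eq_univ, differentiableWithinAt_univ] at this
  have h2 : DifferentiableAt ℝ (c ∘ (extChartAt 𝓘(ℝ, ES) s).symm) (extChartAt 𝓘(ℝ, ES) s s) := by
    have := ((mdifferentiableAt_iff _ _).1 hc).2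
    rwa [ModelWithCorners.range_eq_univ, differentiableWithinAt_univ] at this
  have h3 : MDifferentiableAt 𝓘(ℝ, ES) 𝓘(ℝ, F) (fun s => T s (c s)) s := hT.clm_apply hc
  refine ⟨h3, ?_⟩
  rw [modelDeriv_eq h3, modelDeriv_eq hT, modelDeriv_eq hc]
  have := fderiv_clm_apply h1 h2
  have e : (fun s => T s (c s)) ∘ (extChartAt 𝓘(ℝ, ES) s).symm = fun y =>
    (T ∘ (extChartAt 𝓘(ℝ, ES) s).symm) y ((c ∘ (extChartAt 𝓘(ℝ, ES) s).symm) y) := rfl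
  rw [e, this]
  simp
  abel

/-- The partial derivative of a smooth map in two variables, applied to a smooth curve of tangent
vectors, is smooth. -/
theorem contMDiff_partial {Θ : S × N → N'}
    (hΘ : ContMDiff (𝓘(ℝ, ES).prod 𝓘(ℝ, E)) 𝓘(ℝ, E') ∞ Θ) (x : S → N)
    (y : ∀ s, TangentSpace 𝓘(ℝ, E) (x s))
    (hy : ContMDiff 𝓘(ℝ, ES) 𝓘(ℝ, E).tangent ∞ fun s => (⟨x s, y s⟩ : TangentBundle 𝓘(ℝ, E) N)) :
    ContMDiff 𝓘(ℝ, ES) 𝓘(ℝ, E').tangent ∞ fun s => (⟨Θ (s, x s),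
      mfderiv 𝓘(ℝ, E) 𝓘(ℝ, E') (fun p => Θ (s, p)) (x s) (y s)⟩ : TangentBundle 𝓘(ℝ, E') N') := by
  have : IsManifold 𝓘(ℝ, ES) (∞ + 1) S := by simpa
  have : IsManifold 𝓘(ℝ, E) (∞ + 1) N := by simpa
  let fg : S → TangentBundle 𝓘(ℝ, ES) S := fun g => TotalSpace.mk' ES g 0
  have sfg : ContMDiff 𝓘(ℝ, ES) 𝓘(ℝ, ES).tangent ∞ fg := contMDiff_zeroSection _ _
  let F₂ : (TangentBundle 𝓘(ℝ, ES) S × TangentBundle 𝓘(ℝ, E) N) →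
      TangentBundle (𝓘(ℝ, ES).prod 𝓘(ℝ, E)) (S × N) :=
    (equivTangentBundleProd 𝓘(ℝ, ES) S 𝓘(ℝ, E) N).symm
  have S₂ : ContMDiff (𝓘(ℝ, ES).tangent.prod 𝓘(ℝ, E).tangent) (𝓘(ℝ, ES).prod 𝓘(ℝ, E)).tangent ∞ F₂ :=
    contMDiff_equivTangentBundleProd_symm
  have S₃ : ContMDiff (𝓘(ℝ, ES).prod 𝓘(ℝ, E)).tangent 𝓘(ℝ, E').tangent ∞
      (tangentMap (𝓘(ℝ, ES).prod 𝓘(ℝ, E)) 𝓘(ℝ, E') Θ) :=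
    ContMDiff.contMDiff_tangentMap hΘ (m := ∞) (by simp)
  have := (S₃.comp S₂).comp (sfg.prodMk hy)
  convert this using 1
  funext s
  refine Bundle.TotalSpace.ext rfl (heq_of_eq ?_)
  change _ = mfderiv (𝓘(ℝ, ES).prod 𝓘(ℝ, E)) 𝓘(ℝ, E') Θ (s, x s) (0, y s)
  have h := mfderiv_comp (x s) (I' := 𝓘(ℝ, ES).prod 𝓘(ℝ, E)) (f := fun p => (s, p)) (g := Θ)
    (hΘ.mdifferentiableAt (by simp)) (mdifferentiableAt_const.prodMk mdifferentiableAt_id)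
  rw [mfderiv_prod_right] at h
  exact congrArg (fun T => T (y s)) h

/-- Over a fixed base point the trivialisation centred there is the identity on the fibre, so
smoothness in the tangent bundle is smoothness in the model space. -/
theorem contMDiff_of_totalSpace_const (p : N) (c : S → E)
    (hc : ContMDiff 𝓘(ℝ, ES) 𝓘(ℝ, E).tangent ∞ fun s => (⟨p, c s⟩ : TangentBundle 𝓘(ℝ, E) N)) :
    ContMDiff 𝓘(ℝ, ES) 𝓘(ℝ, E) ∞ c := by
  intro s
  have := (contMDiffAt_totalSpace.1 (hc s)).2
  refine this.congr_of_eventuallyEq (.of_forall fun s' => ?_)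
  simp only [TangentBundle.trivializationAt_apply]
  exact (tangentCoordChange_self (I := 𝓘(ℝ, E)) (mem_extChartAt_source p)).symm

variable [FiniteDimensional ℝ E] [T2Space N]

/-- The derivative of the pullback of a vector field `Y` along a family of maps is the bracket of
the velocity field `V` of the family with `Y`. -/
theorem modelDeriv_eq_bracket {φ : S × N → N}
    (hφ : ContMDiff (𝓘(ℝ, ES).prod 𝓘(ℝ, E)) 𝓘(ℝ, E) ∞ φ) {s : S} (h0 : ∀ p, φ (s, p) = p)
    {V Y : VField E N} {p : N} {c : S → E} (hc : MDifferentiableAt 𝓘(ℝ, ES) 𝓘(ℝ, E) c s) {v : ES}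
    (hV : ∀ (f : SmoothFun E N ℝ) (p : N),
      V.deriv f p = modelDeriv (E := ES) (fun s => f (φ (s, p))) s v)
    (hY : ∀ (f : SmoothFun E N ℝ) (s : S),
      modelDeriv (E := E) (fun p => f (φ (s, p))) p (c s) = Y.deriv f (φ (s, p))) :
    modelDeriv (E := ES) c s v = (⁅V, Y⁆ p : E) := by
  have hc0 : ∀ f : SmoothFun E N ℝ, modelDeriv (E := E) f p (c s) = Y.deriv f p := fun f => by
    have := hY f s
    simp only [h0] at this
    exact this
  let w : E := ⁅V, Y⁆ p
  suffices h : modelDeriv (E := ES) c s v - w = 0 from sub_eq_zero.1 h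
  -- Test on functions `f` and differentiate `hY` in `s`. The product rule gives the derivative of
  -- `c` plus a mixed partial, which is `Y (V f)` after the exchange; the right side gives `V (Y
  -- f)`.
  refine tangent_eq_zero (p := p) (v := modelDeriv (E := ES) c s v - w) fun f => ?_
  have hf : ContMDiff (𝓘(ℝ, ES).prod 𝓘(ℝ, E)) 𝓘(ℝ, ℝ) ∞ fun x : S × N => f (φ x) :=
    f.contMDiff.comp hφ
  obtain ⟨h1, h2⟩ := mixed_partials hf s p
  have h3 := (modelDeriv_clm_apply h1 hc v).2
  rw [h2] at h3
  simp only [hY, h0, ← hV] at h3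
  rw [hc0 (V.deriv f)] at h3
  have h4 := congrArg (fun g : SmoothFun E N ℝ => g p) (VField.bracket_deriv V Y f)
  change modelDeriv (E := E) f p (modelDeriv (E := ES) c s v - w) = 0
  rw [map_sub, sub_eq_zero]
  have h5 : modelDeriv (E := E) f p w = ⁅V, Y⁆.deriv f p := rfl
  rw [h5, h4]
  change _ = V.deriv (Y.deriv f) p - Y.deriv (V.deriv f) p
  rw [h3]
  abel

end Flows

end

end BRS

namespace BRS

noncomputable section

section Derivatives

variable {E : Type*} [NormedAddCommGroup E] [NormedSpace ℝ E]
  {N : Type*} [TopologicalSpace N] [ChartedSpace E N]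
  {E' : Type*} [NormedAddCommGroup E'] [NormedSpace ℝ E']
  {N' : Type*} [TopologicalSpace N'] [ChartedSpace E' N']
  {F : Type*} [NormedAddCommGroup F] [NormedSpace ℝ F]

theorem modelDeriv_comp {g : N' → F} {h : N → N'} {x : N} {y : N'}
    (hg : MDifferentiableAt 𝓘(ℝ, E') 𝓘(ℝ, F) g y) (hh : MDifferentiableAt 𝓘(ℝ, E) 𝓘(ℝ, E') h x)
    (hy : h x = y) (v : E) : modelDeriv (E := E) (fun z => g (h z)) x v =
      modelDeriv (E := E') g y (mfderiv 𝓘(ℝ, E) 𝓘(ℝ, E') h x v : E') := by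
  subst hy
  exact congrArg (fun T : E →L[ℝ] F => T v) (mfderiv_comp (I' := 𝓘(ℝ, E')) x hg hh)

end Derivatives

/-! ### The adjoint action and its derivative -/

section LieGroups

variable {EG : Type*} [NormedAddCommGroup EG] [NormedSpace ℝ EG] [FiniteDimensional ℝ EG]
    {G : Type*} [TopologicalSpace G] [T2Space G]
    [ChartedSpace EG G] [Group G] [LieGroup 𝓘(ℝ, EG) ∞ G]

/-- Left-invariant vector fields are smooth. -/
def leftField (v : GroupLieAlgebra 𝓘(ℝ, EG) G) : VField EG G :=
  ⟨mulInvariantVectorField v, by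
    have := contMDiff_partial (contMDiff_mul 𝓘(ℝ, EG) ∞ : ContMDiff _ _ ∞ fun x : G × G => x.1 * x.2)
      (fun _ => 1) (fun _ => v) contMDiff_const
    convert this using 1
    funext g
    exact Bundle.TotalSpace.ext (mul_one g).symm (heq_of_eq rfl)⟩

open PrincipalBundle

theorem contMDiff_conj : ContMDiff (𝓘(ℝ, EG).prod 𝓘(ℝ, EG)) 𝓘(ℝ, EG) ∞
    fun x : G × G => x.1 * x.2 * x.1⁻¹ :=
  (contMDiff_fst.mul contMDiff_snd).mul contMDiff_fst.inv

variable (EG) in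
/-- The adjoint action as a continuous linear map. -/
def AdL (g : G) : EG →L[ℝ] EG := mfderiv 𝓘(ℝ, EG) 𝓘(ℝ, EG) (fun h => g * h * g⁻¹) 1

variable (G) in
/-- The Lie bracket of the Lie algebra, on the model space. -/
def lieBr (v w : GroupLieAlgebra 𝓘(ℝ, EG) G) : EG :=
  (⁅v, w⁆ : GroupLieAlgebra 𝓘(ℝ, EG) G)

theorem contMDiff_Ad (w : EG) :
    ContMDiff 𝓘(ℝ, EG) 𝓘(ℝ, EG) ∞ fun g : G => AdL EG g w := by
  refine contMDiff_of_totalSpace_const (1 : G) _ ?_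
  have := contMDiff_partial (contMDiff_conj (EG := EG) (G := G)) (fun _ => 1) (fun _ => w)
    contMDiff_const
  convert this using 1
  funext g
  exact Bundle.TotalSpace.ext (by simp) (heq_of_eq rfl)

/-- The derivative of the adjoint action is the Lie bracket. -/
theorem modelDeriv_Ad (v w : EG) :
    modelDeriv (E := EG) (fun g : G => AdL EG g w) 1 v = lieBr G v w := by
  change _ = (⁅leftField (G := G) v, leftField w⁆ : VField EG G) 1
  -- The family of right translations `p ↦ p s` has as velocity at `s = 1` the left-invariant field
  -- of `v`, and pulls the left-invariant field of `w` back to `Ad(s) w` at the identity.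
  have hmul : ContMDiff (𝓘(ℝ, EG).prod 𝓘(ℝ, EG)) 𝓘(ℝ, EG) ∞ fun x : G × G => x.2 * x.1 :=
    contMDiff_snd.mul contMDiff_fst
  refine modelDeriv_eq_bracket hmul (s := 1) (p := 1) (v := v) (fun p => mul_one p) (V := leftField v)
    (Y := leftField w) ((contMDiff_Ad w).mdifferentiableAt (by simp)) (fun f p => ?_) fun f s => ?_
  · have hp : ContMDiff 𝓘(ℝ, EG) 𝓘(ℝ, EG) ∞ (fun g : G => p * g) := contMDiff_mul_left
    exact (modelDeriv_comp (f.contMDiff.mdifferentiableAt (by simp))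
      (hp.mdifferentiableAt (by simp)) (mul_one p) v).symm
  · have h1 : ContMDiff 𝓘(ℝ, EG) 𝓘(ℝ, EG) ∞ (fun g : G => g * s) := contMDiff_mul_right
    have h2 : ContMDiff 𝓘(ℝ, EG) 𝓘(ℝ, EG) ∞ (fun g : G => s * g * s⁻¹) :=
      (contMDiff_const.mul contMDiff_id).mul contMDiff_const
    have h3 : ContMDiff 𝓘(ℝ, EG) 𝓘(ℝ, EG) ∞ (fun g : G => 1 * s * g) := contMDiff_mul_left
    have e1 := modelDeriv_comp (g := fun g => f (g * s)) (h := fun g : G => s * g * s⁻¹) (x := 1)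
      (y := 1) ((f.contMDiff.comp h1).mdifferentiableAt (by simp)) (h2.mdifferentiableAt (by simp))
      (by simp) w
    have e2 := modelDeriv_comp (g := f) (h := fun g : G => 1 * s * g) (x := 1) (y := 1 * s)
      (f.contMDiff.mdifferentiableAt (by simp)) (h3.mdifferentiableAt (by simp))
      (by simp) w
    refine Eq.trans e1.symm (Eq.trans ?_ e2)
    simp

/-- In finite dimensions an operator is a finite combination of its values on a basis, so the
pointwise smoothness from `contMDiff_Ad` suffices. -/
theorem mdifferentiableAt_AdL (g : G) :
    MDifferentiableAt 𝓘(ℝ, EG) 𝓘(ℝ, EG →L[ℝ] EG) (fun g : G => AdL EG g) g := by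
  let b := Module.finBasis ℝ EG
  let T : Fin (Module.finrank ℝ EG) → EG →L[ℝ] (EG →L[ℝ] EG) := fun i =>
    ContinuousLinearMap.smulRightL ℝ EG EG (LinearMap.toContinuousLinearMap (b.coord i))
  have h : (fun g : G => AdL EG g) = fun g : G => ∑ i, T i (AdL EG g (b i)) := by
    funext g
    ext w
    have : ∑ i, b.repr w i • b i = w := b.sum_repr w
    conv_lhs => rw [← this, map_sum]
    rw [sum_apply]
    refine Finset.sum_congr rfl fun i _ => ?_
    rw [map_smul]
    rfl
  rw [h]
  have : ContMDiff 𝓘(ℝ, EG) 𝓘(ℝ, EG →L[ℝ] EG) ∞ (fun g : G => ∑ i, T i (AdL EG g (b i))) :=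
    contMDiff_finsetSum fun i _ => (T i).contMDiff.comp (contMDiff_Ad _)
  exact this.mdifferentiableAt (by simp)

theorem mdifferentiableAt_AdL_inv (g : G) :
    MDifferentiableAt 𝓘(ℝ, EG) 𝓘(ℝ, EG →L[ℝ] EG) (fun g : G => AdL EG g⁻¹) g :=
  (mdifferentiableAt_AdL g⁻¹).comp g ((contMDiff_inv 𝓘(ℝ, EG) ∞).mdifferentiableAt (by simp))

theorem AdL_mul (g h : G) (w : EG) : AdL EG g (AdL EG h w) = AdL EG (g * h) w := by
  have hc : ∀ g : G, ContMDiff 𝓘(ℝ, EG) 𝓘(ℝ, EG) ∞ (fun x : G => g * x * g⁻¹) := fun g =>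
    (contMDiff_const.mul contMDiff_id).mul contMDiff_const
  have h1 := mfderiv_comp_of_eq (I' := 𝓘(ℝ, EG)) (f := fun x : G => h * x * h⁻¹)
    (g := fun x : G => g * x * g⁻¹) (x := 1) (y := 1) ((hc g).mdifferentiableAt (by simp))
    ((hc h).mdifferentiableAt (by simp)) (by simp)
  have h2 : (fun x : G => g * x * g⁻¹) ∘ (fun x : G => h * x * h⁻¹) =
      fun x => g * h * x * (g * h)⁻¹ := by
    funext x
    simp [mul_assoc]
  rw [h2] at h1
  have h3 : h * 1 * h⁻¹ = 1 := by simp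
  rw [h3] at h1
  exact (congrArg (fun T : EG →L[ℝ] EG => T w) h1).symm

theorem AdL_one (w : EG) : AdL EG (1 : G) w = w := by
  have h1 : (fun x : G => 1 * x * 1⁻¹) = id := by
    funext x
    simp
  have : AdL EG (1 : G) = ContinuousLinearMap.id ℝ _ := by
    rw [AdL, h1]; exact mfderiv_id
  rw [this]
  rfl

/-- Differentiate `Ad(g⁻¹) (Ad(g) w) = w` at the identity. -/
theorem modelDeriv_AdL_inv (v w : EG) :
    modelDeriv (E := EG) (fun g : G => AdL EG g⁻¹) 1 v w = -lieBr G v w := by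
  have h1 := (modelDeriv_clm_apply (mdifferentiableAt_AdL_inv (EG := EG) (1 : G))
    ((contMDiff_Ad w).mdifferentiableAt (by simp)) v).2
  have h2 : (fun g : G => AdL EG g⁻¹ (AdL EG g w)) = fun _ => w := by
    funext g
    rw [AdL_mul, inv_mul_cancel, AdL_one]
  have h3 : modelDeriv (E := EG) (fun _ : G => w) 1 = 0 := mfderiv_const
  rw [h2, h3, modelDeriv_Ad, inv_one, AdL_one, AdL_one] at h1
  exact eq_neg_of_add_eq_zero_left h1.symm

end LieGroups

end

end BRS

namespace BRS

noncomputable section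

/-! ### Fundamental fields, connections and the ghost -/

namespace PrincipalBundle

variable
    {EM : Type*} [NormedAddCommGroup EM] [NormedSpace ℝ EM] [FiniteDimensional ℝ EM]
    {M : Type*} [TopologicalSpace M] [ChartedSpace EM M] [IsManifold 𝓘(ℝ, EM) ∞ M]
    {EG : Type*} [NormedAddCommGroup EG] [NormedSpace ℝ EG] [FiniteDimensional ℝ EG]
    {G : Type*} [TopologicalSpace G] [T2Space G]
    [ChartedSpace EG G] [Group G] [LieGroup 𝓘(ℝ, EG) ∞ G]
    {EP : Type*} [NormedAddCommGroup EP] [NormedSpace ℝ EP] [FiniteDimensional ℝ EP]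
    {P : Type*} [TopologicalSpace P] [ChartedSpace EP P] [IsManifold 𝓘(ℝ, EP) ∞ P] [T2Space P]
    (B : PrincipalBundle EM M EG G EP P)

theorem contMDiff_act_swap : ContMDiff (𝓘(ℝ, EG).prod 𝓘(ℝ, EP)) 𝓘(ℝ, EP) ∞
    fun x : G × P => B.act x.2 x.1 :=
  B.contMDiff_act.comp (contMDiff_snd.prodMk contMDiff_fst)

theorem contMDiff_act_left (p : P) : ContMDiff 𝓘(ℝ, EG) 𝓘(ℝ, EP) ∞ fun g : G => B.act p g :=
  B.contMDiff_act.comp (contMDiff_const.prodMk contMDiff_id)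

/-- The fundamental vector fields. -/
def fundField (v : GroupLieAlgebra 𝓘(ℝ, EG) G) : VField EP P :=
  ⟨fun p => B.fundamental p v, by
    have := contMDiff_partial B.contMDiff_act (fun _ => 1) (fun _ => v) contMDiff_const
    convert this using 1
    funext p
    exact Bundle.TotalSpace.ext (B.act_one p).symm (heq_of_eq rfl)⟩

theorem modelDeriv_fundamental {F : Type*} [NormedAddCommGroup F] [NormedSpace ℝ F] {f : P → F}
    (hf : ContMDiff 𝓘(ℝ, EP) 𝓘(ℝ, F) ∞ f) (p : P) (v : GroupLieAlgebra 𝓘(ℝ, EG) G) :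
    modelDeriv (E := EP) f p (B.fundamental p v) =
      modelDeriv (E := EG) (fun g => f (B.act p g)) 1 v :=
  (modelDeriv_comp (hf.mdifferentiableAt (by simp))
    ((B.contMDiff_act_left p).mdifferentiableAt (by simp)) (B.act_one p) v).symm

/-- The pullback of a vector field along the action of `g`, as an element of the model space. -/
def pullAct (Y : VField EP P) (p : P) (g : G) : EP :=
  mfderiv 𝓘(ℝ, EP) 𝓘(ℝ, EP) (fun p' => B.act p' g⁻¹) (B.act p g) (Y (B.act p g))

theorem contMDiff_pullAct (Y : VField EP P) (p : P) :
    ContMDiff 𝓘(ℝ, EG) 𝓘(ℝ, EP) ∞ fun g : G => B.pullAct Y p g := by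
  refine contMDiff_of_totalSpace_const p _ ?_
  have h : ContMDiff (𝓘(ℝ, EG).prod 𝓘(ℝ, EP)) 𝓘(ℝ, EP) ∞ fun x : G × P => B.act x.2 x.1⁻¹ :=
    B.contMDiff_act.comp (contMDiff_snd.prodMk contMDiff_fst.inv)
  have := contMDiff_partial h (fun g => B.act p g) (fun g => Y (B.act p g))
    (Y.contMDiff.comp (B.contMDiff_act_left p))
  convert this using 1
  funext g
  exact Bundle.TotalSpace.ext (by simp [← B.act_mul, B.act_one]) (heq_of_eq rfl)

theorem dAct_pullAct (Y : VField EP P) (p : P) (g : G) :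
    B.dAct p g (B.pullAct Y p g) = Y (B.act p g) := by
  have h := mfderiv_comp_of_eq (I' := 𝓘(ℝ, EP)) (f := fun p' => B.act p' g⁻¹)
    (g := fun p' => B.act p' g) (x := B.act p g) (y := p)
    ((B.contMDiff_act_right g).mdifferentiableAt (by simp))
    ((B.contMDiff_act_right g⁻¹).mdifferentiableAt (by simp)) (by simp [← B.act_mul, B.act_one])
  have h2 : (fun p' => B.act p' g) ∘ (fun p' => B.act p' g⁻¹) = id := by
    funext p'
    simp [← B.act_mul, B.act_one]
  have h3 : B.act (B.act p g) g⁻¹ = p := by simp [← B.act_mul, B.act_one]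
  rw [h2, mfderiv_id, h3] at h
  exact (congrArg (fun T : EP →L[ℝ] EP => T (Y (B.act p g))) h).symm

/-- The right translations of `P` form a family whose velocity at the identity is the fundamental
field, and `c g` is the pullback of `Y` at `p`. -/
theorem modelDeriv_of_dAct {Y : VField EP P} {p : P} {c : G → EP}
    (hc : MDifferentiableAt 𝓘(ℝ, EG) 𝓘(ℝ, EP) c 1) (hY : ∀ g, B.dAct p g (c g) = Y (B.act p g))
    (v : GroupLieAlgebra 𝓘(ℝ, EG) G) :
    modelDeriv (E := EG) c 1 v = (⁅B.fundField v, Y⁆ : VField EP P) p := by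
  refine modelDeriv_eq_bracket B.contMDiff_act_swap (s := 1) B.act_one (V := B.fundField v)
    (Y := Y) hc (fun f p => B.modelDeriv_fundamental f.contMDiff p v) fun f s => ?_
  refine (modelDeriv_comp (g := f) (f.contMDiff.mdifferentiableAt (by simp))
    ((B.contMDiff_act_right s).mdifferentiableAt (by simp)) rfl (c s)).trans ?_
  exact congrArg (modelDeriv (E := EP) f (B.act p s)) (hY s)

/-- For an invariant field the pulled back vector at `p` does not depend on `g`, so its derivative,
the bracket, vanishes. -/
theorem bracket_fundField_of_invariant {X : VField EP P}
    (hX : ∀ p g, B.dAct p g (X p) = X (B.act p g)) (v : GroupLieAlgebra 𝓘(ℝ, EG) G) :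
    ⁅B.fundField v, X⁆ = 0 := by
  ext p
  have h := B.modelDeriv_of_dAct (c := fun _ => X p) mdifferentiableAt_const (hX p) v
  let x : EP := X p
  have h3 : modelDeriv (E := EG) (fun _ : G => x) 1 = 0 := mfderiv_const
  change modelDeriv (E := EG) (fun _ : G => x) 1 v = _ at h
  rw [h3] at h
  exact h.symm

/-- Infinitesimal equivariance `L_v A = -ad_v A`: write `A(Y)` at `p g` as `Ad(g⁻¹)` applied to `A`
of the pulled back field at `p`, and differentiate the product at `g = 1`. -/
theorem Connection.deriv_eval {B : PrincipalBundle EM M EG G EP P} (A : B.Connection)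
    (Y : VField EP P) (v : GroupLieAlgebra 𝓘(ℝ, EG) G) (p : P) :
    modelDeriv (E := EP) (A.eval Y) p (B.fundamental p v) =
      A.eval ⁅B.fundField v, Y⁆ p - lieBr G v (A.eval Y p) := by
  rw [B.modelDeriv_fundamental (A.eval Y).contMDiff]
  let T : EP →L[ℝ] EG := LinearMap.toContinuousLinearMap (E := EP) (F' := EG) (A.form p)
  have h1 : (fun g : G => A.eval Y (B.act p g)) = fun g => AdL EG g⁻¹ (T (B.pullAct Y p g)) := by
    funext g
    have := A.equivariant p g (B.pullAct Y p g)
    rw [B.dAct_pullAct] at this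
    exact this
  have hc := (B.contMDiff_pullAct Y p).mdifferentiableAt (x := 1) (by simp)
  have hT : MDifferentiableAt 𝓘(ℝ, EG) 𝓘(ℝ, EG) (fun g => T (B.pullAct Y p g)) 1 :=
    (T.contMDiff.comp (B.contMDiff_pullAct Y p)).mdifferentiableAt (x := 1) (by simp)
  have h2 := (modelDeriv_clm_apply (mdifferentiableAt_AdL_inv (EG := EG) (1 : G)) hT v).2
  have h3 : B.pullAct Y p 1 = Y p := by
    have := B.dAct_pullAct Y p 1
    have h4 : (fun p' => B.act p' 1) = id := funext B.act_one
    have h5 : B.dAct p 1 = ContinuousLinearMap.id ℝ EP := by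
      have : mfderiv 𝓘(ℝ, EP) 𝓘(ℝ, EP) (fun p' => B.act p' 1) p = ContinuousLinearMap.id ℝ _ := by
        rw [h4]; exact mfderiv_id
      exact this
    rw [h5, B.act_one] at this
    exact this
  have h6 := modelDeriv_comp (E := EG) (g := T) (h := fun g : G => B.pullAct Y p g) (x := 1)
    (y := Y p) T.mdifferentiableAt hc h3 v
  have h7 : modelDeriv (E := EP) T (Y p) = T := T.mfderiv_eq
  have h8 := B.modelDeriv_of_dAct hc (fun g => B.dAct_pullAct Y p g) v
  rw [h7] at h6
  have h9 : ∀ w : EG, AdL EG (1 : G)⁻¹ w = w := fun w => by rw [inv_one, AdL_one]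
  rw [h1]
  have h10 : modelDeriv (E := EG) (fun g : G => AdL EG g⁻¹) 1 v (T (B.pullAct Y p 1)) =
      -lieBr G v (A.eval Y p) := by
    rw [h3]
    exact modelDeriv_AdL_inv (EG := EG) (G := G) v _
  exact h2.trans ((congrArg₂ (fun x y : EG => x + y) h10
    ((h9 _).trans (h6.trans (congrArg T h8)))).trans (neg_add_eq_sub _ _))

theorem proj_fundamental (p : P) (v : GroupLieAlgebra 𝓘(ℝ, EG) G) :
    mfderiv 𝓘(ℝ, EP) 𝓘(ℝ, EM) B.proj p (B.fundamental p v) = 0 := by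
  have h := mfderiv_comp_of_eq (I' := 𝓘(ℝ, EP)) (f := fun g : G => B.act p g)
    (g := B.proj) (x := 1) (y := p) (B.contMDiff_proj.mdifferentiableAt (by simp))
    ((B.contMDiff_act_left p).mdifferentiableAt (by simp)) (B.act_one p)
  have h2 : B.proj ∘ (fun g : G => B.act p g) = fun _ => B.proj p := funext (B.proj_act p)
  rw [h2, mfderiv_const, B.act_one] at h
  exact (congrArg (fun T : EG →L[ℝ] EM => T v) h).symm

/-- In a local trivialisation a vertical vector moves only the group coordinate. The element `v` is
the derivative of this coordinate, translated back to the identity. -/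
theorem exists_fundamental_eq {p : P} {x : TangentSpace 𝓘(ℝ, EP) p}
    (hx : mfderiv 𝓘(ℝ, EP) 𝓘(ℝ, EM) B.proj p x = 0) :
    ∃ v : GroupLieAlgebra 𝓘(ℝ, EG) G, B.fundamental p v = x := by
  obtain ⟨U, e, hU, hm, hs, ht, he, hes, hp⟩ := B.locally_trivial (B.proj p)
  have hps : p ∈ e.source := by rw [hs]; exact hm
  have hpt : e p ∈ e.target := e.map_source hps
  have dproj : MDifferentiableAt 𝓘(ℝ, EP) 𝓘(ℝ, EM) B.proj p :=
    B.contMDiff_proj.mdifferentiableAt (by simp)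
  have de : MDifferentiableAt 𝓘(ℝ, EP) (𝓘(ℝ, EM).prod 𝓘(ℝ, EG)) e p :=
    (he.contMDiffAt (e.open_source.mem_nhds hps)).mdifferentiableAt (by simp)
  have des : MDifferentiableAt (𝓘(ℝ, EM).prod 𝓘(ℝ, EG)) 𝓘(ℝ, EP) e.symm (e p) :=
    (hes.contMDiffAt (e.open_target.mem_nhds hpt)).mdifferentiableAt (by simp)
  have dγ : MDifferentiableAt 𝓘(ℝ, EP) 𝓘(ℝ, EG) (fun q => (e q).2) p := de.snd
  have e1 : (e p).1 = B.proj p := (hp p hps).1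
  let v : EG := mfderiv 𝓘(ℝ, EP) 𝓘(ℝ, EG) (fun q => (e p).2⁻¹ * (e q).2) p x
  have dl : MDifferentiableAt 𝓘(ℝ, EP) 𝓘(ℝ, EG) (fun q => (e p).2⁻¹ * (e q).2) p :=
    (contMDiff_mul_left (I := 𝓘(ℝ, EG)) (n := ∞) (a := (e p).2⁻¹)).mdifferentiableAt
      (by simp) |>.comp p dγ
  refine ⟨v, ?_⟩
  -- both sides are derivatives of local expressions in the trivialisation
  have a1 : mfderiv 𝓘(ℝ, EP) 𝓘(ℝ, EP) (fun q => B.act p ((e p).2⁻¹ * (e q).2)) p =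
      (mfderiv 𝓘(ℝ, EG) 𝓘(ℝ, EP) (fun g => B.act p g) 1).comp
        (mfderiv 𝓘(ℝ, EP) 𝓘(ℝ, EG) (fun q => (e p).2⁻¹ * (e q).2) p) := by
    have := mfderiv_comp_of_eq (I' := 𝓘(ℝ, EG)) (g := fun g => B.act p g) (y := 1)
      ((B.contMDiff_act_left p).mdifferentiableAt (by simp)) dl (inv_mul_cancel _)
    rw [inv_mul_cancel] at this
    exact this
  have a2 : (fun q => B.act p ((e p).2⁻¹ * (e q).2)) = e.symm ∘ fun q => (B.proj p, (e q).2) := by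
    funext q
    have h : e (B.act p ((e p).2⁻¹ * (e q).2)) = (B.proj p, (e q).2) := by
      rw [(hp p hps).2, mul_inv_cancel_left]
    rw [Function.comp_apply, ← h, e.left_inv]
    rw [hs, Set.mem_preimage, B.proj_act]
    exact hm
  have dc : MDifferentiableAt 𝓘(ℝ, EP) (𝓘(ℝ, EM).prod 𝓘(ℝ, EG)) (fun q => (B.proj p, (e q).2)) p :=
    mdifferentiableAt_const.prodMk dγ
  have dc' : MDifferentiableAt 𝓘(ℝ, EP) (𝓘(ℝ, EM).prod 𝓘(ℝ, EG)) (fun q => (B.proj q, (e q).2)) p :=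
    dproj.prodMk dγ
  have a3 := mfderiv_comp_of_eq (I' := 𝓘(ℝ, EM).prod 𝓘(ℝ, EG)) (g := e.symm)
    (f := fun q => (B.proj p, (e q).2)) des dc (by rw [← e1])
  have a4 := mfderiv_comp_of_eq (I' := 𝓘(ℝ, EM).prod 𝓘(ℝ, EG)) (g := e.symm)
    (f := fun q => (B.proj q, (e q).2)) des dc' (by rw [← e1])
  have a5 : e.symm ∘ (fun q => (B.proj q, (e q).2)) =ᶠ[𝓝 p] id := by
    filter_upwards [e.open_source.mem_nhds hps] with q hq
    rw [Function.comp_apply, ← (hp q hq).1]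
    exact e.left_inv hq
  rw [a5.mfderiv_eq, mfderiv_id] at a4
  have a6 : mfderiv 𝓘(ℝ, EP) (𝓘(ℝ, EM).prod 𝓘(ℝ, EG)) (fun q => (B.proj p, (e q).2)) p x =
      mfderiv 𝓘(ℝ, EP) (𝓘(ℝ, EM).prod 𝓘(ℝ, EG)) (fun q => (B.proj q, (e q).2)) p x := by
    rw [mfderiv_prodMk mdifferentiableAt_const dγ, mfderiv_prodMk dproj dγ, mfderiv_const]
    exact Prod.ext hx.symm rfl
  have a7 := congrArg (fun T : EP →L[ℝ] EP => T x) a1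
  have a8 : (mfderiv 𝓘(ℝ, EP) 𝓘(ℝ, EP) (fun q => B.act p ((e p).2⁻¹ * (e q).2)) p : EP →L[ℝ] EP) x
      = x := by
    rw [a2, a3]
    have := congrArg (fun T : EP →L[ℝ] EP => T x) a4
    refine Eq.trans ?_ this.symm
    exact congrArg (mfderiv (𝓘(ℝ, EM).prod 𝓘(ℝ, EG)) 𝓘(ℝ, EP) e.symm (B.proj p, (e p).2)) a6
  exact a7.symm.trans a8

/-- A connection inverts the fundamental vectors, so `A(X)` is the required function and the only
one. In particular, in the presence of a connection the default value in `ghost` does not occur. -/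
theorem ghost_eq {B : PrincipalBundle EM M EG G EP P} (A : B.Connection) (X : B.gaugeAlg) :
    B.ghost X = A.eval X := by
  have h : ∃ ξ : C^∞⟮𝓘(ℝ, EP), P; 𝓘(ℝ, EG), EG⟯,
      ∀ p, B.fundamental p (ξ p) = (X : VField EP P) p := by
    refine ⟨A.eval X, fun p => ?_⟩
    obtain ⟨v, hv⟩ := B.exists_fundamental_eq (X.2.1 p)
    change B.fundamental p (A.form p ((X : VField EP P) p)) = (X : VField EP P) p
    rw [← hv, A.form_fundamental]
  have h2 : B.ghost X = h.choose := dif_pos h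
  rw [h2]
  ext p
  change h.choose p = A.form p ((X : VField EP P) p)
  rw [← h.choose_spec p]
  exact (A.form_fundamental p _).symm

end PrincipalBundle

end

end BRS

namespace BRS

noncomputable section

theorem IsAlt.of_linear {R α V : Type*} [CommRing R] [AddCommGroup α] [Module R α]
    [AddCommGroup V] [Module R V] (T : α →ₗ[R] V) : IsAlt R (fun x : Fin 1 → α => T (x 0)) :=
  ⟨AlternatingMap.ofSubsingleton R α V 0 T, fun _ => rfl⟩

/-! ### Connection and ghost under contraction with fundamental fields -/

namespace PrincipalBundle

variable
    {EM : Type*} [NormedAddCommGroup EM] [NormedSpace ℝ EM] [FiniteDimensional ℝ EM]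
    {M : Type*} [TopologicalSpace M] [ChartedSpace EM M] [IsManifold 𝓘(ℝ, EM) ∞ M]
    {EG : Type*} [NormedAddCommGroup EG] [NormedSpace ℝ EG] [FiniteDimensional ℝ EG]
    {G : Type*} [TopologicalSpace G] [T2Space G]
    [ChartedSpace EG G] [Group G] [LieGroup 𝓘(ℝ, EG) ∞ G]
    {EP : Type*} [NormedAddCommGroup EP] [NormedSpace ℝ EP] [FiniteDimensional ℝ EP]
    {P : Type*} [TopologicalSpace P] [ChartedSpace EP P] [IsManifold 𝓘(ℝ, EP) ∞ P] [T2Space P]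
    {B : PrincipalBundle EM M EG G EP P} {𝕜 : Type*} [RCLike 𝕜]

open CochainAlg

/-- The contraction commutes with `s` up to sign along vector fields that commute with the gauge
algebra. -/
theorem iY_sHom {Z : VField EP P} (hZ : ∀ X : B.gaugeAlg, ⁅(X : VField EP P), Z⁆ = 0)
    (f : B.Alg 𝕜) : iY Z (sHom f) = -sHom (iY Z f) := by
  let T : FormFam EP P 𝕜 →+ FormFam EP P 𝕜 :=
    { toFun := fun g => ⟨famI Z g.1, g.2.famI Z⟩
      map_zero' := rfl
      map_add' := fun _ _ => rfl }
  have hT : ∀ (X : B.gaugeAlg) (w : FormFam EP P 𝕜),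
      T ((B.gaugeAction 𝕜).act X w) = (B.gaugeAction 𝕜).act X (T w) := fun X w => by
    refine Subtype.ext (((derivAction EP P 𝕜).famI_famL (X : VField EP P) Z w.1).trans ?_)
    rw [hZ, w.2.famI_zero_left, sub_zero]
    rfl
  have hs : ∀ w : FormFam EP P 𝕜, T (FormFam.sign w) = -FormFam.sign (T w) := fun w =>
    FormFam.ext fun q Y => by
      change (-1 : ℤ) ^ (q + 1) • w.1 (q + 1) (Fin.cons Z Y) =
        -((-1 : ℤ) ^ q • w.1 (q + 1) (Fin.cons Z Y))
      rw [pow_succ, mul_neg_one, neg_smul]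
  apply fam_injective
  have h1 : (iY Z (sHom f)).fam = fun k X =>
      T (FormFam.sign ((B.gaugeAction 𝕜).famD f.fam k X)) := rfl
  have h2 : (iY Z f).fam = fun k X => T (f.fam k X) := rfl
  have h3 : (-sHom (iY Z f)).fam = -(sHom (iY Z f)).fam := rfl
  rw [h1, h3, fam_sHom, h2, (B.gaugeAction 𝕜).famD_map T hT f.fam]
  funext k X
  exact hs _

theorem bracket_gauge_fundField (X : B.gaugeAlg) (v : GroupLieAlgebra 𝓘(ℝ, EG) G) :
    ⁅(X : VField EP P), B.fundField v⁆ = 0 := by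
  rw [← lie_skew, B.bracket_fundField_of_invariant X.2.2, neg_zero]

/-- Gauge fields are invariant and therefore commute with fundamental fields. So the contraction
anticommutes with `s`, and the Lie derivative belonging to `D` is the one belonging to `d` alone. -/
theorem contraction_fundField (v : GroupLieAlgebra 𝓘(ℝ, EG) G) :
    (B.dga 𝕜).Contraction (iY (B.fundField v)) (lieY (B.fundField v)) where
  i_mul := iY_mul _
  L_mul := lieY_mul _
  i_D x := by
    rw [dga_D, dga_D, D_apply, D_apply, map_add, iY_sHom (fun X => bracket_gauge_fundField X v),
      iY_d]
    abel

section Components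

variable {ι : Type*} (b : Module.Basis ι ℝ (GroupLieAlgebra 𝓘(ℝ, EG) G))

theorem component_add (c : ι) (ξ η : C^∞⟮𝓘(ℝ, EP), P; 𝓘(ℝ, EG), EG⟯) :
    component 𝕜 b c (ξ + η) = component 𝕜 b c ξ + component 𝕜 b c η := by
  ext p
  change ((b.coord c (ξ p + η p) : ℝ) : 𝕜) = ((b.coord c (ξ p) : ℝ) : 𝕜) + ((b.coord c (η p) : ℝ) : 𝕜)
  rw [← RCLike.ofReal_add]
  exact congrArg _ ((b.coord c).map_add _ _)

theorem component_smul (c : ι) (φ : SmoothFun EP P ℝ) {ξ η : C^∞⟮𝓘(ℝ, EP), P; 𝓘(ℝ, EG), EG⟯}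
    (h : ∀ p, η p = φ p • ξ p) : component 𝕜 b c η = φ • component 𝕜 b c ξ := by
  ext p
  change ((b.coord c (η p) : ℝ) : 𝕜) = φ p • ((b.coord c (ξ p) : ℝ) : 𝕜)
  rw [h, RCLike.real_smul_eq_coe_mul, ← RCLike.ofReal_mul]
  exact congrArg _ ((b.coord c).map_smul _ _)

theorem component_rsmul (c : ι) (r : ℝ) (ξ : C^∞⟮𝓘(ℝ, EP), P; 𝓘(ℝ, EG), EG⟯) :
    component 𝕜 b c (r • ξ) = r • component 𝕜 b c ξ := by
  ext p
  change ((b.coord c (r • ξ p) : ℝ) : 𝕜) = r • ((b.coord c (ξ p) : ℝ) : 𝕜)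
  rw [RCLike.real_smul_eq_coe_mul, ← RCLike.ofReal_mul]
  exact congrArg _ ((b.coord c).map_smul _ _)

theorem deriv_component (c : ι) (ξ : C^∞⟮𝓘(ℝ, EP), P; 𝓘(ℝ, EG), EG⟯) (V : VField EP P) (p : P) :
    V.deriv (component 𝕜 b c ξ) p =
      ((b.coord c (modelDeriv (E := EP) ξ p (V p)) : ℝ) : 𝕜) := by
  let T : EG →L[ℝ] 𝕜 := (RCLike.ofRealCLM (K := 𝕜)).comp
    (LinearMap.toContinuousLinearMap (E := EG) (F' := ℝ) (b.coord c))
  have h := modelDeriv_comp (E := EP) (g := T) (h := ξ) (x := p) (y := ξ p) T.mdifferentiableAt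
    (ξ.contMDiff.mdifferentiableAt (by simp)) rfl (V p)
  have h2 : modelDeriv (E := EG) T (ξ p) = T := T.mfderiv_eq
  rw [h2] at h
  exact h

theorem Connection.eval_add (A : B.Connection) (Y Z : VField EP P) :
    A.eval (Y + Z) = A.eval Y + A.eval Z := by
  ext p
  exact (A.form p).map_add _ _

theorem Connection.eval_rsmul (A : B.Connection) (r : ℝ) (Y : VField EP P) :
    A.eval (r • Y) = r • A.eval Y := by
  ext p
  exact (A.form p).map_smul _ _

/-- The component of a connection form as a linear map on vector fields. -/
def Connection.linear (𝕜 : Type*) [RCLike 𝕜] (A : B.Connection) (c : ι) :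
    VField EP P →ₗ[SmoothFun EP P ℝ] SmoothFun EP P 𝕜 where
  toFun Y := component 𝕜 b c (A.eval Y)
  map_add' Y Z := by rw [A.eval_add, component_add]
  map_smul' φ Y := component_smul b c φ fun p => (A.form p).map_smul _ _

/-- The component of the ghost as a linear map on the gauge algebra. -/
def Connection.ghostLinear (𝕜 : Type*) [RCLike 𝕜] (A : B.Connection) (c : ι) :
    B.gaugeAlg →ₗ[ℝ] SmoothFun EP P 𝕜 where
  toFun X := component 𝕜 b c (A.eval X)
  map_add' X Z := (congrArg _ (A.eval_add (X : VField EP P) Z)).trans (component_add b c _ _)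
  map_smul' r X := (congrArg _ (A.eval_rsmul r (X : VField EP P))).trans (component_rsmul b c r _)

variable (𝕜)

/-- A connection as a family of cochains. -/
def Connection.alg (A : B.Connection) (c : ι) : B.Alg 𝕜 := ⟨A.total 𝕜 b c, fun q k => by
  rw [mem_cochains_iff]
  match q, k with
  | 1, 0 => exact ⟨fun X => IsAlt.of_linear (A.linear b 𝕜 c), fun Y => IsAlt.of_isEmpty _⟩
  | 0, k => exact ⟨fun _ => IsAlt.zero, fun _ => IsAlt.zero⟩
  | 1, k + 1 => exact ⟨fun _ => IsAlt.zero, fun _ => IsAlt.zero⟩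
  | q + 2, k => exact ⟨fun _ => IsAlt.zero, fun _ => IsAlt.zero⟩⟩

/-- The ghost as a family of cochains, expressed through a connection. -/
def Connection.ghostAlg (A : B.Connection) (c : ι) : B.Alg 𝕜 := ⟨B.ghostTotal 𝕜 b c, fun q k => by
  rw [mem_cochains_iff]
  match q, k with
  | 0, 1 =>
    refine ⟨fun X => IsAlt.of_isEmpty _, fun Y => ?_⟩
    have : (fun X => B.ghostTotal 𝕜 b c 0 1 X Y) = fun X => A.ghostLinear b 𝕜 c (X 0) :=
      funext fun X => congrArg (component 𝕜 b c) (ghost_eq A (X 0))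
    rw [this]
    exact IsAlt.of_linear (A.ghostLinear b 𝕜 c)
  | 0, 0 => exact ⟨fun _ => IsAlt.zero, fun _ => IsAlt.zero⟩
  | 0, k + 2 => exact ⟨fun _ => IsAlt.zero, fun _ => IsAlt.zero⟩
  | q + 1, k => exact ⟨fun _ => IsAlt.zero, fun _ => IsAlt.zero⟩⟩

variable {𝕜}

/-- The connection serves only to prove that the ghost is a cochain; the family itself does not
involve it. -/
theorem Connection.ghostAlg_eq (A A' : B.Connection) : A.ghostAlg 𝕜 b = A'.ghostAlg 𝕜 b := rfl

theorem Connection.alg_apply (A : B.Connection) (c : ι) (X : Fin 0 → B.gaugeAlg)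
    (Y : Fin 1 → VField EP P) : (A.alg 𝕜 b c) 1 0 X Y = component 𝕜 b c (A.eval (Y 0)) := rfl

theorem Connection.ghostAlg_apply (A : B.Connection) (c : ι) (X : Fin 1 → B.gaugeAlg)
    (Y : Fin 0 → VField EP P) :
    (A.ghostAlg 𝕜 b c) 0 1 X Y = component 𝕜 b c (A.eval (X 0 : VField EP P)) :=
  congrArg (component 𝕜 b c) (ghost_eq A (X 0))

theorem Connection.alg_eq_zero (A : B.Connection) (c : ι) (q k : ℕ) (h : ¬(q = 1 ∧ k = 0)) :
    (A.alg 𝕜 b c).1 q k = 0 := by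
  match q, k, h with
  | 1, 0, h => exact absurd ⟨rfl, rfl⟩ h
  | 0, k, _ => rfl
  | 1, k + 1, _ => rfl
  | q + 2, k, _ => rfl

theorem Connection.ghostAlg_eq_zero (A : B.Connection) (c : ι) (q k : ℕ) (h : ¬(q = 0 ∧ k = 1)) :
    (A.ghostAlg 𝕜 b c).1 q k = 0 := by
  match q, k, h with
  | 0, 1, h => exact absurd ⟨rfl, rfl⟩ h
  | 0, 0, _ => rfl
  | 0, k + 2, _ => rfl
  | q + 1, k, _ => rfl

theorem Connection.isOdd_alg (A : B.Connection) : (B.dga 𝕜).IsOdd (A.alg 𝕜 b) := fun c => by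
  refine CochainAlg.ext fun q k X Y => ?_
  rw [dga_ε, parity_apply]
  by_cases h : q = 1 ∧ k = 0
  · obtain ⟨rfl, rfl⟩ := h
    simp
  · simp [A.alg_eq_zero b c q k h]

theorem Connection.isOdd_ghostAlg (A : B.Connection) : (B.dga 𝕜).IsOdd (A.ghostAlg 𝕜 b) :=
  fun c => by
  refine CochainAlg.ext fun q k X Y => ?_
  rw [dga_ε, parity_apply]
  by_cases h : q = 0 ∧ k = 1
  · obtain ⟨rfl, rfl⟩ := h
    simp
  · simp [A.ghostAlg_eq_zero b c q k h]

theorem Connection.iY_alg (A : B.Connection) (v : GroupLieAlgebra 𝓘(ℝ, EG) G) (c : ι) :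
    iY (B.fundField v) (A.alg 𝕜 b c) = algebraMap 𝕜 (B.Alg 𝕜) ((b.repr v c : ℝ) : 𝕜) := by
  refine CochainAlg.ext fun q k X Y => ?_
  rw [Algebra.algebraMap_eq_smul_one, iY_apply, CochainAlg.smul_apply, val_one]
  match q, k with
  | 0, 0 =>
    rw [A.alg_apply]
    ext p
    have : A.eval (B.fundField v) p = v := A.form_fundamental p v
    change ((b.coord c (A.eval (B.fundField v) p) : ℝ) : 𝕜) = ((b.repr v c : ℝ) : 𝕜) * 1
    rw [this, mul_one]
    rfl
  | 0, k + 1 => exact (mul_zero _).symm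
  | q + 1, k => exact (mul_zero _).symm

theorem Connection.iY_ghostAlg (A : B.Connection) (Z : VField EP P) (c : ι) :
    iY Z (A.ghostAlg 𝕜 b c) = 0 := rfl

variable [Fintype ι]

theorem coord_lieBr (v : GroupLieAlgebra 𝓘(ℝ, EG) G) (w : EG) (c : ι) :
    ((b.coord c (lieBr (EG := EG) G v w) : ℝ) : 𝕜) =
      ∑ x, ∑ y, ((b.repr v x : ℝ) : 𝕜) * structConst 𝕜 b x y c * ((b.coord y w : ℝ) : 𝕜) := by
  have : CompleteSpace EG := FiniteDimensional.complete ℝ EG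
  have : LieGroup 𝓘(ℝ, EG) (minSmoothness ℝ 3) G := by
    simpa using LieGroup.of_le (I := 𝓘(ℝ, EG)) (G := G) (m := 3) (n := ∞) (by norm_cast)
  let u : GroupLieAlgebra 𝓘(ℝ, EG) G := w
  have h1 : ⁅v, u⁆ = ∑ x, ∑ y, (b.repr v x * b.repr u y) • ⁅b x, b y⁆ := by
    conv_lhs => rw [← b.sum_repr v, ← b.sum_repr u]
    simp only [sum_lie, lie_sum, smul_lie, lie_smul]
    rw [Finset.sum_comm]
    simp only [Finset.smul_sum, smul_smul, mul_comm]
  change ((b.repr ⁅v, u⁆ c : ℝ) : 𝕜) = _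
  rw [h1]
  simp only [map_sum, map_smul, Finsupp.coe_finsetSum, Finset.sum_apply, Finsupp.smul_apply,
    smul_eq_mul, RCLike.ofReal_mul, structConst]
  refine Finset.sum_congr rfl fun x _ => Finset.sum_congr rfl fun y _ => ?_
  change _ = _ * _ * ((b.repr u y : ℝ) : 𝕜)
  ring

theorem adj_apply (v : GroupLieAlgebra 𝓘(ℝ, EG) G) (χ : ι → B.Alg 𝕜) (c : ι) (q k : ℕ)
    (X : Fin k → B.gaugeAlg) (Y : Fin q → VField EP P) (ξ : C^∞⟮𝓘(ℝ, EP), P; 𝓘(ℝ, EG), EG⟯)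
    (hξ : ∀ y, χ y q k X Y = component 𝕜 b y ξ) (p : P) :
    SuperDGA.adj (structConst 𝕜 b) (fun x => ((b.repr v x : ℝ) : 𝕜)) χ c q k X Y p =
      ((b.coord c (lieBr (EG := EG) G v (ξ p)) : ℝ) : 𝕜) := by
  rw [coord_lieBr]
  change evalPt 𝕜 q k X Y p (SuperDGA.adj _ _ χ c) = _
  simp only [SuperDGA.adj, map_sum, map_smul, smul_eq_mul]
  refine Finset.sum_congr rfl fun x _ => Finset.sum_congr rfl fun y _ => ?_
  change _ * (χ y q k X Y p) = _
  rw [hξ]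
  rfl

theorem adj_eq_zero (v : ι → 𝕜) (χ : ι → B.Alg 𝕜) (c : ι) (q k : ℕ)
    (h : ∀ y, (χ y).1 q k = 0) (X : Fin k → B.gaugeAlg) (Y : Fin q → VField EP P) :
    SuperDGA.adj (structConst 𝕜 b) v χ c q k X Y = 0 := by
  ext p
  change evalPt 𝕜 q k X Y p (SuperDGA.adj _ _ χ c) = 0
  simp only [SuperDGA.adj, map_sum, map_smul, smul_eq_mul]
  refine Finset.sum_eq_zero fun x _ => Finset.sum_eq_zero fun y _ => ?_
  change _ * ((χ y).1 q k X Y p) = 0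
  rw [h]
  exact mul_zero _

/-- Only bidegree `(1, 0)` is not trivially zero; there the Lie derivative is the infinitesimal
equivariance `Connection.deriv_eval`. -/
theorem Connection.isConn_alg (A : B.Connection) (v : GroupLieAlgebra 𝓘(ℝ, EG) G) :
    SuperDGA.IsConn (structConst 𝕜 b) (iY (B.fundField v)) (lieY (B.fundField v))
      (fun x => ((b.repr v x : ℝ) : 𝕜)) (A.alg 𝕜 b) where
  i_eq := A.iY_alg b v
  L_eq c := by
    refine CochainAlg.ext fun q k X Y => ?_
    rw [lieY_apply]
    by_cases h : q = 1 ∧ k = 0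
    · obtain ⟨rfl, rfl⟩ := h
      ext p
      have h1 := deriv_component (𝕜 := 𝕜) b c (A.eval (Y 0)) (B.fundField v) p
      have h2 := adj_apply b v (A.alg 𝕜 b) c 1 0 X Y (A.eval (Y 0)) (fun y => A.alg_apply b y X Y) p
      have h3 := A.deriv_eval (Y 0) v p
      change (B.fundField v).deriv (component 𝕜 b c (A.eval (Y 0))) p -
        (∑ i : Fin 1, (A.alg 𝕜 b c) 1 0 X (Function.update Y i ⁅B.fundField v, Y i⁆)) p =
        -(SuperDGA.adj (structConst 𝕜 b) (fun x => ((b.repr v x : ℝ) : 𝕜)) (A.alg 𝕜 b) c 1 0 X Y p)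
      rw [h1, h2, Fin.sum_univ_one, A.alg_apply, Function.update_self]
      change ((b.coord c (modelDeriv (E := EP) (A.eval (Y 0)) p (B.fundamental p v)) : ℝ) : 𝕜) -
        ((b.coord c (A.eval ⁅B.fundField v, Y 0⁆ p) : ℝ) : 𝕜) = _
      rw [h3, ← RCLike.ofReal_sub, ← RCLike.ofReal_neg]
      refine congrArg _ ?_
      exact (congrArg (· - _) ((b.coord c).map_sub _ _)).trans (by ring)
    · have h1 : lieD q (B.fundField v) ((A.alg 𝕜 b c).1 q k X) Y = 0 := by
        rw [A.alg_eq_zero b c q k h]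
        exact congrFun (map_zero (lieD (𝕜 := 𝕜) q (B.fundField v))) Y
      have h2 := adj_eq_zero b (fun x => ((b.repr v x : ℝ) : 𝕜)) (A.alg 𝕜 b) c q k
        (fun y => A.alg_eq_zero b y q k h) X Y
      exact h1.trans (neg_zero.symm.trans (congrArg Neg.neg h2.symm))

/-- The ghost has no form arguments, so its contraction vanishes. Its Lie derivative is that of
`A(X)`, and the bracket term drops out because `X` commutes with the fundamental fields. -/
theorem Connection.isTensorial_ghostAlg (A : B.Connection) (v : GroupLieAlgebra 𝓘(ℝ, EG) G) :
    SuperDGA.IsTensorial (structConst 𝕜 b) (iY (B.fundField v)) (lieY (B.fundField v))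
      (fun x => ((b.repr v x : ℝ) : 𝕜)) (A.ghostAlg 𝕜 b) where
  i_eq c := A.iY_ghostAlg b _ c
  L_eq c := by
    refine CochainAlg.ext fun q k X Y => ?_
    rw [lieY_apply]
    by_cases h : q = 0 ∧ k = 1
    · obtain ⟨rfl, rfl⟩ := h
      ext p
      have h0 := A.ghostAlg_apply (𝕜 := 𝕜) b c X Y
      have h1 := deriv_component (𝕜 := 𝕜) b c (A.eval (X 0 : VField EP P)) (B.fundField v) p
      have h2 := adj_apply b v (A.ghostAlg 𝕜 b) c 0 1 X Y (A.eval (X 0 : VField EP P))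
        (fun y => A.ghostAlg_apply b y X Y) p
      have h3 := A.deriv_eval (X 0 : VField EP P) v p
      change (B.fundField v).deriv ((A.ghostAlg 𝕜 b c) 0 1 X Y) p - (∑ i : Fin 0,
        (A.ghostAlg 𝕜 b c) 0 1 X (Function.update Y i ⁅B.fundField v, Y i⁆)) p =
        -(SuperDGA.adj (structConst 𝕜 b) (fun x => ((b.repr v x : ℝ) : 𝕜)) (A.ghostAlg 𝕜 b)
          c 0 1 X Y p)
      rw [h2, h0, h1, Fin.sum_univ_zero]
      refine (sub_zero _).trans ?_
      change ((b.coord c (modelDeriv (E := EP) (A.eval (X 0 : VField EP P)) p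
        (B.fundamental p v)) : ℝ) : 𝕜) = _
      have h4 : A.eval (0 : VField EP P) p = 0 := (A.form p).map_zero
      rw [h3, B.bracket_fundField_of_invariant (X 0).2.2, h4, zero_sub, ← RCLike.ofReal_neg]
      exact congrArg _ ((b.coord c).map_neg _)
    · have h1 : lieD q (B.fundField v) ((A.ghostAlg 𝕜 b c).1 q k X) Y = 0 := by
        rw [A.ghostAlg_eq_zero b c q k h]
        exact congrFun (map_zero (lieD (𝕜 := 𝕜) q (B.fundField v))) Y
      have h2 := adj_eq_zero b (fun x => ((b.repr v x : ℝ) : 𝕜)) (A.ghostAlg 𝕜 b) c q k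
        (fun y => A.ghostAlg_eq_zero b y q k h) X Y
      exact h1.trans (neg_zero.symm.trans (congrArg Neg.neg h2.symm))

end Components

end PrincipalBundle

end

end BRS

namespace BRS

noncomputable section

namespace PrincipalBundle

variable
    {EM : Type*} [NormedAddCommGroup EM] [NormedSpace ℝ EM] [FiniteDimensional ℝ EM]
    {M : Type*} [TopologicalSpace M] [ChartedSpace EM M] [IsManifold 𝓘(ℝ, EM) ∞ M]
    {EG : Type*} [NormedAddCommGroup EG] [NormedSpace ℝ EG] [FiniteDimensional ℝ EG]
    {G : Type*} [TopologicalSpace G] [T2Space G]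
    [ChartedSpace EG G] [Group G] [LieGroup 𝓘(ℝ, EG) ∞ G]
    {EP : Type*} [NormedAddCommGroup EP] [NormedSpace ℝ EP] [FiniteDimensional ℝ EP]
    {P : Type*} [TopologicalSpace P] [ChartedSpace EP P] [IsManifold 𝓘(ℝ, EP) ∞ P] [T2Space P]
    {B : PrincipalBundle EM M EG G EP P} {𝕜 : Type*} [RCLike 𝕜]

open CochainAlg

/-! ### Horizontality of the curvature of a connection -/

section Horizontality

variable {ι : Type*} [Fintype ι] (b : Module.Basis ι ℝ (GroupLieAlgebra 𝓘(ℝ, EG) G))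

theorem sum_lieBr (r : ι → ℝ) (w : EG) :
    ∑ a, r a • lieBr (EG := EG) G (b a) w = lieBr (EG := EG) G (∑ a, r a • b a) w := by
  have : CompleteSpace EG := FiniteDimensional.complete ℝ EG
  have : LieGroup 𝓘(ℝ, EG) (minSmoothness ℝ 3) G := by
    simpa using LieGroup.of_le (I := 𝓘(ℝ, EG)) (G := G) (m := 3) (n := ∞) (by norm_cast)
  let u : GroupLieAlgebra 𝓘(ℝ, EG) G := w
  have h : ⁅∑ a, r a • b a, u⁆ = ∑ a, r a • ⁅b a, u⁆ := by
    simp only [sum_lie, smul_lie]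
  exact h.symm

/-- A vertical vector field in terms of the fundamental vector fields. -/
theorem Connection.eq_sum_fundField (A : B.Connection) {ξ : VField EP P}
    (hξ : ∀ p, mfderiv 𝓘(ℝ, EP) 𝓘(ℝ, EM) B.proj p (ξ p) = 0) :
    ξ = ∑ a, component ℝ b a (A.eval ξ) • B.fundField (b a) := by
  ext p
  obtain ⟨v, hv⟩ := B.exists_fundamental_eq (hξ p)
  have h1 : A.form p (ξ p) = v := by rw [← hv, A.form_fundamental]
  have h2 : (∑ a, component ℝ b a (A.eval ξ) • B.fundField (b a) : VField EP P) p =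
      ∑ a, b.repr v a • B.fundamental p (b a) := by
    have := map_sum (ContMDiffSection.coeAddHom 𝓘(ℝ, EP) EP ∞ (TangentSpace 𝓘(ℝ, EP) : P → Type _))
      (fun a => component ℝ b a (A.eval ξ) • B.fundField (b a)) Finset.univ
    refine (congrFun this p).trans ((Finset.sum_apply _ _ _).trans
      (Finset.sum_congr rfl fun a _ => ?_))
    change (b.coord a (A.form p (ξ p))) • B.fundamental p (b a) = _
    rw [h1]
    rfl
  rw [h2, ← hv]
  simp only [fundamental]
  conv_lhs => rw [← b.sum_repr v]
  erw [map_sum]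
  refine Finset.sum_congr rfl fun a _ => ?_
  erw [map_smul]
  rfl

/-- The curvature of a connection is horizontal. -/
theorem Connection.curvature_vertical {ι : Type*} [Fintype ι]
    (b : Module.Basis ι ℝ (GroupLieAlgebra 𝓘(ℝ, EG) G)) (A : B.Connection) {ξ : VField EP P}
    (hξ : ∀ p, mfderiv 𝓘(ℝ, EP) 𝓘(ℝ, EM) B.proj p (ξ p) = 0) (Y : VField EP P) (p : P) :
    modelDeriv (E := EP) (A.eval Y) p (ξ p) = A.eval ⁅ξ, Y⁆ p +
      modelDeriv (E := EP) (A.eval ξ) p (Y p) - lieBr (EG := EG) G (A.eval ξ p) (A.eval Y p) := by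
  let e : ι → EG := fun a => b a
  let ev : VField EP P →+ EG :=
    { toFun := fun Z => A.eval Z p
      map_zero' := (A.form p).map_zero
      map_add' := fun Z W => (A.form p).map_add _ _ }
  let g : ι → SmoothFun EP P ℝ := fun a => component ℝ b a (A.eval ξ)
  have hsum := A.eq_sum_fundField b hξ
  have hev : ∀ (φ : SmoothFun EP P ℝ) (Z : VField EP P), ev (φ • Z) = φ p • ev Z := fun φ Z =>
    (A.form p).map_smul _ _
  have hfund : ∀ a, ev (B.fundField (b a)) = e a := fun a => A.form_fundamental p (b a)
  -- Expanding `ξ` in fundamental fields with function coefficients `g a`, the bracket also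
  -- differentiates the coefficients along `Y`. These terms are the derivative of `A(ξ)` computed in
  -- `h5`.
  have h1 : ev ⁅ξ, Y⁆ = ∑ a, (g a p • ev ⁅B.fundField (b a), Y⁆ - Y.deriv (g a) p • e a) := by
    conv_lhs => rw [hsum, sum_lie, map_sum]
    refine Finset.sum_congr rfl fun a _ => ?_
    rw [VField.smul_lie_smooth, map_sub, hev, hev, hfund]
  have h2 : modelDeriv (E := EP) (A.eval Y) p (ξ p) =
      ∑ a, g a p • (ev ⁅B.fundField (b a), Y⁆ - lieBr (EG := EG) G (b a) (A.eval Y p)) := by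
    let T : EP →L[ℝ] EG := modelDeriv (E := EP) (A.eval Y) p
    have h3 : (ξ p : EP) = ∑ a, g a p • (B.fundamental p (b a) : EP) := by
      have := congrArg (fun Z : VField EP P => Z p) hsum
      refine this.trans ?_
      have := map_sum (ContMDiffSection.coeAddHom 𝓘(ℝ, EP) EP ∞
        (TangentSpace 𝓘(ℝ, EP) : P → Type _)) (fun a => g a • B.fundField (b a)) Finset.univ
      exact (congrFun this p).trans (Finset.sum_apply _ _ _)
    have h4 : T (ξ p) = ∑ a, g a p • T (B.fundamental p (b a)) := by
      refine (congrArg T h3).trans ((map_sum T _ _).trans (Finset.sum_congr rfl fun a _ => ?_))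
      exact map_smul T _ _
    refine h4.trans (Finset.sum_congr rfl fun a _ => congrArg _ ?_)
    exact A.deriv_eval Y (b a) p
  have h5 : modelDeriv (E := EP) (A.eval ξ) p (Y p) = ∑ a, Y.deriv (g a) p • e a := by
    let u : GroupLieAlgebra 𝓘(ℝ, EG) G := modelDeriv (E := EP) (A.eval ξ) p (Y p)
    have h6 : ∀ a, Y.deriv (g a) p = b.repr u a := fun a => by
      have := deriv_component (𝕜 := ℝ) b a (A.eval ξ) Y p
      exact this
    have h7 := b.sum_repr u
    simp only [h6]
    exact h7.symm
  have h8 : lieBr (EG := EG) G (A.eval ξ p) (A.eval Y p) =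
      ∑ a, g a p • lieBr (EG := EG) G (b a) (A.eval Y p) := by
    rw [sum_lieBr]
    refine congrArg (fun u => lieBr (EG := EG) G u (A.eval Y p)) ?_
    exact (b.sum_repr (A.eval ξ p)).symm
  have h9 : A.eval ⁅ξ, Y⁆ p = ev ⁅ξ, Y⁆ := rfl
  rw [h2, h9, h1, h5, h8, ← Finset.sum_add_distrib, ← Finset.sum_sub_distrib]
  refine Finset.sum_congr rfl fun a _ => ?_
  rw [smul_sub]
  abel

end Horizontality

/-! ### Bounds on the ghost degree -/

section GhostDegree

/-- All components of ghost degree greater than `m` vanish. -/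
def GhostLE (m : ℕ) (f : B.Alg 𝕜) : Prop := ∀ q k, m < k → f.1 q k = 0

theorem GhostLE.mono {m n : ℕ} {f : B.Alg 𝕜} (h : GhostLE m f) (hmn : m ≤ n) : GhostLE n f :=
  fun q k hk => h q k (by omega)

theorem GhostLE.zero (m : ℕ) : GhostLE m (0 : B.Alg 𝕜) := fun _ _ _ => rfl

theorem GhostLE.one : GhostLE 0 (1 : B.Alg 𝕜) := fun q k hk => by
  match q, k, hk with
  | 0, k + 1, _ => rfl
  | q + 1, k + 1, _ => rfl

theorem GhostLE.add {m : ℕ} {f g : B.Alg 𝕜} (hf : GhostLE m f) (hg : GhostLE m g) :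
    GhostLE m (f + g) := fun q k hk => by
  rw [val_add, Pi.add_apply, Pi.add_apply, hf q k hk, hg q k hk, add_zero]

theorem GhostLE.smul {m : ℕ} (c : 𝕜) {f : B.Alg 𝕜} (hf : GhostLE m f) : GhostLE m (c • f) :=
  fun q k hk => by
  funext X Y
  have := hf q k hk
  rw [CochainAlg.smul_apply, this]
  exact mul_zero _

theorem GhostLE.sum {m : ℕ} {J : Type*} (s : Finset J) {f : J → B.Alg 𝕜}
    (hf : ∀ j ∈ s, GhostLE m (f j)) : GhostLE m (∑ j ∈ s, f j) := by
  classical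
  induction s using Finset.induction_on with
  | empty => exact GhostLE.zero m
  | insert a s ha ih =>
    rw [Finset.sum_insert ha]
    exact (hf a (by simp)).add (ih fun j hj => hf j (by simp [hj]))

theorem GhostLE.mul {m n : ℕ} {f g : B.Alg 𝕜} (hf : GhostLE m f) (hg : GhostLE n g) :
    GhostLE (m + n) (f * g) := fun q k hk => by
  funext X Y
  rw [val_mul, Total.mul]
  refine Finset.sum_eq_zero fun i _ => Finset.sum_eq_zero fun l _ => ?_
  have h : ∀ σ τ, f.1 i l (headPart l (X ∘ σ)) (headPart i (Y ∘ τ)) *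
      g.1 (q - i) (k - l) (tailPart l (X ∘ σ)) (tailPart i (Y ∘ τ)) = 0 := fun σ τ => by
    by_cases hl : m < l
    · rw [hf _ _ hl]; exact zero_mul _
    · rw [hg _ (k - l) (by omega)]; exact mul_zero _
  simp [h]

theorem GhostLE.list_prod {n : ℕ} {deg : Fin n → ℕ} {χ : Fin n → B.Alg 𝕜}
    (h : ∀ i, GhostLE (deg i) (χ i)) : GhostLE (∑ i, deg i) (List.ofFn χ).prod := by
  induction n with
  | zero => simpa using GhostLE.one
  | succ n ih =>
    rw [List.ofFn_succ, List.prod_cons, Fin.sum_univ_succ]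
    exact (h 0).mul (ih fun i => h i.succ)

theorem GhostLE.D {m : ℕ} {f : B.Alg 𝕜} (hf : GhostLE m f) : GhostLE (m + 1) (D f) :=
  fun q k hk => by
  rw [D_val]
  match q, k, hk with
  | 0, k + 1, hk =>
    change B.sP 0 k (f.1 0 k) = 0
    rw [hf 0 k (by omega), map_zero]
  | q + 1, k + 1, hk =>
    change B.sP (q + 1) k (f.1 (q + 1) k) + B.dP q (k + 1) (f.1 q (k + 1)) = 0
    rw [hf (q + 1) k (by omega), hf q (k + 1) (by omega), map_zero, map_zero, add_zero]

variable {ι : Type*} [Fintype ι] {f : ι → ι → ι → 𝕜}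

/-- The form `θ` has no ghosts, and `D` contains `s`, which adds at most one. -/
theorem GhostLE.curv {θ : ι → B.Alg 𝕜} (hθ : ∀ a, GhostLE 0 (θ a)) (c : ι) :
    GhostLE 1 ((B.dga 𝕜).curv f θ c) := by
  refine (hθ c).D.add (GhostLE.smul _ ?_)
  exact GhostLE.sum _ fun x _ => GhostLE.sum _ fun y _ =>
    (((hθ x).mul (hθ y)).mono (by omega)).smul _

variable [DecidableEq ι] (b : Module.Basis ι ℝ (GroupLieAlgebra 𝓘(ℝ, EG) G)) {n : ℕ}
  (I : MultilinearMap ℝ (fun _ : Fin n => GroupLieAlgebra 𝓘(ℝ, EG) G) 𝕜)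

theorem GhostLE.peval {m : ℕ} {F : ι → B.Alg 𝕜} (hF : (B.dga 𝕜).IsEven F)
    (h : ∀ a, GhostLE m (F a)) : GhostLE (n * m) ((B.dga 𝕜).peval F (formPoly b I)) := by
  rw [SuperDGA.peval_formPoly b hF]
  refine GhostLE.sum _ fun x _ => GhostLE.smul _ ?_
  exact (GhostLE.list_prod (deg := fun _ => m) fun i => h (x i)).mono (by simp)

/-- In each summand one of the `n` curvature factors is replaced by the ghost-free `η`. For `n = 0`
there is no summand, so the truncated `n - 1` does no harm. -/
theorem GhostLE.trans {m : ℕ} {F η : ι → B.Alg 𝕜} (hF : (B.dga 𝕜).IsEven F)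
    (h : ∀ a, GhostLE m (F a)) (hη : ∀ a, GhostLE 0 (η a)) :
    GhostLE ((n - 1) * m) ((B.dga 𝕜).trans F η (formPoly b I)) := by
  rw [SuperDGA.trans_formPoly b hF]
  refine GhostLE.sum _ fun j _ => GhostLE.sum _ fun x _ => GhostLE.smul _ ?_
  refine (GhostLE.list_prod (deg := Function.update (fun _ => m) j 0) fun i => ?_).mono ?_
  · by_cases hij : i = j
    · subst hij; simpa using hη (x i)
    · simpa [hij] using h (x i)
  · rw [Finset.sum_update_of_mem (Finset.mem_univ j)]
    simp [Finset.card_sdiff]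

/-- The bound holds at each real parameter, and integration preserves vanishing components. Hence
the hypothesis concerns the curvature at real `t` only. -/
theorem GhostLE.transgr {m : ℕ} {θ η : ι → B.Alg 𝕜} (hθ : (B.dga 𝕜).IsOdd θ)
    (hη : (B.dga 𝕜).IsOdd η)
    (h : ∀ (t : ℝ) a, GhostLE m ((B.dga 𝕜).curv f (θ + (t : 𝕜) • η) a))
    (hη0 : ∀ a, GhostLE 0 (η a)) :
    GhostLE ((n - 1) * m) ((B.dga 𝕜).transgr f (formPoly b I) θ η) := fun q k hk => by
  funext X Y
  ext p
  have := (integral_evalAt (evalPt 𝕜 q k X Y p) ((B.dga 𝕜).transPath f (formPoly b I) θ η)).2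
  refine this.symm.trans ?_
  refine (intervalIntegral.integral_congr (g := fun _ => 0) fun t _ => ?_).trans (by simp)
  simp only [SuperDGA.evalAt_transPath hθ hη]
  have h1 := GhostLE.trans b I (SuperDGA.curv_even (f := f) (hθ.add (hη.smul (t : 𝕜)))) (h t) hη0 q k hk
  exact congrArg (fun g : RawCochain EP P 𝕜 B.gaugeAlg q k => g X Y p) h1

end GhostDegree

end PrincipalBundle

end

end BRS

namespace BRS

noncomputable section

/-! ### The Russian formula and segments of connections -/

namespace PrincipalBundle

variable
    {EM : Type*} [NormedAddCommGroup EM] [NormedSpace ℝ EM] [FiniteDimensional ℝ EM]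
    {M : Type*} [TopologicalSpace M] [ChartedSpace EM M] [IsManifold 𝓘(ℝ, EM) ∞ M]
    {EG : Type*} [NormedAddCommGroup EG] [NormedSpace ℝ EG] [FiniteDimensional ℝ EG]
    {G : Type*} [TopologicalSpace G] [T2Space G]
    [ChartedSpace EG G] [Group G] [LieGroup 𝓘(ℝ, EG) ∞ G]
    {EP : Type*} [NormedAddCommGroup EP] [NormedSpace ℝ EP] [FiniteDimensional ℝ EP]
    {P : Type*} [TopologicalSpace P] [ChartedSpace EP P] [IsManifold 𝓘(ℝ, EP) ∞ P] [T2Space P]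
    {B : PrincipalBundle EM M EG G EP P} {𝕜 : Type*} [RCLike 𝕜]

open CochainAlg

theorem iX_d (ξ : B.gaugeAlg) (f : B.Alg 𝕜) : iX ξ (d f) = -d (iX ξ f) := by
  apply fam_injective
  funext k X
  change FormFam.sign (FormFam.d (f.fam (k + 1) (Fin.cons ξ X))) =
    -FormFam.d (FormFam.sign (f.fam (k + 1) (Fin.cons ξ X)))
  rw [FormFam.d_sign, neg_neg]

theorem iX_D (ξ : B.gaugeAlg) (f : B.Alg 𝕜) : iX ξ (D f) = lieX ξ f - D (iX ξ f) := by
  rw [D_apply, D_apply, map_add, iX_sHom, iX_d]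
  abel

theorem lieX_apply (ξ : B.gaugeAlg) (f : B.Alg 𝕜) (q k : ℕ) (X : Fin k → B.gaugeAlg)
    (Y : Fin q → VField EP P) :
    lieX ξ f q k X Y = lieD q (ξ : VField EP P) (f q k X) Y -
      ∑ i, f q k (Function.update X i ⁅ξ, X i⁆) Y := by
  have h := map_sub (FormFam.eval q Y) (FormFam.lie (ξ : VField EP P) (f.fam k X))
    (∑ i, f.fam k (Function.update X i ⁅ξ, X i⁆))
  rw [map_sum] at h
  exact h

theorem lieX_eq_zero (ξ : B.gaugeAlg) {f : B.Alg 𝕜} {q k : ℕ} (h : f.1 q k = 0) :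
    (lieX ξ f).1 q k = 0 := by
  funext X Y
  rw [lieX_apply, h]
  have : lieD q (ξ : VField EP P) ((0 : RawCochain EP P 𝕜 B.gaugeAlg q k) X) Y = 0 :=
    congrFun (map_zero (lieD (𝕜 := 𝕜) q (ξ : VField EP P))) Y
  rw [this]
  simp

/-- Multiplication by a function. -/
theorem function_mul_apply {g : B.Alg 𝕜} (hY : ∀ Z, iY Z g = 0) (hX : ∀ ξ, iX ξ g = 0)
    (hg : parity g = g) (x : B.Alg 𝕜) (q k : ℕ) (X : Fin k → B.gaugeAlg)
    (Y : Fin q → VField EP P) : (g * x) q k X Y = g 0 0 Fin.elim0 Fin.elim0 * x q k X Y := by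
  induction q generalizing x with
  | succ q ih =>
    have h := ih (iY (Y 0) x) (Fin.tail Y)
    rw [iY_apply, Fin.cons_self_tail] at h
    rw [← h]
    have h2 : iY (Y 0) (g * x) = g * iY (Y 0) x := by rw [iY_mul, hY, hg, zero_mul, zero_add]
    rw [← h2, iY_apply, Fin.cons_self_tail]
  | zero =>
    induction k generalizing x with
    | zero =>
      rw [mul_apply_zero, Subsingleton.elim X Fin.elim0, Subsingleton.elim Y Fin.elim0]
    | succ k ih =>
      have h := ih (Fin.tail X) (iX (X 0) x)
      rw [iX_apply, Fin.cons_self_tail, pow_zero, one_smul] at h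
      rw [← h]
      have h2 : iX (X 0) (g * x) = g * iX (X 0) x := by rw [iX_mul, hX, hg, zero_mul, zero_add]
      rw [← h2, iX_apply, Fin.cons_self_tail, pow_zero, one_smul]

section RussianFormula

variable {ι : Type*} (b : Module.Basis ι ℝ (GroupLieAlgebra 𝓘(ℝ, EG) G))

theorem Connection.iX_alg (A : B.Connection) (ξ : B.gaugeAlg) (c : ι) :
    iX ξ (A.alg 𝕜 b c) = 0 := by
  refine CochainAlg.ext fun q k X Y => ?_
  rw [iX_apply, A.alg_eq_zero b c q (k + 1) (by omega)]
  exact smul_zero (A := SmoothFun EP P 𝕜) ((-1 : ℤ) ^ q)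

theorem Connection.iX_ghostAlg_eq_zero (A : B.Connection) (ξ : B.gaugeAlg) (c : ι) (q k : ℕ)
    (h : ¬(q = 0 ∧ k = 0)) : (iX ξ (A.ghostAlg 𝕜 b c)).1 q k = 0 := by
  funext X Y
  rw [iX_apply, A.ghostAlg_eq_zero b c q (k + 1) (by omega)]
  exact smul_zero _

theorem Connection.iX_ghostAlg_apply (A : B.Connection) (ξ : B.gaugeAlg) (c : ι)
    (X : Fin 0 → B.gaugeAlg) (Y : Fin 0 → VField EP P) :
    iX ξ (A.ghostAlg 𝕜 b c) 0 0 X Y = component 𝕜 b c (A.eval ξ) := by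
  rw [iX_apply, pow_zero, one_smul, A.ghostAlg_apply]
  rfl

theorem Connection.iX_iX_ghostAlg (A : B.Connection) (ξ η : B.gaugeAlg) (c : ι) :
    iX η (iX ξ (A.ghostAlg 𝕜 b c)) = 0 := by
  refine CochainAlg.ext fun q k X Y => ?_
  rw [iX_apply, A.iX_ghostAlg_eq_zero b ξ c q (k + 1) (by omega)]
  exact smul_zero (A := SmoothFun EP P 𝕜) ((-1 : ℤ) ^ q)

theorem Connection.iY_iX_ghostAlg (A : B.Connection) (ξ : B.gaugeAlg) (Z : VField EP P) (c : ι) :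
    iY Z (iX ξ (A.ghostAlg 𝕜 b c)) = 0 := by
  refine CochainAlg.ext fun q k X Y => ?_
  rw [iY_apply, A.iX_ghostAlg_eq_zero b ξ c (q + 1) k (by omega)]
  rfl

theorem Connection.parity_iX_ghostAlg (A : B.Connection) (ξ : B.gaugeAlg) (c : ι) :
    parity (iX ξ (A.ghostAlg 𝕜 b c)) = iX ξ (A.ghostAlg 𝕜 b c) := by
  have h := iX_parity ξ (A.ghostAlg 𝕜 b c)
  have h2 : parity (A.ghostAlg 𝕜 b c) = -A.ghostAlg 𝕜 b c := A.isOdd_ghostAlg b c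
  rw [h2, map_neg, neg_inj] at h
  exact h.symm

variable [Fintype ι]

/-- Cartan's formula for `D`, and the contraction of `½[θ, θ]`: its two terms agree by the
antisymmetry of the structure constants, since the contracted ghost is an even function. -/
theorem Connection.iX_curv (A : B.Connection) (ξ : B.gaugeAlg) (c : ι) :
    iX ξ ((B.dga 𝕜).curv (structConst 𝕜 b) (A.alg 𝕜 b + A.ghostAlg 𝕜 b) c) =
      lieX ξ (A.alg 𝕜 b c + A.ghostAlg 𝕜 b c) - D (iX ξ (A.ghostAlg 𝕜 b c)) +
        ∑ x, ∑ y, structConst 𝕜 b x y c •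
          (iX ξ (A.ghostAlg 𝕜 b x) * (A.alg 𝕜 b y + A.ghostAlg 𝕜 b y)) := by
  have : CompleteSpace EG := FiniteDimensional.complete ℝ EG
  have : LieGroup 𝓘(ℝ, EG) (minSmoothness ℝ 3) G := by
    simpa using LieGroup.of_le (I := 𝓘(ℝ, EG)) (G := G) (m := 3) (n := ∞) (by norm_cast)
  set θ : ι → B.Alg 𝕜 := A.alg 𝕜 b + A.ghostAlg 𝕜 b with hθ
  have hodd : ∀ x, parity (θ x) = -θ x := (A.isOdd_alg b).add (A.isOdd_ghostAlg b)
  let g : ι → B.Alg 𝕜 := fun x => iX ξ (A.ghostAlg 𝕜 b x)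
  have hi : ∀ x, iX ξ (θ x) = g x := fun x => by
    rw [hθ, Pi.add_apply, map_add, A.iX_alg, zero_add]
  have hcomm : ∀ x y, θ x * g y = g y * θ x := fun x y =>
    ((supercomm_aux (g y) (θ x)).1 (A.parity_iX_ghostAlg b ξ y)).symm
  have h1 : iX ξ (SuperDGA.br (structConst 𝕜 b) θ θ c) =
      (2 : 𝕜) • ∑ x, ∑ y, structConst 𝕜 b x y c • (g x * θ y) := by
    have e1 : iX ξ (SuperDGA.br (structConst 𝕜 b) θ θ c) =
        ∑ x, ∑ y, structConst 𝕜 b x y c • (g x * θ y) -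
          ∑ x, ∑ y, structConst 𝕜 b x y c • (g y * θ x) := by
      simp only [SuperDGA.br, map_sum, map_smul, iX_mul, hi, hodd, smul_add, Finset.sum_add_distrib,
        neg_mul, smul_neg, Finset.sum_neg_distrib, sub_eq_add_neg, hcomm]
    have e2 : ∑ x, ∑ y, structConst 𝕜 b x y c • (g y * θ x) =
        -∑ x, ∑ y, structConst 𝕜 b x y c • (g x * θ y) := by
      rw [Finset.sum_comm, ← Finset.sum_neg_distrib]
      refine Finset.sum_congr rfl fun x _ => ?_
      rw [← Finset.sum_neg_distrib]
      refine Finset.sum_congr rfl fun y _ => ?_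
      rw [structConst_antisymm b y x c, neg_smul]
    rw [e1, e2, two_smul, sub_neg_eq_add]
  rw [SuperDGA.curv, map_add, map_smul, h1, smul_smul, dga_D, iX_D, hi,
    show (1 / 2 : 𝕜) * 2 = 1 by norm_num, one_smul]
  rfl

/-- The curvature of `A + ω` has no component of positive ghost degree. -/
theorem Connection.iX_curv_eq_zero (A : B.Connection) (ξ : B.gaugeAlg) (c : ι) :
    iX ξ ((B.dga 𝕜).curv (structConst 𝕜 b) (A.alg 𝕜 b + A.ghostAlg 𝕜 b) c) = 0 := by
  rw [A.iX_curv]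
  set θ : ι → B.Alg 𝕜 := A.alg 𝕜 b + A.ghostAlg 𝕜 b with hθ
  let g : ι → B.Alg 𝕜 := fun x => iX ξ (A.ghostAlg 𝕜 b x)
  change lieX ξ (θ c) - D (g c) + ∑ x, ∑ y, structConst 𝕜 b x y c • (g x * θ y) = 0
  have hgθ : ∀ x y q k X Y, (g x * θ y) q k X Y = component 𝕜 b x (A.eval ξ) * θ y q k X Y :=
    fun x y q k X Y => by
    rw [function_mul_apply (fun Z => A.iY_iX_ghostAlg b ξ Z x) (fun η => A.iX_iX_ghostAlg b ξ η x)
      (A.parity_iX_ghostAlg b ξ x), A.iX_ghostAlg_apply]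
  -- One identity settles both possible bidegrees: the curvature of `A` vanishes on `(ξ, W)` because
  -- `ξ` is vertical. Bidegree `(1, 0)` takes an arbitrary field `W`, bidegree `(0, 1)` a gauge
  -- field, the ghost being `A` evaluated on it.
  have key : ∀ (W : VField EP P) (p : P), ((ξ : VField EP P).deriv (component 𝕜 b c (A.eval W)) p -
      component 𝕜 b c (A.eval ⁅(ξ : VField EP P), W⁆) p) -
      W.deriv (component 𝕜 b c (A.eval ξ)) p + ∑ x, ∑ y, structConst 𝕜 b x y c *
        (component 𝕜 b x (A.eval ξ) p * component 𝕜 b y (A.eval W) p) = 0 := fun W p => by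
    have h1 := deriv_component (𝕜 := 𝕜) b c (A.eval W) (ξ : VField EP P) p
    have h2 := deriv_component (𝕜 := 𝕜) b c (A.eval ξ) W p
    have h3 := A.curvature_vertical b (ξ := (ξ : VField EP P)) ξ.2.1 W p
    have h4 := coord_lieBr (𝕜 := 𝕜) b (A.eval (ξ : VField EP P) p) (A.eval W p) c
    have h5 : ∑ x, ∑ y, structConst 𝕜 b x y c *
        (component 𝕜 b x (A.eval ξ) p * component 𝕜 b y (A.eval W) p) =
        ((b.coord c (lieBr (EG := EG) G (A.eval (ξ : VField EP P) p) (A.eval W p)) : ℝ) : 𝕜) := by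
      rw [h4]
      refine Finset.sum_congr rfl fun x _ => Finset.sum_congr rfl fun y _ => ?_
      change _ * (((b.repr (A.eval (ξ : VField EP P) p) x : ℝ) : 𝕜) *
        ((b.coord y (A.eval W p) : ℝ) : 𝕜)) = _
      ring
    rw [h1, h2, h5, h3]
    change (((b.coord c _ : ℝ) : 𝕜) - ((b.coord c (A.eval ⁅(ξ : VField EP P), W⁆ p) : ℝ) : 𝕜)) -
      _ + _ = 0
    have h6 := (b.coord c).map_sub (A.eval ⁅(ξ : VField EP P), W⁆ p +
      modelDeriv (E := EP) (A.eval (ξ : VField EP P)) p (W p))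
      (lieBr (EG := EG) G (A.eval (ξ : VField EP P) p) (A.eval W p))
    have h7 := (b.coord c).map_add (A.eval ⁅(ξ : VField EP P), W⁆ p)
      (modelDeriv (E := EP) (A.eval (ξ : VField EP P)) p (W p))
    have h8 := congrArg (fun r : ℝ => (r : 𝕜)) (h6.trans (congrArg (· - _) h7))
    refine (congrArg (fun z : 𝕜 => z - _ - _ + _) h8).trans ?_
    simp only [RCLike.ofReal_sub, RCLike.ofReal_add]
    ring
  have hzero : ∀ q k : ℕ, ¬(q = 1 ∧ k = 0) → ¬(q = 0 ∧ k = 1) → ∀ y, (θ y).1 q k = 0 :=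
    fun q k h1 h2 y => by
    rw [hθ, Pi.add_apply, val_add, Pi.add_apply, Pi.add_apply, A.alg_eq_zero b y q k h1,
      A.ghostAlg_eq_zero b y q k h2, add_zero]
  have hDzero : ∀ q k : ℕ, ¬(q = 1 ∧ k = 0) → ¬(q = 0 ∧ k = 1) → (D (g c)).1 q k = 0 :=
    fun q k h1 h2 => by
    rw [D_val]
    match q, k, h1, h2 with
    | 0, 0, _, _ => rfl
    | 0, k + 1, _, h2 =>
      change B.sP 0 k ((g c).1 0 k) = 0
      rw [A.iX_ghostAlg_eq_zero b ξ c 0 k (by omega), map_zero]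
    | q + 1, 0, h1, _ =>
      change B.dP q 0 ((g c).1 q 0) = 0
      rw [A.iX_ghostAlg_eq_zero b ξ c q 0 (by omega), map_zero]
    | q + 1, k + 1, _, _ =>
      change B.sP (q + 1) k ((g c).1 (q + 1) k) + B.dP q (k + 1) ((g c).1 q (k + 1)) = 0
      rw [A.iX_ghostAlg_eq_zero b ξ c q (k + 1) (by omega),
        A.iX_ghostAlg_eq_zero b ξ c (q + 1) k (by omega), map_zero, map_zero, add_zero]
  ext q k X Y p
  have hsplit : (lieX ξ (θ c) - D (g c) + ∑ x, ∑ y, structConst 𝕜 b x y c • (g x * θ y)) q k X Y p =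
      lieX ξ (θ c) q k X Y p - D (g c) q k X Y p + ∑ x, ∑ y, structConst 𝕜 b x y c *
        (component 𝕜 b x (A.eval ξ) p * θ y q k X Y p) := by
    change evalPt 𝕜 q k X Y p
      (lieX ξ (θ c) - D (g c) + ∑ x, ∑ y, structConst 𝕜 b x y c • (g x * θ y)) = _
    simp only [map_add, map_sub, map_sum, map_smul, smul_eq_mul]
    refine congrArg _ (Finset.sum_congr rfl fun x _ => Finset.sum_congr rfl fun y _ => ?_)
    change _ * (g x * θ y) q k X Y p = _
    rw [hgθ]
    rfl
  rw [hsplit]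
  change _ = (0 : 𝕜)
  by_cases h1 : q = 1 ∧ k = 0
  · obtain ⟨rfl, rfl⟩ := h1
    have hθ1 : ∀ (y) (X : Fin 0 → B.gaugeAlg) (Y : Fin 1 → VField EP P),
        θ y 1 0 X Y = component 𝕜 b y (A.eval (Y 0)) := fun y X Y => by
      rw [hθ, Pi.add_apply, val_add]
      exact add_zero _
    have e1 : lieX ξ (θ c) 1 0 X Y p = (ξ : VField EP P).deriv (component 𝕜 b c (A.eval (Y 0))) p -
        component 𝕜 b c (A.eval ⁅(ξ : VField EP P), Y 0⁆) p := by
      rw [lieX_apply, Fin.sum_univ_zero, sub_zero]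
      change (ξ : VField EP P).deriv (θ c 1 0 X Y) p -
        (∑ i : Fin 1, θ c 1 0 X (Function.update Y i ⁅(ξ : VField EP P), Y i⁆)) p = _
      rw [Fin.sum_univ_one, hθ1, hθ1, Function.update_self]
    have e2 : D (g c) 1 0 X Y p = (Y 0).deriv (component 𝕜 b c (A.eval ξ)) p := by
      rw [D_val]
      change (∑ i : Fin 1, (-1 : ℤ) ^ (i : ℕ) • (Y i).deriv ((g c) 0 0 X (i.removeNth Y)) +
        bracketSum ((g c) 0 0 X) Y) p = _
      rw [Fin.sum_univ_one, A.iX_ghostAlg_apply]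
      simp [bracketSum]
    rw [e1, e2]
    simp only [hθ1]
    exact key (Y 0) p
  · by_cases h2 : q = 0 ∧ k = 1
    · obtain ⟨rfl, rfl⟩ := h2
      have hθ1 : ∀ (y) (X : Fin 1 → B.gaugeAlg) (Y : Fin 0 → VField EP P),
          θ y 0 1 X Y = component 𝕜 b y (A.eval (X 0 : VField EP P)) := fun y X Y => by
        rw [hθ, Pi.add_apply, val_add]
        exact (zero_add _).trans (A.ghostAlg_apply b y X Y)
      have e1 : lieX ξ (θ c) 0 1 X Y p =
          (ξ : VField EP P).deriv (component 𝕜 b c (A.eval (X 0 : VField EP P))) p -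
          component 𝕜 b c (A.eval ⁅(ξ : VField EP P), (X 0 : VField EP P)⁆) p := by
        rw [lieX_apply, Fin.sum_univ_one, hθ1, Function.update_self]
        change (ξ : VField EP P).deriv (θ c 0 1 X Y) p -
          (∑ i : Fin 0, θ c 0 1 X (Function.update Y i ⁅(ξ : VField EP P), Y i⁆)) p - _ = _
        rw [Fin.sum_univ_zero, hθ1]
        exact congrArg (· - _) (sub_zero _)
      have e2 : D (g c) 0 1 X Y p = (X 0 : VField EP P).deriv (component 𝕜 b c (A.eval ξ)) p := by
        rw [D_val]
        change ((-1 : ℤ) ^ 0 • (∑ i : Fin 1, (-1 : ℤ) ^ (i : ℕ) • lieD 0 (X i : VField EP P)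
          ((g c) 0 0 (i.removeNth X)) + bracketSum ((g c) 0 0) X) Y) p = _
        rw [Fin.sum_univ_one]
        simp only [bracketSum, lieD]
        simp [g, A.iX_ghostAlg_apply]
      rw [e1, e2]
      simp only [hθ1]
      exact key (X 0) p
    · rw [lieX_eq_zero ξ (hzero q k h1 h2 c), hDzero q k h1 h2]
      simp only [hzero q k h1 h2]
      simp

theorem GhostLE.of_iX {f : B.Alg 𝕜} (h : ∀ ξ, iX ξ f = 0) : GhostLE 0 f := fun q k hk => by
  obtain ⟨k, rfl⟩ := Nat.exists_eq_succ_of_ne_zero hk.ne'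
  funext X Y
  have h1 : iX (X 0) f q k (Fin.tail X) Y = 0 := by rw [h]; rfl
  have h2 := apply_cons_eq_zero h1
  rwa [Fin.cons_self_tail] at h2

theorem Connection.ghostLE_curv_ghost (A : B.Connection) (c : ι) :
    GhostLE 0 ((B.dga 𝕜).curv (structConst 𝕜 b) (A.alg 𝕜 b + A.ghostAlg 𝕜 b) c) :=
  GhostLE.of_iX fun ξ => A.iX_curv_eq_zero b ξ c

theorem Connection.ghostLE_alg (A : B.Connection) (c : ι) : GhostLE 0 (A.alg 𝕜 b c) :=
  fun q k hk => A.alg_eq_zero b c q k (by omega)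

end RussianFormula

/-- The affine combination of two connections. -/
def Connection.affine (A A' : B.Connection) (t : ℝ) : B.Connection where
  form p := A.form p + t • (A'.form p - A.form p)
  smooth Y := by
    have h : ContMDiff (M' := EG) 𝓘(ℝ, EP) 𝓘(ℝ, EG) ∞
        (A.eval Y + t • (A'.eval Y - A.eval Y) : C^∞⟮𝓘(ℝ, EP), P; 𝓘(ℝ, EG), EG⟯) :=
      ContMDiffMap.contMDiff _
    exact h
  form_fundamental p v := by
    rw [LinearMap.add_apply, LinearMap.smul_apply, LinearMap.sub_apply, A.form_fundamental,
      A'.form_fundamental, sub_self, smul_zero, add_zero]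
  equivariant p g v := by
    rw [LinearMap.add_apply, LinearMap.smul_apply, LinearMap.sub_apply, A.equivariant,
      A'.equivariant]
    let T : GroupLieAlgebra 𝓘(ℝ, EG) G →ₗ[ℝ] GroupLieAlgebra 𝓘(ℝ, EG) G :=
      (AdL EG g⁻¹ : EG →L[ℝ] EG).toLinearMap
    change T _ + t • (T _ - T _) = T _
    rw [← map_sub, ← map_smul, ← map_add]
    rfl

/-- The affine path between two connections consists of connections, so the Russian formula applies
at each of its points. -/
theorem Connection.alg_affine {ι : Type*} (b : Module.Basis ι ℝ (GroupLieAlgebra 𝓘(ℝ, EG) G))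
    (A A' : B.Connection) (t : ℝ) :
    (A.affine A' t).alg 𝕜 b = A.alg 𝕜 b + (t : 𝕜) • (A'.alg 𝕜 b - A.alg 𝕜 b) := by
  funext c
  refine ext_val ?_
  funext q k
  by_cases h : q = 1 ∧ k = 0
  · obtain ⟨rfl, rfl⟩ := h
    funext X Y
    ext p
    change ((b.coord c (A.form p (Y 0 p) + t • (A'.form p (Y 0 p) - A.form p (Y 0 p))) : ℝ) : 𝕜) =
      ((b.coord c (A.form p (Y 0 p)) : ℝ) : 𝕜) + (t : 𝕜) *
        (((b.coord c (A'.form p (Y 0 p)) : ℝ) : 𝕜) - ((b.coord c (A.form p (Y 0 p)) : ℝ) : 𝕜))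
    rw [map_add, map_smul, map_sub, smul_eq_mul, RCLike.ofReal_add, RCLike.ofReal_mul,
      RCLike.ofReal_sub]
  · rw [(A.affine A' t).alg_eq_zero b c q k h]
    funext X Y
    ext p
    change (0 : 𝕜) = (A.alg 𝕜 b c).1 q k X Y p + (t : 𝕜) *
      ((A'.alg 𝕜 b c).1 q k X Y p - (A.alg 𝕜 b c).1 q k X Y p)
    rw [A.alg_eq_zero b c q k h, A'.alg_eq_zero b c q k h]
    simp

end PrincipalBundle

end

end BRS

namespace BRS

noncomputable section

/-! ### Pointwise dependence of tensorial expressions -/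

section Tensoriality

variable {E : Type*} [NormedAddCommGroup E] [NormedSpace ℝ E] [FiniteDimensional ℝ E]
  {N : Type*} [TopologicalSpace N] [ChartedSpace E N] [IsManifold 𝓘(ℝ, E) ∞ N] [T2Space N]
  {𝕜 : Type*} [RCLike 𝕜]

/-- The value of a smooth-linear function of vector fields at a point depends only on the value of
the vector field at this point. -/
theorem VField.map_apply_eq_zero (T : VField E N →ₗ[SmoothFun E N ℝ] SmoothFun E N 𝕜)
    {W : VField E N} {p : N} (hW : W p = 0) : T W p = 0 := by
  let t := trivializationAt E (TangentSpace 𝓘(ℝ, E) : N → Type _) p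
  let b := Module.finBasis ℝ E
  let ρ : SmoothBumpFunction 𝓘(ℝ, E) p := Classical.arbitrary _
  have hbase : t.baseSet = (chartAt E p).source := rfl
  let ρ' : SmoothFun E N ℝ := ⟨ρ, ρ.contMDiff⟩
  let e : Fin (Module.finrank ℝ E) → VField E N := fun i =>
    ⟨fun q => ρ q • t.localFrame b i q,
      ContMDiffOn.smul_section_of_tsupport ρ.contMDiff.contMDiffOn t.open_baseSet
        (hbase ▸ ρ.tsupport_subset_chartAt_source) (t.contMDiffOn_localFrame_baseSet ∞ b i)⟩
  let c : Fin (Module.finrank ℝ E) → SmoothFun E N ℝ := fun i =>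
    ⟨fun q => ρ q • t.localFrameCoeff 𝓘(ℝ, E) b i q (W q), ρ.contMDiff_smul
      (contMDiffOn_baseSet_localFrameCoeff b (e := t) W.contMDiff.contMDiffOn i)⟩
  -- The square of `ρ` appears because one factor extends the local frame to global fields and the
  -- other one extends the coefficients of `W`. All coefficient functions in this splitting vanish
  -- at `p`.
  have hsplit : W = (1 - ρ' * ρ') • W + ∑ i, c i • e i := by
    ext q
    have hs : (∑ i, c i • e i : VField E N) q = ∑ i, c i q • e i q := by
      have := map_sum (ContMDiffSection.coeAddHom 𝓘(ℝ, E) E ∞ (TangentSpace 𝓘(ℝ, E) : N → Type _))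
        (fun i => c i • e i) Finset.univ
      exact (congrFun this q).trans (Finset.sum_apply _ _ _)
    have h2 : (∑ i, c i • e i : VField E N) q = (ρ q * ρ q) • W q := by
      rw [hs]
      by_cases hq : q ∈ t.baseSet
      · have h3 : W q = ∑ i, t.localFrameCoeff 𝓘(ℝ, E) b i q (W q) • t.localFrame b i q :=
          Bundle.Trivialization.eq_sum_localFrameCoeff_smul (I := 𝓘(ℝ, E)) (e := t) (b := b) (s := W) hq
        conv_rhs => rw [h3, Finset.smul_sum]
        refine Finset.sum_congr rfl fun i _ => ?_
        change (ρ q • t.localFrameCoeff 𝓘(ℝ, E) b i q (W q)) • ρ q • t.localFrame b i q = _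
        rw [smul_eq_mul, smul_smul, smul_smul]
        congr 1
        ring
      · have h4 : ρ q = 0 := by
          by_contra h
          exact hq (ρ.support_subset_source h)
        refine (Finset.sum_eq_zero fun i _ => ?_).trans (by rw [h4, mul_zero, zero_smul])
        have hc : c i q = 0 := by
          change ρ q • t.localFrameCoeff 𝓘(ℝ, E) b i q (W q) = 0
          rw [h4, zero_smul]
        rw [hc, zero_smul]
    change W q = (1 - ρ q * ρ q) • W q + (∑ i, c i • e i : VField E N) q
    rw [h2, ← add_smul, sub_add_cancel, one_smul]
  rw [hsplit, map_add, map_smul, map_sum]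
  have h0 : (1 - ρ' * ρ') p = 0 := by
    change 1 - ρ p * ρ p = 0
    rw [ρ.eq_one]; norm_num
  have hc : ∀ i, c i p = 0 := fun i => by
    change ρ p • t.localFrameCoeff 𝓘(ℝ, E) b i p (W p) = 0
    rw [hW, map_zero, smul_zero]
  change ((1 - ρ' * ρ') p) • T W p + (∑ i, T (c i • e i)) p = 0
  have h5 : (∑ i, T (c i • e i)) p = ∑ i, T (c i • e i) p := by
    have := map_sum (ContMDiffMap.coeFnAddMonoidHom (I := 𝓘(ℝ, E)) (N := N) (I' := 𝓘(ℝ, 𝕜))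
      (G := 𝕜) (n := ∞)) (fun i => T (c i • e i)) Finset.univ
    exact (congrFun this p).trans (Finset.sum_apply _ _ _)
  rw [h0, zero_smul, zero_add, h5]
  refine Finset.sum_eq_zero fun i _ => ?_
  rw [map_smul]
  change c i p • T (e i) p = 0
  rw [hc, zero_smul]

end Tensoriality

section LocallyConstant

variable {E : Type*} [NormedAddCommGroup E] [NormedSpace ℝ E]
  {N : Type*} [TopologicalSpace N] [ChartedSpace E N] [IsManifold 𝓘(ℝ, E) ∞ N]
  {F : Type*} [NormedAddCommGroup F] [NormedSpace ℝ F]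

theorem isLocallyConstant_of_mfderiv_eq_zero {f : N → F} (hf : ContMDiff 𝓘(ℝ, E) 𝓘(ℝ, F) ∞ f)
    (h : ∀ p, modelDeriv (E := E) f p = 0) : IsLocallyConstant f := by
  rw [IsLocallyConstant.iff_eventually_eq]
  intro p
  set χ := extChartAt 𝓘(ℝ, E) p with hχ
  have ht : IsOpen χ.target := isOpen_extChartAt_target p
  have hs : ContMDiffOn 𝓘(ℝ, E) 𝓘(ℝ, E) ∞ χ.symm χ.target := contMDiffOn_extChartAt_symm p
  have hd : ∀ y ∈ χ.target, MDifferentiableAt 𝓘(ℝ, E) 𝓘(ℝ, E) χ.symm y := fun y hy =>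
    (hs.contMDiffAt (ht.mem_nhds hy)).mdifferentiableAt (by simp)
  obtain ⟨r, hr, hball⟩ := Metric.isOpen_iff.1 ht (χ p) (mem_extChartAt_target p)
  have hdiff : DifferentiableOn ℝ (f ∘ χ.symm) (Metric.ball (χ p) r) := fun y hy =>
    ((hf.mdifferentiableAt (by simp)).comp y (hd y (hball hy))).differentiableAt.differentiableWithinAt
  have hzero : Set.EqOn (fderiv ℝ (f ∘ χ.symm)) 0 (Metric.ball (χ p) r) := fun y hy => by
    have h1 := mfderiv_comp (I' := 𝓘(ℝ, E)) y (hf.mdifferentiableAt (x := χ.symm y) (by simp))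
      (hd y (hball hy))
    rw [mfderiv_eq_fderiv] at h1
    ext v
    exact (congrArg (fun T : E →L[ℝ] F => T v) h1).trans
      (congrArg (fun T : E →L[ℝ] F => T (mfderiv 𝓘(ℝ, E) 𝓘(ℝ, E) χ.symm y v)) (h (χ.symm y)))
  filter_upwards [extChartAt_source_mem_nhds (I := 𝓘(ℝ, E)) p,
    (continuousAt_extChartAt (I := 𝓘(ℝ, E)) p) (Metric.ball_mem_nhds _ hr)] with q hq hq2
  have := Metric.isOpen_ball.is_const_of_fderiv_eq_zero
    (convex_ball (χ p) r).isPreconnected hdiff hzero hq2 (Metric.mem_ball_self hr)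
  exact (congrArg f (χ.left_inv hq)).symm.trans
    (this.trans (congrArg f (χ.left_inv (mem_extChartAt_source p))))

end LocallyConstant

/-! ### Fibres, local sections and lifts of vector fields -/

namespace PrincipalBundle

variable
    {EM : Type*} [NormedAddCommGroup EM] [NormedSpace ℝ EM] [FiniteDimensional ℝ EM]
    {M : Type*} [TopologicalSpace M] [ChartedSpace EM M] [IsManifold 𝓘(ℝ, EM) ∞ M] [T2Space M]
    {EG : Type*} [NormedAddCommGroup EG] [NormedSpace ℝ EG] [FiniteDimensional ℝ EG]
    {G : Type*} [TopologicalSpace G] [T2Space G]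
    [ChartedSpace EG G] [Group G] [LieGroup 𝓘(ℝ, EG) ∞ G]
    {EP : Type*} [NormedAddCommGroup EP] [NormedSpace ℝ EP] [FiniteDimensional ℝ EP]
    {P : Type*} [TopologicalSpace P] [ChartedSpace EP P] [IsManifold 𝓘(ℝ, EP) ∞ P] [T2Space P]
    (B : PrincipalBundle EM M EG G EP P) {𝕜 : Type*} [RCLike 𝕜]

/-- Functions with zero derivative along the fundamental vector fields are invariant. -/
theorem apply_act_of_deriv_fundField [ConnectedSpace G] {h : SmoothFun EP P 𝕜}
    (hd : ∀ v, (B.fundField v).deriv h = 0) (p : P) (g : G) : h (B.act p g) = h p := by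
  have hc : ContMDiff 𝓘(ℝ, EG) 𝓘(ℝ, 𝕜) ∞ fun g : G => h (B.act p g) :=
    h.contMDiff.comp (B.contMDiff_act_left p)
  have hl : IsLocallyConstant fun g : G => h (B.act p g) := by
    refine isLocallyConstant_of_mfderiv_eq_zero hc fun g => ?_
    ext w
    have e : (fun x : G => h (B.act p x)) = fun x => h (B.act (B.act p g) (g⁻¹ * x)) := by
      funext x
      rw [← B.act_mul, mul_inv_cancel_left]
    have hc' : ContMDiff 𝓘(ℝ, EG) 𝓘(ℝ, 𝕜) ∞ fun x : G => h (B.act (B.act p g) x) :=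
      h.contMDiff.comp (B.contMDiff_act_left _)
    have h1 := modelDeriv_comp (E := EG) (g := fun x : G => h (B.act (B.act p g) x))
      (h := fun x : G => g⁻¹ * x) (x := g) (y := 1) (hc'.mdifferentiableAt (by simp))
      ((contMDiff_mul_left (I := 𝓘(ℝ, EG)) (n := ∞) (a := g⁻¹)).mdifferentiableAt (by simp))
      (inv_mul_cancel g) w
    rw [e]
    refine h1.trans ?_
    let v : EG := mfderiv 𝓘(ℝ, EG) 𝓘(ℝ, EG) (fun x : G => g⁻¹ * x) g w
    refine (B.modelDeriv_fundamental h.contMDiff (B.act p g) v).symm.trans ?_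
    exact congrArg (fun a : SmoothFun EP P 𝕜 => a (B.act p g)) (hd v)
  have := hl.apply_eq_of_isPreconnected isPreconnected_univ (Set.mem_univ g) (Set.mem_univ 1)
  rwa [B.act_one] at this

theorem exists_act_eq {p q : P} (h : B.proj p = B.proj q) : ∃ g, B.act p g = q := by
  obtain ⟨U, e, hU, hm, hs, ht, he, hes, hp⟩ := B.locally_trivial (B.proj p)
  have hps : p ∈ e.source := by rw [hs]; exact hm
  have hqs : q ∈ e.source := by rw [hs, Set.mem_preimage, ← h]; exact hm
  refine ⟨(e p).2⁻¹ * (e q).2, e.injOn ?_ hqs ?_⟩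
  · rw [hs, Set.mem_preimage, B.proj_act]; exact hm
  · rw [(hp p hps).2, mul_inv_cancel_left, h, ← (hp q hqs).1]

/-- Local sections. -/
theorem exists_local_section (m : M) : ∃ σ : M → P, ContMDiffAt 𝓘(ℝ, EM) 𝓘(ℝ, EP) ∞ σ m ∧
    ∀ᶠ x in 𝓝 m, B.proj (σ x) = x := by
  obtain ⟨U, e, hU, hm, hs, ht, he, hes, hp⟩ := B.locally_trivial m
  have hmt : ((m, 1) : M × G) ∈ e.target := by rw [ht]; exact ⟨hm, Set.mem_univ _⟩
  refine ⟨fun x => e.symm (x, 1), ?_, ?_⟩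
  · exact (hes.contMDiffAt (e.open_target.mem_nhds hmt)).comp m
      (contMDiffAt_id.prodMk contMDiffAt_const)
  · filter_upwards [hU.mem_nhds hm] with x hx
    have hxt : ((x, 1) : M × G) ∈ e.target := by rw [ht]; exact ⟨hx, Set.mem_univ _⟩
    rw [← (hp _ (e.map_target hxt)).1, e.right_inv hxt]

theorem proj_surjective : Function.Surjective B.proj := fun m => by
  obtain ⟨σ, -, h⟩ := B.exists_local_section m
  exact ⟨σ m, h.self_of_nhds⟩

/-- The vector field `Y` on `P` lifts the vector field `Z` on `M`. -/
def IsLift (Y : VField EP P) (Z : VField EM M) : Prop :=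
  ∀ p, mfderiv 𝓘(ℝ, EP) 𝓘(ℝ, EM) B.proj p (Y p) = Z (B.proj p)

/-- The lifts of a vector at a given point form an affine, hence convex, set, so local lifts can be
glued by a partition of unity; this uses that `P` is σ-compact. Locally, transport `(Z, 0)` through
a trivialisation. -/
theorem exists_lift [SigmaCompactSpace P] (Z : VField EM M) : ∃ Y, B.IsLift Y Z := by
  refine exists_contMDiffSection_forall_mem_convex_of_local 𝓘(ℝ, EP)
    (TangentSpace 𝓘(ℝ, EP) : P → Type _)
    (fun p => {v | mfderiv 𝓘(ℝ, EP) 𝓘(ℝ, EM) B.proj p v = Z (B.proj p)}) (fun p => ?_) fun p₀ => ?_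
  · intro x hx y hy a c _ _ hac
    change mfderiv 𝓘(ℝ, EP) 𝓘(ℝ, EM) B.proj p (a • x + c • y) = Z (B.proj p)
    rw [map_add, map_smul, map_smul, hx, hy, ← add_smul, hac, one_smul]
  · obtain ⟨U, e, hU, hm, hs, ht, he, hes, hp⟩ := B.locally_trivial (B.proj p₀)
    have hp₀ : p₀ ∈ e.source := by rw [hs]; exact hm
    have hsplit : ∀ q ∈ e.source, e q = (B.proj q, (e q).2) := fun q hq =>
      Prod.ext (hp q hq).1 rfl
    let s : ∀ q : P, TangentSpace 𝓘(ℝ, EP) q := fun q =>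
      (mfderivWithin (𝓘(ℝ, EM).prod 𝓘(ℝ, EG)) 𝓘(ℝ, EP) e.symm e.target (B.proj q, (e q).2)
        ((Z (B.proj q), 0) : EM × EG) : EP)
    refine ⟨e.source, e.open_source.mem_nhds hp₀, s, ?_, ?_⟩
    · have : IsManifold (𝓘(ℝ, EM).prod 𝓘(ℝ, EG)) (∞ + 1) (M × G) := by
        simpa using (inferInstance : IsManifold (𝓘(ℝ, EM).prod 𝓘(ℝ, EG)) ∞ (M × G))
      have : IsManifold 𝓘(ℝ, EM) (∞ + 1) M := by simpa
      have : IsManifold 𝓘(ℝ, EG) (∞ + 1) G := by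
        simpa using (inferInstance : IsManifold 𝓘(ℝ, EG) ∞ G)
      have : IsManifold 𝓘(ℝ, EP) (∞ + 1) P := by simpa
      have h1 : ContMDiffOn (𝓘(ℝ, EM).prod 𝓘(ℝ, EG)).tangent 𝓘(ℝ, EP).tangent ∞
          (tangentMapWithin (𝓘(ℝ, EM).prod 𝓘(ℝ, EG)) 𝓘(ℝ, EP) e.symm e.target) _ :=
        hes.contMDiffOn_tangentMapWithin (m := ∞) (by simp) e.open_target.uniqueMDiffOn
      let F₂ : (TangentBundle 𝓘(ℝ, EM) M × TangentBundle 𝓘(ℝ, EG) G) →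
          TangentBundle (𝓘(ℝ, EM).prod 𝓘(ℝ, EG)) (M × G) :=
        (equivTangentBundleProd 𝓘(ℝ, EM) M 𝓘(ℝ, EG) G).symm
      have S₂ : ContMDiff (𝓘(ℝ, EM).tangent.prod 𝓘(ℝ, EG).tangent)
          (𝓘(ℝ, EM).prod 𝓘(ℝ, EG)).tangent ∞ F₂ := contMDiff_equivTangentBundleProd_symm
      have h2 : ContMDiffOn 𝓘(ℝ, EP) (𝓘(ℝ, EM).tangent.prod 𝓘(ℝ, EG).tangent) ∞
          (fun q : P => ((⟨B.proj q, Z (B.proj q)⟩ : TangentBundle 𝓘(ℝ, EM) M),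
            (⟨(e q).2, 0⟩ : TangentBundle 𝓘(ℝ, EG) G))) e.source :=
        (Z.contMDiff.comp B.contMDiff_proj).contMDiffOn.prodMk
          ((contMDiff_zeroSection ℝ (TangentSpace 𝓘(ℝ, EG) : G → Type _)).comp_contMDiffOn (contMDiff_snd.comp_contMDiffOn he))
      have h3 := h1.comp (S₂.comp_contMDiffOn h2) (fun q hq => by
        change (B.proj q, (e q).2) ∈ e.target
        rw [← hsplit q hq]
        exact e.map_source hq)
      refine h3.congr fun q hq => ?_
      refine Bundle.TotalSpace.ext ?_ (heq_of_eq rfl)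
      change q = e.symm (B.proj q, (e q).2)
      rw [← hsplit q hq, e.left_inv hq]
    · intro q hq
      have hqt : (B.proj q, (e q).2) ∈ e.target := by
        rw [← hsplit q hq]; exact e.map_source hq
      have hq' : e.symm (B.proj q, (e q).2) = q := by rw [← hsplit q hq, e.left_inv hq]
      have hd : MDifferentiableAt (𝓘(ℝ, EM).prod 𝓘(ℝ, EG)) 𝓘(ℝ, EP) e.symm (B.proj q, (e q).2) :=
        (hes.contMDiffAt (e.open_target.mem_nhds hqt)).mdifferentiableAt (by simp)
      have h1 := mfderiv_comp_of_eq (I' := 𝓘(ℝ, EP)) (g := B.proj) (f := e.symm)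
        (x := (B.proj q, (e q).2)) (y := q) (B.contMDiff_proj.mdifferentiableAt (by simp)) hd hq'
      have h2 : B.proj ∘ e.symm =ᶠ[𝓝 (B.proj q, (e q).2)] Prod.fst := by
        filter_upwards [e.open_target.mem_nhds hqt] with x hx
        rw [Function.comp_apply, ← (hp _ (e.map_target hx)).1, e.right_inv hx]
      rw [h2.mfderiv_eq, mfderiv_fst, hq'] at h1
      have h3 := congrArg (fun T : EM × EG →L[ℝ] EM => T (Z (B.proj q), 0)) h1
      have h4 : mfderivWithin (𝓘(ℝ, EM).prod 𝓘(ℝ, EG)) 𝓘(ℝ, EP) e.symm e.target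
          (B.proj q, (e q).2) = mfderiv (𝓘(ℝ, EM).prod 𝓘(ℝ, EG)) 𝓘(ℝ, EP) e.symm
          (B.proj q, (e q).2) := mfderivWithin_of_mem_nhds (e.open_target.mem_nhds hqt)
      change mfderiv 𝓘(ℝ, EP) 𝓘(ℝ, EM) B.proj q (mfderivWithin (𝓘(ℝ, EM).prod 𝓘(ℝ, EG)) 𝓘(ℝ, EP)
        e.symm e.target (B.proj q, (e q).2) ((Z (B.proj q), 0) : EM × EG) : EP) = Z (B.proj q)
      rw [h4]
      exact h3.symm

end PrincipalBundle

end

end BRS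

namespace BRS

noncomputable section

namespace PrincipalBundle

variable
    {EM : Type*} [NormedAddCommGroup EM] [NormedSpace ℝ EM] [FiniteDimensional ℝ EM]
    {M : Type*} [TopologicalSpace M] [ChartedSpace EM M] [IsManifold 𝓘(ℝ, EM) ∞ M] [T2Space M]
    {EG : Type*} [NormedAddCommGroup EG] [NormedSpace ℝ EG] [FiniteDimensional ℝ EG]
    {G : Type*} [TopologicalSpace G] [T2Space G]
    [ChartedSpace EG G] [Group G] [LieGroup 𝓘(ℝ, EG) ∞ G]
    {EP : Type*} [NormedAddCommGroup EP] [NormedSpace ℝ EP] [FiniteDimensional ℝ EP]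
    {P : Type*} [TopologicalSpace P] [ChartedSpace EP P] [IsManifold 𝓘(ℝ, EP) ∞ P] [T2Space P]
    {B : PrincipalBundle EM M EG G EP P} {𝕜 : Type*} [RCLike 𝕜]

open CochainAlg

/-! ### Calculus of lifted vector fields -/

section Lifts

variable (B) in
/-- The pullback of functions from `M` to `P`. -/
def pullFun : SmoothFun EM M 𝕜 →+ SmoothFun EP P 𝕜 where
  toFun φ := ⟨fun p => φ (B.proj p), φ.contMDiff.comp B.contMDiff_proj⟩
  map_zero' := rfl
  map_add' _ _ := rfl

theorem deriv_pullFun_apply (φ : SmoothFun EM M 𝕜) (Y : VField EP P) (p : P) :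
    Y.deriv (B.pullFun φ) p = mvfderiv 𝓘(ℝ, EM) φ (B.proj p)
      (mfderiv 𝓘(ℝ, EP) 𝓘(ℝ, EM) B.proj p (Y p)) :=
  modelDeriv_comp (E := EP) (g := φ) (h := B.proj) (φ.contMDiff.mdifferentiableAt (by simp))
    (B.contMDiff_proj.mdifferentiableAt (by simp)) rfl (Y p)

theorem IsLift.deriv_pullFun {Y : VField EP P} {Z : VField EM M} (h : B.IsLift Y Z)
    (φ : SmoothFun EM M 𝕜) : Y.deriv (B.pullFun φ) = B.pullFun (Z.deriv φ) := by
  ext p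
  rw [deriv_pullFun_apply]
  exact congrArg (mvfderiv 𝓘(ℝ, EM) φ (B.proj p)) (h p)

theorem isLift_of_deriv {Y : VField EP P} {Z : VField EM M}
    (h : ∀ φ : SmoothFun EM M ℝ, Y.deriv (B.pullFun φ) = B.pullFun (Z.deriv φ)) :
    B.IsLift Y Z := fun p => by
  rw [← sub_eq_zero]
  refine tangent_eq_zero fun φ => ?_
  have h1 := congrArg (fun a : SmoothFun EP P ℝ => a p) (h φ)
  have h2 := deriv_pullFun_apply (B := B) φ Y p
  rw [map_sub, sub_eq_zero]
  exact h2.symm.trans h1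

/-- A field lifts another if and only if their actions on pulled back functions correspond, and this
condition passes to commutators. -/
theorem IsLift.bracket {Y Y' : VField EP P} {Z Z' : VField EM M} (h : B.IsLift Y Z)
    (h' : B.IsLift Y' Z') : B.IsLift ⁅Y, Y'⁆ ⁅Z, Z'⁆ := isLift_of_deriv fun φ => by
  simp only [VField.bracket_deriv, h.deriv_pullFun, h'.deriv_pullFun, map_sub]

theorem IsLift.add {Y Y' : VField EP P} {Z Z' : VField EM M} (h : B.IsLift Y Z)
    (h' : B.IsLift Y' Z') : B.IsLift (Y + Y') (Z + Z') := fun p =>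
  (map_add (mfderiv 𝓘(ℝ, EP) 𝓘(ℝ, EM) B.proj p) (Y p) (Y' p)).trans (congrArg₂ _ (h p) (h' p))

theorem IsLift.smul {Y : VField EP P} {Z : VField EM M} (h : B.IsLift Y Z)
    (φ : SmoothFun EM M ℝ) : B.IsLift (B.pullFun φ • Y) (φ • Z) := fun p =>
  (map_smul (mfderiv 𝓘(ℝ, EP) 𝓘(ℝ, EM) B.proj p) (φ (B.proj p)) (Y p)).trans
    (congrArg (φ (B.proj p) • ·) (h p))

variable [SigmaCompactSpace P]

variable (B) in
/-- A lift of a vector field on `M`. -/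
def lift (Z : VField EM M) : VField EP P := (B.exists_lift Z).choose

theorem isLift_lift (Z : VField EM M) : B.IsLift (B.lift Z) Z := (B.exists_lift Z).choose_spec

end Lifts

/-! ### Horizontal cochains -/

section Horizontal

theorem iY_apply_eq_zero {W : VField EP P} {p : P} (hW : W p = 0) (x : B.Alg 𝕜) (q k : ℕ)
    (X : Fin k → B.gaugeAlg) (Y : Fin q → VField EP P) : iY W x q k X Y p = 0 :=
  let h := x.2.altY (q + 1) k X
  VField.map_apply_eq_zero
    { toFun := fun Z => x (q + 1) k X (Fin.cons Z Y)
      map_add' := fun Z Z' => h.map_cons_add Z Z' Y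
      map_smul' := fun φ Z => h.map_cons_smul φ Z Y } hW

/-- Cochains that are annihilated by a space of vector fields at a point depend only on the
classes of their arguments. -/
theorem apply_congr {S : AddSubgroup (VField EP P)} {p : P} (x : B.Alg 𝕜)
    (hx : ∀ W ∈ S, ∀ q k X Y, iY W x q k X Y p = 0) (q k : ℕ) (X : Fin k → B.gaugeAlg)
    (Y Y' : Fin q → VField EP P) (h : ∀ i, Y i - Y' i ∈ S) : x q k X Y p = x q k X Y' p := by
  induction q generalizing x with
  | zero => rw [Subsingleton.elim Y Y']
  | succ q ih =>
    have h1 : x (q + 1) k X Y =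
        x (q + 1) k X (Fin.cons (Y 0 - Y' 0) (Fin.tail Y)) + iY (Y' 0) x q k X (Fin.tail Y) := by
      rw [iY_apply, ← (x.2.altY (q + 1) k X).map_cons_add, sub_add_cancel, Fin.cons_self_tail]
    have h2 := ih (iY (Y' 0) x) (fun W hW q k X V => by
      rw [iY_apply, iY_apply, (x.2.altY (q + 1 + 1) k X).map_cons_swap]
      have := hx W hW (q + 1) k X (Fin.cons (Y' 0) V)
      rw [iY_apply] at this
      exact neg_eq_zero.2 this) (Fin.tail Y) (Fin.tail Y') (fun i => h i.succ)
    rw [h1]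
    refine (congrArg₂ (· + ·) (hx _ (h 0) q k X (Fin.tail Y)) h2).trans ?_
    rw [zero_add, iY_apply, Fin.cons_self_tail]

/-- Cochains that are annihilated by the fundamental vector fields. -/
def IsHor (x : B.Alg 𝕜) : Prop := ∀ v, iY (B.fundField v) x = 0

/-- At `p` the difference of two arguments with the same projection is a fundamental vector. By
tensoriality the field may be replaced by the corresponding fundamental field, whose contraction
with `x` is zero. -/
theorem IsHor.congr {x : B.Alg 𝕜} (hx : IsHor x) {p : P} {q k : ℕ} (X : Fin k → B.gaugeAlg)
    {Y Y' : Fin q → VField EP P} (h : ∀ i, mfderiv 𝓘(ℝ, EP) 𝓘(ℝ, EM) B.proj p (Y i p) =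
      mfderiv 𝓘(ℝ, EP) 𝓘(ℝ, EM) B.proj p (Y' i p)) : x q k X Y p = x q k X Y' p := by
  let T := mfderiv 𝓘(ℝ, EP) 𝓘(ℝ, EM) B.proj p
  let ev : VField EP P →+ TangentSpace 𝓘(ℝ, EM) (B.proj p) :=
    { toFun := fun W => T (W p)
      map_zero' := map_zero T
      map_add' := fun W W' => map_add T (W p) (W' p) }
  refine apply_congr (S := ev.ker) x (fun W hW q k X Y => ?_) q k X Y Y' fun i => ?_
  · obtain ⟨v, hv⟩ := B.exists_fundamental_eq (p := p) (x := W p) hW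
    have h1 : (W - B.fundField v) p = 0 := sub_eq_zero.2 hv.symm
    have h2 := iY_apply_eq_zero h1 x q k X Y
    have h3 : iY (B.fundField v) x q k X Y = 0 := by rw [hx v]; rfl
    have h4 : iY W x q k X Y = iY (W - B.fundField v) x q k X Y + iY (B.fundField v) x q k X Y := by
      rw [iY_apply, iY_apply, iY_apply, ← (x.2.altY (q + 1) k X).map_cons_add, sub_add_cancel]
    rw [h4, h3, add_zero, h2]
  · rw [AddMonoidHom.mem_ker, map_sub, sub_eq_zero]
    exact h i

theorem IsHor.apply_update_vertical {x : B.Alg 𝕜} (hx : IsHor x) {q k : ℕ}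
    (X : Fin k → B.gaugeAlg) (Y : Fin q → VField EP P) (i : Fin q) {V : VField EP P}
    (hV : B.IsLift V 0) : x q k X (Function.update Y i V) = 0 := by
  ext p
  have h1 : x q k X (Function.update Y i V) p = x q k X (Function.update Y i 0) p := by
    refine hx.congr X fun j => ?_
    by_cases hj : j = i
    · subst hj
      rw [Function.update_self, Function.update_self, hV p]
      exact (map_zero _).symm
    · rw [Function.update_of_ne hj, Function.update_of_ne hj]
  rw [h1, (x.2.altY q k X).map_coord_zero i (Function.update_self _ _ _)]

/-- On lifts, vertical Lie derivatives reduce to derivatives of the values. -/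
theorem IsHor.lieD_apply {x : B.Alg 𝕜} (hx : IsHor x) {V : VField EP P} (hV : B.IsLift V 0)
    {q k : ℕ} (X : Fin k → B.gaugeAlg) {Y : Fin q → VField EP P} {Z : Fin q → VField EM M}
    (hY : ∀ i, B.IsLift (Y i) (Z i)) : lieD q V (x q k X) Y = V.deriv (x q k X Y) := by
  change V.deriv (x q k X Y) - ∑ i, x q k X (Function.update Y i ⁅V, Y i⁆) = _
  rw [Finset.sum_eq_zero fun i _ => ?_, sub_zero]
  refine hx.apply_update_vertical X Y i ?_
  have := hV.bracket (hY i)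
  rwa [zero_lie] at this

theorem isLift_fundField (v : GroupLieAlgebra 𝓘(ℝ, EG) G) : B.IsLift (B.fundField v) 0 :=
  fun p => B.proj_fundamental p v

theorem isLift_gauge (X : B.gaugeAlg) : B.IsLift (X : VField EP P) 0 := X.2.1

theorem IsHor.d {x : B.Alg 𝕜} (hx : IsHor x) (hl : ∀ v, lieY (B.fundField v) x = 0) :
    IsHor (CochainAlg.d x) := fun v => by
  rw [iY_d, hx v, hl v, map_zero, sub_zero]

theorem IsHor.sHom {x : B.Alg 𝕜} (hx : IsHor x) : IsHor (sHom x) := fun v => by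
  rw [iY_sHom (fun X => bracket_gauge_fundField X v), hx v, map_zero, neg_zero]

/-- Brackets of a fundamental field with lifts are vertical, so on lifts the vanishing Lie
derivative of `x` is just the derivative of its value. -/
theorem IsHor.deriv_eq_zero {x : B.Alg 𝕜} (hx : IsHor x) (hl : ∀ v, lieY (B.fundField v) x = 0)
    {q k : ℕ} (X : Fin k → B.gaugeAlg) {Y : Fin q → VField EP P} {Z : Fin q → VField EM M}
    (hY : ∀ i, B.IsLift (Y i) (Z i)) (v : GroupLieAlgebra 𝓘(ℝ, EG) G) :
    (B.fundField v).deriv (x q k X Y) = 0 := by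
  rw [← hx.lieD_apply (isLift_fundField v) X hY]
  have : lieY (B.fundField v) x q k X Y = 0 := by rw [hl v]; rfl
  exact this

end Horizontal

/-! ### Descent of basic cochains to the base -/

section Pullback

variable {q k : ℕ}

theorem IsPullback.apply_lift {c : RawCochain EM M 𝕜 B.gaugeAlg q k}
    {f : RawCochain EP P 𝕜 B.gaugeAlg q k} (h : B.IsPullback c f) (X : Fin k → B.gaugeAlg)
    {Y : Fin q → VField EP P} {Z : Fin q → VField EM M} (hY : ∀ i, B.IsLift (Y i) (Z i)) :
    f X Y = B.pullFun (c X Z) := by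
  ext p
  exact h X Y Z p fun i => (hY i p).symm

theorem IsPullback.add {c c' : RawCochain EM M 𝕜 B.gaugeAlg q k}
    {f f' : RawCochain EP P 𝕜 B.gaugeAlg q k} (h : B.IsPullback c f) (h' : B.IsPullback c' f') :
    B.IsPullback (c + c') (f + f') := fun X Y Z p hZ =>
  congrArg₂ (fun a b : 𝕜 => a + b) (h X Y Z p hZ) (h' X Y Z p hZ)

theorem IsPullback.sub {c c' : RawCochain EM M 𝕜 B.gaugeAlg q k}
    {f f' : RawCochain EP P 𝕜 B.gaugeAlg q k} (h : B.IsPullback c f) (h' : B.IsPullback c' f') :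
    B.IsPullback (c - c') (f - f') := fun X Y Z p hZ =>
  congrArg₂ (fun a b : 𝕜 => a - b) (h X Y Z p hZ) (h' X Y Z p hZ)

variable (B 𝕜 q k) in
theorem isPullback_zero : B.IsPullback (0 : RawCochain EM M 𝕜 B.gaugeAlg q k) 0 :=
  fun _ _ _ _ _ => rfl

theorem pullFun_injective : Function.Injective (B.pullFun (𝕜 := 𝕜)) := fun φ ψ h => by
  ext m
  obtain ⟨p, rfl⟩ := B.proj_surjective m
  exact congrArg (fun a : SmoothFun EP P 𝕜 => a p) h

theorem isLift_update {Y : Fin q → VField EP P} {Z : Fin q → VField EM M}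
    (hY : ∀ i, B.IsLift (Y i) (Z i)) (i : Fin q) {y : VField EP P} {z : VField EM M}
    (h : B.IsLift y z) (j : Fin q) :
    B.IsLift (Function.update Y i y j) (Function.update Z i z j) := by
  by_cases hj : j = i
  · subst hj
    rwa [Function.update_self, Function.update_self]
  · rw [Function.update_of_ne hj, Function.update_of_ne hj]
    exact hY j

variable [SigmaCompactSpace P]

theorem isPullback_of_lift {x : B.Alg 𝕜} (hx : IsHor x) {c : RawCochain EM M 𝕜 B.gaugeAlg q k}
    (h : ∀ X Z, x q k X (fun i => B.lift (Z i)) = B.pullFun (c X Z)) :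
    B.IsPullback c (x.1 q k) := fun X Y Z p hZ => by
  have h1 : x q k X Y p = x q k X (fun i => B.lift (Z i)) p :=
    hx.congr X fun i => (hZ i).symm.trans (isLift_lift (Z i) p).symm
  rw [h1, h]
  rfl

/-- Vector fields on `M` have lifts and the projection is surjective, so the values on lifts
determine the cochain. -/
theorem IsPullback.unique {c c' : RawCochain EM M 𝕜 B.gaugeAlg q k}
    {f : RawCochain EP P 𝕜 B.gaugeAlg q k} (h : B.IsPullback c f) (h' : B.IsPullback c' f) :
    c = c' := by
  funext X Z
  ext m
  obtain ⟨p, rfl⟩ := B.proj_surjective m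
  exact congrArg (fun a : SmoothFun EP P 𝕜 => a p)
    ((h.apply_lift X fun i => isLift_lift (Z i)).symm.trans
      (h'.apply_lift X fun i => isLift_lift (Z i)))

/-- The identities are checked upstairs, where pulling back functions is injective. The chosen lifts
need not depend linearly on the field, but a sum or multiple of lifts is also a lift and gives the
same value. -/
theorem IsPullback.mem_CM {c : RawCochain EM M 𝕜 B.gaugeAlg q k}
    {f : RawCochain EP P 𝕜 B.gaugeAlg q k} (h : B.IsPullback c f) (hf : f ∈ B.CP 𝕜 q k) :
    c ∈ B.CM 𝕜 q k := by
  obtain ⟨h1, h2⟩ := mem_cochains_iff.1 hf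
  refine mem_cochains_iff.2 ⟨fun X => ?_, fun Z => ?_⟩
  · refine ⟨{ toFun := c X, map_update_add' := ?_, map_update_smul' := ?_,
              map_eq_zero_of_eq' := ?_ }, fun _ => rfl⟩
    · intro inst Z i z z'
      rw [Subsingleton.elim inst (instDecidableEqFin _)]
      have hZ := fun i => isLift_lift (B := B) (Z i)
      refine pullFun_injective (B := B) ?_
      rw [map_add, ← h.apply_lift X (isLift_update hZ i (isLift_lift z)),
        ← h.apply_lift X (isLift_update hZ i (isLift_lift z')),
        ← h.apply_lift X (isLift_update hZ i ((isLift_lift z).add (isLift_lift z')))]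
      exact (h1 X).map_update_add _ i _ _
    · intro inst Z i φ z
      rw [Subsingleton.elim inst (instDecidableEqFin _)]
      have hZ := fun i => isLift_lift (B := B) (Z i)
      refine pullFun_injective (B := B) ?_
      have h3 : ∀ ψ : SmoothFun EM M 𝕜, B.pullFun (φ • ψ) = B.pullFun φ • B.pullFun ψ :=
        fun _ => rfl
      refine Eq.trans ?_ (h3 _).symm
      rw [← h.apply_lift X (isLift_update hZ i (isLift_lift z)),
        ← h.apply_lift X (isLift_update hZ i ((isLift_lift z).smul φ))]
      exact (h1 X).map_update_smul _ i _ _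
    · intro Z i j hij hne
      refine pullFun_injective (B := B) ?_
      rw [map_zero, ← h.apply_lift X (fun i => isLift_lift (Z i))]
      exact (h1 X).map_eq_zero _ hne (congrArg B.lift hij)
  · have key : ∀ X, B.pullFun (c X Z) = f X fun i => B.lift (Z i) := fun X =>
      (h.apply_lift X fun i => isLift_lift (Z i)).symm
    refine ⟨{ toFun := fun X => c X Z, map_update_add' := ?_, map_update_smul' := ?_,
              map_eq_zero_of_eq' := ?_ }, fun _ => rfl⟩
    · intro inst X i ξ ξ'
      rw [Subsingleton.elim inst (instDecidableEqFin _)]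
      refine pullFun_injective (B := B) ?_
      rw [map_add, key, key, key]
      exact (h2 _).map_update_add X i ξ ξ'
    · intro inst X i r ξ
      rw [Subsingleton.elim inst (instDecidableEqFin _)]
      refine pullFun_injective (B := B) ?_
      have h3 : ∀ ψ : SmoothFun EM M 𝕜, B.pullFun (r • ψ) = r • B.pullFun ψ := fun _ => rfl
      refine Eq.trans ?_ (h3 _).symm
      rw [key, key]
      exact (h2 _).map_update_smul X i r ξ
    · intro X i j hij hne
      refine pullFun_injective (B := B) ?_
      rw [map_zero, key]
      exact (h2 _).map_eq_zero X hne hij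

/-- Basic cochains descend to `M`. -/
theorem IsHor.exists_isPullback [ConnectedSpace G] {x : B.Alg 𝕜} (hx : IsHor x)
    (hl : ∀ v, lieY (B.fundField v) x = 0) (q k : ℕ) :
    ∃ c : RawCochain EM M 𝕜 B.gaugeAlg q k, B.IsPullback c (x.1 q k) := by
  have key : ∀ (X : Fin k → B.gaugeAlg) (Z : Fin q → VField EM M), ∃ c : SmoothFun EM M 𝕜,
      x q k X (fun i => B.lift (Z i)) = B.pullFun c := fun X Z => by
    set φ := x q k X (fun i => B.lift (Z i)) with hφ
    have hfib : ∀ p p', B.proj p = B.proj p' → φ p = φ p' := fun p p' h => by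
      obtain ⟨g, rfl⟩ := B.exists_act_eq h
      exact (B.apply_act_of_deriv_fundField
        (hx.deriv_eq_zero hl X fun i => isLift_lift (Z i)) p g).symm
    -- An arbitrary set-theoretic section is enough: `φ` is constant on fibres, so the composite
    -- agrees near each point with the one for a smooth local section and is therefore smooth.
    choose σ hσ using B.proj_surjective
    have hs : ContMDiff 𝓘(ℝ, EM) 𝓘(ℝ, 𝕜) ∞ fun m => φ (σ m) := fun m => by
      obtain ⟨τ, hτ, hτ'⟩ := B.exists_local_section m
      refine (φ.contMDiff.contMDiffAt.comp m hτ).congr_of_eventuallyEq ?_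
      filter_upwards [hτ'] with y hy
      exact hfib _ _ ((hσ y).trans hy.symm)
    exact ⟨⟨fun m => φ (σ m), hs⟩, ContMDiffMap.ext fun p => hfib _ _ (hσ _).symm⟩
  choose c hc using key
  exact ⟨c, isPullback_of_lift hx hc⟩

theorem bracketSum_pullFun {c : RawCochain EM M 𝕜 B.gaugeAlg q k}
    {f : RawCochain EP P 𝕜 B.gaugeAlg q k} (h : B.IsPullback c f) (X : Fin k → B.gaugeAlg)
    {Y : Fin (q + 1) → VField EP P} {Z : Fin (q + 1) → VField EM M}
    (hY : ∀ i, B.IsLift (Y i) (Z i)) :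
    bracketSum (f X) Y = B.pullFun (bracketSum (c X) Z) := by
  cases q with
  | zero => rfl
  | succ q =>
    rw [bracketSum_map]
    simp only [bracketSum]
    refine Finset.sum_congr rfl fun i _ => Finset.sum_congr rfl fun j _ => congrArg _ ?_
    refine h.apply_lift X fun l => ?_
    refine Fin.cases ?_ (fun l => ?_) l
    · exact (hY _).bracket (hY _)
    · exact hY _

/-- Evaluated on lifts, derivatives and brackets on `P` correspond to those on `M`, term by term. -/
theorem IsPullback.d {x : B.Alg 𝕜} (hx : IsHor x) (hl : ∀ v, lieY (B.fundField v) x = 0)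
    {c : RawCochain EM M 𝕜 B.gaugeAlg q k} (h : B.IsPullback c (x.1 q k)) :
    B.IsPullback (B.dM q k c) (B.dP q k (x.1 q k)) := by
  refine isPullback_of_lift (hx.d hl) fun X Z => ?_
  rw [d_apply_succ]
  have hY := fun i => isLift_lift (B := B) (Z i)
  change _ = B.pullFun (∑ i : Fin (q + 1), (-1 : ℤ) ^ (i : ℕ) • (Z i).deriv (c X (i.removeNth Z)) +
    bracketSum (c X) Z)
  rw [map_add, map_sum, ← bracketSum_pullFun h X hY]
  refine congrArg (· + _) (Finset.sum_congr rfl fun i _ => ?_)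
  rw [map_zsmul, ← (hY i).deriv_pullFun]
  exact congrArg (fun a => (-1 : ℤ) ^ (i : ℕ) • (B.lift (Z i)).deriv a)
    (h.apply_lift X (Y := i.removeNth fun i => B.lift (Z i)) (fun j => hY (i.succAbove j)))

/-- Gauge fields lift the zero field, so their Lie derivatives annihilate the values, which are
pulled back functions. What remains is the bracket part, the coboundary of the trivial module. -/
theorem IsPullback.s {x : B.Alg 𝕜} (hx : IsHor x)
    {c : RawCochain EM M 𝕜 B.gaugeAlg q k} (h : B.IsPullback c (x.1 q k)) :
    B.IsPullback (B.sM q k c) (B.sP q k (x.1 q k)) := by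
  rw [← sHom_apply_succ]
  refine isPullback_of_lift hx.sHom fun X Z => ?_
  rw [sHom_apply_succ]
  have hY := fun i => isLift_lift (B := B) (Z i)
  let Y := fun i => B.lift (Z i)
  let ev := Pi.evalAddMonoidHom (fun _ : Fin q → VField EP P => SmoothFun EP P 𝕜) Y
  let ev' := Pi.evalAddMonoidHom (fun _ : Fin q → VField EM M => SmoothFun EM M 𝕜) Z
  change ev ((-1 : ℤ) ^ q • (∑ i : Fin (k + 1), (-1 : ℤ) ^ (i : ℕ) • lieD q (X i : VField EP P)
    (x q k (i.removeNth X)) + bracketSum (x q k) X)) = (B.pullFun.comp ev') ((-1 : ℤ) ^ q •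
      (∑ i : Fin (k + 1), (-1 : ℤ) ^ (i : ℕ) • (0 : RawForm EM M 𝕜 q) + bracketSum c X))
  simp only [map_zsmul, map_add, map_sum, smul_zero, Finset.sum_const_zero, zero_add,
    bracketSum_map]
  have h0 : ∀ (ξ : B.gaugeAlg) (X : Fin k → B.gaugeAlg),
      ev (lieD q (ξ : VField EP P) (x q k X)) = 0 := fun ξ X => by
    refine (hx.lieD_apply (isLift_gauge ξ) X hY).trans ?_
    rw [h.apply_lift X hY, (isLift_gauge ξ).deriv_pullFun, VField.zero_deriv, map_zero]
  have h1 : (fun X => ev (x q k X)) = fun X => (B.pullFun.comp ev') (c X) :=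
    funext fun X => h.apply_lift X hY
  simp only [h0, smul_zero, Finset.sum_const_zero, zero_add, h1]

end Pullback

end PrincipalBundle

end

end BRS

namespace BRS

noncomputable section

/-! ### Cohomology `s` mod `d` in terms of the total differential -/

section ModCohomology

variable {C : ℕ → ℕ → Type*} [∀ q k, AddCommGroup (C q k)] [∀ q k, Module ℝ (C q k)]
  {S : ∀ q k, Submodule ℝ (C q k)} (d : ∀ q k, C q k →ₗ[ℝ] C (q + 1) k)
  (s : ∀ q k, C q k →ₗ[ℝ] C q (k + 1))

/-- The component of bidegree `(q, k + 1)` of `(s + d) z`. -/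
def totalComp (z : ∀ q k, C q k) : ∀ q k, C q (k + 1)
  | 0, k => s 0 k (z 0 k)
  | q + 1, k => s (q + 1) k (z (q + 1) k) + d q (k + 1) (z q (k + 1))

variable {d s} {z : ∀ q k, C q k}

theorem mem_modCocycles (hz : ∀ q k, z q k ∈ S q k) {q k : ℕ}
    (h : totalComp d s z q k = 0) :
    z q k ∈ modCocycles S d s q k := by
  cases q with
  | zero => exact ⟨hz 0 k, h⟩
  | succ q =>
    -- Membership asks for `s f` itself as a value of `d`, hence the sign in front of the component
    -- that solves `s f + d g = 0`.
    exact ⟨hz (q + 1) k, -z q (k + 1), neg_mem (hz q (k + 1)),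
      (map_neg _ _).trans (neg_eq_of_add_eq_zero_left h)⟩

theorem totalComp_mem_modCoboundaries (hz : ∀ q k, z q k ∈ S q k) (q k : ℕ) :
    totalComp d s z q k ∈ modCoboundaries S d s q (k + 1) := by
  cases q with
  | zero => exact ⟨z 0 k, hz 0 k, rfl⟩
  | succ q =>
    exact Submodule.add_mem_sup ⟨_, hz (q + 1) k, rfl⟩ ⟨_, hz q (k + 1), rfl⟩

theorem modClass_eq {q k : ℕ} {f g : C q k} (hf : f ∈ modCocycles S d s q k)
    (hg : g ∈ modCocycles S d s q k) (h : f - g ∈ modCoboundaries S d s q k) :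
    modClass S d s f hf = modClass S d s g hg :=
  (Submodule.Quotient.eq _).2 h

end ModCohomology

namespace PrincipalBundle

variable
    {EM : Type*} [NormedAddCommGroup EM] [NormedSpace ℝ EM] [FiniteDimensional ℝ EM]
    {M : Type*} [TopologicalSpace M] [ChartedSpace EM M] [IsManifold 𝓘(ℝ, EM) ∞ M] [T2Space M]
    {EG : Type*} [NormedAddCommGroup EG] [NormedSpace ℝ EG] [FiniteDimensional ℝ EG]
    {G : Type*} [TopologicalSpace G] [T2Space G]
    [ChartedSpace EG G] [Group G] [LieGroup 𝓘(ℝ, EG) ∞ G]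
    {EP : Type*} [NormedAddCommGroup EP] [NormedSpace ℝ EP] [FiniteDimensional ℝ EP]
    {P : Type*} [TopologicalSpace P] [ChartedSpace EP P] [IsManifold 𝓘(ℝ, EP) ∞ P] [T2Space P]
    {B : PrincipalBundle EM M EG G EP P} {𝕜 : Type*} [RCLike 𝕜]

open CochainAlg

theorem totalComp_val (x : B.Alg 𝕜) (q k : ℕ) :
    totalComp B.dP B.sP x.1 q k = (D x).1 q (k + 1) := by
  rw [D_val]
  cases q <;> rfl

/-- The cocycle condition in bidegree `(q, k)` is the component of `D x` of ghost degree `k + 1`,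
which exceeds `m`. -/
theorem mem_ZP {m q k : ℕ} {x : B.Alg 𝕜} (hx : GhostLE m (D x)) (hk : m ≤ k) :
    x.1 q k ∈ B.ZP 𝕜 q k :=
  mem_modCocycles x.2 ((totalComp_val x q k).trans (hx q (k + 1) (by omega)))

/-- The components of `r` in bidegrees `(q, k - 1)` and `(q - 1, k)` exhibit the difference as a
coboundary. The strict inequality makes `k` positive and makes the error term vanish in ghost degree
`k`. -/
theorem classP_eq {m q k : ℕ} {x y r : B.Alg 𝕜} (hr : GhostLE m (D r - (x - y))) (hk : m < k)
    (hx : x.1 q k ∈ B.ZP 𝕜 q k) (hy : y.1 q k ∈ B.ZP 𝕜 q k) : B.classP hx = B.classP hy := by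
  obtain ⟨k, rfl⟩ := Nat.exists_eq_succ_of_ne_zero (by omega : k ≠ 0)
  refine modClass_eq hx hy ?_
  have h : (D r).1 q (k + 1) - (x.1 q (k + 1) - y.1 q (k + 1)) = 0 := hr q (k + 1) hk
  rw [← sub_eq_zero.1 h, ← totalComp_val]
  exact totalComp_mem_modCoboundaries r.2 q k

/-- Cochains that are annihilated by the contractions with and the Lie derivatives along the
fundamental vector fields. -/
def IsBasic (x : B.Alg 𝕜) : Prop := IsHor x ∧ ∀ v, lieY (B.fundField v) x = 0

variable [SigmaCompactSpace P]

theorem IsBasic.isPullback_totalComp {x : B.Alg 𝕜} (hx : IsBasic x)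
    {c : ∀ q k, RawCochain EM M 𝕜 B.gaugeAlg q k} (h : ∀ q k, B.IsPullback (c q k) (x.1 q k))
    (q k : ℕ) : B.IsPullback (totalComp B.dM B.sM c q k) ((D x).1 q (k + 1)) := by
  rw [← totalComp_val]
  cases q with
  | zero => exact (h 0 k).s hx.1
  | succ q => exact ((h (q + 1) k).s hx.1).add ((h q (k + 1)).d hx.1 hx.2)

/-- On `M` the total differential of the descended family pulls back to a vanishing component of `D
x`, so it vanishes by uniqueness. -/
theorem IsBasic.mem_ZM {m q k : ℕ} {x : B.Alg 𝕜} (hx : IsBasic x)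
    {c : ∀ q k, RawCochain EM M 𝕜 B.gaugeAlg q k} (h : ∀ q k, B.IsPullback (c q k) (x.1 q k))
    (hD : GhostLE m (D x)) (hk : m ≤ k) : c q k ∈ B.ZM 𝕜 q k := by
  refine mem_modCocycles (S := B.CM 𝕜) (fun q k => (h q k).mem_CM (x.2 q k)) ?_
  have h1 := hx.isPullback_totalComp h q k
  rw [hD q (k + 1) (by omega)] at h1
  exact h1.unique (B.isPullback_zero 𝕜 q (k + 1))

/-- For the coboundary to exist on `M`, the primitive `r` must be basic itself, so that its
components descend. -/
theorem IsBasic.classM_eq [ConnectedSpace G] {m q k : ℕ} {x y r : B.Alg 𝕜} (hb : IsBasic r)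
    (hr : GhostLE m (D r - (x - y))) (hk : m < k) {c c' : RawCochain EM M 𝕜 B.gaugeAlg q k}
    (h : B.IsPullback c (x.1 q k)) (h' : B.IsPullback c' (y.1 q k))
    (hc : c ∈ B.ZM 𝕜 q k) (hc' : c' ∈ B.ZM 𝕜 q k) : B.classM hc = B.classM hc' := by
  obtain ⟨k, rfl⟩ := Nat.exists_eq_succ_of_ne_zero (by omega : k ≠ 0)
  refine modClass_eq hc hc' ?_
  choose e he using fun q k => hb.1.exists_isPullback hb.2 q k
  have h1 : (D r).1 q (k + 1) - (x.1 q (k + 1) - y.1 q (k + 1)) = 0 := hr q (k + 1) hk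
  have h2 := hb.isPullback_totalComp he q k
  rw [sub_eq_zero.1 h1] at h2
  rw [(h.sub h').unique h2]
  exact totalComp_mem_modCoboundaries (S := B.CM 𝕜) (fun q k => (he q k).mem_CM (r.2 q k)) q k

end PrincipalBundle

end

end BRS

/-! ### Ghost degrees of the transgressions and the squares comparing them -/

namespace BRS

noncomputable section

theorem SuperDGA.IsConn.sub {𝕜 A : Type*} [Field 𝕜] [Ring A] [Algebra 𝕜 A] {ι : Type*} [Fintype ι]
    {f : ι → ι → ι → 𝕜} {i L : A →ₗ[𝕜] A} {v : ι → 𝕜} {θ θ' : ι → A} (h : IsConn f i L v θ)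
    (h' : IsConn f i L v θ') : IsTensorial f i L v (θ - θ') where
  i_eq a := by rw [Pi.sub_apply, map_sub, h.i_eq, h'.i_eq, sub_self]
  L_eq c := by
    rw [Pi.sub_apply, map_sub, h.L_eq, h'.L_eq]
    simp only [adj, Pi.sub_apply, smul_sub, Finset.sum_sub_distrib]
    abel

theorem SuperDGA.IsTensorial.zero {𝕜 A : Type*} [Field 𝕜] [Ring A] [Algebra 𝕜 A] {ι : Type*}
    [Fintype ι] {f : ι → ι → ι → 𝕜} {i L : A →ₗ[𝕜] A} {v : ι → 𝕜} :
    IsTensorial f i L v (0 : ι → A) where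
  i_eq a := map_zero i
  L_eq c := by
    rw [Pi.zero_apply, map_zero]
    simp only [adj, Pi.zero_apply, smul_zero, Finset.sum_const_zero, neg_zero]

namespace PrincipalBundle

variable
    {EM : Type*} [NormedAddCommGroup EM] [NormedSpace ℝ EM] [FiniteDimensional ℝ EM]
    {M : Type*} [TopologicalSpace M] [ChartedSpace EM M] [IsManifold 𝓘(ℝ, EM) ∞ M] [T2Space M]
    {EG : Type*} [NormedAddCommGroup EG] [NormedSpace ℝ EG] [FiniteDimensional ℝ EG]
    {G : Type*} [TopologicalSpace G] [T2Space G]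
    [ChartedSpace EG G] [Group G] [LieGroup 𝓘(ℝ, EG) ∞ G]
    {EP : Type*} [NormedAddCommGroup EP] [NormedSpace ℝ EP] [FiniteDimensional ℝ EP]
    {P : Type*} [TopologicalSpace P] [ChartedSpace EP P] [IsManifold 𝓘(ℝ, EP) ∞ P] [T2Space P]
    {B : PrincipalBundle EM M EG G EP P} {𝕜 : Type*} [RCLike 𝕜]

open CochainAlg SuperDGA

theorem GhostLE.sub {m : ℕ} {f g : B.Alg 𝕜} (hf : GhostLE m f) (hg : GhostLE m g) :
    GhostLE m (f - g) := fun q k hk => by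
  have h : (f - g).1 q k = f.1 q k - g.1 q k := rfl
  rw [h, hf q k hk, hg q k hk, sub_zero]

variable {ι : Type*} [Fintype ι] [DecidableEq ι]
  (b : Module.Basis ι ℝ (GroupLieAlgebra 𝓘(ℝ, EG) G))

theorem structConst_groupLie_antisymm (x y z : ι) :
    structConst 𝕜 b x y z = -structConst 𝕜 b y x z := by
  have : CompleteSpace EG := FiniteDimensional.complete ℝ EG
  have : LieGroup 𝓘(ℝ, EG) (minSmoothness ℝ 3) G := by
    simpa using LieGroup.of_le (I := 𝓘(ℝ, EG)) (G := G) (m := 3) (n := ∞) (by norm_cast)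
  exact structConst_antisymm b x y z

theorem jacobi_structConst_groupLie : Jacobi (structConst 𝕜 b) := by
  have : CompleteSpace EG := FiniteDimensional.complete ℝ EG
  have : LieGroup 𝓘(ℝ, EG) (minSmoothness ℝ 3) G := by
    simpa using LieGroup.of_le (I := 𝓘(ℝ, EG)) (G := G) (m := 3) (n := ∞) (by norm_cast)
  exact jacobi_structConst b

theorem ghostLE_curv_zero (f : ι → ι → ι → 𝕜) (c : ι) :
    GhostLE 0 ((B.dga 𝕜).curv f 0 c) := by
  have h : (B.dga 𝕜).curv f 0 c = 0 := by
    simp only [curv, br, Pi.zero_apply, map_zero, mul_zero, smul_zero, Finset.sum_const_zero,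
      add_zero]
  rw [h]
  exact GhostLE.zero 0

section Transgressions

variable {n : ℕ} (I : MultilinearMap ℝ (fun _ : Fin n => GroupLieAlgebra 𝓘(ℝ, EG) G) 𝕜)
  (A A' : B.Connection)

/-- The consistent transgression. -/
def Connection.consAlg : B.Alg 𝕜 :=
  (B.dga 𝕜).transgr (structConst 𝕜 b) (formPoly b I) 0 (A.alg 𝕜 b + A.ghostAlg 𝕜 b)

/-- The covariant transgression. -/
def Connection.covAlg : B.Alg 𝕜 :=
  (B.dga 𝕜).transgr (structConst 𝕜 b) (formPoly b I) (A.alg 𝕜 b) (A.ghostAlg 𝕜 b)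

theorem Connection.consAlg_val : (A.consAlg b I).1 = B.Qcons b I A :=
  (transgression_val b I IsOdd.zero ((A.isOdd_alg b).add (A.isOdd_ghostAlg b))).symm

theorem Connection.covAlg_val : (A.covAlg b I).1 = B.Qcov b I A :=
  (transgression_val b I (A.isOdd_alg b) (A.isOdd_ghostAlg b)).symm

/-- The transgression between two connections, both shifted by the ghost, has ghost degree zero. -/
theorem Connection.ghostLE_transgr_alg_add_ghostAlg : GhostLE 0 ((B.dga 𝕜).transgr
    (structConst 𝕜 b) (formPoly b I) (A.alg 𝕜 b + A.ghostAlg 𝕜 b) (A'.alg 𝕜 b - A.alg 𝕜 b)) := by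
  refine (GhostLE.transgr b I ((A.isOdd_alg b).add (A.isOdd_ghostAlg b))
    ((A'.isOdd_alg b).sub (A.isOdd_alg b)) (fun t a => ?_)
    fun a => (A'.ghostLE_alg b a).sub (A.ghostLE_alg b a)).mono (m := (n - 1) * 0) (by simp)
  have h := (A.affine A' t).ghostLE_curv_ghost (𝕜 := 𝕜) b a
  rw [A.alg_affine, (A.affine A' t).ghostAlg_eq b A] at h
  rwa [add_right_comm]

/-- Along a ghost-free path each of the `n - 1` curvature factors has ghost degree at most one. Such
paths form the error edges in the covariant squares, and this is where the bound `k ≥ n` is used for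
the classes. -/
theorem GhostLE.transgr_of_zero {θ η : ι → B.Alg 𝕜} (hθ : (B.dga 𝕜).IsOdd θ)
    (hη : (B.dga 𝕜).IsOdd η) (h : ∀ a, GhostLE 0 (θ a)) (h' : ∀ a, GhostLE 0 (η a)) :
    GhostLE (n - 1) ((B.dga 𝕜).transgr (structConst 𝕜 b) (formPoly b I) θ η) :=
  (GhostLE.transgr b I hθ hη (fun t => GhostLE.curv fun a => (h a).add ((h' a).smul _)) h').mono
    (by simp)

theorem ghostLE_transgr_zero : GhostLE 0 ((B.dga 𝕜).transgr (structConst 𝕜 b) (formPoly b I)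
    (0 : ι → B.Alg 𝕜) 0) := by
  refine (GhostLE.transgr b I IsOdd.zero IsOdd.zero (fun t a => ?_)
    fun a => GhostLE.zero 0).mono (m := (n - 1) * 0) (by simp)
  rw [smul_zero, add_zero]
  exact ghostLE_curv_zero _ a

theorem Connection.ghostLE_peval_curv_ghost : GhostLE 0 ((B.dga 𝕜).peval
    ((B.dga 𝕜).curv (structConst 𝕜 b) (A.alg 𝕜 b + A.ghostAlg 𝕜 b)) (formPoly b I)) :=
  GhostLE.peval b I (curv_even ((A.isOdd_alg b).add (A.isOdd_ghostAlg b))) (A.ghostLE_curv_ghost b)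

/-- The path runs from `0`, with zero curvature, to `A + ω`, whose curvature has no ghosts by the
Russian formula. -/
theorem Connection.ghostLE_D_consAlg (hp : Invariant (structConst 𝕜 b) (formPoly b I)) :
    GhostLE 0 (D (A.consAlg b I)) := by
  have h := D_transgr (S := B.dga 𝕜) (structConst_groupLie_antisymm b) (jacobi_structConst_groupLie b) hp IsOdd.zero
    ((A.isOdd_alg b).add (A.isOdd_ghostAlg b))
  rw [zero_add] at h
  exact h ▸ (A.ghostLE_peval_curv_ghost b I).sub
    (GhostLE.peval b I (curv_even IsOdd.zero) (ghostLE_curv_zero _))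

/-- The path starts at `A`, where each of the `n` curvature factors may contain `sA`. This endpoint
is responsible for the bound `n`. -/
theorem Connection.ghostLE_D_covAlg (hp : Invariant (structConst 𝕜 b) (formPoly b I)) :
    GhostLE n (D (A.covAlg b I)) := by
  have h := D_transgr (S := B.dga 𝕜) (structConst_groupLie_antisymm b) (jacobi_structConst_groupLie b) hp (A.isOdd_alg b) (A.isOdd_ghostAlg b)
  exact h ▸ ((A.ghostLE_peval_curv_ghost b I).mono (Nat.zero_le n)).sub
    ((GhostLE.peval b I (curv_even (A.isOdd_alg b)) (GhostLE.curv (A.ghostLE_alg b))).mono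
      (mul_one n).le)

/-- The square `t(A + ω) + tu(A' - A)`: one edge is the point `0`, two edges are the consistent
transgressions of `A` and `A'`, and the fourth runs from `A + ω` to `A' + ω` through connections
shifted by the ghost, hence in ghost degree zero. -/
theorem Connection.exists_consAlg_sub (hp : Invariant (structConst 𝕜 b) (formPoly b I)) :
    ∃ r : B.Alg 𝕜, GhostLE 0 (D r - (A.consAlg b I - A'.consAlg b I)) := by
  have hw := (A.isOdd_alg (𝕜 := 𝕜) b).add (A.isOdd_ghostAlg b)
  have ha := (A'.isOdd_alg (𝕜 := 𝕜) b).sub (A.isOdd_alg b)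
  have h := D_squareInt (S := B.dga 𝕜) (structConst_groupLie_antisymm b) (jacobi_structConst_groupLie b) hp IsOdd.zero hw IsOdd.zero ha
  refine ⟨(B.dga 𝕜).squareInt (structConst 𝕜 b) (formPoly b I) 0 (A.alg 𝕜 b + A.ghostAlg 𝕜 b) 0
    (A'.alg 𝕜 b - A.alg 𝕜 b), ?_⟩
  have e : A.alg 𝕜 b + A.ghostAlg 𝕜 b + (A'.alg 𝕜 b - A.alg 𝕜 b) =
      A'.alg 𝕜 b + A'.ghostAlg 𝕜 b := by
    rw [A'.ghostAlg_eq b A]; abel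
  rw [zero_add, zero_add, add_zero, e] at h
  rw [← dga_D, h]
  have e2 : ∀ x y z w : B.Alg 𝕜, x - y - (z - w) - (w - z) = x - y := fun x y z w => by abel
  exact (e2 _ _ _ _).symm ▸ (A.ghostLE_transgr_alg_add_ghostAlg b I A').sub
    (ghostLE_transgr_zero b I)

/-- The square `tA + tuω`: the covariant edge runs from `A` to `A + ω`, the consistent edge is the
diagonal from `0` to `A + ω`, one edge is a point, and the remaining one from `0` to `A` contains no
ghosts. -/
theorem Connection.exists_covAlg_sub_consAlg
    (hp : Invariant (structConst 𝕜 b) (formPoly b I)) :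
    ∃ r : B.Alg 𝕜, GhostLE (n - 1) (D r - (A.covAlg b I - A.consAlg b I)) := by
  have h := D_squareInt (S := B.dga 𝕜) (structConst_groupLie_antisymm b) (jacobi_structConst_groupLie b) hp IsOdd.zero (A.isOdd_alg b) IsOdd.zero
    (A.isOdd_ghostAlg b)
  refine ⟨(B.dga 𝕜).squareInt (structConst 𝕜 b) (formPoly b I) 0 (A.alg 𝕜 b) 0
    (A.ghostAlg 𝕜 b), ?_⟩
  rw [zero_add, zero_add, add_zero] at h
  rw [← dga_D, h]
  have e2 : ∀ x y z w : B.Alg 𝕜, x - y - (z - w) - (x - z) = w - y := fun x y z w => by abel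
  exact (e2 _ _ _ _).symm ▸ (GhostLE.transgr_of_zero b I IsOdd.zero (A.isOdd_alg b)
    (fun _ => GhostLE.zero 0) (A.ghostLE_alg b)).sub
      ((ghostLE_transgr_zero b I).mono (Nat.zero_le _))

theorem Connection.isBasic_covAlg (hp : Invariant (structConst 𝕜 b) (formPoly b I)) :
    IsBasic (A.covAlg b I) :=
  forall_and.1 fun v => transgr_basic (contraction_fundField v) (structConst_groupLie_antisymm b) (jacobi_structConst_groupLie b) hp (A.isOdd_alg b)
    (A.isOdd_ghostAlg b) (A.isConn_alg b v) (A.isTensorial_ghostAlg b v)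

/-- The square `A + tω + u(A' - A)`: besides the two covariant edges there is one from `A + ω` to
`A' + ω`, of ghost degree zero, and one from `A` to `A'`, of ghost degree at most `n - 1`. Its
members satisfy the connection conditions and `A' - A` is tensorial, so the primitive is basic and
descends to `M`. -/
theorem Connection.exists_covAlg_sub (hp : Invariant (structConst 𝕜 b) (formPoly b I)) :
    ∃ r : B.Alg 𝕜, IsBasic r ∧
    GhostLE (n - 1) (D r - (A.covAlg b I - A'.covAlg b I)) := by
  have ha := (A'.isOdd_alg (𝕜 := 𝕜) b).sub (A.isOdd_alg b)
  have h := D_squareInt (S := B.dga 𝕜) (structConst_groupLie_antisymm b) (jacobi_structConst_groupLie b) hp (A.isOdd_alg b) (A.isOdd_ghostAlg b) ha IsOdd.zero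
  refine ⟨(B.dga 𝕜).squareInt (structConst 𝕜 b) (formPoly b I) (A.alg 𝕜 b) (A.ghostAlg 𝕜 b)
    (A'.alg 𝕜 b - A.alg 𝕜 b) 0, forall_and.1 fun v => squareInt_basic
      (contraction_fundField v) (structConst_groupLie_antisymm b) (jacobi_structConst_groupLie b) hp
      (A.isOdd_alg b) (A.isOdd_ghostAlg b) ha IsOdd.zero (A.isConn_alg b v)
      (A.isTensorial_ghostAlg b v) ((A'.isConn_alg b v).sub (A.isConn_alg b v)) IsTensorial.zero, ?_⟩
  rw [add_zero, add_zero, add_sub_cancel] at h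
  rw [← dga_D, h]
  have e2 : ∀ x y z w : B.Alg 𝕜, x - y - (z - w) - (w - z) = x - y := fun x y z w => by abel
  exact (e2 _ _ _ _).symm ▸
    ((A.ghostLE_transgr_alg_add_ghostAlg b I A').mono (Nat.zero_le _)).sub
      (GhostLE.transgr_of_zero b I (A.isOdd_alg b) ha (A.ghostLE_alg b)
        fun a => (A'.ghostLE_alg b a).sub (A.ghostLE_alg b a))

end Transgressions

end PrincipalBundle

end

end BRS

/-! ### Assembly of the three statements -/

theorem mainTheorem9
    {𝕜 : Type*} [RCLike 𝕜]
    {EM : Type*} [NormedAddCommGroup EM] [NormedSpace ℝ EM] [FiniteDimensional ℝ EM]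
    {M : Type*} [TopologicalSpace M] [T2Space M] [SecondCountableTopology M]
    [ChartedSpace EM M] [IsManifold 𝓘(ℝ, EM) ∞ M]
    {EG : Type*} [NormedAddCommGroup EG] [NormedSpace ℝ EG] [FiniteDimensional ℝ EG]
    {G : Type*} [TopologicalSpace G] [T2Space G] [ConnectedSpace G]
    [ChartedSpace EG G] [Group G] [LieGroup 𝓘(ℝ, EG) ∞ G]
    {EP : Type*} [NormedAddCommGroup EP] [NormedSpace ℝ EP] [FiniteDimensional ℝ EP]
    {P : Type*} [TopologicalSpace P] [T2Space P] [SecondCountableTopology P]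
    [ChartedSpace EP P] [IsManifold 𝓘(ℝ, EP) ∞ P]
    (B : BRS.PrincipalBundle EM M EG G EP P)
    {ι : Type*} [Fintype ι] (b : Module.Basis ι ℝ (GroupLieAlgebra 𝓘(ℝ, EG) G))
    (n : ℕ) (I : MultilinearMap ℝ (fun _ : Fin n => GroupLieAlgebra 𝓘(ℝ, EG) G) 𝕜)
    (I_symm : ∀ (σ : Equiv.Perm (Fin n)) (v : Fin n → GroupLieAlgebra 𝓘(ℝ, EG) G),
      I (fun i => v (σ i)) = I v)
    (I_inv : ∀ (u : GroupLieAlgebra 𝓘(ℝ, EG) G) (v : Fin n → GroupLieAlgebra 𝓘(ℝ, EG) G),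
      ∑ i, I (Function.update v i ⁅u, v i⁆) = 0) :
    -- i) the consistent classes on `P`
    (∀ q k : ℕ, q + k + 1 = 2 * n → 1 ≤ k →
      ∃ hcons : ∀ A : B.Connection, B.Qcons b I A q k ∈ B.ZP 𝕜 q k,
        ∀ A A' : B.Connection, B.classP (hcons A) = B.classP (hcons A')) ∧
    -- `Q_cov(A, ω)` descends to a unique cochain `c A` on `M`
    ∃ c : B.Connection → ∀ q k : ℕ, BRS.RawCochain EM M 𝕜 B.gaugeAlg q k,
      (∀ (A : B.Connection) (q k : ℕ), c A q k ∈ B.CM 𝕜 q k ∧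
        B.IsPullback (c A q k) (B.Qcov b I A q k) ∧
        ∀ c' ∈ B.CM 𝕜 q k, B.IsPullback c' (B.Qcov b I A q k) → c' = c A q k) ∧
      ∀ q k : ℕ, q + k + 1 = 2 * n → n ≤ k →
        -- ii) the covariant classes on `M`
        (∃ hcov : ∀ A : B.Connection, c A q k ∈ B.ZM 𝕜 q k,
          ∀ A A' : B.Connection, B.classM (hcov A) = B.classM (hcov A')) ∧
        -- iii) the image of the covariant class on `P`, represented by the pullback `Q_cov(A, ω)`
        -- of `c A`, is the consistent class
        ∃ (hcov : ∀ A : B.Connection, B.Qcov b I A q k ∈ B.ZP 𝕜 q k)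
          (hcons : ∀ A : B.Connection, B.Qcons b I A q k ∈ B.ZP 𝕜 q k),
          ∀ A : B.Connection, B.classP (hcov A) = B.classP (hcons A) := by
  classical
  -- Local compactness and second countability make `P` σ-compact, as the partition of unity behind
  -- lifts requires.
  have : LocallyCompactSpace P := Manifold.locallyCompact_of_finiteDimensional 𝓘(ℝ, EP)
  have hp := BRS.invariant_formPoly (𝕜 := 𝕜) b I I_inv
  have hcons : ∀ (A : B.Connection) (q k : ℕ), B.Qcons b I A q k ∈ B.ZP 𝕜 q k := fun A q k => by
    rw [← A.consAlg_val]
    exact BRS.PrincipalBundle.mem_ZP (A.ghostLE_D_consAlg b I hp) (Nat.zero_le k)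
  have hcov : ∀ (A : B.Connection) (q k : ℕ), n ≤ k → B.Qcov b I A q k ∈ B.ZP 𝕜 q k :=
    fun A q k hk => by
      rw [← A.covAlg_val]
      exact BRS.PrincipalBundle.mem_ZP (A.ghostLE_D_covAlg b I hp) hk
  have hb := fun A : B.Connection => A.isBasic_covAlg b I hp
  choose c hc using fun (A : B.Connection) (q k : ℕ) => (hb A).1.exists_isPullback (hb A).2 q k
  refine ⟨fun q k _ hk => ⟨fun A => hcons A q k, fun A A' => ?_⟩, c, fun A q k => ⟨?_, ?_, ?_⟩,
    fun q k hqk hk => ⟨⟨fun A => (hb A).mem_ZM (hc A) (A.ghostLE_D_covAlg b I hp) hk,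
      fun A A' => ?_⟩, fun A => hcov A q k hk, fun A => hcons A q k, fun A => ?_⟩⟩
  · obtain ⟨r, hr⟩ := A.exists_consAlg_sub b I A' hp
    simp only [← BRS.PrincipalBundle.Connection.consAlg_val]
    exact BRS.PrincipalBundle.classP_eq hr hk _ _
  · exact (hc A q k).mem_CM ((A.covAlg b I).2 q k)
  · rw [← A.covAlg_val]
    exact hc A q k
  · intro c' _ h
    rw [← A.covAlg_val] at h
    exact h.unique (hc A q k)
  · obtain ⟨r, hr, hr'⟩ := A.exists_covAlg_sub b I A' hp
    -- The inequality is `n - 1 < k`. It follows from `n ≤ k` unless `n = 0`, where subtraction is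
    -- truncated; that case is excluded by `q + k + 1 = 2 * n`.
    exact hr.classM_eq hr' (by omega) (hc A q k) (hc A' q k) _ _
  · obtain ⟨r, hr⟩ := A.exists_covAlg_sub_consAlg b I hp
    simp only [← BRS.PrincipalBundle.Connection.consAlg_val,
      ← BRS.PrincipalBundle.Connection.covAlg_val]
    exact BRS.PrincipalBundle.classP_eq hr (by omega) _ _
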